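/- Let $n\ge 1$, $\beta>0$ and $g,g_0,g_1,g_0',g_1'\ge 0$ be real, and put $\gamma=i\beta/2$, $$v_a(z)=\frac{\sin\frac12(i\beta g+z)}{\sin\frac12 z},\qquad v_b(z)=\frac{\sin\frac12(i\beta g_0+z)}{\sin\frac12 z}\,\frac{\cos\frac12(i\beta g_1+z)}{\cos\frac12 z}\, \frac{\sin\frac12(i\beta g_0'+\gamma+z)}{\sin\frac12(\gamma+z)}\,\frac{\cos\frac12(i\beta g_1'+\gamma+z)}{\cos\frac12(\gamma+z)} .$$ For disjoint $J,K\subset\{1,\dots,n\}$ and signs $\varepsilon_j\in\{1,-1\}$ $(j\in J)$ let $$V_{\varepsilon J;K}=\prod_{j\in J}v_b(\varepsilon_jx_j)\prod_{j,j'\in J,\;j<j'}v_a(\varepsilon_jx_j+\varepsilon_{j'}x_{j'})\,v_a(\varepsilon_jx_j+\varepsilon_{j'}x_{j'}+2\gamma)\prod_{j\in J,\;k\in K}v_a(\varepsilon_jx_j+x_k)\,v_a(\varepsilon_jx_j-x_k),$$ and for $1\le r\le n$ let $\hat D_r$ be the analytic difference operator $$(\hat D_rf)(x)=\sum_{|J|=r,\;\varepsilon_j=\pm1\,(j\in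 J)}\;\;\sum_{\substack{\emptyset=J_0\subsetneq J_1\subsetneq\cdots\subsetneq J_s=J\\1\le s\le r}}(-1)^{s-1}\prod_{s'=1}^{s}V_{\varepsilon(J_{s'}\setminus J_{s'-1});\,J_{s'}^c}(x)\;\Bigl(f\bigl(x+i\beta\textstyle\sum_{j\in J_1}\varepsilon_je_j\bigr)-f(x)\Bigr),$$ where $J_{s'}^c=\{1,\dots,n\}\setminus J_{s'}$ and $e_1,\dots,e_n$ is the standard basis. Let $\mathbb D=\mathbb R[\hat D_1,\dots,\hat D_n]$ be the real algebra of difference operators generated by $\hat D_1,\dots,\hat D_n$. Let $W=S_n\ltimes\{\pm1\}^n$ act by permutations and sign flips of the variables, let $\mathbb T=\mathbb R^n/2\pi\mathbb Z^n$, and let $\mathcal A^W$ be the space of $W$-invariant trigonometric polynomials, i.e. of $W$-invariant finite linear combinations of $e^{i(\lambda_1x_1+\cdots+\lambda_nx_n)}$, $\lambda\in\mathbb Z^n$. With $(a;q)_\infty=\prod_{m\ge0}(1-aq^m)$, $(a_1,\dots,a_k;q)_\infty=\prod_{s=1}^k(a_s;q)_\infty$ and $q=e^{-\beta}$, put $$d_a^+(z)=\frac{(e^{iz};q)_\infty}{(q^{g}e^{iz};q)_\infty},\qquad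 d_b^+(z)=\frac{(e^{2iz};q)_\infty}{(q^{g_0}e^{iz},\,-q^{g_1}e^{iz},\,q^{g_0'+1/2}e^{iz},\,-q^{g_1'+1/2}e^{iz};q)_\infty},$$ $d_c(z)=d_c^+(z)d_c^+(-z)$ for $c=a,b$, and $$\Delta(x)=\prod_{1\le j<k\le n}d_a(x_j+x_k)\,d_a(x_j-x_k)\prod_{1\le j\le n}d_b(x_j),$$ which is real and nonnegative on $\mathbb T$. Let $L^2_W(\mathbb T,\Delta\,dx)$ be the Hilbert space of $W$-invariant functions on $\mathbb T$ that are square integrable with respect to $\Delta\,dx$. Then every $\hat D\in\mathbb D$ maps $\mathcal A^W$ into itself, and $\hat D$ is essentially self-adjoint on $\mathcal A^W\subset L^2_W(\mathbb T,\Delta\,dx)$: the operator with domain $\mathcal A^W$ that it defines in $L^2_W(\mathbb T,\Delta\,dx)$ is densely defined and symmetric, and its closure is self-adjoint. -/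

import Mathlib

noncomputable section

namespace Koornwinder

/-- The parameters `β, g, g₀, g₁, g₀', g₁'`. -/
structure Params where
  β : ℝ
  g : ℝ
  g₀ : ℝ
  g₁ : ℝ
  g₀' : ℝ
  g₁' : ℝ

/-- The standing assumptions on the parameters. -/
structure Params.Admissible (P : Params) : Prop where
  β_pos : 0 < P.β
  g_nonneg : 0 ≤ P.g
  g₀_nonneg : 0 ≤ P.g₀
  g₁_nonneg : 0 ≤ P.g₁
  g₀'_nonneg : 0 ≤ P.g₀'
  g₁'_nonneg : 0 ≤ P.g₁'

/-- Action of an element `(σ, ε)` of the hyperoctahedral group: permutation of the variables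
followed by sign flips. -/
def weylAct {n : ℕ} {A : Type*} [AddCommGroup A] (σ : Equiv.Perm (Fin n)) (ε : Fin n → ℤˣ)
    (x : Fin n → A) : Fin n → A :=
  fun j => ((ε j : ℤˣ) : ℤ) • x (σ j)

/-! ### The coefficients (half-period scale factor `α = 1/2`) -/

/-- `γ = i β / 2`. -/
def Params.γ (P : Params) : ℂ := Complex.I * P.β / 2

/-- `v_a(z) = sin α(μ + z) / sin αz` with `α = 1/2` and `μ = iβg`. -/
def va (P : Params) (z : ℂ) : ℂ :=
  Complex.sin ((Complex.I * P.β * P.g + z) / 2) / Complex.sin (z / 2)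

/-- `v_b(z)` with `α = 1/2`, `μ_δ = iβg_δ` and `μ_δ' = iβg_δ'`. -/
def vb (P : Params) (z : ℂ) : ℂ :=
  Complex.sin ((Complex.I * P.β * P.g₀ + z) / 2) / Complex.sin (z / 2)
    * (Complex.cos ((Complex.I * P.β * P.g₁ + z) / 2) / Complex.cos (z / 2))
    * (Complex.sin ((Complex.I * P.β * P.g₀' + P.γ + z) / 2) / Complex.sin ((P.γ + z) / 2))
    * (Complex.cos ((Complex.I * P.β * P.g₁' + P.γ + z) / 2) / Complex.cos ((P.γ + z) / 2))

/-- The building block `V_{εJ;K}(x)`. -/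
def coeffV {n : ℕ} (P : Params) (ε : Fin n → ℤ) (J K : Finset (Fin n)) (x : Fin n → ℂ) : ℂ :=
  (∏ j ∈ J, vb P (ε j * x j))
    * (∏ j ∈ J, ∏ k ∈ J with j < k,
        va P (ε j * x j + ε k * x k) * va P (ε j * x j + ε k * x k + 2 * P.γ))
    * ∏ j ∈ J, ∏ k ∈ K, va P (ε j * x j + x k) * va P (ε j * x j - x k)

/-! ### The difference operators -/

/-- The points of `ℂⁿ` at which all coefficients of the difference operators, and all their
translates over `iβ ℤⁿ`, have nonzero denominators. Its complement is a locally finite union of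
affine hyperplanes and it is stable under the translations over `iβ ℤⁿ`. -/
def Regular (n : ℕ) (P : Params) : Type :=
  {x : Fin n → ℂ //
    (∀ j, ∀ k l : ℤ, x j ≠ k * Real.pi + l * P.γ) ∧
    (∀ j k, j ≠ k → ∀ a b : ℤ,
      x j + x k ≠ a * (2 * Real.pi) + b * (2 * P.γ) ∧
      x j - x k ≠ a * (2 * Real.pi) + b * (2 * P.γ))}

/-- The translation `x ↦ x + iβ m`, `m ∈ ℤⁿ`. -/
def Regular.shift {n : ℕ} {P : Params} (m : Fin n → ℤ) (x : Regular n P) : Regular n P :=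
  ⟨fun j => x.1 j + Complex.I * P.β * m j, by
    refine ⟨fun j k l h => x.2.1 j k (l - 2 * m j) ?_, fun j k hjk a b => ⟨fun h => ?_, fun h => ?_⟩⟩
    · push_cast
      simp only [Params.γ] at h ⊢
      linear_combination h
    · refine (x.2.2 j k hjk a (b - m j - m k)).1 ?_
      push_cast
      simp only [Params.γ] at h ⊢
      linear_combination h
    · refine (x.2.2 j k hjk a (b - m j + m k)).2 ?_
      push_cast
      simp only [Params.γ] at h ⊢
      linear_combination h⟩

/-- The sign configurations `ε_j = ±1`, `j ∈ J` (extended by `0` outside `J`). -/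
def signs {n : ℕ} (J : Finset (Fin n)) : Finset (Fin n → ℤ) :=
  Fintype.piFinset fun j => if j ∈ J then {1, -1} else {0}

open scoped Classical in
/-- The chains `∅ = J₀ ⊊ J₁ ⊊ ⋯ ⊊ J_s = J`. -/
def chains {n : ℕ} (J : Finset (Fin n)) (s : ℕ) : Finset (Fin (s + 1) → Finset (Fin n)) :=
  {c | StrictMono c ∧ c 0 = ∅ ∧ c (Fin.last s) = J}

/-- `e_{εJ} = ∑_{j ∈ J} ε_j e_j`. -/
def signVec {n : ℕ} (ε : Fin n → ℤ) (J : Finset (Fin n)) : Fin n → ℤ :=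
  fun j => if j ∈ J then ε j else 0

/-- The analytic difference operator `D̂_r`, acting on functions on the regular points:
`∑_{J, ε} ∑_{∅ ⊊ J₁ ⊊ ⋯ ⊊ J_s = J} (-1)^{s-1}
  ∏_{s'} V_{ε(J_{s'} ∖ J_{s'-1}); J_{s'}ᶜ} (exp(-β θ̂_{εJ₁}) - 1)`,
where `exp(-β θ̂_{εJ₁})` is the translation over `iβ e_{εJ₁}`. -/
def diffOp (n : ℕ) (P : Params) (r : ℕ) : Module.End ℂ (Regular n P → ℂ) where
  toFun f x :=
    ∑ J ∈ Finset.powersetCard r (Finset.univ : Finset (Fin n)), ∑ ε ∈ signs J,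
      ∑ s ∈ Finset.Icc 1 r, ∑ c ∈ chains J s,
        (-1 : ℂ) ^ (s - 1)
          * (∏ i : Fin s, coeffV P ε (c i.succ \ c i.castSucc) (c i.succ)ᶜ x.1)
          * (f (x.shift (signVec ε (c 1))) - f x)
  map_add' f h := by
    funext x
    simp only [Pi.add_apply, ← Finset.sum_add_distrib]
    refine Finset.sum_congr rfl fun _ _ => Finset.sum_congr rfl fun _ _ =>
      Finset.sum_congr rfl fun _ _ => Finset.sum_congr rfl fun _ _ => ?_
    ring
  map_smul' a f := by
    funext x
    simp only [Pi.smul_apply, smul_eq_mul, RingHom.id_apply, Finset.mul_sum]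
    refine Finset.sum_congr rfl fun _ _ => Finset.sum_congr rfl fun _ _ =>
      Finset.sum_congr rfl fun _ _ => Finset.sum_congr rfl fun _ _ => ?_
    ring

/-- `𝔻 = ℝ[D̂₁, …, D̂ₙ]`, the real algebra of operators generated by `D̂₁, …, D̂ₙ`. -/
def diffOpAlgebra (n : ℕ) (P : Params) : Subalgebra ℝ (Module.End ℂ (Regular n P → ℂ)) :=
  Algebra.adjoin ℝ (diffOp n P '' Set.Icc 1 n)

/-! ### Trigonometric polynomials -/

/-- The exponential `e^λ(x) = exp(i ∑ λ_j x_j)`, as an entire function on `ℂⁿ`. -/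
def expo {n : ℕ} (l : Fin n → ℤ) (x : Fin n → ℂ) : ℂ :=
  Complex.exp (Complex.I * ∑ j, (l j : ℂ) * x j)

/-- `𝒜`, the trigonometric polynomials (as entire functions on `ℂⁿ`). -/
def trigPoly (n : ℕ) : Submodule ℂ ((Fin n → ℂ) → ℂ) :=
  Submodule.span ℂ (Set.range expo)

/-- `𝒜^W`, the `W`-invariant trigonometric polynomials. -/
def trigPolyW (n : ℕ) : Submodule ℂ ((Fin n → ℂ) → ℂ) where
  carrier := {f | f ∈ trigPoly n ∧ ∀ σ ε x, f (weylAct σ ε x) = f x}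
  zero_mem' := ⟨Submodule.zero_mem _, fun _ _ _ => rfl⟩
  add_mem' hf hh := ⟨Submodule.add_mem _ hf.1 hh.1, fun σ ε x => by
    simp only [Pi.add_apply, hf.2 σ ε x, hh.2 σ ε x]⟩
  smul_mem' a _ hf := ⟨Submodule.smul_mem _ a hf.1, fun σ ε x => by
    simp only [Pi.smul_apply, hf.2 σ ε x]⟩

/-- Restriction of a function on `ℂⁿ` to the regular points. -/
def restrictRegular {n : ℕ} (P : Params) (f : (Fin n → ℂ) → ℂ) : Regular n P → ℂ :=
  fun x => f x.1

/-! ### The torus, the weight function and the Hilbert space -/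

instance factTwoPiPos : Fact ((0 : ℝ) < 2 * Real.pi) := ⟨Real.two_pi_pos⟩

/-- The torus `𝕋 = ℝⁿ / 2πℤⁿ`. Its `volume` is Lebesgue measure `dx`, of total mass `(2π)ⁿ`. -/
abbrev Torus (n : ℕ) : Type := Fin n → AddCircle (2 * Real.pi)

/-- The function on the torus defined by a `2πℤⁿ`-periodic function on `ℂⁿ`
(evaluated at the representative in `(-π, π]ⁿ`). -/
def onTorus {n : ℕ} (f : (Fin n → ℂ) → ℂ) (t : Torus n) : ℂ :=
  f fun j => ((AddCircle.equivIoc (2 * Real.pi) (-Real.pi) (t j) : ℝ) : ℂ)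

/-- The `q`-shifted factorial `(a; q)_∞ = ∏_{m ≥ 0} (1 - a q^m)`. -/
def qPoch (a q : ℂ) : ℂ := ∏' m : ℕ, (1 - a * q ^ m)

/-- `e^{iz}` for `z ∈ ℝ / 2πℤ`. -/
def cexpI (z : AddCircle (2 * Real.pi)) : ℂ := (AddCircle.toCircle z : ℂ)

/-- `e^{-βs}`. -/
def Params.qpow (P : Params) (s : ℝ) : ℂ := (Real.exp (-P.β * s) : ℝ)

/-- `d_a^+(z)`. -/
def daPlus (P : Params) (z : AddCircle (2 * Real.pi)) : ℂ :=
  qPoch (cexpI z) (P.qpow 1) / qPoch (P.qpow P.g * cexpI z) (P.qpow 1)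

/-- `d_b^+(z)`. -/
def dbPlus (P : Params) (z : AddCircle (2 * Real.pi)) : ℂ :=
  qPoch (cexpI z ^ 2) (P.qpow 1)
    / (qPoch (P.qpow P.g₀ * cexpI z) (P.qpow 1)
      * qPoch (-P.qpow P.g₁ * cexpI z) (P.qpow 1)
      * qPoch (P.qpow (P.g₀' + 1 / 2) * cexpI z) (P.qpow 1)
      * qPoch (-P.qpow (P.g₁' + 1 / 2) * cexpI z) (P.qpow 1))

/-- `d_a(z) = d_a^+(z) d_a^+(-z)`. -/
def da (P : Params) (z : AddCircle (2 * Real.pi)) : ℂ := daPlus P z * daPlus P (-z)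

/-- `d_b(z) = d_b^+(z) d_b^+(-z)`. -/
def db (P : Params) (z : AddCircle (2 * Real.pi)) : ℂ := dbPlus P z * dbPlus P (-z)

/-- The weight function `Δ`. -/
def weight {n : ℕ} (P : Params) (t : Torus n) : ℂ :=
  (∏ j, ∏ k with j < k, da P (t j + t k) * da P (t j - t k)) * ∏ j, db P (t j)

theorem cexpI_coe (x : ℝ) : cexpI (x : AddCircle (2 * Real.pi)) = Complex.exp (Complex.I * x) := by
  have h : 2 * Real.pi / (2 * Real.pi) = 1 := div_self Real.two_pi_pos.ne'
  rw [cexpI, AddCircle.toCircle_apply_mk, Circle.coe_exp, h, one_mul, mul_comm]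

theorem conj_cexpI (z : AddCircle (2 * Real.pi)) :
    (starRingEnd ℂ) (cexpI z) = cexpI (-z) := by
  rw [cexpI, cexpI, AddCircle.toCircle_neg, Circle.coe_inv_eq_conj]

theorem conj_qPoch (a q : ℂ) :
    (starRingEnd ℂ) (qPoch a q) = qPoch ((starRingEnd ℂ) a) ((starRingEnd ℂ) q) := by
  have h := Function.LeftInverse.map_tprod (L := SummationFilter.unconditional ℕ)
    (fun m : ℕ => (1 - a * q ^ m)) (g := starRingEnd ℂ) (g' := starRingEnd ℂ)
    Complex.continuous_conj Complex.continuous_conj Complex.conj_conj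
  simp only [map_sub, map_mul, map_pow, map_one] at h
  exact h

theorem conj_qpow (P : Params) (s : ℝ) : (starRingEnd ℂ) (P.qpow s) = P.qpow s :=
  Complex.conj_ofReal _

theorem da_eq_normSq (P : Params) (z : AddCircle (2 * Real.pi)) :
    da P z = (Complex.normSq (daPlus P z) : ℝ) := by
  rw [← Complex.mul_conj, da]
  congr 1
  simp only [daPlus, map_div₀, map_mul, conj_qPoch, conj_qpow, conj_cexpI]

theorem db_eq_normSq (P : Params) (z : AddCircle (2 * Real.pi)) :
    db P z = (Complex.normSq (dbPlus P z) : ℝ) := by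
  rw [← Complex.mul_conj, db]
  congr 1
  simp only [dbPlus, map_div₀, map_mul, map_neg, map_pow, conj_qPoch, conj_qpow, conj_cexpI]

/-- `Δ` is real and nonnegative on the torus. -/
theorem weight_real_nonneg {n : ℕ} (P : Params) (t : Torus n) :
    ∃ w : ℝ, 0 ≤ w ∧ weight P t = w := by
  refine ⟨(∏ j, ∏ k with j < k, Complex.normSq (daPlus P (t j + t k))
      * Complex.normSq (daPlus P (t j - t k))) * ∏ j, Complex.normSq (dbPlus P (t j)), ?_, ?_⟩
  · exact mul_nonneg (Finset.prod_nonneg fun _ _ => Finset.prod_nonneg fun _ _ =>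
      mul_nonneg (Complex.normSq_nonneg _) (Complex.normSq_nonneg _))
      (Finset.prod_nonneg fun _ _ => Complex.normSq_nonneg _)
  · simp only [weight, da_eq_normSq, db_eq_normSq]
    push_cast
    rfl

/-- The measure `Δ dx` on the torus (`Δ` is real and nonnegative). -/
def weightMeasure (n : ℕ) (P : Params) : MeasureTheory.Measure (Torus n) :=
  MeasureTheory.volume.withDensity fun t => ENNReal.ofReal (weight P t).re

/-- `L²_W(𝕋, Δ dx)`: the (classes of) `W`-invariant functions that are square integrable with
respect to `Δ dx`. -/
def L2W (n : ℕ) (P : Params) :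
    Submodule ℂ (MeasureTheory.Lp ℂ 2 (weightMeasure n P)) where
  carrier := {u | ∃ φ : Torus n → ℂ, (∀ σ ε t, φ (weylAct σ ε t) = φ t) ∧
    (u : Torus n → ℂ) =ᵐ[weightMeasure n P] φ}
  zero_mem' := ⟨0, fun _ _ _ => rfl, MeasureTheory.Lp.coeFn_zero _ _ _⟩
  add_mem' := by
    rintro u v ⟨φ, hφ, hu⟩ ⟨ψ, hψ, hv⟩
    refine ⟨φ + ψ, fun σ ε t => ?_, (MeasureTheory.Lp.coeFn_add u v).trans (hu.add hv)⟩
    simp only [Pi.add_apply, hφ σ ε t, hψ σ ε t]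
  smul_mem' := by
    rintro a u ⟨φ, hφ, hu⟩
    refine ⟨a • φ, fun σ ε t => ?_,
      (MeasureTheory.Lp.coeFn_smul a u).trans (hu.const_smul a)⟩
    simp only [Pi.smul_apply, hφ σ ε t]

theorem isClosed_L2W (n : ℕ) (P : Params) :
    IsClosed (L2W n P : Set (MeasureTheory.Lp ℂ 2 (weightMeasure n P))) := by
  refine isClosed_of_closure_subset fun u hu => ?_
  obtain ⟨v, hv, hvu⟩ := mem_closure_iff_seq_limit.1 hu
  choose φ hφ hvφ using hv
  obtain ⟨ns, -, hns⟩ :=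
    (MeasureTheory.tendstoInMeasure_of_tendsto_Lp hvu).exists_seq_tendsto_ae
  refine ⟨fun t => Filter.limUnder Filter.atTop fun k => φ (ns k) t, fun σ ε t => ?_, ?_⟩
  · simp only [hφ]
  · have h : ∀ᵐ t ∂(weightMeasure n P), ∀ k, (v k : Torus n → ℂ) t = φ k t :=
      MeasureTheory.ae_all_iff.2 hvφ
    filter_upwards [hns, h] with t h1 h2
    simp only [h2] at h1
    exact h1.limUnder_eq.symm

instance completeSpace_L2W (n : ℕ) (P : Params) : CompleteSpace (L2W n P) :=
  (isClosed_L2W n P).completeSpace_coe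

/-! ### Essential self-adjointness -/

/-- A densely defined symmetric operator is essentially self-adjoint if its closure is
self-adjoint. -/
def IsEssentiallySelfAdjoint {H : Type*} [NormedAddCommGroup H] [InnerProductSpace ℂ H]
    [CompleteSpace H] (T : H →ₗ.[ℂ] H) : Prop :=
  Dense (T.domain : Set H) ∧ T.IsFormalAdjoint T ∧ IsSelfAdjoint T.closure

/-- `T` is the operator in `L²_W(𝕋, Δ dx)` with domain `𝒜^W` defined by the difference operator
`D`: the domain consists of the classes of the elements of `𝒜^W`, all of these are square
integrable, `D` maps `𝒜^W` into itself, and `T` sends the class of `f` to that of `D f`. -/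
structure IsRealization {n : ℕ} {P : Params} (D : Module.End ℂ (Regular n P → ℂ))
    (T : L2W n P →ₗ.[ℂ] L2W n P) : Prop where
  exists_of_mem_domain : ∀ u : T.domain, ∃ f ∈ trigPolyW n,
    ((u : L2W n P) : Torus n → ℂ) =ᵐ[weightMeasure n P] onTorus f
  exists_mem_domain : ∀ f ∈ trigPolyW n, ∃ u : T.domain, ∃ h ∈ trigPolyW n,
    ((u : L2W n P) : Torus n → ℂ) =ᵐ[weightMeasure n P] onTorus f ∧
    D (restrictRegular P f) = restrictRegular P h ∧
    (T u : Torus n → ℂ) =ᵐ[weightMeasure n P] onTorus h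

end Koornwinder

end

/-! Three properties of each operator `D̂_r` carry the theorem: it preserves the invariant
trigonometric polynomials, it respects an increasing filtration of them by finite-dimensional
subspaces, and it is symmetric for `Δ dx`. A symmetric, densely defined operator whose domain is
exhausted by finite-dimensional invariant subspaces is essentially self-adjoint
(`isEssentiallySelfAdjoint_of_finiteDimensional`): the orthogonal projections onto these subspaces
intertwine the operator with its adjoint, so the graph of the adjoint lies in the closure of the
graph of the operator.

Invariance. In the coordinates `w_j = e^{i x_j}` the chain sum collapses to `∑_ε V_ε U_{supp ε} (T_ε
- 1)`, where `ε` runs over `{-1,0,1}^n` and `U` satisfies a linear recursion (`diffOp_apply`,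
`sum_coeffM_uCoef`). All denominators are products of factors `1 - c e^l`. These are prime among
Laurent polynomials, so regularity can be tested along one factor at a time (`mem_range_of_locAt`),
and each factor gives at most a simple pole. If `c² = 1`, the zero set is fixed pointwise by a
reflection and the residue of an invariant function vanishes (`dOp_mem_locAt_of_sq`). If `|c| < 1`,
the terms of `ε` and `ε + b` are paired, with `b` the sign vector equal to `l`: the residues of the
coefficients cancel by the recursion (`uCoef_add_mem_locAt`), and the two translates of an invariant
polynomial agree on the zero set because they differ by a reflection (`dOp_mem_locAt_of_norm_lt`).

Triangularity. Exponents are ordered by pairing them with the powers of a transcendental number.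
Along a ray in this generic imaginary direction all coefficients stay bounded, so the image of a
polynomial grows no faster than the polynomial itself (`height_le_of_dOp_eq`). Invariance under sign
flips makes the filtration pieces finite-dimensional.

Symmetry. Multiplication by a coefficient `V_ε` moves the arguments of the weight factors by `q`, so
that `V_ε Δ` has no poles (`coeffM_mul_weightM`) and is holomorphic on the strip needed to move the
contour by half a step. After that shift each term of the quadratic form is visibly Hermitian
(`integral_termA`, `conj_termB`).

Products. A product of symmetric operators is symmetric if the factors commute, and this follows
from the properties above. The commutator of two symmetric filtered operators is skew and strictly
lowers leading exponents, hence it is zero by induction and positivity of the form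
(`IsSymmFil.comm`). So the whole real algebra consists of symmetric filtered operators
(`exists_isSymmFil`), and density of the invariant polynomials (`dense_range_embL`) concludes. -/

noncomputable section

/-! ### Laurent polynomials: generic growth, and divisibility by the factors `1 - c e^l`. -/

namespace Koornwinder

/-! ### Laurent polynomials and their evaluation -/

/-- Laurent polynomials in `n` variables. -/
abbrev Laurent (n : ℕ) : Type := AddMonoidAlgebra ℂ (Fin n → ℤ)

/-- The character `w ↦ ∏ w_j ^ l_j`. -/
def chi {n : ℕ} (l : Fin n → ℤ) (w : Fin n → ℂˣ) : ℂˣ := ∏ j, w j ^ l j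

variable {n : ℕ}

theorem chi_zero (w : Fin n → ℂˣ) : chi 0 w = 1 := by simp [chi]

theorem chi_add (l m : Fin n → ℤ) (w : Fin n → ℂˣ) : chi (l + m) w = chi l w * chi m w := by
  simp [chi, zpow_add, Finset.prod_mul_distrib]

theorem chi_neg (l : Fin n → ℤ) (w : Fin n → ℂˣ) : chi (-l) w = (chi l w)⁻¹ := by
  simp [chi]

theorem chi_sub (l m : Fin n → ℤ) (w : Fin n → ℂˣ) : chi (l - m) w = chi l w / chi m w := by
  simp [chi, zpow_sub, Finset.prod_mul_distrib, div_eq_mul_inv]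

theorem chi_zsmul (k : ℤ) (l : Fin n → ℤ) (w : Fin n → ℂˣ) : chi (k • l) w = chi l w ^ k := by
  simp only [chi, Pi.smul_apply, smul_eq_mul, ← Finset.prod_zpow]
  exact Finset.prod_congr rfl fun _ _ => by rw [mul_comm, zpow_mul]

theorem chi_single (j : Fin n) (k : ℤ) (w : Fin n → ℂˣ) : chi (Pi.single j k) w = w j ^ k := by
  rw [chi, Finset.prod_eq_single j]
  · simp
  · intro i _ h
    simp [h]
  · simp

theorem chi_mul (l : Fin n → ℤ) (w v : Fin n → ℂˣ) : chi l (w * v) = chi l w * chi l v := by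
  simp [chi, mul_zpow, Finset.prod_mul_distrib]

/-- `chi` as a homomorphism from the lattice. -/
def chiHom (w : Fin n → ℂˣ) : Multiplicative (Fin n → ℤ) →* ℂ where
  toFun l := (chi l.toAdd w : ℂ)
  map_one' := by simp [chi_zero]
  map_mul' l m := by simp [chi_add]

/-- Evaluation of Laurent polynomials. -/
def ev (w : Fin n → ℂˣ) : Laurent n →ₐ[ℂ] ℂ := AddMonoidAlgebra.lift ℂ ℂ _ (chiHom w)

@[simp] theorem ev_single (w : Fin n → ℂˣ) (l : Fin n → ℤ) (a : ℂ) :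
    ev w (AddMonoidAlgebra.single l a) = a * chi l w := by
  simp [ev, chiHom]

theorem ev_eq_sum (w : Fin n → ℂˣ) (p : Laurent n) :
    ev w p = ∑ l ∈ p.coeff.support, p.coeff l * chi l w := by
  rw [ev, AddMonoidAlgebra.lift_apply]
  rfl

/-- Monomial substitutions act on the Laurent polynomials. Full and half translations and the
hyperoctahedral group all act on points in this way. -/
theorem exists_ev_comp (s : (Fin n → ℂˣ) → Fin n → ℂˣ)
    (hs : ∀ l : Fin n → ℤ, ∃ (a : ℂ) (m : Fin n → ℤ), ∀ w, (chi l (s w) : ℂ) = a * chi m w)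
    (p : Laurent n) : ∃ p' : Laurent n, ∀ w, ev w p' = ev (s w) p := by
  induction p using AddMonoidAlgebra.induction_linear with
  | zero => exact ⟨0, fun w => by simp⟩
  | add p q hp hq =>
    obtain ⟨p', hp⟩ := hp
    obtain ⟨q', hq⟩ := hq
    exact ⟨p' + q', fun w => by simp [hp, hq]⟩
  | single l a =>
    obtain ⟨b, m, h⟩ := hs l
    exact ⟨AddMonoidAlgebra.single m (a * b), fun w => by simp [h, mul_assoc]⟩

/-! ### A generic direction -/

/-- A transcendental number larger than `0`. -/
theorem exists_pos_transcendental : ∃ t : ℝ, 0 < t ∧ Transcendental ℤ t := by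
  have h := transcendental_liouvilleNumber (m := 2) le_rfl
  rcases lt_trichotomy (liouvilleNumber ((2 : ℕ) : ℝ)) 0 with h0 | h0 | h0
  · exact ⟨_, neg_pos.2 h0, fun h' => h (by simpa using h'.neg)⟩
  · exact absurd (h0 ▸ isAlgebraic_zero) h
  · exact ⟨_, h0, h⟩

/-- A positive transcendental number. -/
def genericBase : ℝ := exists_pos_transcendental.choose

/-- The pairing of a lattice vector with a fixed direction, positive with rationally independent
components. -/
def height : (Fin n → ℤ) →+ ℝ where
  toFun l := ∑ j, (l j : ℝ) * genericBase ^ (j : ℕ)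
  map_zero' := by simp
  map_add' l m := by simp [add_mul, Finset.sum_add_distrib]

theorem height_apply (l : Fin n → ℤ) : height l = ∑ j, (l j : ℝ) * genericBase ^ (j : ℕ) := rfl

theorem genericBase_pos : 0 < genericBase := exists_pos_transcendental.choose_spec.1

/-- A nontrivial integral relation between the powers of `genericBase` would make it algebraic.
Consequently `height` totally orders the exponents, and a nonzero Laurent polynomial has a single
leading exponent. -/
theorem height_injective : Function.Injective (height : (Fin n → ℤ) →+ ℝ) := by
  rw [injective_iff_map_eq_zero]
  intro l hl
  by_contra h0
  refine exists_pos_transcendental.choose_spec.2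
    ⟨∑ j : Fin n, Polynomial.C (l j) * Polynomial.X ^ (j : ℕ), ?_, ?_⟩
  · obtain ⟨i, hi⟩ := Function.ne_iff.1 h0
    intro h
    apply hi
    have := congrArg (fun p => Polynomial.coeff p i) h
    simpa [Polynomial.finsetSum_coeff, Polynomial.coeff_C_mul, Polynomial.coeff_X_pow, Fin.val_inj]
      using this
  · simpa [height_apply, genericBase] using hl

end Koornwinder

end

noncomputable section

namespace Koornwinder

variable {n : ℕ}

/-! ### Multiplicative coordinates and growth along a ray -/

/-- The multiplicative coordinates `e^{i x_j}`. -/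
def expU (x : Fin n → ℂ) : Fin n → ℂˣ := fun j =>
  Units.mk0 (Complex.exp (Complex.I * x j)) (Complex.exp_ne_zero _)

@[simp] theorem expU_val (x : Fin n → ℂ) (j : Fin n) :
    (expU x j : ℂ) = Complex.exp (Complex.I * x j) := rfl

theorem chi_expU (l : Fin n → ℤ) (x : Fin n → ℂ) : (chi l (expU x) : ℂ) = expo l x := by
  simp only [chi, Units.coe_prod, Units.val_zpow_eq_zpow_val, expU_val, expo, Finset.mul_sum,
    Complex.exp_sum]
  refine Finset.prod_congr rfl fun j _ => ?_
  rw [← Complex.exp_int_mul]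
  ring_nf

theorem expU_surjective : Function.Surjective (expU : (Fin n → ℂ) → Fin n → ℂˣ) := by
  intro w
  refine ⟨fun j => -Complex.I * Complex.log (w j), ?_⟩
  funext j
  ext
  rw [expU_val, ← mul_assoc]
  simp [Complex.exp_log]

/-- Points on a ray in a generic imaginary direction. -/
def ray (n : ℕ) (R : ℝ) : Fin n → ℂ := fun j =>
  (((j : ℝ) + 1) / (n + 1) : ℝ) + ((-R * genericBase ^ (j : ℕ) : ℝ) : ℂ) * Complex.I

/-- The real parts are distinct numbers in `(0, 1]`. This keeps `x_j` and `x_j ± x_k` off all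
excluded hyperplanes, whatever the imaginary parts are; see `regRay`. -/
theorem ray_re (R : ℝ) (j : Fin n) : (ray n R j).re = ((j : ℝ) + 1) / (n + 1) := by
  simp [ray, -Complex.ofReal_mul, -Complex.ofReal_div]

theorem chi_ray (l : Fin n → ℤ) (R : ℝ) :
    (chi l (expU (ray n R)) : ℂ) = chi l (expU (ray n 0)) * Real.exp (R * height l) := by
  simp only [chi_expU, expo, ray, height_apply]
  push_cast
  rw [← Complex.exp_add]
  congr 1
  simp only [Finset.mul_sum, ← Finset.sum_add_distrib]
  refine Finset.sum_congr rfl fun j _ => ?_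
  linear_combination (-(l j : ℂ) * R * (genericBase : ℂ) ^ (j : ℕ)) * Complex.I_sq

-- On the ray the character of `l` has modulus a constant times `exp (R * height l)`. The fixed
-- factor `v` only changes constants; it is there for the translates of `p`.
open Filter Asymptotics Topology in
theorem ev_ray_isBigO {p : Laurent n} {d : ℝ} (hp : ∀ l ∈ p.coeff.support, height l ≤ d)
    (v : Fin n → ℂˣ) :
    (fun R : ℝ => ev (expU (ray n R) * v) p) =O[atTop] fun R : ℝ => Real.exp (R * d) := by
  simp only [ev_eq_sum]
  refine IsBigO.fun_sum fun l hl => ?_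
  refine IsBigO.of_bound (‖p.coeff l * (chi l (expU (ray n 0)) * chi l v)‖) ?_
  filter_upwards [eventually_ge_atTop 0] with R hR
  rw [chi_mul, Units.val_mul, chi_ray]
  simp only [norm_mul, Complex.norm_real, Real.norm_eq_abs, Real.abs_exp]
  have : Real.exp (R * height l) ≤ Real.exp (R * d) :=
    Real.exp_le_exp.2 (mul_le_mul_of_nonneg_left (hp l hl) hR)
  calc _ = ‖p.coeff l‖ * (‖(chi l (expU (ray n 0)) : ℂ)‖ * ‖(chi l v : ℂ)‖)
        * Real.exp (R * height l) := by ring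
    _ ≤ _ := by gcongr

-- The heights of different exponents differ, so the top one wins: after division by its exponential
-- only the leading coefficient, times a unit, survives in the limit.
open Filter Asymptotics Topology in
theorem height_le_of_ev_ray_isBigO {p : Laurent n} {d : ℝ}
    (h : (fun R : ℝ => ev (expU (ray n R)) p) =O[atTop] fun R : ℝ => Real.exp (R * d)) :
    ∀ l ∈ p.coeff.support, height l ≤ d := by
  by_contra! hcon
  obtain ⟨l₁, hl₁, hd₁⟩ := hcon
  obtain ⟨l, hl, hmax⟩ := p.coeff.support.exists_max_image height ⟨l₁, hl₁⟩
  have hd : d < height l := hd₁.trans_le (hmax l₁ hl₁)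
  have h1 : Tendsto (fun R : ℝ => ev (expU (ray n R)) p * Real.exp (-(R * height l))) atTop
      (𝓝 (p.coeff l * chi l (expU (ray n 0)))) := by
    have h2 : ∀ m ∈ p.coeff.support, Tendsto (fun R : ℝ => p.coeff m * chi m (expU (ray n 0))
        * (Real.exp (R * (height m - height l)) : ℂ)) atTop
        (𝓝 (if m = l then p.coeff l * chi l (expU (ray n 0)) else 0)) := by
      intro m hm
      split_ifs with hml
      · subst hml
        simp
      · have hlt : height m - height l < 0 :=
          sub_neg.2 (lt_of_le_of_ne (hmax m hm) fun h => hml (height_injective h))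
        have h3 : Tendsto (fun R : ℝ => Real.exp (R * (height m - height l))) atTop (𝓝 0) :=
          Real.tendsto_exp_atBot.comp (tendsto_id.atTop_mul_const_of_neg hlt)
        have h4 := ((Complex.continuous_ofReal.tendsto 0).comp h3).const_mul
          (p.coeff m * chi m (expU (ray n 0)) : ℂ)
        simpa using h4
    have h5 := tendsto_finsetSum _ h2
    rw [Finset.sum_ite_eq' , if_pos hl] at h5
    refine h5.congr fun R => ?_
    rw [ev_eq_sum, Finset.sum_mul]
    refine Finset.sum_congr rfl fun m _ => ?_
    rw [chi_ray m R, mul_sub, sub_eq_add_neg, Real.exp_add]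
    push_cast
    ring
  have h6 : Tendsto (fun R : ℝ => ev (expU (ray n R)) p * Real.exp (-(R * height l))) atTop
      (𝓝 0) := by
    have h7 : (fun R : ℝ => ev (expU (ray n R)) p * (Real.exp (-(R * height l)) : ℂ)) =O[atTop]
        fun R : ℝ => Real.exp (R * d) * Real.exp (-(R * height l)) :=
      h.mul (IsBigO.of_bound 1 (Eventually.of_forall fun R => by
        rw [Complex.norm_real, one_mul]))
    refine h7.trans_tendsto ?_
    have h8 : Tendsto (fun R : ℝ => Real.exp (R * (d - height l))) atTop (𝓝 0) :=
      Real.tendsto_exp_atBot.comp (tendsto_id.atTop_mul_const_of_neg (sub_neg.2 hd))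
    refine h8.congr fun R => ?_
    rw [← Real.exp_add]
    ring_nf
  have h9 := tendsto_nhds_unique h1 h6
  exact (mul_ne_zero (Finsupp.mem_support_iff.1 hl) (Units.ne_zero _)) h9

open Filter Asymptotics in
theorem eq_zero_of_ev_ray {p : Laurent n} (h : ∀ R, ev (expU (ray n R)) p = 0) : p = 0 := by
  by_contra h0
  have h1 : p.coeff.support.Nonempty := by
    rwa [Finsupp.support_nonempty_iff, ne_eq, AddMonoidAlgebra.coeff_eq_zero]
  obtain ⟨l, hl⟩ := h1
  -- The zero function satisfies every growth bound, in particular one below the height of an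
  -- exponent in the support.
  have h2 : height l ≤ height l - 1 := by
    refine height_le_of_ev_ray_isBigO (p := p) ?_ l hl
    simp only [h]
    exact isBigO_zero _ _
  linarith

theorem ev_ext {p q : Laurent n} (h : ∀ w, ev w p = ev w q) : p = q :=
  sub_eq_zero.1 (eq_zero_of_ev_ray fun R => by simp [h])

end Koornwinder

end

noncomputable section

namespace Koornwinder

variable {n : ℕ}

/-! ### The linear factors `1 - c e^l` -/

/-- The Laurent polynomial `1 - c e^l`. -/
def linFac (l : Fin n → ℤ) (c : ℂˣ) : Laurent n := 1 - AddMonoidAlgebra.single l (c : ℂ)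

@[simp] theorem ev_linFac (w : Fin n → ℂˣ) (l : Fin n → ℤ) (c : ℂˣ) :
    ev w (linFac l c) = 1 - c * chi l w := by
  simp [linFac]

theorem linFac_dvd_pow (l : Fin n → ℤ) (c : ℂˣ) (k : ℕ) :
    linFac l c ∣ 1 - AddMonoidAlgebra.single (k • l) ((c ^ k : ℂˣ) : ℂ) := by
  have := sub_dvd_pow_sub_pow (1 : Laurent n) (AddMonoidAlgebra.single l (c : ℂ)) k
  rwa [one_pow, AddMonoidAlgebra.single_pow, ← Units.val_pow_eq_pow_val] at this

theorem linFac_dvd_zpow (l : Fin n → ℤ) (c : ℂˣ) (k : ℤ) :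
    linFac l c ∣ 1 - AddMonoidAlgebra.single (k • l) ((c ^ k : ℂˣ) : ℂ) := by
  obtain ⟨m, rfl | rfl⟩ := k.eq_nat_or_neg
  · simpa using linFac_dvd_pow l c m
  · have h : (1 - AddMonoidAlgebra.single ((-(m : ℤ)) • l) ((c ^ (-(m : ℤ)) : ℂˣ) : ℂ) : Laurent n)
        = -AddMonoidAlgebra.single ((-(m : ℤ)) • l) ((c ^ (-(m : ℤ)) : ℂˣ) : ℂ)
          * (1 - AddMonoidAlgebra.single (m • l) ((c ^ m : ℂˣ) : ℂ)) := by
      rw [mul_sub, mul_one, neg_mul, AddMonoidAlgebra.single_mul_single, ← Units.val_mul,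
        AddMonoidAlgebra.one_def]
      simp
      ring
    rw [h]
    exact (linFac_dvd_pow l c m).mul_left _

/-- The retraction onto the zero set of `1 - c e^l`, moving only the coordinate `j`. -/
def retract (l : Fin n → ℤ) (c : ℂˣ) (j : Fin n) (w : Fin n → ℂˣ) : Fin n → ℂˣ :=
  w * Pi.mulSingle j ((c * chi l w) ^ (-l j))

theorem chi_mulSingle (m : Fin n → ℤ) (j : Fin n) (a : ℂˣ) :
    chi m (Pi.mulSingle j a) = a ^ m j := by
  rw [chi, Finset.prod_eq_single j]
  · simp
  · intro i _ h
    simp [h]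
  · simp

theorem chi_retract (l m : Fin n → ℤ) (c : ℂˣ) (j : Fin n) (w : Fin n → ℂˣ) :
    chi m (retract l c j w) = c ^ (-(l j * m j)) * chi (m - (l j * m j) • l) w := by
  rw [retract, chi_mul, chi_mulSingle, chi_sub, chi_zsmul, ← zpow_mul, mul_zpow, neg_mul,
    zpow_neg (chi l w)]
  rw [div_eq_mul_inv]
  exact mul_left_comm _ _ _

/-- Pulling back along the retraction turns the monomial of `m` into a multiple of the monomial of
`m - (l_j m_j) l`. The difference of the two is a monomial times `1 - (c e^l)^k` with `k = -l_j
m_j`, which `linFac l c` divides. -/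
theorem exists_retract (l : Fin n → ℤ) (c : ℂˣ) (j : Fin n) (p : Laurent n) :
    ∃ p' : Laurent n, (∀ w, ev w p' = ev (retract l c j w) p) ∧ linFac l c ∣ p - p' := by
  induction p using AddMonoidAlgebra.induction_linear with
  | zero => exact ⟨0, fun w => by simp, by simp⟩
  | add p q hp hq =>
    obtain ⟨p', hp, hpd⟩ := hp
    obtain ⟨q', hq, hqd⟩ := hq
    refine ⟨p' + q', fun w => by simp [hp, hq], ?_⟩
    rw [add_sub_add_comm]
    exact dvd_add hpd hqd
  | single m a =>
    refine ⟨AddMonoidAlgebra.single (m - (l j * m j) • l)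
      (a * ((c ^ (-(l j * m j)) : ℂˣ) : ℂ)), fun w => ?_, ?_⟩
    · rw [ev_single, ev_single, chi_retract, Units.val_mul, mul_assoc]
    · have h := (linFac_dvd_zpow l c (-(l j * m j))).mul_left (AddMonoidAlgebra.single m a)
      rwa [mul_sub, mul_one, AddMonoidAlgebra.single_mul_single, neg_smul, ← sub_eq_add_neg] at h

theorem retract_mem {l : Fin n → ℤ} {j : Fin n} (hj : l j * l j = 1) (c : ℂˣ)
    (w : Fin n → ℂˣ) : c * chi l (retract l c j w) = 1 := by
  rw [chi_retract, hj, one_smul, sub_self, chi_zero, mul_one, zpow_neg_one, mul_inv_cancel]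

/-- A Laurent polynomial is divisible by `1 - c e^l` if it vanishes where `c e^l = 1`. -/
theorem linFac_dvd_iff {l : Fin n → ℤ} {j : Fin n} (hj : l j * l j = 1) {c : ℂˣ}
    {p : Laurent n} : linFac l c ∣ p ↔ ∀ w, c * chi l w = 1 → ev w p = 0 := by
  constructor
  · rintro ⟨q, rfl⟩ w hw
    rw [map_mul, ev_linFac, ← Units.val_mul, hw]
    simp
  · intro h
    -- The retraction lands in the zero set, so the pullback vanishes identically, while it is
    -- congruent to `p` modulo the factor.
    obtain ⟨p', hp', hd⟩ := exists_retract l c j p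
    have h0 : p' = 0 := ev_ext fun w => by
      rw [hp', h _ (retract_mem hj c w), map_zero]
    simpa [h0] using hd

/-- Primality: residue classes modulo the factor are represented by pullbacks along the retraction,
the pullback of the product vanishes, and the Laurent polynomials have no zero divisors. -/
theorem linFac_dvd_mul {l : Fin n → ℤ} {j : Fin n} (hj : l j * l j = 1) {c : ℂˣ}
    {p q : Laurent n} (h : linFac l c ∣ p * q) : linFac l c ∣ p ∨ linFac l c ∣ q := by
  obtain ⟨p', hp', hpd⟩ := exists_retract l c j p
  obtain ⟨q', hq', hqd⟩ := exists_retract l c j q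
  have h0 : p' * q' = 0 := ev_ext fun w => by
    rw [map_mul, hp', hq', ← map_mul, (linFac_dvd_iff hj).1 h _ (retract_mem hj c w), map_zero]
  rcases mul_eq_zero.1 h0 with h1 | h1
  · exact Or.inl (by simpa [h1] using hpd)
  · exact Or.inr (by simpa [h1] using hqd)

theorem not_linFac_dvd_one {l : Fin n → ℤ} {j : Fin n} (hj : l j * l j = 1) {c : ℂˣ} :
    ¬ linFac l c ∣ 1 := fun h => by
  simpa using (linFac_dvd_iff hj).1 h _ (retract_mem hj c 1)

/-- Divisibility says that `d e^m = 1` wherever `c e^l = 1`. Pulled back along the retraction this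
is an identity between a monomial and `1`, and the exponents and coefficients can be compared. -/
theorem linFac_dvd_linFac {l m : Fin n → ℤ} {j : Fin n} (hj : l j * l j = 1) {c d : ℂˣ}
    (h : linFac l c ∣ linFac m d) : m = (l j * m j) • l ∧ d = c ^ (l j * m j) := by
  have h1 : (1 : Laurent n) = AddMonoidAlgebra.single (m - (l j * m j) • l)
      ((d * c ^ (-(l j * m j)) : ℂˣ) : ℂ) := ev_ext fun w => by
    have := (linFac_dvd_iff hj).1 h _ (retract_mem hj c w)
    rw [ev_linFac, chi_retract, sub_eq_zero] at this
    rw [map_one, this, ev_single]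
    push_cast
    ring
  rw [AddMonoidAlgebra.one_def, AddMonoidAlgebra.single_inj] at h1
  rcases h1 with ⟨h1, h2⟩ | h1
  · refine ⟨(sub_eq_zero.1 h1.symm), ?_⟩
    have h3 : (1 : ℂˣ) = d * c ^ (-(l j * m j)) := Units.ext h2
    rw [zpow_neg, eq_mul_inv_iff_mul_eq, one_mul] at h3
    exact h3.symm
  · exact absurd h1.1 one_ne_zero

/-- The vectors with entries in `{-1, 0, 1}`, not all zero. -/
def IsRootLike (l : Fin n → ℤ) : Prop := l ≠ 0 ∧ ∀ j, l j = -1 ∨ l j = 0 ∨ l j = 1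

theorem IsRootLike.exists_unit {l : Fin n → ℤ} (h : IsRootLike l) : ∃ j, l j * l j = 1 := by
  obtain ⟨j, hj⟩ := Function.ne_iff.1 h.1
  refine ⟨j, ?_⟩
  rcases h.2 j with h | h | h
  · simp [h]
  · exact absurd h hj
  · simp [h]

/-- With entries in `{-1, 0, 1}` the multiplier `l_j m_j` can only be `±1`, so distinct factors
define the same hypersurface only through inversion. -/
theorem IsRootLike.linFac_dvd_linFac {l m : Fin n → ℤ} (hl : IsRootLike l) (hm : IsRootLike m)
    {c d : ℂˣ} (h : linFac l c ∣ linFac m d) : (m = l ∧ d = c) ∨ (m = -l ∧ d = c⁻¹) := by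
  obtain ⟨j, hj⟩ := hl.exists_unit
  obtain ⟨h1, h2⟩ := Koornwinder.linFac_dvd_linFac hj h
  have h3 : l j * m j = -1 ∨ l j * m j = 0 ∨ l j * m j = 1 := by
    rcases hl.2 j with h | h | h <;> rcases hm.2 j with h' | h' | h' <;> simp [h, h']
  rcases h3 with h3 | h3 | h3
  · right
    rw [h3] at h1 h2
    simpa using And.intro h1 h2
  · rw [h3, zero_smul] at h1
    exact absurd h1 hm.1
  · left
    rw [h3] at h1 h2
    simpa using And.intro h1 h2

/-! ### Localization at a linear factor -/

variable {X : Type*} (pt : X → Fin n → ℂˣ)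

/-- The function defined by a Laurent polynomial on a space of points. -/
def evOn : Laurent n →ₐ[ℂ] (X → ℂ) := AlgHom.pi fun x => ev (pt x)

@[simp] theorem evOn_apply (p : Laurent n) (x : X) : evOn pt p x = ev (pt x) p := rfl

/-- The functions that are regular along the zero set of `1 - c e^l`. -/
def locAt (l : Fin n → ℤ) (c : ℂˣ) (j : Fin n) (hj : l j * l j = 1) : Subalgebra ℂ (X → ℂ) where
  carrier := {g | ∃ p q : Laurent n, ¬ linFac l c ∣ p ∧ evOn pt p * g = evOn pt q}
  mul_mem' := by
    rintro g h ⟨p, q, hp, hg⟩ ⟨p', q', hp', hh⟩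
    refine ⟨p * p', q * q', fun h => (linFac_dvd_mul hj h).elim hp hp', ?_⟩
    rw [map_mul, map_mul, ← hg, ← hh]
    ring
  add_mem' := by
    rintro g h ⟨p, q, hp, hg⟩ ⟨p', q', hp', hh⟩
    refine ⟨p * p', p' * q + p * q', fun h => (linFac_dvd_mul hj h).elim hp hp', ?_⟩
    rw [map_add, map_mul, map_mul, map_mul, ← hg, ← hh]
    ring
  algebraMap_mem' a := ⟨1, algebraMap ℂ _ a, not_linFac_dvd_one hj, by
    rw [map_one, one_mul, AlgHom.commutes]⟩

variable {pt}

theorem evOn_mem_locAt {l : Fin n → ℤ} {c : ℂˣ} {j : Fin n} {hj : l j * l j = 1}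
    (p : Laurent n) : evOn pt p ∈ locAt pt l c j hj :=
  ⟨1, p, not_linFac_dvd_one hj, by rw [map_one, one_mul]⟩

theorem inv_mem_locAt {l : Fin n → ℤ} {c : ℂˣ} {j : Fin n} {hj : l j * l j = 1}
    {p : Laurent n} (hp : ¬ linFac l c ∣ p) (h0 : ∀ x, ev (pt x) p ≠ 0) :
    (evOn pt p)⁻¹ ∈ locAt pt l c j hj :=
  ⟨p, 1, hp, by
    funext x
    simp [h0 x]⟩

/-- The functions with a denominator that is a product of linear factors from `S`. -/
def denOf (pt : X → Fin n → ℂˣ) (S : Set ((Fin n → ℤ) × ℂˣ)) : Subalgebra ℂ (X → ℂ) where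
  carrier := {g | ∃ p ∈ Submonoid.closure ((fun a => linFac a.1 a.2) '' S), ∃ q : Laurent n,
    evOn pt p * g = evOn pt q}
  mul_mem' := by
    rintro g h ⟨p, hp, q, hg⟩ ⟨p', hp', q', hh⟩
    refine ⟨p * p', mul_mem hp hp', q * q', ?_⟩
    rw [map_mul, map_mul, ← hg, ← hh]
    ring
  add_mem' := by
    rintro g h ⟨p, hp, q, hg⟩ ⟨p', hp', q', hh⟩
    refine ⟨p * p', mul_mem hp hp', p' * q + p * q', ?_⟩
    rw [map_add, map_mul, map_mul, map_mul, ← hg, ← hh]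
    ring
  algebraMap_mem' a := ⟨1, one_mem _, algebraMap ℂ _ a, by
    rw [map_one, one_mul, AlgHom.commutes]⟩

theorem inv_mem_denOf {S : Set ((Fin n → ℤ) × ℂˣ)} {l : Fin n → ℤ} {c : ℂˣ} (h : (l, c) ∈ S)
    (h0 : ∀ x, ev (pt x) (linFac l c) ≠ 0) : (evOn pt (linFac l c))⁻¹ ∈ denOf pt S :=
  ⟨linFac l c, Submonoid.subset_closure ⟨_, h, rfl⟩, 1, by
    funext x
    simp only [Pi.mul_apply, Pi.inv_apply, evOn_apply, map_one]
    exact mul_inv_cancel₀ (h0 x)⟩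

theorem evOn_mem_denOf {S : Set ((Fin n → ℤ) × ℂˣ)} (p : Laurent n) : evOn pt p ∈ denOf pt S :=
  ⟨1, one_mem _, p, by rw [map_one, one_mul]⟩

/-- A function with a denominator that is a product of linear factors is a Laurent polynomial
if it is regular along each of these factors. -/
theorem mem_range_of_locAt (hinj : Function.Injective (evOn pt)) {S : Set ((Fin n → ℤ) × ℂˣ)}
    (h0 : ∀ a ∈ S, ∀ x, ev (pt x) (linFac a.1 a.2) ≠ 0)
    {g : X → ℂ} (hg : g ∈ denOf pt S)
    (hloc : ∀ a ∈ S, ∃ j hj, g ∈ locAt pt a.1 a.2 j hj) : ∃ q, g = evOn pt q := by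
  obtain ⟨p, hp, q, hq⟩ := hg
  induction hp using Submonoid.closure_induction generalizing g q with
  | one => exact ⟨q, by rw [← hq, map_one, one_mul]⟩
  | mem p hp =>
    obtain ⟨a, ha, rfl⟩ := hp
    dsimp only at hq
    obtain ⟨j, hj, p', q', hp', hq'⟩ := hloc a ha
    -- Both sides equal `p' · (1 - c e^l) · g` as functions. By primality the factor divides `q`,
    -- and it can then be cancelled because it has no zeros at the points.
    have h1 : p' * q = linFac a.1 a.2 * q' := hinj (by
      rw [map_mul, map_mul, ← hq, ← hq']
      ring)
    obtain ⟨q₂, rfl⟩ := (linFac_dvd_mul hj ⟨_, h1⟩).resolve_left hp'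
    refine ⟨q₂, ?_⟩
    funext x
    have := congrFun hq x
    rw [map_mul] at this
    exact mul_left_cancel₀ (h0 a ha x) this
  | mul p₁ p₂ _ _ ih₁ ih₂ =>
    -- The first half of the denominator is removed from the function `p₂ g`, which is as regular as
    -- `g`; the second half is then removed from `g`.
    have h2 : ∃ q', evOn pt p₂ * g = evOn pt q' := by
      refine (ih₁ (g := evOn pt p₂ * g) (fun a ha => ?_) q ?_)
      · obtain ⟨j, hj, h⟩ := hloc a ha
        exact ⟨j, hj, mul_mem (evOn_mem_locAt p₂) h⟩
      · rw [← hq, map_mul, mul_assoc]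
    obtain ⟨q', hq'⟩ := h2
    exact ih₂ hloc q' hq'

end Koornwinder

end

/-! ### The difference operators in multiplicative coordinates. -/

noncomputable section

namespace Koornwinder

variable {n : ℕ}

/-! ### Products over pairs -/

/-- The pairs `j < k`. -/
def ltPairs (n : ℕ) : Finset (Fin n × Fin n) := {p | p.1 < p.2}

theorem mem_ltPairs {p : Fin n × Fin n} : p ∈ ltPairs n ↔ p.1 < p.2 := by simp [ltPairs]

theorem prod_prod_lt {M : Type*} [CommMonoid M] (f : Fin n → Fin n → M) :
    ∏ j, ∏ k with j < k, f j k = ∏ p ∈ ltPairs n, f p.1 p.2 := by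
  rw [ltPairs, Finset.prod_filter, Fintype.prod_prod_type]
  simp [Finset.prod_filter]

theorem prod_prod_eq_ltPairs {M : Type*} [CommMonoid M] (f : Fin n → Fin n → M)
    (h : ∀ j, f j j = 1) :
    ∏ j, ∏ k, f j k = ∏ p ∈ ltPairs n, f p.1 p.2 * f p.2 p.1 := by
  have h1 : ∀ j, ∏ k, f j k = (∏ k with j < k, f j k) * ∏ k with k < j, f j k := by
    intro j
    simp only [Finset.prod_filter, ← Finset.prod_mul_distrib]
    refine Finset.prod_congr rfl fun k _ => ?_
    rcases lt_trichotomy j k with h' | h' | h'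
    · simp [h', h'.not_gt]
    · simp [h', h]
    · simp [h', h'.not_gt]
  simp only [h1, Finset.prod_mul_distrib]
  rw [prod_prod_lt]
  congr 1
  rw [← prod_prod_lt fun j k => f k j]
  simp only [Finset.prod_filter]
  exact Finset.prod_comm

open scoped Classical in
theorem prod_cross {M : Type*} [CommMonoid M] (S C : Finset (Fin n)) (h : Disjoint S C)
    (f : Fin n → Fin n → M) :
    ∏ j ∈ S, ∏ k ∈ C, f j k = ∏ p ∈ ltPairs n, (if p.1 ∈ S ∧ p.2 ∈ C then f p.1 p.2 else 1)
      * (if p.2 ∈ S ∧ p.1 ∈ C then f p.2 p.1 else 1) := by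
  rw [← prod_prod_eq_ltPairs fun j k => if j ∈ S ∧ k ∈ C then f j k else 1]
  · have h1 : ∀ j, (∏ k, if j ∈ S ∧ k ∈ C then f j k else 1)
        = if j ∈ S then ∏ k ∈ C, f j k else 1 := by
      intro j
      by_cases hj : j ∈ S <;> simp [hj, Finset.prod_ite_mem]
    simp [h1, Finset.prod_ite_mem]
  · intro j
    rw [if_neg]
    exact fun hj => Finset.disjoint_left.1 h hj.1 hj.2

theorem prod_ltPairs_perm {M : Type*} [CommMonoid M] (σ : Equiv.Perm (Fin n))
    (f : Fin n → Fin n → M) (hf : ∀ j k, f j k = f k j) :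
    ∏ p ∈ ltPairs n, f (σ p.1) (σ p.2) = ∏ p ∈ ltPairs n, f p.1 p.2 := by
  have key : ∀ τ : Equiv.Perm (Fin n), ∀ p ∈ ltPairs n,
      (if τ p.1 < τ p.2 then (τ p.1, τ p.2) else (τ p.2, τ p.1)) ∈ ltPairs n := by
    intro τ p hp
    rw [mem_ltPairs] at hp ⊢
    split_ifs with h
    · exact h
    · exact lt_of_le_of_ne (not_lt.1 h) fun h' => hp.ne' (τ.injective h')
  refine Finset.prod_bij' (fun p _ => if σ p.1 < σ p.2 then (σ p.1, σ p.2) else (σ p.2, σ p.1))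
    (fun p _ => if σ.symm p.1 < σ.symm p.2 then (σ.symm p.1, σ.symm p.2)
      else (σ.symm p.2, σ.symm p.1)) (key σ) (key σ.symm) ?_ ?_ ?_
  · intro p hp
    rw [mem_ltPairs] at hp
    by_cases h : σ p.1 < σ p.2 <;> simp [h, hp, hp.not_gt]
  · intro p hp
    rw [mem_ltPairs] at hp
    by_cases h : σ.symm p.1 < σ.symm p.2 <;> simp [h, hp, hp.not_gt]
  · intro p hp
    split_ifs
    · rfl
    · exact hf _ _

/-! ### The coefficients in multiplicative coordinates -/

/-- `e^{-β/2}`. -/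
def Params.rU (P : Params) : ℂˣ := Units.mk0 (P.qpow (1 / 2)) (by simp [Params.qpow])

/-- `e^{-β}`. -/
def Params.qU (P : Params) : ℂˣ := P.rU ^ 2

theorem Params.rU_val (P : Params) : (P.rU : ℂ) = P.qpow (1 / 2) := rfl

theorem Params.qpow_add (P : Params) (s t : ℝ) : P.qpow (s + t) = P.qpow s * P.qpow t := by
  simp [Params.qpow, mul_add, Complex.exp_add]

theorem Params.qU_val (P : Params) : (P.qU : ℂ) = P.qpow 1 := by
  rw [Params.qU, pow_two, Units.val_mul, P.rU_val, ← P.qpow_add]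
  norm_num

theorem Params.qU_val' (P : Params) : (P.qU : ℂ) = Complex.exp (-P.β) := by
  rw [P.qU_val]
  simp [Params.qpow]

theorem Params.rU_val' (P : Params) : (P.rU : ℂ) = Complex.exp (-P.β / 2) := by
  rw [P.rU_val]
  simp only [Params.qpow]
  push_cast
  ring_nf

/-- The building block `e^{βg/2} (1 - q^g y) / (1 - y)`. -/
def uFac (P : Params) (g : ℝ) (y : ℂ) : ℂ :=
  Complex.exp (P.β * g / 2) * ((1 - P.qpow g * y) * (1 - y)⁻¹)

/-- The one-variable coefficient in multiplicative coordinates. -/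
def vbm (P : Params) (y : ℂ) : ℂ :=
  uFac P P.g₀ y * uFac P P.g₁ (-y) * (uFac P P.g₀' (P.rU * y) * uFac P P.g₁' (-P.rU * y))

theorem sin_eq_mul (y : ℂ) : Complex.sin y
    = Complex.I / 2 * Complex.exp (-Complex.I * y) * (1 - Complex.exp (2 * Complex.I * y)) := by
  rw [Complex.sin, mul_sub, mul_one, mul_assoc (Complex.I / 2) (Complex.exp _), ← Complex.exp_add]
  ring_nf

theorem cos_eq_mul (y : ℂ) : Complex.cos y
    = 1 / 2 * Complex.exp (-Complex.I * y) * (1 + Complex.exp (2 * Complex.I * y)) := by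
  rw [Complex.cos, mul_add, mul_one, mul_assoc (1 / 2 : ℂ) (Complex.exp _), ← Complex.exp_add]
  ring_nf

/-- Each sine is `e^{-iy}` times `1 - e^{2iy}` up to a constant, and the shift `iβg` contributes the
real factor `q^g`. For the cosines the sign of the argument of `uFac` changes. -/
theorem sin_div_sin (P : Params) (g : ℝ) (z : ℂ) :
    Complex.sin ((Complex.I * P.β * g + z) / 2) / Complex.sin (z / 2)
      = uFac P g (Complex.exp (Complex.I * z)) := by
  have h1 : Complex.exp (2 * Complex.I * ((Complex.I * P.β * g + z) / 2))
      = P.qpow g * Complex.exp (Complex.I * z) := by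
    simp only [Params.qpow]
    push_cast
    rw [← Complex.exp_add]
    congr 1
    linear_combination (P.β * g : ℂ) * Complex.I_sq
  have h2 : Complex.exp (-Complex.I * ((Complex.I * P.β * g + z) / 2))
      = Complex.exp (P.β * g / 2) * Complex.exp (-Complex.I * (z / 2)) := by
    rw [← Complex.exp_add]
    congr 1
    linear_combination (-P.β * g / 2 : ℂ) * Complex.I_sq
  have h3 : 2 * Complex.I * (z / 2) = Complex.I * z := by ring
  rw [sin_eq_mul, sin_eq_mul (z / 2), h1, h2, h3, uFac]
  have h4 : Complex.I / 2 * Complex.exp (-Complex.I * (z / 2)) ≠ 0 := by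
    simp [Complex.exp_ne_zero]
  rw [div_eq_mul_inv, mul_inv]
  field_simp

theorem cos_div_cos (P : Params) (g : ℝ) (z : ℂ) :
    Complex.cos ((Complex.I * P.β * g + z) / 2) / Complex.cos (z / 2)
      = uFac P g (-Complex.exp (Complex.I * z)) := by
  have h1 : Complex.exp (2 * Complex.I * ((Complex.I * P.β * g + z) / 2))
      = P.qpow g * Complex.exp (Complex.I * z) := by
    simp only [Params.qpow]
    push_cast
    rw [← Complex.exp_add]
    congr 1
    linear_combination (P.β * g : ℂ) * Complex.I_sq
  have h2 : Complex.exp (-Complex.I * ((Complex.I * P.β * g + z) / 2))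
      = Complex.exp (P.β * g / 2) * Complex.exp (-Complex.I * (z / 2)) := by
    rw [← Complex.exp_add]
    congr 1
    linear_combination (-P.β * g / 2 : ℂ) * Complex.I_sq
  have h3 : 2 * Complex.I * (z / 2) = Complex.I * z := by ring
  rw [cos_eq_mul, cos_eq_mul (z / 2), h1, h2, h3, uFac]
  have h4 : (1 / 2 : ℂ) * Complex.exp (-Complex.I * (z / 2)) ≠ 0 := by
    simp [Complex.exp_ne_zero]
  rw [div_eq_mul_inv, mul_inv]
  field_simp
  ring

theorem va_eq (P : Params) (z : ℂ) : va P z = uFac P P.g (Complex.exp (Complex.I * z)) :=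
  sin_div_sin P P.g z

theorem exp_I_γ (P : Params) (z : ℂ) : Complex.exp (Complex.I * (P.γ + z))
    = P.rU * Complex.exp (Complex.I * z) := by
  rw [P.rU_val', ← Complex.exp_add, Params.γ]
  congr 1
  linear_combination (P.β / 2 : ℂ) * Complex.I_sq

theorem vb_eq (P : Params) (z : ℂ) : vb P z = vbm P (Complex.exp (Complex.I * z)) := by
  rw [vb, add_assoc, add_assoc, sin_div_sin, sin_div_sin, cos_div_cos, cos_div_cos, exp_I_γ, vbm]
  ring

/-- The variables with nonzero sign. -/
def supp (ε : Fin n → SignType) : Finset (Fin n) := {j | ε j ≠ 0}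

theorem mem_supp {ε : Fin n → SignType} {j : Fin n} : j ∈ supp ε ↔ ε j ≠ 0 := by simp [supp]

/-- `w_j ^ ε_j`. -/
def sgnPow (ε : Fin n → SignType) (w : Fin n → ℂˣ) (j : Fin n) : ℂˣ := w j ^ (ε j : ℤ)

open scoped Classical in
/-- The contribution of the pair `{j, k}` to the coefficient `V_{ε;C}`. -/
def pairFac (P : Params) (ε : Fin n → SignType) (C : Finset (Fin n)) (w : Fin n → ℂˣ)
    (j k : Fin n) : ℂ :=
  if ε j ≠ 0 ∧ ε k ≠ 0 then
    uFac P P.g (sgnPow ε w j * sgnPow ε w k) * uFac P P.g (P.qU * (sgnPow ε w j * sgnPow ε w k))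
  else if ε j ≠ 0 ∧ k ∈ C then
    uFac P P.g (sgnPow ε w j * w k) * uFac P P.g (sgnPow ε w j * (w k)⁻¹)
  else if ε k ≠ 0 ∧ j ∈ C then
    uFac P P.g (sgnPow ε w k * w j) * uFac P P.g (sgnPow ε w k * (w j)⁻¹)
  else 1

/-- The contribution of the variable `j` to the coefficient `V_{ε;C}`. -/
def singleFac (P : Params) (ε : Fin n → SignType) (w : Fin n → ℂˣ) (j : Fin n) : ℂ :=
  if ε j ≠ 0 then vbm P (sgnPow ε w j) else 1

/-- The coefficient `V_{ε;C}` in multiplicative coordinates. -/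
def coeffM (P : Params) (ε : Fin n → SignType) (C : Finset (Fin n)) (w : Fin n → ℂˣ) : ℂ :=
  (∏ j, singleFac P ε w j) * ∏ p ∈ ltPairs n, pairFac P ε C w p.1 p.2

theorem expU_zpow (x : Fin n → ℂ) (j : Fin n) (k : ℤ) :
    ((expU x j ^ k : ℂˣ) : ℂ) = Complex.exp (Complex.I * (k * x j)) := by
  rw [Units.val_zpow_eq_zpow_val, expU_val, ← Complex.exp_int_mul]
  ring_nf

theorem exp_I_add (x y : ℂ) : Complex.exp (Complex.I * (x + y))
    = Complex.exp (Complex.I * x) * Complex.exp (Complex.I * y) := by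
  rw [mul_add, Complex.exp_add]

/-- A pair `(J, ε)` is encoded by one vector with values in `{-1, 0, 1}` and support `J`. Since `J`
and `C` are disjoint, at most one of the cases of `pairFac` applies to each pair of variables, and
all products can be collected over pairs `j < k`. -/
theorem coeffV_eq (P : Params) (ε : Fin n → SignType) (e : Fin n → ℤ) (J C : Finset (Fin n))
    (hJ : J = supp ε) (he : ∀ j ∈ J, e j = (ε j : ℤ)) (hC : Disjoint J C) (x : Fin n → ℂ) :
    coeffV P e J C x = coeffM P ε C (expU x) := by
  classical
  subst hJ
  have hγ : Complex.exp (Complex.I * (2 * P.γ)) = P.qU := by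
    rw [P.qU_val', Params.γ]
    congr 1
    linear_combination (P.β : ℂ) * Complex.I_sq
  have hz : ∀ (s : SignType) (y : ℂ), Complex.exp (Complex.I * ((s : ℂ) * y))
      = Complex.exp (Complex.I * y) ^ (s : ℤ) := fun s y => by
    rw [← Complex.exp_int_mul, SignType.intCast_cast]
    ring_nf
  have h1 : ∏ j ∈ supp ε, vb P (e j * x j) = ∏ j, singleFac P ε (expU x) j := by
    simp only [supp, Finset.prod_filter, singleFac]
    refine Finset.prod_congr rfl fun j _ => ?_
    split_ifs with h
    · rw [he j (mem_supp.2 h), vb_eq, sgnPow, expU_zpow]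
    · rfl
  rw [coeffV, coeffM, h1, mul_assoc, prod_cross _ _ hC]
  congr 1
  have h2 : ∏ j ∈ supp ε, ∏ k ∈ supp ε with j < k,
      va P (e j * x j + e k * x k) * va P (e j * x j + e k * x k + 2 * P.γ)
      = ∏ p ∈ ltPairs n, if ε p.1 ≠ 0 ∧ ε p.2 ≠ 0 then
        va P (e p.1 * x p.1 + e p.2 * x p.2)
          * va P (e p.1 * x p.1 + e p.2 * x p.2 + 2 * P.γ) else 1 := by
    rw [← prod_prod_lt fun j k => if ε j ≠ 0 ∧ ε k ≠ 0 then
        va P (e j * x j + e k * x k) * va P (e j * x j + e k * x k + 2 * P.γ) else 1]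
    simp only [supp, Finset.prod_filter]
    refine Finset.prod_congr rfl fun j _ => ?_
    by_cases hj : ε j = 0
    · simp [hj]
    · simp only [ne_eq, hj, not_false_eq_true, if_true, true_and]
      refine Finset.prod_congr rfl fun k _ => ?_
      by_cases hk : ε k = 0 <;> simp [hk]
  rw [h2, ← Finset.prod_mul_distrib]
  refine Finset.prod_congr rfl fun p _ => ?_
  have hd : ∀ k, ε k ≠ 0 → k ∉ C := fun k hk => Finset.disjoint_left.1 hC (mem_supp.2 hk)
  by_cases hj : ε p.1 = 0 <;> by_cases hk : ε p.2 = 0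
  · simp [pairFac, hj, hk, mem_supp]
  · have hk' := hd _ hk
    have e2 := he _ (mem_supp.2 hk)
    by_cases hjC : p.1 ∈ C
    · simp [pairFac, hj, hk, mem_supp, hjC, va_eq, e2, sub_eq_add_neg, exp_I_add, sgnPow,
        hz, mul_neg, Complex.exp_neg]
    · simp [pairFac, hj, hk, mem_supp, hjC]
  · have hj' := hd _ hj
    have e1 := he _ (mem_supp.2 hj)
    by_cases hkC : p.2 ∈ C
    · simp [pairFac, hj, hk, mem_supp, hkC, va_eq, e1, sub_eq_add_neg, exp_I_add, sgnPow,
        hz, mul_neg, Complex.exp_neg]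
    · simp [pairFac, hj, hk, mem_supp, hkC]
  · have hj' := hd _ hj
    have hk' := hd _ hk
    have e1 := he _ (mem_supp.2 hj)
    have e2 := he _ (mem_supp.2 hk)
    simp [pairFac, hj, hk, mem_supp, hj', hk', va_eq, e1, e2, exp_I_add, hγ, sgnPow, hz,
      mul_comm (P.qU : ℂ)]

end Koornwinder

end

noncomputable section

namespace Koornwinder

variable {n : ℕ}

/-! ### Sums over chains -/

open scoped Classical in
/-- The chains `A = J₀ ⊊ J₁ ⊊ ⋯ ⊊ J_s = J`. -/
def chainsFrom (A J : Finset (Fin n)) (s : ℕ) : Finset (Fin (s + 1) → Finset (Fin n)) :=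
  {c | StrictMono c ∧ c 0 = A ∧ c (Fin.last s) = J}

theorem mem_chainsFrom {A J : Finset (Fin n)} {s : ℕ} {c : Fin (s + 1) → Finset (Fin n)} :
    c ∈ chainsFrom A J s ↔ StrictMono c ∧ c 0 = A ∧ c (Fin.last s) = J := by
  simp [chainsFrom]

theorem chains_eq (J : Finset (Fin n)) (s : ℕ) : chains J s = chainsFrom ∅ J s := rfl

theorem strictMono_cons {s : ℕ} {A : Finset (Fin n)} {c : Fin (s + 1) → Finset (Fin n)} :
    StrictMono (Fin.cons A c : Fin (s + 2) → Finset (Fin n)) ↔ A ⊂ c 0 ∧ StrictMono c := by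
  rw [Fin.strictMono_iff_lt_succ, Fin.strictMono_iff_lt_succ, Fin.forall_fin_succ]
  simp

theorem sum_chainsFrom_succ {M : Type*} [AddCommMonoid M] (A J : Finset (Fin n)) (s : ℕ)
    (F : (Fin (s + 2) → Finset (Fin n)) → M) :
    ∑ c ∈ chainsFrom A J (s + 1), F c
      = ∑ B with A ⊂ B, ∑ c ∈ chainsFrom B J s, F (Fin.cons A c) := by
  rw [Finset.sum_sigma']
  refine Finset.sum_bij' (fun c _ => ⟨c 1, Fin.tail c⟩) (fun p _ => Fin.cons A p.2) ?_ ?_ ?_ ?_ ?_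
  · intro c hc
    obtain ⟨h1, h2, h3⟩ := mem_chainsFrom.1 hc
    rw [← Fin.cons_self_tail c, strictMono_cons, h2] at h1
    simp only [Finset.mem_sigma, Finset.mem_filter, Finset.mem_univ, true_and, mem_chainsFrom]
    exact ⟨h1.1, h1.2, rfl, h3⟩
  · rintro ⟨B, c⟩ hc
    simp only [Finset.mem_sigma, Finset.mem_filter, Finset.mem_univ, true_and, mem_chainsFrom] at hc
    obtain ⟨h1, h2, rfl, h4⟩ := hc
    rw [mem_chainsFrom]
    refine ⟨strictMono_cons.2 ⟨h1, h2⟩, rfl, ?_⟩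
    rw [← Fin.succ_last, Fin.cons_succ]
    exact h4
  · intro c hc
    obtain ⟨h1, h2, h3⟩ := mem_chainsFrom.1 hc
    rw [← h2]
    exact Fin.cons_self_tail c
  · rintro ⟨B, c⟩ hc
    simp only [Finset.mem_sigma, Finset.mem_filter, Finset.mem_univ, true_and, mem_chainsFrom] at hc
    obtain ⟨h1, h2, rfl, h4⟩ := hc
    simp
  · intro c hc
    obtain ⟨h1, h2, h3⟩ := mem_chainsFrom.1 hc
    rw [← h2]
    exact congrArg F (Fin.cons_self_tail c).symm

/-- The signed sum over chains of length `s` from `A` to `J` of the products of the weights. -/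
def chainSum (κ : Finset (Fin n) → Finset (Fin n) → ℂ) (J : Finset (Fin n)) :
    ℕ → Finset (Fin n) → ℂ
  | 0, A => if A = J then 1 else 0
  | s + 1, A => -∑ B with A ⊂ B, κ A B * chainSum κ J s B

theorem sum_chainsFrom (κ : Finset (Fin n) → Finset (Fin n) → ℂ) (J : Finset (Fin n)) (s : ℕ)
    (A : Finset (Fin n)) :
    ∑ c ∈ chainsFrom A J s, (-1 : ℂ) ^ s * ∏ i : Fin s, κ (c i.castSucc) (c i.succ)
      = chainSum κ J s A := by
  induction s generalizing A with
  | zero =>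
    rw [chainSum]
    split_ifs with h
    · subst h
      have : chainsFrom A A 0 = {fun _ => A} := by
        ext c
        rw [mem_chainsFrom, Finset.mem_singleton]
        constructor
        · rintro ⟨-, h, -⟩
          funext i
          rw [Fin.fin_one_eq_zero i, h]
        · rintro rfl
          exact ⟨fun i j hij => absurd hij (by omega), rfl, rfl⟩
      simp [this]
    · have : chainsFrom A J 0 = ∅ := by
        rw [Finset.eq_empty_iff_forall_notMem]
        intro c hc
        obtain ⟨-, h1, h2⟩ := mem_chainsFrom.1 hc
        exact h (h1.symm.trans h2)
      simp [this]
  | succ s ih =>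
    rw [sum_chainsFrom_succ, chainSum, ← Finset.sum_neg_distrib]
    refine Finset.sum_congr rfl fun B _ => ?_
    rw [← ih B, Finset.mul_sum, ← Finset.sum_neg_distrib]
    refine Finset.sum_congr rfl fun c hc => ?_
    obtain ⟨-, h1, -⟩ := mem_chainsFrom.1 hc
    rw [Fin.prod_univ_succ]
    simp only [Fin.castSucc_zero, Fin.cons_zero, ← Fin.succ_castSucc, Fin.cons_succ, h1]
    ring

/-- The operator attached to a chain depends on its first nontrivial set only. Splitting off this
set leaves a sum over the rest of the chain that does not see `Φ`. -/
theorem sum_chainsFrom_mul (κ : Finset (Fin n) → Finset (Fin n) → ℂ) (J : Finset (Fin n)) (s : ℕ)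
    (A : Finset (Fin n)) (Φ : Finset (Fin n) → ℂ) :
    ∑ c ∈ chainsFrom A J (s + 1), (-1 : ℂ) ^ s
        * (∏ i : Fin (s + 1), κ (c i.castSucc) (c i.succ)) * Φ (c 1)
      = ∑ B with A ⊂ B, κ A B * Φ B * chainSum κ J s B := by
  rw [sum_chainsFrom_succ]
  refine Finset.sum_congr rfl fun B _ => ?_
  rw [← sum_chainsFrom κ J s B, Finset.mul_sum]
  refine Finset.sum_congr rfl fun c hc => ?_
  obtain ⟨-, h1, -⟩ := mem_chainsFrom.1 hc
  rw [Fin.prod_univ_succ, show (1 : Fin (s + 1 + 1)) = Fin.succ 0 from rfl]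
  simp only [Fin.castSucc_zero, Fin.cons_zero, ← Fin.succ_castSucc, Fin.cons_succ, h1]
  ring

theorem chainSum_eq_zero {κ : Finset (Fin n) → Finset (Fin n) → ℂ} {J : Finset (Fin n)} {s : ℕ}
    {A : Finset (Fin n)} (h : ¬ A ⊆ J) : chainSum κ J s A = 0 := by
  induction s generalizing A with
  | zero =>
    rw [chainSum, if_neg]
    rintro rfl
    exact h subset_rfl
  | succ s ih =>
    rw [chainSum, neg_eq_zero]
    refine Finset.sum_eq_zero fun B hB => ?_
    rw [ih fun hBJ => h ((Finset.mem_filter.1 hB).2.1.trans hBJ), mul_zero]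

theorem chainSum_congr {κ κ' : Finset (Fin n) → Finset (Fin n) → ℂ} {J : Finset (Fin n)} {s : ℕ}
    {A : Finset (Fin n)} (h : ∀ B C, A ⊆ B → B ⊂ C → C ⊆ J → κ B C = κ' B C) :
    chainSum κ J s A = chainSum κ' J s A := by
  induction s generalizing A with
  | zero => rfl
  | succ s ih =>
    rw [chainSum, chainSum]
    congr 1
    refine Finset.sum_congr rfl fun B hB => ?_
    have hAB := (Finset.mem_filter.1 hB).2
    by_cases hBJ : B ⊆ J
    · rw [h A B subset_rfl hAB hBJ, ih fun C D hC => h C D (hAB.1.trans hC)]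
    · rw [chainSum_eq_zero hBJ, chainSum_eq_zero hBJ, mul_zero, mul_zero]

/-! ### Restriction of sign vectors -/

/-- The restriction of a sign vector to a set. -/
def restr (ε : Fin n → SignType) (B : Finset (Fin n)) : Fin n → SignType :=
  fun j => if j ∈ B then ε j else 0

/-- The sum of two sign vectors with disjoint supports. -/
def glue (ε δ : Fin n → SignType) : Fin n → SignType := fun j => if ε j ≠ 0 then ε j else δ j

theorem supp_restr (ε : Fin n → SignType) (B : Finset (Fin n)) :
    supp (restr ε B) = supp ε ∩ B := by
  ext j
  simp [mem_supp, restr, and_comm]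

theorem supp_glue (ε δ : Fin n → SignType) : supp (glue ε δ) = supp ε ∪ supp δ := by
  ext j
  simp only [mem_supp, glue, Finset.mem_union]
  by_cases h : ε j = 0 <;> simp [h]

theorem supp_eq_empty {ε : Fin n → SignType} : supp ε = ∅ ↔ ε = 0 := by
  simp [supp, Finset.filter_eq_empty_iff, funext_iff]

theorem supp_zero : supp (0 : Fin n → SignType) = ∅ := supp_eq_empty.2 rfl

theorem eq_zero_of_notMem_supp {ε : Fin n → SignType} {j : Fin n} (h : j ∉ supp ε) : ε j = 0 := by
  simpa [mem_supp] using h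

/-! ### The difference operators in multiplicative coordinates -/

/-- The second coefficient of the difference operator of order `r`; the first argument bounds the
depth of the recursion. -/
def uCoef (P : Params) (w : Fin n → ℂˣ) (r : ℕ) : ℕ → Finset (Fin n) → ℂ
  | 0, A => if A.card = r then 1 else 0
  | m + 1, A => (if A.card = r then 1 else 0)
      - ∑ ε with ε ≠ 0 ∧ Disjoint (supp ε) A,
          coeffM P ε (A ∪ supp ε)ᶜ w * uCoef P w r m (A ∪ supp ε)

/-- Translation in multiplicative coordinates. -/
def shiftU (P : Params) (ε : Fin n → SignType) (w : Fin n → ℂˣ) : Fin n → ℂˣ :=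
  fun j => w j * P.qU ^ (ε j : ℤ)

/-- The difference operator of order `r` in multiplicative coordinates. -/
def dOp (P : Params) (r : ℕ) (f : (Fin n → ℂˣ) → ℂ) (w : Fin n → ℂˣ) : ℂ :=
  ∑ ε, coeffM P ε (supp ε)ᶜ w * uCoef P w r r (supp ε) * (f (shiftU P ε w) - f w)

/-- Every step enlarges `A` by at least one element, and only sets of cardinality `r` contribute.
Hence `r - |A|` steps exhaust the recursion and its value no longer depends on the depth. -/
theorem uCoef_succ (P : Params) (w : Fin n → ℂˣ) (r : ℕ) (m : ℕ) (A : Finset (Fin n))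
    (h : r ≤ m + A.card) : uCoef P w r (m + 1) A = uCoef P w r m A := by
  have hcard : ∀ ε ∈ Finset.univ.filter (fun ε : Fin n → SignType => ε ≠ 0 ∧ Disjoint (supp ε) A),
      A.card + 1 ≤ (A ∪ supp ε).card := by
    intro ε hε
    obtain ⟨h0, hd⟩ := (Finset.mem_filter.1 hε).2
    rw [Finset.card_union_of_disjoint hd.symm]
    have : 0 < (supp ε).card :=
      Finset.card_pos.2 (Finset.nonempty_iff_ne_empty.2 fun h => h0 (supp_eq_empty.1 h))
    omega
  induction m generalizing A with
  | zero =>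
    rw [uCoef, uCoef, sub_eq_self]
    refine Finset.sum_eq_zero fun ε hε => ?_
    have := hcard ε hε
    rw [uCoef, if_neg (by omega), mul_zero]
  | succ m ih =>
    rw [uCoef, uCoef]
    congr 1
    refine Finset.sum_congr rfl fun ε hε => ?_
    have := hcard ε hε
    rw [ih _ (by omega)]
    intro δ hδ
    obtain ⟨h0, hd⟩ := (Finset.mem_filter.1 hδ).2
    rw [Finset.card_union_of_disjoint hd.symm]
    have : 0 < (supp δ).card :=
      Finset.card_pos.2 (Finset.nonempty_iff_ne_empty.2 fun h => h0 (supp_eq_empty.1 h))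
    omega

/-- The weight of a step of a chain. -/
def stepWeight (P : Params) (x : Fin n → ℂ) (e : Fin n → SignType) (A B : Finset (Fin n)) : ℂ :=
  coeffV P (fun j => (e j : ℤ)) (B \ A) Bᶜ x

/-- The sign vectors that extend `A` to a set of cardinality `r`. -/
def extensions (r : ℕ) (A : Finset (Fin n)) : Finset (Fin n → SignType) :=
  {e | Disjoint (supp e) A ∧ A.card + (supp e).card = r}

theorem mem_extensions {r : ℕ} {A : Finset (Fin n)} {e : Fin n → SignType} :
    e ∈ extensions r A ↔ Disjoint (supp e) A ∧ A.card + (supp e).card = r := by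
  simp [extensions]

theorem stepWeight_eq (P : Params) (x : Fin n → ℂ) {e : Fin n → SignType} {A B : Finset (Fin n)}
    (he : Disjoint (supp e) A) (hB : B ⊆ A ∪ supp e) :
    stepWeight P x e A B = coeffM P (restr e B) Bᶜ (expU x) := by
  refine coeffV_eq P _ _ _ _ ?_ ?_ ?_ x
  · rw [supp_restr]
    ext j
    simp only [Finset.mem_sdiff, Finset.mem_inter]
    constructor
    · rintro ⟨h1, h2⟩
      exact ⟨(Finset.mem_union.1 (hB h1)).resolve_left h2, h1⟩
    · rintro ⟨h1, h2⟩
      exact ⟨h2, Finset.disjoint_left.1 he h1⟩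
  · intro j hj
    rw [restr, if_pos (Finset.mem_sdiff.1 hj).1]
  · exact (disjoint_compl_right (a := B)).mono_left Finset.sdiff_subset

theorem union_supp_restr {e : Fin n → SignType} {A B : Finset (Fin n)} (hAB : A ⊆ B)
    (hB : B ⊆ A ∪ supp e) : A ∪ supp (restr e B) = B := by
  rw [supp_restr]
  ext j
  have := @hB j
  have := @hAB j
  simp only [Finset.mem_union, Finset.mem_inter] at *
  tauto

theorem union_supp_restr_compl {e : Fin n → SignType} {A B : Finset (Fin n)} (hAB : A ⊆ B)
    (hB : B ⊆ A ∪ supp e) : B ∪ supp (restr e Bᶜ) = A ∪ supp e := by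
  rw [supp_restr]
  ext j
  have := @hB j
  have := @hAB j
  simp only [Finset.mem_union, Finset.mem_inter, Finset.mem_compl] at *
  tauto

theorem stepWeight_restr_compl (P : Params) (x : Fin n → ℂ) (e : Fin n → SignType)
    {B C : Finset (Fin n)} (hBC : B ⊆ C) (D : Finset (Fin n)) :
    stepWeight P x e C D = stepWeight P x (restr e Bᶜ) C D := by
  have h4 : ∀ j ∈ D \ C, (restr e Bᶜ j : ℤ) = (e j : ℤ) := by
    intro j hj
    rw [restr, if_pos (Finset.mem_compl.2 fun h => (Finset.mem_sdiff.1 hj).2 (hBC h))]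
  refine congrArg₂ (· * ·) (congrArg₂ (· * ·) ?_ ?_) ?_
  · exact Finset.prod_congr rfl fun j hj => by
      dsimp only
      rw [h4 j hj]
  · refine Finset.prod_congr rfl fun j hj => Finset.prod_congr rfl fun k hk => ?_
    dsimp only
    rw [h4 j hj, h4 k (Finset.mem_filter.1 hk).1]
  · exact Finset.prod_congr rfl fun j hj => by
      dsimp only
      rw [h4 j hj]

/-- A sign vector `e` with an intermediate set `B` between `A` and `A ∪ supp e` is the same as the
restriction of `e` to `B` together with its restriction to the complement. The other sets `B` carry
no chains. This reindexing converts sums over chains into the recursion of `uCoef`. -/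
theorem sum_extensions (P : Params) (x : Fin n → ℂ) (r m : ℕ) (A : Finset (Fin n))
    (Φ : (Fin n → SignType) → ℂ) :
    ∑ e ∈ extensions r A, ∑ B with A ⊂ B, stepWeight P x e A B * Φ (restr e B)
        * ∑ s ∈ Finset.range m, chainSum (stepWeight P x e) (A ∪ supp e) s B
      = ∑ ε with ε ≠ 0 ∧ Disjoint (supp ε) A, coeffM P ε (A ∪ supp ε)ᶜ (expU x) * Φ ε
        * ∑ e ∈ extensions r (A ∪ supp ε), ∑ s ∈ Finset.range m,
            chainSum (stepWeight P x e) (A ∪ supp ε ∪ supp e) s (A ∪ supp ε) := by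
  have h1 : ∀ e ∈ extensions r A, ∑ B with A ⊂ B, stepWeight P x e A B * Φ (restr e B)
        * ∑ s ∈ Finset.range m, chainSum (stepWeight P x e) (A ∪ supp e) s B
      = ∑ B with A ⊂ B ∧ B ⊆ A ∪ supp e, stepWeight P x e A B * Φ (restr e B)
        * ∑ s ∈ Finset.range m, chainSum (stepWeight P x e) (A ∪ supp e) s B := by
    intro e _
    rw [← Finset.filter_filter]
    refine (Finset.sum_filter_of_ne fun B _ hB => ?_).symm
    by_contra hn
    exact hB (by rw [Finset.sum_eq_zero fun s _ => chainSum_eq_zero hn, mul_zero])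
  rw [Finset.sum_congr rfl h1]
  simp only [Finset.mul_sum (extensions _ _)]
  rw [Finset.sum_sigma', Finset.sum_sigma']
  refine Finset.sum_bij' (fun p _ => ⟨restr p.1 p.2, restr p.1 p.2ᶜ⟩)
    (fun p _ => ⟨glue p.1 p.2, A ∪ supp p.1⟩) ?_ ?_ ?_ ?_ ?_
  · rintro ⟨e, B⟩ h
    simp only [Finset.mem_sigma, mem_extensions, Finset.mem_filter, Finset.mem_univ, true_and] at h ⊢
    obtain ⟨⟨hd, hc⟩, hAB, hB⟩ := h
    have h2 := union_supp_restr hAB.1 hB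
    rw [h2]
    refine ⟨⟨fun h0 => ?_, hd.mono_left ?_⟩, ?_, ?_⟩
    · rw [h0, supp_zero, Finset.union_empty] at h2
      exact hAB.ne h2
    · rw [supp_restr]
      exact Finset.inter_subset_left
    · rw [supp_restr]
      exact (disjoint_compl_left (a := B)).mono_left Finset.inter_subset_right
    · rw [← hc, ← Finset.card_union_of_disjoint hd.symm, ← union_supp_restr_compl hAB.1 hB,
        Finset.card_union_of_disjoint]
      rw [supp_restr]
      exact (disjoint_compl_right (a := B)).mono_right Finset.inter_subset_right
  · rintro ⟨ε, δ⟩ h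
    simp only [Finset.mem_sigma, mem_extensions, Finset.mem_filter, Finset.mem_univ, true_and] at h ⊢
    obtain ⟨⟨h0, hd⟩, hd', hc⟩ := h
    have h0' := Finset.nonempty_iff_ne_empty.2 fun h => h0 (supp_eq_empty.1 h)
    rw [supp_glue]
    refine ⟨⟨?_, ?_⟩, ?_, ?_⟩
    · exact Finset.disjoint_union_left.2 ⟨hd, hd'.mono_right Finset.subset_union_left⟩
    · rw [← hc, Finset.card_union_of_disjoint hd.symm, Finset.card_union_of_disjoint, add_assoc]
      exact (hd'.mono_right Finset.subset_union_right).symm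
    · refine Finset.ssubset_iff_subset_ne.2 ⟨Finset.subset_union_left, fun h => ?_⟩
      obtain ⟨j, hj⟩ := h0'
      exact Finset.disjoint_left.1 hd hj (h ▸ Finset.mem_union_right _ hj)
    · exact Finset.union_subset_union_right Finset.subset_union_left
  · rintro ⟨e, B⟩ h
    simp only [Finset.mem_sigma, mem_extensions, Finset.mem_filter, Finset.mem_univ, true_and] at h ⊢
    obtain ⟨⟨hd, hc⟩, hAB, hB⟩ := h
    have h2 := union_supp_restr hAB.1 hB
    rw [h2]
    congr 1
    funext j
    by_cases hj : j ∈ B <;> simp [glue, restr, hj]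
    intro h
    exact h.symm
  · rintro ⟨ε, δ⟩ h
    simp only [Finset.mem_sigma, mem_extensions, Finset.mem_filter, Finset.mem_univ, true_and] at h ⊢
    obtain ⟨⟨h0, hd⟩, hd', hc⟩ := h
    have hA : ∀ j ∈ A, ε j = 0 := fun j hj =>
      eq_zero_of_notMem_supp (Finset.disjoint_right.1 hd hj)
    have hA' : ∀ j ∈ A ∪ supp ε, δ j = 0 := fun j hj =>
      eq_zero_of_notMem_supp (Finset.disjoint_right.1 hd' hj)
    congr 1
    · funext j
      by_cases hj : ε j = 0
      · by_cases hjA : j ∈ A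
        · simp [restr, glue, hj, hjA, hA' j (Finset.mem_union_left _ hjA)]
        · simp [restr, mem_supp, hj, hjA]
      · simp [restr, mem_supp, glue, hj]
    · funext j
      by_cases hj : j ∈ A ∪ supp ε
      · simp [restr, hA' j hj]
        simp at hj
        intro h1 h2
        exact absurd hj (by tauto)
      · rw [restr, if_pos (Finset.mem_compl.2 hj), glue, if_neg]
        intro h
        exact hj (Finset.mem_union_right _ (mem_supp.2 h))
  · rintro ⟨e, B⟩ h
    simp only [Finset.mem_sigma, mem_extensions, Finset.mem_filter, Finset.mem_univ, true_and] at h ⊢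
    obtain ⟨⟨hd, hc⟩, hAB, hB⟩ := h
    have h2 := union_supp_restr hAB.1 hB
    rw [h2, union_supp_restr_compl hAB.1 hB, stepWeight_eq P x hd hB]
    refine congrArg _ ?_
    exact Finset.sum_congr rfl fun s _ => chainSum_congr fun C D hBC _ _ =>
      stepWeight_restr_compl P x e hBC D

theorem sum_chainSum_zero (P : Params) (x : Fin n → ℂ) (r : ℕ) (A : Finset (Fin n)) :
    ∑ e ∈ extensions r A, chainSum (stepWeight P x e) (A ∪ supp e) 0 A
      = if A.card = r then 1 else 0 := by
  have h1 : ∀ e ∈ extensions r A, chainSum (stepWeight P x e) (A ∪ supp e) 0 A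
      = if e = 0 then 1 else 0 := by
    intro e he
    obtain ⟨hd, -⟩ := mem_extensions.1 he
    rw [chainSum]
    congr 1
    rw [@eq_comm _ A, Finset.union_eq_left, ← supp_eq_empty, eq_iff_iff]
    exact ⟨fun h => Finset.disjoint_self_iff_empty _ |>.1 (hd.mono_right h), fun h => by simp [h]⟩
  rw [Finset.sum_congr rfl h1, Finset.sum_ite_eq']
  simp [mem_extensions, supp_zero]

/-- Unrolled, the recursion is the signed sum over all ways of enlarging `A` to a set of size `r` by
a signed chain with at most `m` steps. The recursion step is the first step of the chain. -/
theorem uCoef_eq_sum (P : Params) (x : Fin n → ℂ) (r m : ℕ) (A : Finset (Fin n)) :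
    uCoef P (expU x) r m A = ∑ e ∈ extensions r A, ∑ s ∈ Finset.range (m + 1),
      chainSum (stepWeight P x e) (A ∪ supp e) s A := by
  induction m generalizing A with
  | zero =>
    rw [uCoef, ← sum_chainSum_zero P x]
    simp
  | succ m ih =>
    rw [uCoef]
    simp only [Finset.sum_range_succ' _ (m + 1), Finset.sum_add_distrib]
    rw [sum_chainSum_zero, sub_eq_neg_add]
    congr 1
    have h2 := sum_extensions P x r (m + 1) A fun _ => 1
    simp only [mul_one, ← ih] at h2
    rw [← h2, ← Finset.sum_neg_distrib]
    refine Finset.sum_congr rfl fun e _ => ?_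
    simp only [chainSum, Finset.mul_sum, Finset.sum_neg_distrib]
    rw [Finset.sum_comm]

theorem sum_powersetCard_signs {M : Type*} [AddCommMonoid M] (r : ℕ)
    (F : Finset (Fin n) → (Fin n → ℤ) → M) :
    ∑ J ∈ Finset.powersetCard r (Finset.univ : Finset (Fin n)), ∑ ε ∈ signs J, F J ε
      = ∑ e ∈ extensions r (∅ : Finset (Fin n)), F (supp e) fun j => (e j : ℤ) := by
  have hcast : ∀ s : SignType, SignType.sign ((s : SignType) : ℤ) = s := by decide
  have key : ∀ (J : Finset (Fin n)) (ε : Fin n → ℤ), ε ∈ signs J →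
      (fun j => ((SignType.sign (ε j) : SignType) : ℤ)) = ε
        ∧ supp (fun j => SignType.sign (ε j)) = J := by
    intro J ε hε
    have h : ∀ j, (j ∈ J ∧ (ε j = 1 ∨ ε j = -1)) ∨ (j ∉ J ∧ ε j = 0) := by
      intro j
      have := Fintype.mem_piFinset.1 hε j
      by_cases hj : j ∈ J <;> simp_all
    constructor
    · funext j
      rcases h j with ⟨-, h | h⟩ | ⟨-, h⟩ <;> simp [h]
    · ext j
      rcases h j with ⟨h', h | h⟩ | ⟨h', h⟩ <;> simp [h, h', mem_supp]
  rw [Finset.sum_sigma']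
  refine Finset.sum_bij' (fun p _ j => SignType.sign (p.2 j)) (fun e _ => ⟨supp e, fun j => (e j : ℤ)⟩)
    ?_ ?_ ?_ ?_ ?_
  · rintro ⟨J, ε⟩ h
    obtain ⟨hJ, hε⟩ := Finset.mem_sigma.1 h
    rw [mem_extensions, (key J ε hε).2]
    simpa using Finset.mem_powersetCard.1 hJ
  · intro e he
    rw [mem_extensions] at he
    rw [Finset.mem_sigma]
    refine ⟨Finset.mem_powersetCard.2 ⟨Finset.subset_univ _, by simpa using he⟩, ?_⟩
    refine Fintype.mem_piFinset.2 fun j => ?_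
    have : ∀ s : SignType, (s : ℤ) ∈ if s ≠ 0 then ({1, -1} : Finset ℤ) else {0} := by decide
    simpa only [mem_supp] using this (e j)
  · rintro ⟨J, ε⟩ h
    obtain ⟨hJ, hε⟩ := Finset.mem_sigma.1 h
    dsimp only
    rw [(key J ε hε).1, (key J ε hε).2]
  · intro e he
    funext j
    exact hcast _
  · rintro ⟨J, ε⟩ h
    obtain ⟨hJ, hε⟩ := Finset.mem_sigma.1 h
    dsimp only
    rw [(key J ε hε).1, (key J ε hε).2]

/-- Terms with the same translation, that is, with the same first set and the same signs on it, are
collected. Their common factor is the coefficient of the first step, and the remaining steps and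
signs add up to `uCoef`. -/
theorem diffOp_apply (P : Params) {r : ℕ} (hr : 1 ≤ r) (F : (Fin n → ℂˣ) → ℂ) (x : Regular n P) :
    diffOp n P r (fun y => F (expU y.1)) x = dOp P r F (expU x.1) := by
  obtain ⟨r, rfl⟩ := Nat.exists_eq_add_of_le' hr
  have hshift : ∀ (e : Fin n → SignType) (B : Finset (Fin n)),
      expU (x.shift (signVec (fun j => (e j : ℤ)) B)).1 = shiftU P (restr e B) (expU x.1) := by
    intro e B
    have h : ((x.shift (signVec (fun j => (e j : ℤ)) B)).1 : Fin n → ℂ)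
        = fun j => x.1 j + Complex.I * P.β * (restr e B j : ℤ) := by
      funext j
      change x.1 j + Complex.I * P.β * (signVec (fun j => (e j : ℤ)) B j : ℤ) = _
      by_cases hj : j ∈ B <;> simp [signVec, restr, hj]
    rw [h]
    funext j
    ext
    rw [expU_val, shiftU, Units.val_mul, expU_val, exp_I_add, Units.val_zpow_eq_zpow_val, P.qU_val',
      ← Complex.exp_int_mul]
    congr 2
    linear_combination (P.β * (restr e B j : ℤ) : ℂ) * Complex.I_sq
  change ∑ J ∈ Finset.powersetCard (r + 1) (Finset.univ : Finset (Fin n)), ∑ ε ∈ signs J,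
      ∑ s ∈ Finset.Icc 1 (r + 1), ∑ c ∈ chains J s,
        (-1 : ℂ) ^ (s - 1)
          * (∏ i : Fin s, coeffV P ε (c i.succ \ c i.castSucc) (c i.succ)ᶜ x.1)
          * (F (expU (x.shift (signVec ε (c 1))).1) - F (expU x.1)) = _
  rw [sum_powersetCard_signs, dOp]
  have h1 : ∀ e ∈ extensions (r + 1) (∅ : Finset (Fin n)),
      ∑ s ∈ Finset.Icc 1 (r + 1), ∑ c ∈ chains (supp e) s,
        (-1 : ℂ) ^ (s - 1)
          * (∏ i : Fin s, coeffV P (fun j => (e j : ℤ)) (c i.succ \ c i.castSucc) (c i.succ)ᶜ x.1)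
          * (F (expU (x.shift (signVec (fun j => (e j : ℤ)) (c 1))).1) - F (expU x.1))
      = ∑ B with ∅ ⊂ B, stepWeight P x.1 e ∅ B
        * (F (shiftU P (restr e B) (expU x.1)) - F (expU x.1))
        * ∑ s ∈ Finset.range (r + 1), chainSum (stepWeight P x.1 e) (∅ ∪ supp e) s B := by
    intro e _
    rw [Finset.empty_union, ← Finset.Ico_succ_right_eq_Icc, Finset.sum_Ico_eq_sum_range]
    simp only [Finset.mul_sum]
    rw [Finset.sum_comm]
    refine Finset.sum_congr (by simp) fun s _ => ?_
    have h2 := sum_chainsFrom_mul (stepWeight P x.1 e) (supp e) s ∅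
      fun B => F (shiftU P (restr e B) (expU x.1)) - F (expU x.1)
    rw [← h2, Nat.add_comm 1 s, Nat.add_sub_cancel, chains_eq]
    refine Finset.sum_congr rfl fun c _ => ?_
    rw [hshift]
    rfl
  rw [Finset.sum_congr rfl h1, sum_extensions P x.1 (r + 1) (r + 1) ∅
    fun ε => F (shiftU P ε (expU x.1)) - F (expU x.1)]
  simp only [Finset.empty_union, Finset.disjoint_empty_right, and_true, ← uCoef_eq_sum]
  rw [Finset.sum_filter]
  refine Finset.sum_congr rfl fun ε _ => ?_
  by_cases hε : ε = 0
  · have : shiftU P ε (expU x.1) = expU x.1 := by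
      funext j
      simp [shiftU, hε]
    rw [this, sub_self, mul_zero, if_neg (not_not.2 hε), mul_zero]
  -- The sum on the left has depth one less than the coefficient in `dOp`; as `supp ε` is nonempty,
  -- both depths are in the stable range.
  · rw [if_pos hε, uCoef_succ]
    · ring
    · have : 0 < (supp ε).card :=
        Finset.card_pos.2 (Finset.nonempty_iff_ne_empty.2 fun h => hε (supp_eq_empty.1 h))
      omega

end Koornwinder

end

/-! ### The poles of the coefficients and their cancellation on invariant polynomials. -/

noncomputable section

namespace Koornwinder

variable {n : ℕ}

/-! ### The linear factors of the denominators -/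

/-- The lattice vector `s e_j`. -/
def sgl (j : Fin n) (s : SignType) : Fin n → ℤ := Pi.single j (s : ℤ)

/-- The lattice vector `s e_j + t e_k`. -/
def dbl (j k : Fin n) (s t : SignType) : Fin n → ℤ := Pi.single j (s : ℤ) + Pi.single k (t : ℤ)

/-- The linear factors that occur in the denominators of the coefficients. -/
def factorSet (n : ℕ) (P : Params) : Set ((Fin n → ℤ) × ℂˣ) :=
  {a | (∃ j, ∃ s : SignType, s ≠ 0 ∧ a.1 = sgl j s ∧
      (a.2 = 1 ∨ a.2 = -1 ∨ a.2 = P.rU ∨ a.2 = -P.rU)) ∨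
    (∃ j k, ∃ s t : SignType, j ≠ k ∧ s ≠ 0 ∧ t ≠ 0 ∧ a.1 = dbl j k s t ∧
      (a.2 = 1 ∨ a.2 = P.qU))}

theorem SignType.coe_eq_or {s : SignType} (h : s ≠ 0) : (s : ℤ) = 1 ∨ (s : ℤ) = -1 := by
  revert s
  decide

theorem SignType.coe_injective : Function.Injective (fun s : SignType => (s : ℤ)) := by
  intro s t
  revert s t
  decide

theorem SignType.coe_ne_zero {s : SignType} (h : s ≠ 0) : (s : ℤ) ≠ 0 := by
  revert s
  decide

theorem dbl_left {j k : Fin n} (h : j ≠ k) (s t : SignType) : dbl j k s t j = s := by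
  simp [dbl, h]

theorem dbl_right {j k : Fin n} (h : j ≠ k) (s t : SignType) : dbl j k s t k = t := by
  simp [dbl, h.symm]

theorem dbl_comm (j k : Fin n) (s t : SignType) : dbl j k s t = dbl k j t s := add_comm _ _

theorem dbl_of_ne {i j k : Fin n} (hj : i ≠ j) (hk : i ≠ k) (s t : SignType) :
    dbl j k s t i = 0 := by
  simp [dbl, hj, hk]

theorem isRootLike_sgl (j : Fin n) {s : SignType} (hs : s ≠ 0) : IsRootLike (sgl j s) := by
  refine ⟨fun h => ?_, fun i => ?_⟩
  · have := congrFun h j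
    rcases SignType.coe_eq_or hs with h | h <;> simp [sgl, h] at this
  · by_cases h : i = j
    · subst h
      rcases SignType.coe_eq_or hs with h | h <;> simp [sgl, h]
    · simp [sgl, h]

theorem isRootLike_dbl {j k : Fin n} (hjk : j ≠ k) {s t : SignType} (hs : s ≠ 0) (ht : t ≠ 0) :
    IsRootLike (dbl j k s t) := by
  refine ⟨fun h => ?_, fun i => ?_⟩
  · have := congrFun h j
    rw [dbl_left hjk] at this
    rcases SignType.coe_eq_or hs with h | h <;> simp [h] at this
  · by_cases h : i = j
    · subst h
      rw [dbl_left hjk]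
      rcases SignType.coe_eq_or hs with h | h <;> simp [h]
    · by_cases h' : i = k
      · subst h'
        rw [dbl_right hjk]
        rcases SignType.coe_eq_or ht with h | h <;> simp [h]
      · rw [dbl_of_ne h h']
        simp

theorem isRootLike_of_mem {P : Params} {a : (Fin n → ℤ) × ℂˣ} (ha : a ∈ factorSet n P) :
    IsRootLike a.1 := by
  rcases ha with ⟨j, s, hs, h, -⟩ | ⟨j, k, s, t, hjk, hs, ht, h, -⟩
  · rw [h]
    exact isRootLike_sgl j hs
  · rw [h]
    exact isRootLike_dbl hjk hs ht

/-- The support of a lattice vector. -/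
def lsupp (l : Fin n → ℤ) : Finset (Fin n) := {j | l j ≠ 0}

theorem lsupp_neg (l : Fin n → ℤ) : lsupp (-l) = lsupp l := by
  ext j
  simp [lsupp]

theorem lsupp_sgl (j : Fin n) {s : SignType} (hs : s ≠ 0) : lsupp (sgl j s) = {j} := by
  ext i
  simp only [lsupp, Finset.mem_filter, Finset.mem_univ, true_and, Finset.mem_singleton]
  by_cases h : i = j
  · subst h
    simpa [sgl] using SignType.coe_ne_zero hs
  · simp [sgl, h]

theorem lsupp_dbl {j k : Fin n} (hjk : j ≠ k) {s t : SignType} (hs : s ≠ 0) (ht : t ≠ 0) :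
    lsupp (dbl j k s t) = {j, k} := by
  ext i
  simp only [lsupp, Finset.mem_filter, Finset.mem_univ, true_and, Finset.mem_insert,
    Finset.mem_singleton]
  by_cases h : i = j
  · subst h
    rw [dbl_left hjk]
    simpa using SignType.coe_ne_zero hs
  · by_cases h' : i = k
    · subst h'
      rw [dbl_right hjk]
      simpa using SignType.coe_ne_zero ht
    · simp [dbl_of_ne h h', h, h']

/-- The multiplicative coordinates of a regular point. -/
def regPt (n : ℕ) (P : Params) : Regular n P → Fin n → ℂˣ := fun x => expU x.1

theorem chi_sgl (j : Fin n) (s : SignType) (w : Fin n → ℂˣ) : chi (sgl j s) w = w j ^ (s : ℤ) :=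
  chi_single _ _ _

theorem chi_dbl (j k : Fin n) (s t : SignType) (w : Fin n → ℂˣ) :
    chi (dbl j k s t) w = w j ^ (s : ℤ) * w k ^ (t : ℤ) := by
  rw [dbl, chi_add, chi_single, chi_single]

/-- Every constant in `factorSet` has the form `exp (i (c₁ π + c₂ γ))`, with `c₁ = 0` and `c₂` even
for the two-variable factors. A zero of the factor would lie on one of the hyperplanes excluded in
`Regular`. -/
theorem linFac_ne_zero {P : Params} {a : (Fin n → ℤ) × ℂˣ} (ha : a ∈ factorSet n P)
    (x : Regular n P) : ev (regPt n P x) (linFac a.1 a.2) ≠ 0 := by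
  rw [ev_linFac, sub_ne_zero, regPt]
  intro h
  have hr : (P.rU : ℂ) = Complex.exp (Complex.I * P.γ) := by
    rw [P.rU_val', Params.γ]
    congr 1
    linear_combination (-P.β / 2 : ℂ) * Complex.I_sq
  have hq : (P.qU : ℂ) = Complex.exp (Complex.I * (2 * P.γ)) := by
    rw [P.qU_val', Params.γ]
    congr 1
    linear_combination (-P.β : ℂ) * Complex.I_sq
  have hm : (-1 : ℂ) = Complex.exp (Complex.I * Real.pi) := by
    rw [mul_comm, Complex.exp_pi_mul_I]
  rcases ha with ⟨j, s, hs, h1, hc⟩ | ⟨j, k, s, t, hjk, hs, ht, h1, hc⟩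
  · rw [h1, chi_sgl, expU_zpow] at h
    have key : ∃ c₁ c₂ : ℤ, (a.2 : ℂ) = Complex.exp (Complex.I * (c₁ * Real.pi + c₂ * P.γ)) := by
      rcases hc with hc | hc | hc | hc
      · exact ⟨0, 0, by simp [hc]⟩
      · exact ⟨1, 0, by simp [hc, hm]⟩
      · exact ⟨0, 1, by simp [hc, hr]⟩
      · refine ⟨1, 1, ?_⟩
        rw [hc, Units.val_neg, hr, neg_eq_neg_one_mul, hm, ← Complex.exp_add]
        simp [mul_add]
    obtain ⟨c₁, c₂, hc'⟩ := key
    rw [hc', ← exp_I_add, eq_comm, Complex.exp_eq_one_iff] at h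
    obtain ⟨m, hm⟩ := h
    have hm' : c₁ * Real.pi + c₂ * P.γ + (s : ℤ) * x.1 j = m * (2 * Real.pi) :=
      mul_left_cancel₀ Complex.I_ne_zero (by rw [hm]; ring)
    rcases SignType.coe_eq_or hs with h | h <;> rw [h] at hm'
    · refine x.2.1 j (2 * m - c₁) (-c₂) ?_
      push_cast at hm' ⊢
      linear_combination hm'
    · refine x.2.1 j (c₁ - 2 * m) c₂ ?_
      push_cast at hm' ⊢
      linear_combination -hm'
  · rw [h1, chi_dbl, Units.val_mul, expU_zpow, expU_zpow] at h
    have key : ∃ c₂ : ℤ, (a.2 : ℂ) = Complex.exp (Complex.I * (c₂ * (2 * P.γ))) := by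
      rcases hc with hc | hc
      · exact ⟨0, by simp [hc]⟩
      · exact ⟨1, by simp [hc, hq]⟩
    obtain ⟨c₂, hc'⟩ := key
    rw [hc', ← exp_I_add, ← exp_I_add, eq_comm, Complex.exp_eq_one_iff] at h
    obtain ⟨m, hm⟩ := h
    have hm' : c₂ * (2 * P.γ) + ((s : ℤ) * x.1 j + (t : ℤ) * x.1 k) = m * (2 * Real.pi) :=
      mul_left_cancel₀ Complex.I_ne_zero (by rw [hm]; ring)
    rcases SignType.coe_eq_or hs with h | h <;> rcases SignType.coe_eq_or ht with h' | h' <;>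
      rw [h, h'] at hm'
    · refine (x.2.2 j k hjk m (-c₂)).1 ?_
      push_cast at hm' ⊢
      linear_combination hm'
    · refine (x.2.2 j k hjk m (-c₂)).2 ?_
      push_cast at hm' ⊢
      linear_combination hm'
    · refine (x.2.2 j k hjk (-m) c₂).2 ?_
      push_cast at hm' ⊢
      linear_combination -hm'
    · refine (x.2.2 j k hjk (-m) c₂).1 ?_
      push_cast at hm' ⊢
      linear_combination -hm'

/-! ### Coefficients in subalgebras of functions -/

variable {X : Type*} (pt : X → Fin n → ℂˣ) (P : Params)

/-- A block `u(c e^l)` as a function of the point. -/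
def uOn (g : ℝ) (l : Fin n → ℤ) (c : ℂˣ) : X → ℂ := fun x => uFac P g (c * chi l (pt x))

variable {pt P}

theorem singleFac_eq {ε : Fin n → SignType} {j : Fin n} (h : ε j ≠ 0) :
    (fun x => singleFac P ε (pt x) j) = uOn pt P P.g₀ (sgl j (ε j)) 1
      * uOn pt P P.g₁ (sgl j (ε j)) (-1)
      * (uOn pt P P.g₀' (sgl j (ε j)) P.rU * uOn pt P P.g₁' (sgl j (ε j)) (-P.rU)) := by
  funext x
  simp [singleFac, h, vbm, uOn, chi_sgl, sgnPow]

theorem pairFac_eq_both {ε : Fin n → SignType} {C : Finset (Fin n)} {j k : Fin n} (hj : ε j ≠ 0)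
    (hk : ε k ≠ 0) : (fun x => pairFac P ε C (pt x) j k)
      = uOn pt P P.g (dbl j k (ε j) (ε k)) 1 * uOn pt P P.g (dbl j k (ε j) (ε k)) P.qU := by
  funext x
  simp [pairFac, hj, hk, uOn, chi_dbl, sgnPow]

theorem pairFac_eq_left {ε : Fin n → SignType} {C : Finset (Fin n)} {j k : Fin n} (hj : ε j ≠ 0)
    (hk : ε k = 0) (hC : k ∈ C) : (fun x => pairFac P ε C (pt x) j k)
      = uOn pt P P.g (dbl j k (ε j) 1) 1 * uOn pt P P.g (dbl j k (ε j) (-1)) 1 := by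
  funext x
  simp [pairFac, hj, hk, hC, uOn, chi_dbl, sgnPow]

theorem pairFac_comm (ε : Fin n → SignType) (C : Finset (Fin n)) (w : Fin n → ℂˣ) (j k : Fin n) :
    pairFac P ε C w j k = pairFac P ε C w k j := by
  unfold pairFac
  by_cases hj : ε j = 0 <;> by_cases hk : ε k = 0
  · simp [hj, hk]
  · simp [hj, hk]
  · simp [hj, hk]
  · simp [hj, hk, mul_comm]

theorem pairFac_eq_one {ε : Fin n → SignType} {C : Finset (Fin n)} {w : Fin n → ℂˣ} {j k : Fin n}
    (h1 : ¬ (ε j ≠ 0 ∧ ε k ≠ 0)) (h2 : ¬ (ε j ≠ 0 ∧ k ∈ C)) (h3 : ¬ (ε k ≠ 0 ∧ j ∈ C)) :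
    pairFac P ε C w j k = 1 := by
  rw [pairFac, if_neg h1, if_neg h2, if_neg h3]

theorem coeffM_eq_fun (ε : Fin n → SignType) (C : Finset (Fin n)) :
    (fun x => coeffM P ε C (pt x)) = (∏ j, fun x => singleFac P ε (pt x) j)
      * ∏ p ∈ ltPairs n, fun x => pairFac P ε C (pt x) p.1 p.2 := by
  funext x
  simp [coeffM]

variable {S : Subalgebra ℂ (X → ℂ)}

/-- Stated for an arbitrary subalgebra, since the same bookkeeping serves for regularity along a
factor, for the shape of denominators, and for boundedness along the rays. -/
theorem coeffM_mem {ε : Fin n → SignType} {C : Finset (Fin n)}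
    (h1 : ∀ j, (fun x => singleFac P ε (pt x) j) ∈ S)
    (h2 : ∀ j k, j ≠ k → (fun x => pairFac P ε C (pt x) j k) ∈ S) :
    (fun x => coeffM P ε C (pt x)) ∈ S := by
  rw [coeffM_eq_fun]
  exact mul_mem (Subalgebra.prod_mem _ fun j _ => h1 j)
    (Subalgebra.prod_mem _ fun p hp => h2 _ _ (mem_ltPairs.1 hp).ne)

theorem mul_prod_mem {ι : Type*} [DecidableEq ι] {s : Finset ι} {i : ι} (hi : i ∈ s)
    {f : ι → X → ℂ} {a : X → ℂ} (ha : a * f i ∈ S) (h : ∀ k ∈ s, k ≠ i → f k ∈ S) :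
    a * ∏ k ∈ s, f k ∈ S := by
  rw [← Finset.mul_prod_erase s f hi, ← mul_assoc]
  exact mul_mem ha (Subalgebra.prod_mem _ fun k hk =>
    h k (Finset.mem_of_mem_erase hk) (Finset.ne_of_mem_erase hk))

theorem mul_coeffM_mem_of_single {ε : Fin n → SignType} {C : Finset (Fin n)} {a : X → ℂ}
    (i : Fin n) (h0 : a * (fun x => singleFac P ε (pt x) i) ∈ S)
    (h1 : ∀ j, j ≠ i → (fun x => singleFac P ε (pt x) j) ∈ S)
    (h2 : ∀ j k, j ≠ k → (fun x => pairFac P ε C (pt x) j k) ∈ S) :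
    a * (fun x => coeffM P ε C (pt x)) ∈ S := by
  rw [coeffM_eq_fun, ← mul_assoc]
  exact mul_mem (mul_prod_mem (Finset.mem_univ i) h0 fun j _ => h1 j)
    (Subalgebra.prod_mem _ fun p hp => h2 _ _ (mem_ltPairs.1 hp).ne)

theorem mul_coeffM_mem_of_pair {ε : Fin n → SignType} {C : Finset (Fin n)} {a : X → ℂ}
    {i i' : Fin n} (hi : i ≠ i') (h0 : a * (fun x => pairFac P ε C (pt x) i i') ∈ S)
    (h1 : ∀ j, (fun x => singleFac P ε (pt x) j) ∈ S)
    (h2 : ∀ j k, j ≠ k → ({j, k} : Finset (Fin n)) ≠ {i, i'} →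
      (fun x => pairFac P ε C (pt x) j k) ∈ S) :
    a * (fun x => coeffM P ε C (pt x)) ∈ S := by
  have key : ∀ i i' : Fin n, i < i' → a * (fun x => pairFac P ε C (pt x) i i') ∈ S →
      (∀ j k, j ≠ k → ({j, k} : Finset (Fin n)) ≠ {i, i'} →
        (fun x => pairFac P ε C (pt x) j k) ∈ S) → a * (fun x => coeffM P ε C (pt x)) ∈ S := by
    intro i i' hi h0 h2
    rw [coeffM_eq_fun, mul_left_comm]
    refine mul_mem (Subalgebra.prod_mem _ fun j _ => h1 j)
      (mul_prod_mem (i := (i, i')) (mem_ltPairs.2 hi) h0 fun p hp hpi => h2 _ _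
        (mem_ltPairs.1 hp).ne fun h => hpi ?_)
    have hlt := mem_ltPairs.1 hp
    obtain ⟨j, k⟩ := p
    have hj : j ∈ ({i, i'} : Finset (Fin n)) := h ▸ (by simp)
    have hk : k ∈ ({i, i'} : Finset (Fin n)) := h ▸ (by simp)
    simp only [Finset.mem_insert, Finset.mem_singleton] at hj hk
    dsimp only at hlt
    rcases hj with rfl | rfl <;> rcases hk with rfl | rfl
    · exact absurd hlt (lt_irrefl _)
    · rfl
    · exact absurd hlt hi.not_gt
    · exact absurd hlt (lt_irrefl _)
  rcases lt_or_gt_of_ne hi with h | h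
  · exact key i i' h h0 h2
  · refine key i' i h ?_ ?_
    · simpa only [pairFac_comm] using h0
    · rw [Finset.pair_comm]
      exact h2

theorem singleFac_mem {ε : Fin n → SignType} {j : Fin n}
    (h : ε j ≠ 0 → ∀ c, (sgl j (ε j), c) ∈ factorSet n P → ∀ g, uOn pt P g (sgl j (ε j)) c ∈ S) :
    (fun x => singleFac P ε (pt x) j) ∈ S := by
  by_cases hj : ε j = 0
  · simp only [singleFac, hj, ne_eq, not_true_eq_false, if_false]
    exact one_mem S
  · rw [singleFac_eq hj]
    have hm : ∀ c, (c = 1 ∨ c = -1 ∨ c = P.rU ∨ c = -P.rU) → (sgl j (ε j), c) ∈ factorSet n P :=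
      fun c hc => Or.inl ⟨j, ε j, hj, rfl, hc⟩
    exact mul_mem (mul_mem (h hj _ (hm _ (by simp)) _) (h hj _ (hm _ (by simp)) _))
      (mul_mem (h hj _ (hm _ (by simp)) _) (h hj _ (hm _ (by simp)) _))

/-- The four blocks have the constants `1`, `-1`, `r`, `-r`. These are distinct because `r ≠ ±1`, so
`a` only has to tame the one block with constant `c₀`. -/
theorem mul_singleFac_mem {ε : Fin n → SignType} {j : Fin n} {a : X → ℂ} (hj : ε j ≠ 0) {c₀ : ℂˣ}
    (hc₀ : c₀ = 1 ∨ c₀ = -1 ∨ c₀ = P.rU ∨ c₀ = -P.rU)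
    (h0 : ∀ g, a * uOn pt P g (sgl j (ε j)) c₀ ∈ S)
    (h1 : P.rU ≠ 1 ∧ P.rU ≠ -1)
    (h : ∀ c, c ≠ c₀ → (sgl j (ε j), c) ∈ factorSet n P → ∀ g, uOn pt P g (sgl j (ε j)) c ∈ S) :
    a * (fun x => singleFac P ε (pt x) j) ∈ S := by
  have hm : ∀ c, (c = 1 ∨ c = -1 ∨ c = P.rU ∨ c = -P.rU) → (sgl j (ε j), c) ∈ factorSet n P :=
    fun c hc => Or.inl ⟨j, ε j, hj, rfl, hc⟩
  have hne : (1 : ℂˣ) ≠ -1 := fun h => by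
    have := congrArg Units.val h
    norm_num at this
  have hr : P.rU ≠ -P.rU := fun h => by
    have h2 := congrArg Units.val h
    rw [Units.val_neg, self_eq_neg] at h2
    exact Units.ne_zero _ h2
  have hr2 : -P.rU ≠ 1 := fun h => h1.2 (by rw [← h, neg_neg])
  have hr3 : -P.rU ≠ -1 := fun h => h1.1 (neg_injective h)
  rw [singleFac_eq hj]
  have e1 := fun hc => h 1 hc (hm 1 (by simp)) P.g₀
  have e2 := fun hc => h (-1) hc (hm _ (by simp)) P.g₁
  have e3 := fun hc => h P.rU hc (hm _ (by simp)) P.g₀'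
  have e4 := fun hc => h (-P.rU) hc (hm _ (by simp)) P.g₁'
  rcases hc₀ with rfl | rfl | rfl | rfl
  · have := mul_mem (mul_mem (h0 P.g₀) (e2 hne.symm)) (mul_mem (e3 h1.1) (e4 hr2))
    convert this using 1
    ring
  · have := mul_mem (mul_mem (h0 P.g₁) (e1 hne)) (mul_mem (e3 h1.2) (e4 hr3))
    convert this using 1
    ring
  · have := mul_mem (mul_mem (h0 P.g₀') (e1 h1.1.symm)) (mul_mem (e2 h1.2.symm) (e4 hr.symm))
    convert this using 1
    ring
  · have := mul_mem (mul_mem (h0 P.g₁') (e1 hr2.symm)) (mul_mem (e2 hr3.symm) (e3 hr))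
    convert this using 1
    ring

/-- The condition on `c ≠ 1` records that blocks with constant `q` occur only when both variables
move, and then with the signs of `ε`. -/
theorem pairFac_mem {ε : Fin n → SignType} {C : Finset (Fin n)} {j k : Fin n} (hjk : j ≠ k)
    (h : ∀ s t c, (dbl j k s t, c) ∈ factorSet n P → s ≠ 0 → t ≠ 0 →
      (c ≠ 1 → s = ε j ∧ t = ε k) → uOn pt P P.g (dbl j k s t) c ∈ S) :
    (fun x => pairFac P ε C (pt x) j k) ∈ S := by
  have hm : ∀ s t c, s ≠ 0 → t ≠ 0 → (c = 1 ∨ c = P.qU) → (dbl j k s t, c) ∈ factorSet n P :=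
    fun s t c hs ht hc => Or.inr ⟨j, k, s, t, hjk, hs, ht, rfl, hc⟩
  by_cases hj : ε j = 0 <;> by_cases hk : ε k = 0
  · have : (fun x => pairFac P ε C (pt x) j k) = 1 := by
      funext x
      exact pairFac_eq_one (by simp [hj]) (by simp [hj]) (by simp [hk])
    rw [this]
    exact one_mem S
  · by_cases hC : j ∈ C
    · simp only [pairFac_comm _ _ _ j k]
      rw [pairFac_eq_left hk hj hC, dbl_comm, dbl_comm k]
      exact mul_mem (h _ _ _ (hm _ _ _ (by decide) hk (by simp)) (by decide) hk (by simp))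
        (h _ _ _ (hm _ _ _ (by decide) hk (by simp)) (by decide) hk (by simp))
    · have : (fun x => pairFac P ε C (pt x) j k) = 1 := by
        funext x
        exact pairFac_eq_one (by simp [hj]) (by simp [hj]) (by simp [hC])
      rw [this]
      exact one_mem S
  · by_cases hC : k ∈ C
    · rw [pairFac_eq_left hj hk hC]
      exact mul_mem (h _ _ _ (hm _ _ _ hj (by decide) (by simp)) hj (by decide) (by simp))
        (h _ _ _ (hm _ _ _ hj (by decide) (by simp)) hj (by decide) (by simp))
    · have : (fun x => pairFac P ε C (pt x) j k) = 1 := by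
        funext x
        exact pairFac_eq_one (by simp [hk]) (by simp [hC]) (by simp [hk])
      rw [this]
      exact one_mem S
  · rw [pairFac_eq_both hj hk]
    exact mul_mem (h _ _ _ (hm _ _ _ hj hk (by simp)) hj hk (by simp))
      (h _ _ _ (hm _ _ _ hj hk (by simp)) hj hk (by simp))

/-- The recursion only ever enlarges `A`, so hypotheses on `A` that survive enlargement may be
carried along by `p`. -/
theorem uCoef_mem_of {r : ℕ} (p : Finset (Fin n) → Prop)
    (hp : ∀ A (ε : Fin n → SignType), p A → Disjoint (supp ε) A → p (A ∪ supp ε))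
    (h : ∀ ε A, p A → Disjoint (supp ε) A → (fun x => coeffM P ε (A ∪ supp ε)ᶜ (pt x)) ∈ S) (m : ℕ)
    (A : Finset (Fin n)) (hA : p A) : (fun x => uCoef P (pt x) r m A) ∈ S := by
  have hc : ∀ A : Finset (Fin n), (fun _ : X => if A.card = r then (1 : ℂ) else 0) ∈ S := by
    intro A
    split_ifs
    · exact one_mem S
    · exact zero_mem S
  induction m generalizing A with
  | zero => exact hc A
  | succ m ih =>
    have h1 : (fun x => uCoef P (pt x) r (m + 1) A)
        = (fun _ : X => if A.card = r then (1 : ℂ) else 0)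
          - ∑ ε with ε ≠ 0 ∧ Disjoint (supp ε) A, (fun x => coeffM P ε (A ∪ supp ε)ᶜ (pt x))
            * fun x => uCoef P (pt x) r m (A ∪ supp ε) := by
      funext x
      simp [uCoef]
    rw [h1]
    refine sub_mem (hc A) (sum_mem fun ε hε => ?_)
    have hd := (Finset.mem_filter.1 hε).2.2
    exact mul_mem (h ε A hA hd) (ih _ (hp A ε hA hd))

end Koornwinder

end

noncomputable section

namespace Koornwinder

variable {n : ℕ} {P : Params}

/-! ### Local regularity of the coefficients -/

theorem norm_rU_lt_one (hβ : 0 < P.β) : ‖(P.rU : ℂ)‖ < 1 := by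
  rw [P.rU_val', Complex.norm_exp]
  simp
  linarith

theorem norm_qU_lt_one (hβ : 0 < P.β) : ‖(P.qU : ℂ)‖ < 1 := by
  rw [P.qU_val', Complex.norm_exp]
  simpa using hβ

theorem rU_ne_one (hβ : 0 < P.β) : P.rU ≠ 1 ∧ P.rU ≠ -1 := by
  have := norm_rU_lt_one hβ
  constructor <;> intro h <;> rw [h] at this <;> simp at this

theorem qU_ne_one (hβ : 0 < P.β) : P.qU ≠ 1 := by
  have := norm_qU_lt_one hβ
  intro h
  rw [h] at this
  simp at this

theorem ne_inv_of_norm {c d : ℂˣ} (hc : ‖(c : ℂ)‖ ≤ 1) (hd : ‖(d : ℂ)‖ < 1) : c ≠ d⁻¹ := by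
  intro h
  have h1 : (c : ℂ) * d = 1 := by rw [h]; simp
  have h2 : ‖(c : ℂ)‖ * ‖(d : ℂ)‖ = 1 := by rw [← norm_mul, h1, norm_one]
  nlinarith [norm_nonneg (c : ℂ), norm_nonneg (d : ℂ)]

theorem norm_le_one_of_mem (hβ : 0 < P.β) {a : (Fin n → ℤ) × ℂˣ} (ha : a ∈ factorSet n P) :
    ‖(a.2 : ℂ)‖ ≤ 1 := by
  have h1 := (norm_rU_lt_one hβ).le
  have h2 := (norm_qU_lt_one hβ).le
  rcases ha with ⟨j, s, hs, -, h | h | h | h⟩ | ⟨j, k, s, t, hjk, hs, ht, -, h | h⟩ <;>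
    simp [h, h1, h2]

theorem uOn_eq {X : Type*} (pt : X → Fin n → ℂˣ) (g : ℝ) (l : Fin n → ℤ) (c : ℂˣ) :
    uOn pt P g l c = evOn pt (algebraMap ℂ _ (Complex.exp (P.β * g / 2))
        * (1 - AddMonoidAlgebra.single l (P.qpow g * c))) * (evOn pt (linFac l c))⁻¹ := by
  funext x
  have h1 : ev (pt x) (algebraMap ℂ (Laurent n) (Complex.exp (P.β * g / 2))
      * (1 - AddMonoidAlgebra.single l (P.qpow g * c)))
      = Complex.exp (P.β * g / 2) * (1 - P.qpow g * c * chi l (pt x)) := by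
    rw [map_mul, AlgHom.commutes, map_sub, map_one, ev_single]
    rfl
  rw [Pi.mul_apply, Pi.inv_apply, evOn_apply, evOn_apply, h1, ev_linFac, uOn, uFac]
  ring

variable {l₀ : Fin n → ℤ} {c₀ : ℂˣ} {i₀ : Fin n} {hi₀ : l₀ i₀ * l₀ i₀ = 1}

theorem uOn_mem_locAt (hl₀ : IsRootLike l₀) {l : Fin n → ℤ} {c : ℂˣ}
    (h : (l, c) ∈ factorSet n P) (h1 : ¬ (l = l₀ ∧ c = c₀)) (h2 : ¬ (l = -l₀ ∧ c = c₀⁻¹)) (g : ℝ) :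
    uOn (regPt n P) P g l c ∈ locAt (regPt n P) l₀ c₀ i₀ hi₀ := by
  rw [uOn_eq]
  refine mul_mem (evOn_mem_locAt _)
    (inv_mem_locAt (p := linFac l c) (fun hd => ?_) fun x => linFac_ne_zero h x)
  rcases hl₀.linFac_dvd_linFac (isRootLike_of_mem h) hd with h' | h'
  · exact h1 h'
  · exact h2 h'

theorem uOn_mem_locAt_of_lsupp (hl₀ : IsRootLike l₀) {l : Fin n → ℤ} {c : ℂˣ}
    (h : (l, c) ∈ factorSet n P) (h1 : lsupp l ≠ lsupp l₀) (g : ℝ) :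
    uOn (regPt n P) P g l c ∈ locAt (regPt n P) l₀ c₀ i₀ hi₀ :=
  uOn_mem_locAt hl₀ h (fun h' => h1 (by rw [h'.1])) (fun h' => h1 (by rw [h'.1, lsupp_neg])) g

/-- A block with the constant `c₀` is singular along the given zero set only if `l = l₀`, or if `l =
-l₀` and `c₀² = 1`. In the second case the two linear factors differ by an invertible monomial. -/
theorem mul_uOn_mem_locAt (h₀ : (l₀, c₀) ∈ factorSet n P) {l : Fin n → ℤ}
    (h : (l, c₀) ∈ factorSet n P) (g : ℝ) :
    evOn (regPt n P) (linFac l₀ c₀) * uOn (regPt n P) P g l c₀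
      ∈ locAt (regPt n P) l₀ c₀ i₀ hi₀ := by
  have hl₀ : IsRootLike l₀ := isRootLike_of_mem h₀
  by_cases h1 : l = l₀
  · subst h1
    rw [uOn_eq, mul_left_comm]
    refine mul_mem (evOn_mem_locAt _) ?_
    have : evOn (regPt n P) (linFac l c₀) * (evOn (regPt n P) (linFac l c₀))⁻¹ = 1 := by
      funext x
      exact mul_inv_cancel₀ (linFac_ne_zero h x)
    rw [this]
    exact one_mem _
  · by_cases h2 : l = -l₀ ∧ c₀ = c₀⁻¹
    · obtain ⟨rfl, hc⟩ := h2
      rw [uOn_eq, mul_left_comm]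
      refine mul_mem (evOn_mem_locAt _) ?_
      have : evOn (regPt n P) (linFac l₀ c₀) * (evOn (regPt n P) (linFac (-l₀) c₀))⁻¹
          = evOn (regPt n P) (-AddMonoidAlgebra.single l₀ (c₀ : ℂ)) := by
        funext x
        have hne := linFac_ne_zero h x
        have hc2 : (c₀ : ℂ) * c₀ = 1 := by
          rw [← Units.val_mul, eq_inv_iff_mul_eq_one.1 hc, Units.val_one]
        simp only [Pi.mul_apply, Pi.inv_apply, evOn_apply, ev_linFac, map_neg, ev_single,
          chi_neg] at hne ⊢
        rw [← div_eq_mul_inv, div_eq_iff hne]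
        have hx : (chi l₀ (regPt n P x) : ℂ) * ((chi l₀ (regPt n P x))⁻¹ : ℂˣ) = 1 := by simp
        linear_combination (-(c₀ : ℂ) ^ 2) * hx - hc2
      rw [this]
      exact evOn_mem_locAt _
    · exact mul_mem (evOn_mem_locAt _) (uOn_mem_locAt hl₀ h (fun h' => h1 h'.1) h2 g)

theorem singleFac_mem_locAt (hl₀ : IsRootLike l₀) (ε : Fin n → SignType) {j : Fin n}
    (h : ε j ≠ 0 → lsupp l₀ ≠ {j}) :
    (fun x => singleFac P ε (regPt n P x) j) ∈ locAt (regPt n P) l₀ c₀ i₀ hi₀ :=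
  singleFac_mem fun hj c hc g => uOn_mem_locAt_of_lsupp hl₀ hc
    (by rw [lsupp_sgl j hj]; exact (h hj).symm) g

theorem pairFac_mem_locAt (hl₀ : IsRootLike l₀) (ε : Fin n → SignType) (C : Finset (Fin n))
    {j k : Fin n} (hjk : j ≠ k) (h : lsupp l₀ ≠ {j, k}) :
    (fun x => pairFac P ε C (regPt n P x) j k) ∈ locAt (regPt n P) l₀ c₀ i₀ hi₀ :=
  pairFac_mem hjk fun s t c hc hs ht _ => uOn_mem_locAt_of_lsupp hl₀ hc
    (by rw [lsupp_dbl hjk hs ht]; exact h.symm) _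

theorem singleton_ne_pair {i j k : Fin n} (h : j ≠ k) : ({i} : Finset (Fin n)) ≠ {j, k} := by
  intro h'
  have := congrArg Finset.card h'
  rw [Finset.card_singleton, Finset.card_pair h] at this
  omega

/-- A pole along `1 - c₀ e^{l₀}` requires a block in exactly the variables of `l₀`. There is none if
these variables are all frozen, or if one of them is frozen and also absent from `C`. -/
theorem coeffM_mem_locAt (h₀ : (l₀, c₀) ∈ factorSet n P) (ε : Fin n → SignType)
    (C : Finset (Fin n))
    (h : (∀ j ∈ lsupp l₀, ε j = 0) ∨ ∃ i ∈ lsupp l₀, ε i = 0 ∧ i ∉ C) :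
    (fun x => coeffM P ε C (regPt n P x)) ∈ locAt (regPt n P) l₀ c₀ i₀ hi₀ := by
  have hl₀ : IsRootLike l₀ := isRootLike_of_mem h₀
  refine coeffM_mem (fun j => singleFac_mem_locAt hl₀ ε fun hj hs => ?_) fun j k hjk => ?_
  · rw [hs] at h
    simp only [Finset.mem_singleton, forall_eq, exists_eq_left] at h
    tauto
  · by_cases hs : lsupp l₀ = {j, k}
    · rw [hs] at h
      have : (fun x => pairFac P ε C (regPt n P x) j k) = 1 := by
        funext x
        simp only [Finset.mem_insert, Finset.mem_singleton, forall_eq_or_imp, forall_eq,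
          exists_eq_or_imp, exists_eq_left] at h
        exact pairFac_eq_one (by tauto) (by tauto) (by tauto)
      rw [this]
      exact one_mem _
    · exact pairFac_mem_locAt hl₀ ε C hjk hs

/-- With one moving variable the two blocks have the exponents `±e_j + e_k` and `±e_j - e_k`, which
are neither equal nor opposite, so only one of them can be singular. With two moving variables the
second block has the constant `q ≠ 1` and is harmless. -/
theorem mul_pairFac_mem_locAt_one (hβ : 0 < P.β) (h₀ : (l₀, c₀) ∈ factorSet n P) (hc₀ : c₀ = 1)
    (ε : Fin n → SignType) (C : Finset (Fin n)) {j k : Fin n} (hjk : j ≠ k) :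
    evOn (regPt n P) (linFac l₀ c₀) * (fun x => pairFac P ε C (regPt n P x) j k)
      ∈ locAt (regPt n P) l₀ c₀ i₀ hi₀ := by
  have hl₀ : IsRootLike l₀ := isRootLike_of_mem h₀
  have hm : ∀ {j k : Fin n} {s t c}, j ≠ k → s ≠ 0 → t ≠ 0 → (c = 1 ∨ c = P.qU) →
      (dbl j k s t, c) ∈ factorSet n P :=
    fun hjk hs ht hc => Or.inr ⟨_, _, _, _, hjk, hs, ht, rfl, hc⟩
  have hq : P.qU ≠ c₀ ∧ P.qU ≠ c₀⁻¹ := by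
    subst hc₀
    simpa using qU_ne_one hβ
  have key : ∀ j k : Fin n, j ≠ k → ε j ≠ 0 → ε k = 0 → k ∈ C →
      evOn (regPt n P) (linFac l₀ c₀) * (fun x => pairFac P ε C (regPt n P x) j k)
        ∈ locAt (regPt n P) l₀ c₀ i₀ hi₀ := by
    intro j k hjk hj hk hC
    rw [pairFac_eq_left hj hk hC]
    have m1 : (dbl j k (ε j) 1, c₀) ∈ factorSet n P := hm hjk hj (by decide) (Or.inl hc₀)
    have m2 : (dbl j k (ε j) (-1), c₀) ∈ factorSet n P := hm hjk hj (by decide) (Or.inl hc₀)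
    rw [← hc₀]
    by_cases h1 : dbl j k (ε j) 1 = l₀ ∨ dbl j k (ε j) 1 = -l₀
    · rw [← mul_assoc]
      refine mul_mem (mul_uOn_mem_locAt h₀ m1 _) (uOn_mem_locAt hl₀ m2 ?_ ?_ _)
      · rintro ⟨h2, -⟩
        rcases h1 with h1 | h1
        · have := congrFun (h1.trans h2.symm) k
          rw [dbl_right hjk, dbl_right hjk] at this
          exact absurd this (by decide)
        · have := congrFun (h1.trans (congrArg _ h2.symm)) j
          rw [Pi.neg_apply, dbl_left hjk, dbl_left hjk] at this
          have := SignType.coe_ne_zero hj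
          omega
      · rintro ⟨h2, -⟩
        rcases h1 with h1 | h1
        · have := congrFun (h2.trans (congrArg _ h1.symm)) j
          rw [Pi.neg_apply, dbl_left hjk, dbl_left hjk] at this
          have := SignType.coe_ne_zero hj
          omega
        · have := congrFun (h1.trans h2.symm) k
          rw [dbl_right hjk, dbl_right hjk] at this
          exact absurd this (by decide)
    · rw [mul_left_comm]
      exact mul_mem (uOn_mem_locAt hl₀ m1 (fun h => h1 (Or.inl h.1)) (fun h => h1 (Or.inr h.1)) _)
        (mul_uOn_mem_locAt h₀ m2 _)
  by_cases hj : ε j = 0 <;> by_cases hk : ε k = 0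
  · refine mul_mem (evOn_mem_locAt _) ?_
    have : (fun x => pairFac P ε C (regPt n P x) j k) = 1 := by
      funext x
      exact pairFac_eq_one (by simp [hj]) (by simp [hj]) (by simp [hk])
    rw [this]
    exact one_mem _
  · by_cases hC : j ∈ C
    · simp only [pairFac_comm _ _ _ j k]
      exact key k j hjk.symm hk hj hC
    · refine mul_mem (evOn_mem_locAt _) ?_
      have : (fun x => pairFac P ε C (regPt n P x) j k) = 1 := by
        funext x
        exact pairFac_eq_one (by simp [hj]) (by simp [hj]) (by simp [hC])
      rw [this]
      exact one_mem _
  · by_cases hC : k ∈ C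
    · exact key j k hjk hj hk hC
    · refine mul_mem (evOn_mem_locAt _) ?_
      have : (fun x => pairFac P ε C (regPt n P x) j k) = 1 := by
        funext x
        exact pairFac_eq_one (by simp [hk]) (by simp [hC]) (by simp [hk])
      rw [this]
      exact one_mem _
  · rw [pairFac_eq_both hj hk, ← mul_assoc]
    refine mul_mem ?_ (uOn_mem_locAt hl₀ (hm hjk hj hk (Or.inr rfl)) (fun h => hq.1 h.2)
      (fun h => hq.2 h.2) _)
    rw [← hc₀]
    exact mul_uOn_mem_locAt h₀ (hm hjk hj hk (Or.inl hc₀)) _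

/-- The constant `q` occurs once, in the second block of a pair of moving variables; every other
block of the pair has constant `1`. -/
theorem mul_pairFac_mem_locAt_q (hβ : 0 < P.β) (h₀ : (l₀, c₀) ∈ factorSet n P) (hc₀ : c₀ = P.qU)
    (ε : Fin n → SignType) (C : Finset (Fin n)) {j k : Fin n} (hjk : j ≠ k) :
    evOn (regPt n P) (linFac l₀ c₀) * (fun x => pairFac P ε C (regPt n P x) j k)
      ∈ locAt (regPt n P) l₀ c₀ i₀ hi₀ := by
  have hl₀ : IsRootLike l₀ := isRootLike_of_mem h₀
  have hm : ∀ {j k : Fin n} {s t c}, j ≠ k → s ≠ 0 → t ≠ 0 → (c = 1 ∨ c = P.qU) →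
      (dbl j k s t, c) ∈ factorSet n P :=
    fun hjk hs ht hc => Or.inr ⟨_, _, _, _, hjk, hs, ht, rfl, hc⟩
  have hq : 1 ≠ c₀ := by
    subst hc₀
    exact (qU_ne_one hβ).symm
  have hq' : 1 ≠ c₀⁻¹ := fun h => hq (inv_eq_one.1 h.symm).symm
  by_cases h : ε j ≠ 0 ∧ ε k ≠ 0
  · rw [pairFac_eq_both h.1 h.2, mul_left_comm]
    refine mul_mem (uOn_mem_locAt hl₀ (hm hjk h.1 h.2 (Or.inl rfl)) (fun h => hq h.2)
      (fun h => hq' h.2) _) ?_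
    rw [← hc₀]
    exact mul_uOn_mem_locAt h₀ (hm hjk h.1 h.2 (Or.inr hc₀)) _
  · refine mul_mem (evOn_mem_locAt _) (pairFac_mem hjk fun s t c hc hs ht h' => ?_)
    have : c = 1 := by
      by_contra hne
      obtain ⟨rfl, rfl⟩ := h' hne
      exact h ⟨hs, ht⟩
    subst this
    exact uOn_mem_locAt hl₀ hc (fun h => hq h.2) (fun h => hq' h.2) _

/-- Each coefficient has at most a simple pole along the zero set of a linear factor. -/
theorem mul_coeffM_mem_locAt (hβ : 0 < P.β) (h₀ : (l₀, c₀) ∈ factorSet n P)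
    (ε : Fin n → SignType) (C : Finset (Fin n)) :
    evOn (regPt n P) (linFac l₀ c₀) * (fun x => coeffM P ε C (regPt n P x))
      ∈ locAt (regPt n P) l₀ c₀ i₀ hi₀ := by
  have hl₀ : IsRootLike l₀ := isRootLike_of_mem h₀
  have h₀' := h₀
  rcases h₀ with ⟨j, s, hs, h1, hc⟩ | ⟨j, k, s, t, hjk, hs, ht, h1, hc⟩
  · dsimp only at h1 hc
    have hls : lsupp l₀ = {j} := by rw [h1, lsupp_sgl j hs]
    have hp : ∀ j' k, j' ≠ k → (fun x => pairFac P ε C (regPt n P x) j' k)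
        ∈ locAt (regPt n P) l₀ c₀ i₀ hi₀ := fun j' k hjk =>
      pairFac_mem_locAt hl₀ ε C hjk (by rw [hls]; exact singleton_ne_pair hjk)
    have hsf : ∀ j', j' ≠ j → (fun x => singleFac P ε (regPt n P x) j')
        ∈ locAt (regPt n P) l₀ c₀ i₀ hi₀ := fun j' hj' =>
      singleFac_mem_locAt hl₀ ε fun _ => by
        rw [hls]
        exact fun h => hj' (Finset.singleton_injective h).symm
    refine mul_coeffM_mem_of_single j ?_ hsf hp
    by_cases hj : ε j = 0
    · refine mul_mem (evOn_mem_locAt _) (singleFac_mem fun h => absurd hj h)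
    · refine mul_singleFac_mem hj hc (fun g => mul_uOn_mem_locAt h₀'
        (Or.inl ⟨j, ε j, hj, rfl, hc⟩) g) (rU_ne_one hβ) fun c hcc hcm g => ?_
      refine uOn_mem_locAt hl₀ hcm (fun h => hcc h.2) (fun h => ?_) g
      have hn := norm_le_one_of_mem hβ hcm
      rcases hc with hc | hc | hc | hc
      · exact hcc (by rw [h.2, hc, inv_one])
      · exact hcc (by rw [h.2, hc]; simp)
      · exact ne_inv_of_norm hn (by rw [hc]; exact norm_rU_lt_one hβ) h.2
      · exact ne_inv_of_norm hn (by rw [hc, Units.val_neg, norm_neg]; exact norm_rU_lt_one hβ) h.2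
  · dsimp only at h1 hc
    have hls : lsupp l₀ = {j, k} := by rw [h1, lsupp_dbl hjk hs ht]
    refine mul_coeffM_mem_of_pair hjk ?_ (fun j' => singleFac_mem_locAt hl₀ ε fun _ => by
      rw [hls]; exact (singleton_ne_pair hjk).symm) fun j' k' hjk' hne =>
      pairFac_mem_locAt hl₀ ε C hjk' (by rw [hls]; exact hne.symm)
    rcases hc with hc | hc
    · exact mul_pairFac_mem_locAt_one hβ h₀' hc ε C hjk
    · exact mul_pairFac_mem_locAt_q hβ h₀' hc ε C hjk

/-- A coefficient is regular along the zero set of `1 - c e^b`, with `c` of modulus less than `1`,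
if its signs do not restrict to `b`. -/
theorem coeffM_mem_locAt_of_ne (hβ : 0 < P.β) (h₀ : (l₀, c₀) ∈ factorSet n P)
    (hc₀ : ‖(c₀ : ℂ)‖ < 1) {b : Fin n → SignType} (hb : ∀ j, l₀ j = (b j : ℤ))
    {ε : Fin n → SignType} {i : Fin n} (hi : b i ≠ 0) (hε : ε i ≠ b i) (C : Finset (Fin n)) :
    (fun x => coeffM P ε C (regPt n P x)) ∈ locAt (regPt n P) l₀ c₀ i₀ hi₀ := by
  have hl₀ : IsRootLike l₀ := isRootLike_of_mem h₀
  have hil : i ∈ lsupp l₀ := by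
    simpa [lsupp, hb] using SignType.coe_ne_zero hi
  have hinv : ∀ {l : Fin n → ℤ} {c : ℂˣ}, (l, c) ∈ factorSet n P → c ≠ c₀⁻¹ := fun h =>
    ne_inv_of_norm (norm_le_one_of_mem hβ h) hc₀
  refine coeffM_mem (fun j => singleFac_mem fun hj c hc g => ?_) fun j k hjk =>
    pairFac_mem hjk fun s t c hc hs ht hst => ?_
  · refine uOn_mem_locAt hl₀ hc (fun h => ?_) (fun h => hinv hc h.2) g
    rw [← h.1, lsupp_sgl j hj, Finset.mem_singleton] at hil
    subst hil
    have := hb i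
    rw [← h.1, sgl, Pi.single_eq_same] at this
    exact hε (SignType.coe_injective this)
  · refine uOn_mem_locAt hl₀ hc (fun h => ?_) (fun h => hinv hc h.2) _
    -- Modulus less than one rules out the constant `1`, hence the block comes from two moving
    -- variables and its exponent consists of the signs of `ε`.
    have hc1 : c ≠ 1 := by
      rintro rfl
      rw [← h.2] at hc₀
      simp at hc₀
    obtain ⟨rfl, rfl⟩ := hst hc1
    rw [← h.1, lsupp_dbl hjk hs ht, Finset.mem_insert, Finset.mem_singleton] at hil
    have := hb i
    rw [← h.1] at this
    rcases hil with rfl | rfl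
    · rw [dbl_left hjk] at this
      exact hε (SignType.coe_injective this)
    · rw [dbl_right hjk] at this
      exact hε (SignType.coe_injective this)

end Koornwinder

end

noncomputable section

namespace Koornwinder

variable {n : ℕ} {P : Params}

/-! ### Factorization of the coefficients -/

theorem coeffM_zero (C : Finset (Fin n)) (w : Fin n → ℂˣ) : coeffM P 0 C w = 1 := by
  simp [coeffM, singleFac, pairFac]

theorem glue_zero (b : Fin n → SignType) : glue 0 b = b := by
  funext j
  simp [glue]

theorem pairFac_glue {ε b : Fin n → SignType} {C : Finset (Fin n)} {j k : Fin n}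
    (hj : ε j = 0 ∨ b j = 0) (hk : ε k = 0 ∨ b k = 0) (hjC : j ∈ C → ε j = 0 ∧ b j = 0)
    (hkC : k ∈ C → ε k = 0 ∧ b k = 0) (w : Fin n → ℂˣ) :
    pairFac P (glue ε b) C w j k = pairFac P ε C w j k * pairFac P b C w j k
      * ((if j ∈ supp ε ∧ k ∈ supp b then uFac P P.g (sgnPow ε w j * sgnPow b w k)
              * uFac P P.g (P.qU * (sgnPow ε w j * sgnPow b w k)) else 1)
        * (if k ∈ supp ε ∧ j ∈ supp b then uFac P P.g (sgnPow ε w k * sgnPow b w j)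
              * uFac P P.g (P.qU * (sgnPow ε w k * sgnPow b w j)) else 1)) := by
  by_cases h1 : ε j = 0
  · by_cases h2 : ε k = 0
    · have hgj : glue ε b j = b j := by simp [glue, h1]
      have hgk : glue ε b k = b k := by simp [glue, h2]
      have e1 : pairFac P ε C w j k = 1 := pairFac_eq_one (by simp [h1]) (by simp [h1]) (by simp [h2])
      rw [e1, if_neg (by simp [mem_supp, h1]), if_neg (by simp [mem_supp, h2])]
      simp only [pairFac, sgnPow, hgj, hgk, mul_one, one_mul]
    · have h3 := hk.resolve_left h2
      have hkC' : k ∉ C := fun h => h2 (hkC h).1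
      by_cases h4 : b j = 0
      · have e1 : pairFac P b C w j k = 1 :=
          pairFac_eq_one (by simp [h3]) (by simp [h4]) (by simp [h3])
        have hgj : glue ε b j = ε j := by simp [glue, h1, h4]
        have hgk : glue ε b k = ε k := by simp [glue, h2]
        rw [e1, if_neg (by simp [mem_supp, h1]), if_neg (by simp [mem_supp, h4])]
        simp only [pairFac, sgnPow, hgj, hgk, mul_one]
      · have hjC' : j ∉ C := fun h => h4 (hjC h).2
        have e1 : pairFac P b C w j k = 1 :=
          pairFac_eq_one (by simp [h3]) (by simp [hkC']) (by simp [h3])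
        have e2 : pairFac P ε C w j k = 1 :=
          pairFac_eq_one (by simp [h1]) (by simp [h1]) (by simp [hjC'])
        have hgj : glue ε b j = b j := by simp [glue, h1]
        have hgk : glue ε b k = ε k := by simp [glue, h2]
        rw [e1, e2, if_neg (by simp [mem_supp, h1]), if_pos ⟨mem_supp.2 h2, mem_supp.2 h4⟩, pairFac,
          if_pos ⟨hgj ▸ h4, hgk ▸ h2⟩, sgnPow, sgnPow, hgj, hgk, sgnPow, sgnPow,
          mul_comm ((w k ^ (ε k : ℤ) : ℂˣ) : ℂ), one_mul, one_mul, one_mul]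
  · have h4 := hj.resolve_left h1
    have hjC' : j ∉ C := fun h => h1 (hjC h).1
    by_cases h2 : ε k = 0
    · by_cases h3 : b k = 0
      · have e1 : pairFac P b C w j k = 1 :=
          pairFac_eq_one (by simp [h3]) (by simp [h4]) (by simp [h3])
        have hgj : glue ε b j = ε j := by simp [glue, h1]
        have hgk : glue ε b k = ε k := by simp [glue, h2, h3]
        rw [e1, if_neg (by simp [mem_supp, h3]), if_neg (by simp [mem_supp, h4])]
        simp only [pairFac, sgnPow, hgj, hgk, mul_one]
      · have hkC' : k ∉ C := fun h => h3 (hkC h).2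
        have e1 : pairFac P b C w j k = 1 :=
          pairFac_eq_one (by simp [h4]) (by simp [h4]) (by simp [hjC'])
        have e2 : pairFac P ε C w j k = 1 :=
          pairFac_eq_one (by simp [h2]) (by simp [hkC']) (by simp [h2])
        have hgj : glue ε b j = ε j := by simp [glue, h1]
        have hgk : glue ε b k = b k := by simp [glue, h2]
        rw [e1, e2, if_pos ⟨mem_supp.2 h1, mem_supp.2 h3⟩, if_neg (by simp [mem_supp, h2]), pairFac,
          if_pos ⟨hgj ▸ h1, hgk ▸ h3⟩, sgnPow, sgnPow, hgj, hgk, sgnPow, sgnPow, one_mul, one_mul,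
          mul_one]
    · have h3 := hk.resolve_left h2
      have hgj : glue ε b j = ε j := by simp [glue, h1]
      have hgk : glue ε b k = ε k := by simp [glue, h2]
      have e1 : pairFac P b C w j k = 1 :=
        pairFac_eq_one (by simp [h4]) (by simp [h4]) (by simp [h3])
      rw [e1, if_neg (by simp [mem_supp, h3]), if_neg (by simp [mem_supp, h4])]
      simp only [pairFac, sgnPow, hgj, hgk, mul_one]

/-- Among the pair factors only those joining a variable of `ε` to a variable of `b` are new. They
carry the blocks `u(yz) u(qyz)`, to be compared with the blocks `u(yz) u(y/z)` of `coeffM_union`. -/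
theorem coeffM_glue {ε b : Fin n → SignType} (hd : Disjoint (supp ε) (supp b))
    {C : Finset (Fin n)} (hC : Disjoint C (supp ε)) (hC' : Disjoint C (supp b))
    (w : Fin n → ℂˣ) :
    coeffM P (glue ε b) C w = coeffM P ε C w * coeffM P b C w
      * ∏ a ∈ supp ε, ∏ i ∈ supp b, uFac P P.g (sgnPow ε w a * sgnPow b w i)
        * uFac P P.g (P.qU * (sgnPow ε w a * sgnPow b w i)) := by
  classical
  have hεb : ∀ j, ε j = 0 ∨ b j = 0 := by
    intro j
    by_contra! h
    exact Finset.disjoint_left.1 hd (mem_supp.2 h.1) (mem_supp.2 h.2)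
  have hεC : ∀ j ∈ C, ε j = 0 := fun j hj => eq_zero_of_notMem_supp (Finset.disjoint_left.1 hC hj)
  have hbC : ∀ j ∈ C, b j = 0 := fun j hj => eq_zero_of_notMem_supp (Finset.disjoint_left.1 hC' hj)
  rw [prod_cross _ _ hd, coeffM, coeffM, coeffM]
  have h1 : ∏ j, singleFac P (glue ε b) w j
      = (∏ j, singleFac P ε w j) * ∏ j, singleFac P b w j := by
    rw [← Finset.prod_mul_distrib]
    refine Finset.prod_congr rfl fun j _ => ?_
    rcases hεb j with h | h
    · simp [singleFac, glue, h, sgnPow]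
    · by_cases h' : ε j = 0 <;> simp [singleFac, glue, h, h', sgnPow]
  have h2 : ∏ p ∈ ltPairs n, pairFac P (glue ε b) C w p.1 p.2
      = (∏ p ∈ ltPairs n, pairFac P ε C w p.1 p.2) * (∏ p ∈ ltPairs n, pairFac P b C w p.1 p.2)
        * ∏ p ∈ ltPairs n, (if p.1 ∈ supp ε ∧ p.2 ∈ supp b then
            uFac P P.g (sgnPow ε w p.1 * sgnPow b w p.2)
              * uFac P P.g (P.qU * (sgnPow ε w p.1 * sgnPow b w p.2)) else 1)
          * (if p.2 ∈ supp ε ∧ p.1 ∈ supp b then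
            uFac P P.g (sgnPow ε w p.2 * sgnPow b w p.1)
              * uFac P P.g (P.qU * (sgnPow ε w p.2 * sgnPow b w p.1)) else 1) := by
    rw [← Finset.prod_mul_distrib, ← Finset.prod_mul_distrib]
    refine Finset.prod_congr rfl fun p _ => ?_
    exact pairFac_glue (hεb _) (hεb _) (fun h => ⟨hεC _ h, hbC _ h⟩) (fun h => ⟨hεC _ h, hbC _ h⟩) w
  rw [h1, h2]
  ring

/-- Freezing additional variables multiplies by `u(yz) u(y/z)`. This is symmetric under `z ↦ 1/z`,
so the frozen variable may be written with the sign that `b` gives it. -/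
theorem coeffM_union {ε b : Fin n → SignType} (hd : Disjoint (supp ε) (supp b))
    {C : Finset (Fin n)} (hC : Disjoint C (supp ε)) (hC' : Disjoint C (supp b))
    (w : Fin n → ℂˣ) :
    coeffM P ε (C ∪ supp b) w = coeffM P ε C w
      * ∏ a ∈ supp ε, ∏ i ∈ supp b, uFac P P.g (sgnPow ε w a * sgnPow b w i)
        * uFac P P.g (sgnPow ε w a * ((sgnPow b w i)⁻¹ : ℂˣ)) := by
  classical
  have hεb : ∀ j, ε j = 0 ∨ b j = 0 := by
    intro j
    by_contra! h
    exact Finset.disjoint_left.1 hd (mem_supp.2 h.1) (mem_supp.2 h.2)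
  have hεC : ∀ j ∈ C, ε j = 0 := fun j hj => eq_zero_of_notMem_supp (Finset.disjoint_left.1 hC hj)
  have hbC : ∀ j ∈ C, b j = 0 := fun j hj => eq_zero_of_notMem_supp (Finset.disjoint_left.1 hC' hj)
  have hsign : ∀ (y z : ℂˣ) (s : SignType), s ≠ 0 →
      uFac P P.g (y * (z ^ (s : ℤ) : ℂˣ)) * uFac P P.g (y * ((z ^ (s : ℤ))⁻¹ : ℂˣ))
      = uFac P P.g (y * z) * uFac P P.g (y * (z⁻¹ : ℂˣ)) := by
    intro y z s hs
    rcases SignType.coe_eq_or hs with h | h <;> simp [h, mul_comm]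
  rw [prod_cross _ _ hd, coeffM, coeffM, mul_assoc, ← Finset.prod_mul_distrib]
  congr 1
  refine Finset.prod_congr rfl fun p _ => ?_
  obtain ⟨j, k⟩ := p
  dsimp only
  have h1 := hεC j
  have h2 := hεC k
  have h3 := hbC j
  have h4 := hbC k
  by_cases hj : ε j = 0
  · by_cases hk : ε k = 0
    · simp [pairFac, hj, hk, mem_supp]
    · have hk' := (hεb k).resolve_left hk
      by_cases hj' : b j = 0
      · simp [pairFac, hj, hk, mem_supp, hj', hk']
      · have hjC : j ∉ C := fun h => hj' (h3 h)
        simp only [pairFac, hj, hk, mem_supp, hj', hk', ne_eq, not_true_eq_false, not_false_eq_true,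
          Finset.mem_union, hjC, false_and, and_false, and_true, if_true, if_false,
          one_mul, false_or]
        rw [sgnPow, sgnPow, hsign _ _ _ hj']
  · have hj' := (hεb j).resolve_left hj
    by_cases hk : ε k = 0
    · by_cases hk' : b k = 0
      · simp [pairFac, hj, hk, mem_supp, hj', hk']
      · have hkC : k ∉ C := fun h => hk' (h4 h)
        simp only [pairFac, hj, hk, mem_supp, hj', hk', ne_eq, not_true_eq_false, not_false_eq_true,
          Finset.mem_union, hkC, false_and, and_false, and_true, if_true, if_false,
          one_mul, mul_one, false_or]
        rw [sgnPow, sgnPow, hsign _ _ _ hk']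
    · have hk' := (hεb k).resolve_left hk
      simp [pairFac, hj, hk, mem_supp, hj', hk']

/-! ### Congruences modulo a linear factor -/

variable {l₀ : Fin n → ℤ} {c₀ : ℂˣ} {i₀ : Fin n} {hi₀ : l₀ i₀ * l₀ i₀ = 1}

/-- The multiples of the linear factor among the functions regular along its zero set. -/
def IsSmall (S : Subalgebra ℂ (Regular n P → ℂ)) (l₀ : Fin n → ℤ) (c₀ : ℂˣ)
    (a : Regular n P → ℂ) : Prop :=
  ∃ h ∈ S, a = evOn (regPt n P) (linFac l₀ c₀) * h

theorem isSmall_prod_sub {S : Subalgebra ℂ (Regular n P → ℂ)} {ι : Type*} (s : Finset ι)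
    (f g : ι → Regular n P → ℂ) (hf : ∀ i ∈ s, f i ∈ S) (hg : ∀ i ∈ s, g i ∈ S)
    (h : ∀ i ∈ s, IsSmall S l₀ c₀ (f i - g i)) :
    IsSmall S l₀ c₀ (∏ i ∈ s, f i - ∏ i ∈ s, g i) := by
  classical
  induction s using Finset.induction_on with
  | empty => exact ⟨0, zero_mem _, by simp⟩
  | insert i s hi ih =>
    obtain ⟨a, ha, ha'⟩ := ih (fun k hk => hf k (Finset.mem_insert_of_mem hk))
      (fun k hk => hg k (Finset.mem_insert_of_mem hk)) fun k hk => h k (Finset.mem_insert_of_mem hk)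
    obtain ⟨c, hc, hc'⟩ := h i (Finset.mem_insert_self _ _)
    refine ⟨f i * a + c * ∏ k ∈ s, g k, add_mem (mul_mem (hf i (Finset.mem_insert_self _ _)) ha)
      (mul_mem hc (Subalgebra.prod_mem _ fun k hk => hg k (Finset.mem_insert_of_mem hk))), ?_⟩
    rw [Finset.prod_insert hi, Finset.prod_insert hi]
    linear_combination f i * ha' + (∏ k ∈ s, g k) * hc'

/-- From `u(a) - u(b) = e^{βg/2} (1 - q^g) (a - b) / ((1 - a) (1 - b))`: the numerator is divisible
by the linear factor since `a = b` on its zero set, and the denominators are regular there. -/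
theorem isSmall_uOn_sub (hl₀ : IsRootLike l₀) {l m : Fin n → ℤ} {c d : ℂˣ}
    (h : (l, c) ∈ factorSet n P) (h' : (m, d) ∈ factorSet n P) (hl : lsupp l ≠ lsupp l₀)
    (hm : lsupp m ≠ lsupp l₀) (heq : ∀ w, c₀ * chi l₀ w = 1 → c * chi l w = d * chi m w) (g : ℝ) :
    IsSmall (locAt (regPt n P) l₀ c₀ i₀ hi₀) l₀ c₀
      (uOn (regPt n P) P g l c - uOn (regPt n P) P g m d) := by
  have hdvd : linFac l₀ c₀ ∣ AddMonoidAlgebra.single l (c : ℂ) - AddMonoidAlgebra.single m (d : ℂ) :=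
    (linFac_dvd_iff hi₀).2 fun w hw => by
      rw [map_sub, ev_single, ev_single, ← Units.val_mul, ← Units.val_mul, heq w hw, sub_self]
  obtain ⟨p, hp⟩ := hdvd
  have key : ∀ {l c}, (l, c) ∈ factorSet n P → lsupp l ≠ lsupp l₀ →
      (evOn (regPt n P) (linFac l c))⁻¹ ∈ locAt (regPt n P) l₀ c₀ i₀ hi₀ := by
    intro l c h hl
    refine inv_mem_locAt (p := linFac l c) (fun hd => ?_) fun x => linFac_ne_zero h x
    rcases hl₀.linFac_dvd_linFac (isRootLike_of_mem h) hd with ⟨h', -⟩ | ⟨h', -⟩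
    · exact hl (congrArg lsupp h')
    · exact hl ((congrArg lsupp h').trans (lsupp_neg l₀))
  refine ⟨algebraMap ℂ _ (Complex.exp (P.β * g / 2) * (1 - P.qpow g)) * evOn (regPt n P) p
      * ((evOn (regPt n P) (linFac l c))⁻¹ * (evOn (regPt n P) (linFac m d))⁻¹),
    mul_mem (mul_mem (Subalgebra.algebraMap_mem _ _) (evOn_mem_locAt p))
      (mul_mem (key h hl) (key h' hm)), ?_⟩
  funext x
  have h1 := linFac_ne_zero h x
  have h2 := linFac_ne_zero h' x
  have h3 := congrArg (ev (regPt n P x)) hp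
  simp only [map_sub, map_mul, ev_single] at h3
  simp only [Pi.sub_apply, Pi.mul_apply, Pi.inv_apply, evOn_apply, uOn, uFac,
    Pi.algebraMap_apply, Algebra.algebraMap_self, RingHom.id_apply]
  have h4 : ev (regPt n P x) (linFac l₀ c₀) * (Complex.exp (P.β * g / 2) * (1 - P.qpow g)
      * ev (regPt n P x) p * ((ev (regPt n P x) (linFac l c))⁻¹ * (ev (regPt n P x) (linFac m d))⁻¹))
      = Complex.exp (P.β * g / 2) * (1 - P.qpow g) * (c * chi l (regPt n P x)
        - d * chi m (regPt n P x))
        * ((ev (regPt n P x) (linFac l c))⁻¹ * (ev (regPt n P x) (linFac m d))⁻¹) := by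
    rw [h3]
    ring
  rw [h4]
  simp only [ev_linFac] at h1 h2 ⊢
  field_simp
  ring

/-- Along the zero set of `1 - c e^b` the coefficient of `ε + b` factors up to regular functions. -/
theorem coeffM_glue_sub_mem (hβ : 0 < P.β) (h₀ : (l₀, c₀) ∈ factorSet n P)
    {b : Fin n → SignType} (hb : ∀ j, l₀ j = (b j : ℤ)) (ι : Equiv.Perm (Fin n))
    (hι : ∀ i, ι i ∈ supp b ↔ i ∈ supp b)
    (hz : ∀ w, c₀ * chi l₀ w = 1 → ∀ i ∈ supp b, P.qU * (sgnPow b w (ι i) * sgnPow b w i) = 1)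
    {ε : Fin n → SignType} (hd : Disjoint (supp ε) (supp b))
    {C : Finset (Fin n)} (hC : Disjoint C (supp ε)) (hC' : Disjoint C (supp b)) :
    ((fun x => coeffM P (glue ε b) C (regPt n P x))
      - (fun x => coeffM P ε (C ∪ supp b) (regPt n P x)) * fun x => coeffM P b C (regPt n P x))
      ∈ locAt (regPt n P) l₀ c₀ i₀ hi₀ := by
  have hl₀ : IsRootLike l₀ := isRootLike_of_mem h₀
  have hls : lsupp l₀ = supp b := by
    ext j
    simp only [lsupp, Finset.mem_filter, Finset.mem_univ, true_and, hb, mem_supp]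
    exact ⟨fun h h' => h (by rw [h']; rfl), SignType.coe_ne_zero⟩
  have hm : ∀ {j k : Fin n} {s t c}, j ≠ k → s ≠ 0 → t ≠ 0 → (c = 1 ∨ c = P.qU) →
      (dbl j k s t, c) ∈ factorSet n P :=
    fun hjk hs ht hc => Or.inr ⟨_, _, _, _, hjk, hs, ht, rfl, hc⟩
  have hne : ∀ {a i}, a ∈ supp ε → i ∈ supp b → a ≠ i := fun ha hi h =>
    Finset.disjoint_left.1 hd ha (h ▸ hi)
  have hnl : ∀ {a i} {s t : SignType}, a ∈ supp ε → i ∈ supp b → s ≠ 0 → t ≠ 0 →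
      lsupp (dbl a i s t) ≠ lsupp l₀ := by
    intro a i s t ha hi hs ht h
    rw [lsupp_dbl (hne ha hi) hs ht, hls] at h
    exact Finset.disjoint_left.1 hd ha (h ▸ by simp)
  -- the cross factors
  let F : Fin n → Fin n → Regular n P → ℂ := fun a i =>
    uOn (regPt n P) P P.g (dbl a (ι i) (ε a) (b (ι i))) P.qU
  let G : Fin n → Fin n → Regular n P → ℂ := fun a i =>
    uOn (regPt n P) P P.g (dbl a i (ε a) (-b i)) 1
  let H : Fin n → Fin n → Regular n P → ℂ := fun a i =>
    uOn (regPt n P) P P.g (dbl a i (ε a) (b i)) 1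
  have hneg : ∀ {s : SignType}, s ≠ 0 → -s ≠ 0 := by decide
  have hFS : ∀ a ∈ supp ε, ∀ i ∈ supp b, F a i ∈ locAt (regPt n P) l₀ c₀ i₀ hi₀ := fun a ha i hi =>
    uOn_mem_locAt_of_lsupp hl₀ (hm (hne ha ((hι i).2 hi)) (mem_supp.1 ha)
      (mem_supp.1 ((hι i).2 hi)) (Or.inr rfl))
      (hnl ha ((hι i).2 hi) (mem_supp.1 ha) (mem_supp.1 ((hι i).2 hi))) _
  have hGS : ∀ a ∈ supp ε, ∀ i ∈ supp b, G a i ∈ locAt (regPt n P) l₀ c₀ i₀ hi₀ := fun a ha i hi =>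
    uOn_mem_locAt_of_lsupp hl₀ (hm (hne ha hi) (mem_supp.1 ha)
      (hneg (mem_supp.1 hi)) (Or.inl rfl))
      (hnl ha hi (mem_supp.1 ha) (hneg (mem_supp.1 hi))) _
  have hHS : ∀ a ∈ supp ε, ∀ i ∈ supp b, H a i ∈ locAt (regPt n P) l₀ c₀ i₀ hi₀ := fun a ha i hi =>
    uOn_mem_locAt_of_lsupp hl₀ (hm (hne ha hi) (mem_supp.1 ha)
      (mem_supp.1 hi) (Or.inl rfl))
      (hnl ha hi (mem_supp.1 ha) (mem_supp.1 hi)) _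
  -- On the zero set `q z_{ι i} z_i = 1`, so `q y z_{ι i} = y / z_i` and the factors of `F` and `G`
  -- agree one by one. The permutation `ι` in `F` is undone by reindexing the product in `hFH`.
  have hsmall : IsSmall (locAt (regPt n P) l₀ c₀ i₀ hi₀) l₀ c₀
      (∏ a ∈ supp ε, ∏ i ∈ supp b, F a i - ∏ a ∈ supp ε, ∏ i ∈ supp b, G a i) := by
    refine isSmall_prod_sub _ _ _ (fun a ha => Subalgebra.prod_mem _ (hFS a ha))
      (fun a ha => Subalgebra.prod_mem _ (hGS a ha)) fun a ha =>
      isSmall_prod_sub _ _ _ (hFS a ha) (hGS a ha) fun i hi => ?_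
    have hi' := (hι i).2 hi
    refine isSmall_uOn_sub hl₀ (hm (hne ha hi') (mem_supp.1 ha) (mem_supp.1 hi') (Or.inr rfl))
      (hm (hne ha hi) (mem_supp.1 ha) (hneg (mem_supp.1 hi)) (Or.inl rfl))
      (hnl ha hi' (mem_supp.1 ha) (mem_supp.1 hi'))
      (hnl ha hi (mem_supp.1 ha) (hneg (mem_supp.1 hi))) (fun w hw => ?_) _
    have h1 := hz w hw i hi
    have h2 : ((-b i : SignType) : ℤ) = -(b i : ℤ) := by
      generalize b i = s
      revert s
      decide
    rw [chi_dbl, chi_dbl, h2, zpow_neg, one_mul, mul_left_comm, mul_right_inj,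
      eq_inv_iff_mul_eq_one, mul_assoc]
    exact h1
  have hFH : ∀ x, ∏ a ∈ supp ε, ∏ i ∈ supp b,
      uFac P P.g (sgnPow ε (regPt n P x) a * sgnPow b (regPt n P x) i)
        * uFac P P.g (P.qU * (sgnPow ε (regPt n P x) a * sgnPow b (regPt n P x) i))
      = (∏ a ∈ supp ε, ∏ i ∈ supp b, H a i x) * ∏ a ∈ supp ε, ∏ i ∈ supp b, F a i x := by
    intro x
    rw [← Finset.prod_mul_distrib]
    refine Finset.prod_congr rfl fun a _ => ?_
    rw [Finset.prod_mul_distrib]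
    congr 1
    · refine Finset.prod_congr rfl fun i _ => ?_
      simp [H, uOn, chi_dbl, sgnPow]
    · refine (Finset.prod_bijective ι ι.bijective (fun i => (hι i).symm) fun i _ => ?_).symm
      simp [F, uOn, chi_dbl, sgnPow]
  have hGH : ∀ x, ∏ a ∈ supp ε, ∏ i ∈ supp b,
      uFac P P.g (sgnPow ε (regPt n P x) a * sgnPow b (regPt n P x) i)
        * uFac P P.g (sgnPow ε (regPt n P x) a * ((sgnPow b (regPt n P x) i)⁻¹ : ℂˣ))
      = (∏ a ∈ supp ε, ∏ i ∈ supp b, H a i x) * ∏ a ∈ supp ε, ∏ i ∈ supp b, G a i x := by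
    intro x
    rw [← Finset.prod_mul_distrib]
    refine Finset.prod_congr rfl fun a _ => ?_
    rw [Finset.prod_mul_distrib]
    congr 1
    · refine Finset.prod_congr rfl fun i _ => ?_
      simp [H, uOn, chi_dbl, sgnPow]
    · refine Finset.prod_congr rfl fun i _ => ?_
      have h2 : ((-b i : SignType) : ℤ) = -(b i : ℤ) := by
        generalize b i = s
        revert s
        decide
      simp only [G, uOn, chi_dbl, sgnPow, h2, zpow_neg]
      push_cast
      simp
  obtain ⟨h, hh, hh'⟩ := hsmall
  have hb0 : (fun x => coeffM P ε C (regPt n P x)) ∈ locAt (regPt n P) l₀ c₀ i₀ hi₀ := by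
    refine coeffM_mem_locAt h₀ ε C (Or.inl fun j hj => ?_)
    rw [hls] at hj
    exact eq_zero_of_notMem_supp (Finset.disjoint_right.1 hd hj)
  -- The small factor supplies the linear factor that compensates the simple pole of the coefficient
  -- of `b`.
  have heq : ((fun x => coeffM P (glue ε b) C (regPt n P x))
      - (fun x => coeffM P ε (C ∪ supp b) (regPt n P x)) * fun x => coeffM P b C (regPt n P x))
      = (fun x => coeffM P ε C (regPt n P x)) * (∏ a ∈ supp ε, ∏ i ∈ supp b, H a i)
        * (evOn (regPt n P) (linFac l₀ c₀) * fun x => coeffM P b C (regPt n P x)) * h := by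
    have : ∀ x, (∏ a ∈ supp ε, ∏ i ∈ supp b, F a i x) - ∏ a ∈ supp ε, ∏ i ∈ supp b, G a i x
        = evOn (regPt n P) (linFac l₀ c₀) x * h x := fun x => by
      have := congrFun hh' x
      simpa using this
    funext x
    simp only [Pi.sub_apply, Pi.mul_apply, Finset.prod_apply]
    rw [coeffM_glue hd hC hC', coeffM_union hd hC hC', hFH, hGH]
    linear_combination (coeffM P ε C (regPt n P x) * coeffM P b C (regPt n P x)
      * ∏ a ∈ supp ε, ∏ i ∈ supp b, H a i x) * this x
  rw [heq]
  exact mul_mem (mul_mem (mul_mem hb0 (Subalgebra.prod_mem _ fun a ha =>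
    Subalgebra.prod_mem _ fun i hi => hHS a ha i hi)) (mul_coeffM_mem_locAt hβ h₀ b C)) hh

end Koornwinder

end

noncomputable section

namespace Koornwinder

variable {n : ℕ} {P : Params}

/-! ### Regularity along the factors `1 - c e^b` with `|c| < 1` -/

-- Sign vectors that avoid `A` either avoid `supp b`, or restrict to `b` on `supp b`, or meet `supp
-- b` in some other way. The first two classes correspond by adding `b`, which is the pairing behind
-- the cancellation of residues; the third class has no pole.
open scoped Classical in
theorem sum_disjoint_split {M : Type*} [AddCommMonoid M] {A : Finset (Fin n)}
    {b : Fin n → SignType} (hb : b ≠ 0) (hA : Disjoint (supp b) A) (G : (Fin n → SignType) → M) :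
    ∑ ε with Disjoint (supp ε) A, G ε
      = ∑ ε with Disjoint (supp ε) (A ∪ supp b), (G ε + G (glue ε b))
        + ∑ ε with Disjoint (supp ε) A ∧ ¬ Disjoint (supp ε) (supp b) ∧ ∃ i ∈ supp b, ε i ≠ b i,
          G ε := by
  obtain ⟨i₀, hi₀⟩ : (supp b).Nonempty :=
    Finset.nonempty_iff_ne_empty.2 fun h => hb (supp_eq_empty.1 h)
  have h1 : ∑ ε with Disjoint (supp ε) (A ∪ supp b), G (glue ε b)
      = ∑ ε with Disjoint (supp ε) A ∧ ∀ i ∈ supp b, ε i = b i, G ε := by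
    refine Finset.sum_bij' (fun ε _ => glue ε b) (fun ε _ => restr ε (supp b)ᶜ) ?_ ?_ ?_ ?_ ?_
    · intro ε hε
      obtain ⟨hd, hd'⟩ := Finset.disjoint_union_right.1 (Finset.mem_filter.1 hε).2
      refine Finset.mem_filter.2 ⟨Finset.mem_univ _, ?_, fun i hi => ?_⟩
      · rw [supp_glue]
        exact Finset.disjoint_union_left.2 ⟨hd, hA⟩
      · simp [glue, eq_zero_of_notMem_supp (Finset.disjoint_right.1 hd' hi)]
    · intro ε hε
      obtain ⟨hd, -⟩ := (Finset.mem_filter.1 hε).2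
      refine Finset.mem_filter.2 ⟨Finset.mem_univ _, ?_⟩
      rw [supp_restr]
      exact Finset.disjoint_union_right.2 ⟨hd.mono_left Finset.inter_subset_left,
        (disjoint_compl_left (a := supp b)).mono_left Finset.inter_subset_right⟩
    · intro ε hε
      obtain ⟨hd, hd'⟩ := Finset.disjoint_union_right.1 (Finset.mem_filter.1 hε).2
      funext i
      by_cases hi : i ∈ supp b
      · simp [restr, hi, eq_zero_of_notMem_supp (Finset.disjoint_right.1 hd' hi)]
      · simp only [restr, glue, Finset.mem_compl, hi, not_false_eq_true, if_true]
        by_cases h : ε i = 0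
        · simp [h, eq_zero_of_notMem_supp hi]
        · simp [h]
    · intro ε hε
      obtain ⟨-, h⟩ := (Finset.mem_filter.1 hε).2
      funext i
      by_cases hi : i ∈ supp b
      · simp [restr, glue, hi, h i hi]
      · simp only [restr, glue, Finset.mem_compl, hi, not_false_eq_true, if_true]
        by_cases h : ε i = 0
        · simp [h, eq_zero_of_notMem_supp hi]
        · simp [h]
    · intro ε hε
      rfl
  rw [Finset.sum_add_distrib, h1]
  simp only [Finset.sum_filter, ← Finset.sum_add_distrib]
  refine Finset.sum_congr rfl fun ε _ => ?_
  by_cases h : Disjoint (supp ε) A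
  · by_cases h' : Disjoint (supp ε) (supp b)
    · have : ¬ ∀ i ∈ supp b, ε i = b i := fun h2 => by
        have h3 := eq_zero_of_notMem_supp (Finset.disjoint_right.1 h' hi₀)
        rw [h2 _ hi₀] at h3
        exact mem_supp.1 hi₀ h3
      simp [Finset.disjoint_union_right, h, h', this]
    · by_cases h2 : ∀ i ∈ supp b, ε i = b i
      · have h3 : ¬ ∃ i ∈ supp b, ε i ≠ b i := by
          push Not
          exact h2
        rw [if_pos h, if_neg (fun h => h' (Finset.disjoint_union_right.1 h).2), if_pos ⟨h, h2⟩,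
          if_neg (fun h => h3 h.2.2), zero_add, add_zero]
      · have h3 : ∃ i ∈ supp b, ε i ≠ b i := by
          push Not at h2
          exact h2
        rw [if_pos h, if_neg (fun h => h' (Finset.disjoint_union_right.1 h).2),
          if_neg (fun h => h2 h.2), if_pos ⟨h, h', h3⟩, zero_add, zero_add]
  · simp [Finset.disjoint_union_right, h]

/-- At stable depth the recursion reads as one linear relation, the term of `ε = 0` being `U_A`
itself. Its right-hand side is constant, and that is all the residue computation needs. -/
theorem sum_coeffM_uCoef (P : Params) (w : Fin n → ℂˣ) (r : ℕ) (A : Finset (Fin n)) :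
    ∑ ε with Disjoint (supp ε) A, coeffM P ε (A ∪ supp ε)ᶜ w * uCoef P w r r (A ∪ supp ε)
      = if A.card = r then 1 else 0 := by
  classical
  have h := uCoef_succ P w r r A (Nat.le_add_right _ _)
  rw [uCoef] at h
  have h0 : (0 : Fin n → SignType) ∈ Finset.univ.filter fun ε : Fin n → SignType =>
      Disjoint (supp ε) A := by simp [supp_zero]
  rw [← Finset.add_sum_erase _ _ h0, coeffM_zero, one_mul, supp_zero, Finset.union_empty]
  have h2 : (Finset.univ.filter fun ε : Fin n → SignType => Disjoint (supp ε) A).erase 0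
      = Finset.univ.filter fun ε : Fin n → SignType => ε ≠ 0 ∧ Disjoint (supp ε) A := by
    ext ε
    simp
  rw [h2]
  linear_combination -h

theorem exists_ev_shiftU (P : Params) (ε : Fin n → SignType) (p : Laurent n) :
    ∃ p' : Laurent n, ∀ w, ev w p' = ev (shiftU P ε w) p := by
  refine exists_ev_comp _ (fun l => ⟨chi l fun j => P.qU ^ (ε j : ℤ), l, fun w => ?_⟩) p
  rw [← Units.val_mul, mul_comm, ← chi_mul]
  rfl

variable {l₀ : Fin n → ℤ} {c₀ : ℂˣ} {i₀ : Fin n} {hi₀ : l₀ i₀ * l₀ i₀ = 1}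

theorem lsupp_eq_supp {b : Fin n → SignType} (hb : ∀ j, l₀ j = (b j : ℤ)) : lsupp l₀ = supp b := by
  ext j
  simp only [lsupp, Finset.mem_filter, Finset.mem_univ, true_and, hb, mem_supp]
  exact ⟨fun h h' => h (by rw [h']; rfl), SignType.coe_ne_zero⟩

/-- A variable of `l₀` that lies in `A` neither moves nor is coupled in any later step of the
recursion, so no block in all variables of `l₀` ever appears. -/
theorem uCoef_mem_locAt (h₀ : (l₀, c₀) ∈ factorSet n P) (r m : ℕ) (A : Finset (Fin n))
    (hA : ¬ Disjoint (lsupp l₀) A) :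
    (fun x => uCoef P (regPt n P x) r m A) ∈ locAt (regPt n P) l₀ c₀ i₀ hi₀ := by
  refine uCoef_mem_of (fun A => ¬ Disjoint (lsupp l₀) A)
    (fun A ε hA _ h => hA (h.mono_right Finset.subset_union_left)) (fun ε A hA hd => ?_) m A hA
  obtain ⟨i, hi, hiA⟩ := Finset.not_disjoint_iff.1 hA
  exact coeffM_mem_locAt h₀ ε _ (Or.inr ⟨i, hi, eq_zero_of_notMem_supp
    (Finset.disjoint_right.1 hd hiA), by simp [hiA]⟩)

section

variable {b : Fin n → SignType} {r : ℕ}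

theorem compl_union_supp {A B : Finset (Fin n)} (h : Disjoint B A) : (A ∪ B)ᶜ ∪ B = Aᶜ := by
  ext j
  have : j ∈ B → j ∉ A := fun h1 => Finset.disjoint_left.1 h h1
  simp only [Finset.mem_union, Finset.mem_compl]
  tauto

/-- The residues of `U_A` and of `V_b U_{A ∪ supp b}` cancel. In the relation `sum_coeffM_uCoef`,
pair `ε` with `ε + b`. For `ε ≠ 0` the pair equals `V_ε (U_{A'} + V_b U_{A' ∪ supp b}) + (V_{ε+b} -
V_ε V_b) U_{A' ∪ supp b}` with `A' = A ∪ supp ε`: the first part is regular by induction on the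
complement of `A`, the second by `coeffM_glue_sub_mem`. The pair of `ε = 0` is the claim. -/
theorem uCoef_add_mem_locAt (hβ : 0 < P.β) (h₀ : (l₀, c₀) ∈ factorSet n P)
    (hc₀ : ‖(c₀ : ℂ)‖ < 1) (hb : ∀ j, l₀ j = (b j : ℤ)) (ι : Equiv.Perm (Fin n))
    (hι : ∀ i, ι i ∈ supp b ↔ i ∈ supp b)
    (hz : ∀ w, c₀ * chi l₀ w = 1 → ∀ i ∈ supp b, P.qU * (sgnPow b w (ι i) * sgnPow b w i) = 1)
    (A : Finset (Fin n)) (hA : Disjoint (supp b) A) :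
    ((fun x => uCoef P (regPt n P x) r r A) + (fun x => coeffM P b (A ∪ supp b)ᶜ (regPt n P x))
      * fun x => uCoef P (regPt n P x) r r (A ∪ supp b)) ∈ locAt (regPt n P) l₀ c₀ i₀ hi₀ := by
  classical
  have hls := lsupp_eq_supp hb
  have hb0 : b ≠ 0 := by
    rintro rfl
    exact (isRootLike_of_mem h₀).1 (funext fun j => (hb j).trans rfl)
  set S := locAt (regPt n P) l₀ c₀ i₀ hi₀ with hS
  let V : (Fin n → SignType) → Finset (Fin n) → Regular n P → ℂ := fun ε C x =>
    coeffM P ε C (regPt n P x)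
  let U : Finset (Fin n) → Regular n P → ℂ := fun A x => uCoef P (regPt n P x) r r A
  have hU : ∀ A, ¬ Disjoint (supp b) A → U A ∈ S := fun A hA =>
    uCoef_mem_locAt h₀ r r A (by rwa [hls])
  induction hm : Aᶜ.card using Nat.strong_induction_on generalizing A with
  | _ m ih =>
  subst hm
  have hR : ∑ ε with Disjoint (supp ε) A, V ε (A ∪ supp ε)ᶜ * U (A ∪ supp ε) ∈ S := by
    have : ∑ ε with Disjoint (supp ε) A, V ε (A ∪ supp ε)ᶜ * U (A ∪ supp ε)
        = algebraMap ℂ _ (if A.card = r then 1 else 0) := by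
      funext x
      rw [Finset.sum_apply]
      exact sum_coeffM_uCoef P (regPt n P x) r A
    rw [this]
    exact Subalgebra.algebraMap_mem _ _
  rw [sum_disjoint_split hb0 hA] at hR
  have hrest : ∑ ε with Disjoint (supp ε) A ∧ ¬ Disjoint (supp ε) (supp b) ∧ ∃ i ∈ supp b, ε i ≠ b i,
      V ε (A ∪ supp ε)ᶜ * U (A ∪ supp ε) ∈ S := by
    refine sum_mem fun ε hε => ?_
    obtain ⟨-, h2, i, hi, hne⟩ := (Finset.mem_filter.1 hε).2
    exact mul_mem (coeffM_mem_locAt_of_ne hβ h₀ hc₀ hb (mem_supp.1 hi) hne _)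
      (hU _ fun h => h2 (h.mono_right Finset.subset_union_right).symm)
  have hmain := sub_mem hR hrest
  rw [add_sub_cancel_right] at hmain
  have h0 : (0 : Fin n → SignType) ∈ Finset.univ.filter fun ε : Fin n → SignType =>
      Disjoint (supp ε) (A ∪ supp b) := by simp [supp_zero]
  rw [← Finset.add_sum_erase _ _ h0] at hmain
  have hothers : ∑ ε ∈ (Finset.univ.filter fun ε : Fin n → SignType =>
      Disjoint (supp ε) (A ∪ supp b)).erase 0, (V ε (A ∪ supp ε)ᶜ * U (A ∪ supp ε)
        + V (glue ε b) (A ∪ supp (glue ε b))ᶜ * U (A ∪ supp (glue ε b))) ∈ S := by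
    refine sum_mem fun ε hε => ?_
    obtain ⟨hε0, hε⟩ := Finset.mem_erase.1 hε
    obtain ⟨hd, hd'⟩ := Finset.disjoint_union_right.1 (Finset.mem_filter.1 hε).2
    have hdis : Disjoint (supp b) (A ∪ supp ε) := Finset.disjoint_union_right.2 ⟨hA, hd'.symm⟩
    rw [supp_glue, ← Finset.union_assoc]
    have e1 := coeffM_glue_sub_mem (i₀ := i₀) (hi₀ := hi₀) hβ h₀ hb ι hι hz (ε := ε) hd'
      (C := (A ∪ supp ε ∪ supp b)ᶜ)
      ((disjoint_compl_left (a := A ∪ supp ε ∪ supp b)).mono_right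
        (Finset.subset_union_right.trans Finset.subset_union_left))
      ((disjoint_compl_left (a := A ∪ supp ε ∪ supp b)).mono_right Finset.subset_union_right)
    rw [compl_union_supp hdis] at e1
    have e2 := ih (A ∪ supp ε)ᶜ.card (Finset.card_lt_card (by
      rw [Finset.compl_ssubset_compl]
      refine Finset.ssubset_iff_subset_ne.2 ⟨Finset.subset_union_left, fun h => ?_⟩
      obtain ⟨j, hj⟩ := Finset.nonempty_iff_ne_empty.2 fun h => hε0 (supp_eq_empty.1 h)
      exact Finset.disjoint_left.1 hd hj (h ▸ Finset.mem_union_right _ hj))) (A ∪ supp ε) hdis rfl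
    have e3 : V ε (A ∪ supp ε)ᶜ ∈ S := coeffM_mem_locAt h₀ ε _ (Or.inl fun j hj =>
      eq_zero_of_notMem_supp (Finset.disjoint_right.1 hd' (hls ▸ hj)))
    have e4 : U (A ∪ supp ε ∪ supp b) ∈ S := hU _ fun h => by
      have h' := h.mono_right Finset.subset_union_right
      exact hb0 (supp_eq_empty.1 (Finset.disjoint_self_iff_empty _ |>.1 h'))
    have e5 := add_mem (mul_mem e3 e2) (mul_mem e1 e4)
    convert e5 using 1
    ring
  have hfin := sub_mem hmain hothers
  rw [add_sub_cancel_right, glue_zero, supp_zero, Finset.union_empty] at hfin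
  have : V 0 Aᶜ = 1 := funext fun x => coeffM_zero _ _
  rwa [this, one_mul] at hfin

/-- With `A = supp ε`, the terms of `ε` and `ε + b` add up to `V_ε (U_A + V_b U_{A ∪ supp b}) (T_ε -
1)`, `(V_{ε+b} - V_ε V_b) U_{A ∪ supp b} (T_{ε+b} - 1)` and `V_ε U_{A ∪ supp b} V_b (T_{ε+b} -
T_ε)`. In the last expression the simple pole of `V_b` meets the zero of `T_{ε+b} p - T_ε p`
provided by `hp`. -/
theorem dOp_mem_locAt_of_norm_lt (hβ : 0 < P.β) (h₀ : (l₀, c₀) ∈ factorSet n P)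
    (hc₀ : ‖(c₀ : ℂ)‖ < 1) (hb : ∀ j, l₀ j = (b j : ℤ)) (ι : Equiv.Perm (Fin n))
    (hι : ∀ i, ι i ∈ supp b ↔ i ∈ supp b)
    (hz : ∀ w, c₀ * chi l₀ w = 1 → ∀ i ∈ supp b, P.qU * (sgnPow b w (ι i) * sgnPow b w i) = 1)
    (p : Laurent n) (hp : ∀ w, c₀ * chi l₀ w = 1 → ∀ ε : Fin n → SignType,
      Disjoint (supp ε) (supp b) → ev (shiftU P (glue ε b) w) p = ev (shiftU P ε w) p) :
    (fun x => dOp P r (fun w => ev w p) (regPt n P x)) ∈ locAt (regPt n P) l₀ c₀ i₀ hi₀ := by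
  classical
  have hls := lsupp_eq_supp hb
  have hb0 : b ≠ 0 := by
    rintro rfl
    exact (isRootLike_of_mem h₀).1 (funext fun j => (hb j).trans rfl)
  set S := locAt (regPt n P) l₀ c₀ i₀ hi₀ with hS
  let V : (Fin n → SignType) → Finset (Fin n) → Regular n P → ℂ := fun ε C x =>
    coeffM P ε C (regPt n P x)
  let U : Finset (Fin n) → Regular n P → ℂ := fun A x => uCoef P (regPt n P x) r r A
  have hU : ∀ A, ¬ Disjoint (supp b) A → U A ∈ S := fun A hA =>
    uCoef_mem_locAt h₀ r r A (by rwa [hls])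
  choose s hs using fun ε => exists_ev_shiftU P ε p
  let T : (Fin n → SignType) → Regular n P → ℂ := fun ε => evOn (regPt n P) (s ε)
  let T0 : Regular n P → ℂ := evOn (regPt n P) p
  have hT : ∀ ε, T ε ∈ S := fun ε => evOn_mem_locAt _
  have hT0 : T0 ∈ S := evOn_mem_locAt _
  have heq : (fun x => dOp P r (fun w => ev w p) (regPt n P x))
      = ∑ ε with Disjoint (supp ε) (∅ : Finset (Fin n)), V ε (supp ε)ᶜ * U (supp ε) * (T ε - T0) := by
    funext x
    rw [Finset.sum_apply]
    simp only [Finset.disjoint_empty_right, Finset.filter_true]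
    refine Finset.sum_congr rfl fun ε _ => ?_
    simp only [Pi.mul_apply, Pi.sub_apply, T, T0, evOn_apply, hs]
    rfl
  rw [heq, sum_disjoint_split hb0 (Finset.disjoint_empty_right _)]
  refine add_mem (sum_mem fun ε hε => ?_) (sum_mem fun ε hε => ?_)
  · have hd : Disjoint (supp ε) (supp b) := by simpa using (Finset.mem_filter.1 hε).2
    have e1 := coeffM_glue_sub_mem (i₀ := i₀) (hi₀ := hi₀) hβ h₀ hb ι hι hz (ε := ε) hd
      (C := (supp ε ∪ supp b)ᶜ)
      ((disjoint_compl_left (a := supp ε ∪ supp b)).mono_right Finset.subset_union_left)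
      ((disjoint_compl_left (a := supp ε ∪ supp b)).mono_right Finset.subset_union_right)
    rw [compl_union_supp hd.symm] at e1
    have e2 := uCoef_add_mem_locAt (r := r) (i₀ := i₀) (hi₀ := hi₀) hβ h₀ hc₀ hb ι hι hz (supp ε)
      hd.symm
    have e3 : V ε (supp ε)ᶜ ∈ S := coeffM_mem_locAt h₀ ε _ (Or.inl fun j hj =>
      eq_zero_of_notMem_supp (Finset.disjoint_right.1 hd (hls ▸ hj)))
    have e4 : U (supp ε ∪ supp b) ∈ S := hU _ fun h => by
      have h' := h.mono_right Finset.subset_union_right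
      exact hb0 (supp_eq_empty.1 (Finset.disjoint_self_iff_empty _ |>.1 h'))
    have hdvd : linFac l₀ c₀ ∣ s (glue ε b) - s ε := (linFac_dvd_iff hi₀).2 fun w hw => by
      rw [map_sub, hs, hs, hp w hw ε hd, sub_self]
    obtain ⟨h, hh⟩ := hdvd
    have hTT : T (glue ε b) - T ε = evOn (regPt n P) (linFac l₀ c₀) * evOn (regPt n P) h := by
      rw [← map_mul, ← hh, map_sub]
    have e5 : V b (supp ε ∪ supp b)ᶜ * (T (glue ε b) - T ε) ∈ S := by
      rw [hTT, ← mul_assoc, mul_comm (V b _)]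
      exact mul_mem (mul_coeffM_mem_locAt hβ h₀ b _) (evOn_mem_locAt _)
    rw [supp_glue]
    have e6 := add_mem (add_mem (mul_mem (mul_mem e3 e2) (sub_mem (hT ε) hT0))
      (mul_mem (mul_mem e1 e4) (sub_mem (hT (glue ε b)) hT0))) (mul_mem (mul_mem e3 e4) e5)
    convert e6 using 1
    ring
  · obtain ⟨-, h2, i, hi, hne⟩ := (Finset.mem_filter.1 hε).2
    exact mul_mem (mul_mem (coeffM_mem_locAt_of_ne hβ h₀ hc₀ hb (mem_supp.1 hi) hne _)
      (hU _ fun h => h2 h.symm)) (sub_mem (hT ε) hT0)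

end

end Koornwinder

end

noncomputable section

namespace Koornwinder

variable {n : ℕ} {P : Params}

/-! ### Equivariance under the hyperoctahedral group -/

/-- The action of the hyperoctahedral group in multiplicative coordinates. -/
def wAct (σ : Equiv.Perm (Fin n)) (η : Fin n → ℤˣ) (w : Fin n → ℂˣ) : Fin n → ℂˣ :=
  fun j => w (σ j) ^ ((η j : ℤˣ) : ℤ)

/-- The action of the hyperoctahedral group on sign vectors. -/
def sAct (σ : Equiv.Perm (Fin n)) (η : Fin n → ℤˣ) (ε : Fin n → SignType) : Fin n → SignType :=
  fun j => SignType.sign ((η j : ℤˣ) : ℤ) * ε (σ j)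

/-- The preimage of a set under a permutation. -/
def pre (σ : Equiv.Perm (Fin n)) (C : Finset (Fin n)) : Finset (Fin n) := {j | σ j ∈ C}

theorem mem_pre {σ : Equiv.Perm (Fin n)} {C : Finset (Fin n)} {j : Fin n} :
    j ∈ pre σ C ↔ σ j ∈ C := by simp [pre]

theorem card_pre (σ : Equiv.Perm (Fin n)) (C : Finset (Fin n)) : (pre σ C).card = C.card := by
  rw [← Finset.card_map σ.toEmbedding]
  congr 1
  ext j
  simp only [Finset.mem_map, mem_pre, Equiv.coe_toEmbedding]
  constructor
  · rintro ⟨i, hi, rfl⟩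
    exact hi
  · intro h
    exact ⟨σ.symm j, by simpa using h, by simp⟩

theorem coe_sAct (σ : Equiv.Perm (Fin n)) (η : Fin n → ℤˣ) (ε : Fin n → SignType) (j : Fin n) :
    (sAct σ η ε j : ℤ) = (η j : ℤ) * (ε (σ j) : ℤ) := by
  rcases Int.units_eq_one_or (η j) with h | h <;> simp [sAct, h]

theorem sAct_ne_zero {σ : Equiv.Perm (Fin n)} {η : Fin n → ℤˣ} {ε : Fin n → SignType} {j : Fin n} :
    sAct σ η ε j ≠ 0 ↔ ε (σ j) ≠ 0 := by
  rcases Int.units_eq_one_or (η j) with h | h <;> simp [sAct, h]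

theorem sAct_bijective (σ : Equiv.Perm (Fin n)) (η : Fin n → ℤˣ) :
    Function.Bijective (sAct σ η) := by
  refine Finite.injective_iff_bijective.1 fun ε δ h => funext fun j => ?_
  have h1 := congrFun h (σ.symm j)
  have h2 := congrArg (fun s : SignType => (s : ℤ)) h1
  simp only [coe_sAct, Equiv.apply_symm_apply] at h2
  exact SignType.coe_injective (mul_left_cancel₀ (Units.ne_zero _) h2)

theorem sgnPow_sAct (σ : Equiv.Perm (Fin n)) (η : Fin n → ℤˣ) (ε : Fin n → SignType)
    (w : Fin n → ℂˣ) (j : Fin n) : sgnPow (sAct σ η ε) (wAct σ η w) j = sgnPow ε w (σ j) := by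
  rw [sgnPow, sgnPow, coe_sAct, wAct, ← zpow_mul, ← mul_assoc]
  rcases Int.units_eq_one_or (η j) with h | h <;> simp [h]

theorem supp_sAct (σ : Equiv.Perm (Fin n)) (η : Fin n → ℤˣ) (ε : Fin n → SignType) :
    supp (sAct σ η ε) = pre σ (supp ε) := by
  ext j
  rw [mem_supp, sAct_ne_zero, mem_pre, mem_supp]

theorem singleFac_sAct (σ : Equiv.Perm (Fin n)) (η : Fin n → ℤˣ) (ε : Fin n → SignType)
    (w : Fin n → ℂˣ) (j : Fin n) :
    singleFac P (sAct σ η ε) (wAct σ η w) j = singleFac P ε w (σ j) := by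
  rw [singleFac, singleFac, sgnPow_sAct]
  exact if_congr sAct_ne_zero rfl rfl

/-- Flipping a moving variable is absorbed by its sign; flipping a frozen one merely exchanges the
blocks `u(yz)` and `u(y/z)`. -/
theorem pairFac_sAct (σ : Equiv.Perm (Fin n)) (η : Fin n → ℤˣ) (ε : Fin n → SignType)
    (C : Finset (Fin n)) (w : Fin n → ℂˣ) (j k : Fin n) :
    pairFac P (sAct σ η ε) (pre σ C) (wAct σ η w) j k = pairFac P ε C w (σ j) (σ k) := by
  have key : ∀ (y : ℂˣ) (k : Fin n),
      uFac P P.g (y * (wAct σ η w k : ℂˣ)) * uFac P P.g (y * ((wAct σ η w k)⁻¹ : ℂˣ))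
      = uFac P P.g (y * w (σ k)) * uFac P P.g (y * ((w (σ k))⁻¹ : ℂˣ)) := by
    intro y k
    rw [wAct]
    rcases Int.units_eq_one_or (η k) with h | h
    · simp [h]
    · simp [h, mul_comm]
  simp only [pairFac, sgnPow_sAct, sAct_ne_zero, mem_pre, key]

theorem coeffM_sAct (σ : Equiv.Perm (Fin n)) (η : Fin n → ℤˣ) (ε : Fin n → SignType)
    (C : Finset (Fin n)) (w : Fin n → ℂˣ) :
    coeffM P (sAct σ η ε) (pre σ C) (wAct σ η w) = coeffM P ε C w := by
  simp only [coeffM, singleFac_sAct, pairFac_sAct]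
  rw [Equiv.prod_comp σ fun j => singleFac P ε w j,
    prod_ltPairs_perm σ (fun j k => pairFac P ε C w j k) (pairFac_comm ε C w)]

theorem pre_compl (σ : Equiv.Perm (Fin n)) (C : Finset (Fin n)) : pre σ Cᶜ = (pre σ C)ᶜ := by
  ext j
  simp [mem_pre]

theorem pre_union (σ : Equiv.Perm (Fin n)) (C D : Finset (Fin n)) :
    pre σ (C ∪ D) = pre σ C ∪ pre σ D := by
  ext j
  simp [mem_pre]

theorem disjoint_pre {σ : Equiv.Perm (Fin n)} {C D : Finset (Fin n)} :
    Disjoint (pre σ C) (pre σ D) ↔ Disjoint C D := by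
  simp only [Finset.disjoint_left, mem_pre]
  exact ⟨fun h j hj => by simpa using @h (σ.symm j) (by simpa using hj), fun h j hj => h hj⟩

theorem uCoef_wAct (σ : Equiv.Perm (Fin n)) (η : Fin n → ℤˣ) (w : Fin n → ℂˣ) (r m : ℕ)
    (A : Finset (Fin n)) : uCoef P (wAct σ η w) r m (pre σ A) = uCoef P w r m A := by
  induction m generalizing A with
  | zero => rw [uCoef, uCoef, card_pre]
  | succ m ih =>
    rw [uCoef, uCoef, card_pre]
    refine congrArg _ ?_
    refine (Finset.sum_bijective (sAct σ η) (sAct_bijective σ η) (fun ε => ?_) fun ε _ => ?_).symm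
    · simp only [Finset.mem_filter, Finset.mem_univ, true_and, supp_sAct, disjoint_pre]
      refine and_congr_left fun _ => not_congr ?_
      rw [← supp_eq_empty, ← supp_eq_empty, supp_sAct, ← Finset.card_eq_zero, ← card_pre σ,
        Finset.card_eq_zero]
    · rw [supp_sAct, ← pre_union, ← pre_compl, coeffM_sAct, ih]

theorem shiftU_sAct (σ : Equiv.Perm (Fin n)) (η : Fin n → ℤˣ) (ε : Fin n → SignType)
    (w : Fin n → ℂˣ) : shiftU P (sAct σ η ε) (wAct σ η w) = wAct σ η (shiftU P ε w) := by
  funext j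
  rw [shiftU, wAct, wAct, shiftU, mul_zpow, ← zpow_mul, coe_sAct, mul_comm (η j : ℤ)]

theorem dOp_wAct (σ : Equiv.Perm (Fin n)) (η : Fin n → ℤˣ) {f : (Fin n → ℂˣ) → ℂ}
    (hf : ∀ w, f (wAct σ η w) = f w) (r : ℕ) (w : Fin n → ℂˣ) :
    dOp P r f (wAct σ η w) = dOp P r f w := by
  rw [dOp, dOp]
  refine (Finset.sum_bijective (sAct σ η) (sAct_bijective σ η) (fun ε => by simp) fun ε _ => ?_).symm
  rw [supp_sAct, ← pre_compl, coeffM_sAct, uCoef_wAct, shiftU_sAct, hf, hf]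

/-- The invariance of a Laurent polynomial under the hyperoctahedral group. -/
def IsInv (p : Laurent n) : Prop := ∀ σ η w, ev (wAct σ η w) p = ev w p

theorem expU_weylAct (σ : Equiv.Perm (Fin n)) (η : Fin n → ℤˣ) (x : Fin n → ℂ) :
    expU (weylAct σ η x) = wAct σ η (expU x) := by
  funext j
  ext
  rw [wAct, expU_zpow, expU_val, weylAct, zsmul_eq_mul]

/-- The action of the hyperoctahedral group on the regular points. -/
def Regular.weyl (σ : Equiv.Perm (Fin n)) (η : Fin n → ℤˣ) (x : Regular n P) : Regular n P :=
  ⟨weylAct σ η x.1, by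
    refine ⟨fun j k l h => ?_, fun j k hjk a b => ?_⟩
    · rcases Int.units_eq_one_or (η j) with h1 | h1
      · exact x.2.1 (σ j) k l (by simpa [weylAct, h1] using h)
      · refine x.2.1 (σ j) (-k) (-l) ?_
        simp only [weylAct, h1] at h
        push_cast at h ⊢
        simp only [neg_smul, one_smul] at h
        linear_combination -h
    · have hne : σ j ≠ σ k := fun h => hjk (σ.injective h)
      have h1 := x.2.2 (σ j) (σ k) hne
      rcases Int.units_eq_one_or (η j) with hj | hj <;>
        rcases Int.units_eq_one_or (η k) with hk | hk <;>
        simp only [weylAct, hj, hk, Units.val_one, Units.val_neg, neg_smul, one_smul]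
      · exact h1 a b
      · refine ⟨fun h => (h1 a b).2 (by linear_combination h),
          fun h => (h1 a b).1 (by linear_combination h)⟩
      · refine ⟨fun h => (h1 (-a) (-b)).2 (by push_cast; linear_combination -h),
          fun h => (h1 (-a) (-b)).1 (by push_cast; linear_combination -h)⟩
      · refine ⟨fun h => (h1 (-a) (-b)).1 (by push_cast; linear_combination -h),
          fun h => (h1 (-a) (-b)).2 (by push_cast; linear_combination -h)⟩⟩

theorem regPt_weyl (σ : Equiv.Perm (Fin n)) (η : Fin n → ℤˣ) (x : Regular n P) :
    regPt n P (x.weyl σ η) = wAct σ η (regPt n P x) := expU_weylAct σ η x.1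

theorem exists_ev_wAct (σ : Equiv.Perm (Fin n)) (η : Fin n → ℤˣ) (p : Laurent n) :
    ∃ p' : Laurent n, ∀ w, ev w p' = ev (wAct σ η w) p := by
  refine exists_ev_comp _ (fun l => ⟨1, fun j => (η (σ.symm j) : ℤ) * l (σ.symm j), fun w => ?_⟩) p
  rw [one_mul]
  congr 1
  rw [chi, chi, ← Equiv.prod_comp σ fun i => w i ^ _]
  simp [wAct, zpow_mul]

/-! ### Regular points on the rays -/

theorem abs_lt_of_eq_mul_pi {a : ℝ} {k : ℤ} (h : a = k * Real.pi) (ha : |a| < 3) : a = 0 := by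
  have hk : k = 0 := by
    by_contra hk
    have h1 : (1 : ℝ) ≤ |(k : ℝ)| := by exact_mod_cast Int.one_le_abs hk
    rw [h, abs_mul, abs_of_pos Real.pi_pos] at ha
    nlinarith [Real.pi_gt_three]
  rw [h, hk]
  simp

/-- The points of the rays are regular. -/
def regRay (n : ℕ) (P : Params) (R : ℝ) : Regular n P :=
  ⟨ray n R, by
    have hb : ∀ j : Fin n, 0 < ((j : ℝ) + 1) / (n + 1) ∧ ((j : ℝ) + 1) / (n + 1) ≤ 1 := fun j => by
      have h : ((j : ℕ) : ℝ) < n := by exact_mod_cast j.2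
      refine ⟨by positivity, ?_⟩
      rw [div_le_one (by positivity)]
      linarith
    refine ⟨fun j k l h => ?_, fun j k hjk a b => ⟨fun h => ?_, fun h => ?_⟩⟩
    · have h1 := congrArg Complex.re h
      simp only [ray_re, Params.γ, Complex.add_re] at h1
      have h2 := abs_lt_of_eq_mul_pi (a := ((j : ℝ) + 1) / (n + 1)) (k := k)
        (by rw [h1]; simp) (by rw [abs_of_pos (hb j).1]; linarith [(hb j).2])
      exact (hb j).1.ne' h2
    · have h1 := congrArg Complex.re h
      simp only [ray_re, Params.γ, Complex.add_re] at h1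
      have h2 := abs_lt_of_eq_mul_pi (a := ((j : ℝ) + 1) / (n + 1) + ((k : ℝ) + 1) / (n + 1))
        (k := 2 * a) (by rw [h1]; simp; ring)
        (by rw [abs_of_pos (add_pos (hb j).1 (hb k).1)]; linarith [(hb j).2, (hb k).2])
      exact (add_pos (hb j).1 (hb k).1).ne' h2
    · have h1 := congrArg Complex.re h
      simp only [ray_re, Params.γ, Complex.sub_re] at h1
      have h2 := abs_lt_of_eq_mul_pi (a := ((j : ℝ) + 1) / (n + 1) - ((k : ℝ) + 1) / (n + 1))
        (k := 2 * a) (by rw [h1]; simp; ring)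
        (by rw [abs_lt]; constructor <;> linarith [(hb j).1, (hb j).2, (hb k).1, (hb k).2])
      rw [← sub_div, div_eq_zero_iff] at h2
      have h3 : ((n : ℝ) + 1) ≠ 0 := by positivity
      have h4 : ((j : ℕ) : ℝ) = (k : ℕ) := by linarith [h2.resolve_right h3]
      exact hjk (Fin.ext (by exact_mod_cast h4))⟩

theorem evOn_regPt_injective : Function.Injective (evOn (regPt n P)) := by
  rw [injective_iff_map_eq_zero]
  intro p hp
  exact eq_zero_of_ev_ray fun R => congrFun hp (regRay n P R)

end Koornwinder

end

noncomputable section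

namespace Koornwinder

variable {n : ℕ} {P : Params}

/-! ### Regularity along the reflection hyperplanes -/

section

variable {l₀ : Fin n → ℤ} {c₀ : ℂˣ} {i₀ : Fin n} {hi₀ : l₀ i₀ * l₀ i₀ = 1}

/-- Both coefficients may have a simple pole, but not simultaneously: if `ε` moves a variable of
`l₀`, then `A` contains it and `U_A` is regular; otherwise `V_ε` is regular. -/
theorem coeffM_mul_uCoef_mem (hβ : 0 < P.β) (h₀ : (l₀, c₀) ∈ factorSet n P) (r m : ℕ)
    (ε : Fin n → SignType) (C A : Finset (Fin n)) (hA : supp ε ⊆ A)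
    (h : evOn (regPt n P) (linFac l₀ c₀) * (fun x => uCoef P (regPt n P x) r m A)
      ∈ locAt (regPt n P) l₀ c₀ i₀ hi₀) :
    evOn (regPt n P) (linFac l₀ c₀) * ((fun x => coeffM P ε C (regPt n P x))
      * fun x => uCoef P (regPt n P x) r m A) ∈ locAt (regPt n P) l₀ c₀ i₀ hi₀ := by
  by_cases hd : Disjoint (lsupp l₀) (supp ε)
  · rw [mul_left_comm]
    exact mul_mem (coeffM_mem_locAt h₀ ε C (Or.inl fun j hj =>
      eq_zero_of_notMem_supp (Finset.disjoint_left.1 hd hj))) h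
  · rw [← mul_assoc]
    exact mul_mem (mul_coeffM_mem_locAt hβ h₀ ε C)
      (uCoef_mem_locAt h₀ r m A fun h => hd (h.mono_right hA))

theorem mul_uCoef_mem_locAt (hβ : 0 < P.β) (h₀ : (l₀, c₀) ∈ factorSet n P) (r m : ℕ)
    (A : Finset (Fin n)) :
    evOn (regPt n P) (linFac l₀ c₀) * (fun x => uCoef P (regPt n P x) r m A)
      ∈ locAt (regPt n P) l₀ c₀ i₀ hi₀ := by
  have hc : ∀ A : Finset (Fin n), (fun _ : Regular n P => if A.card = r then (1 : ℂ) else 0)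
      ∈ locAt (regPt n P) l₀ c₀ i₀ hi₀ := by
    intro A
    split_ifs
    · exact one_mem _
    · exact zero_mem _
  induction m generalizing A with
  | zero => exact mul_mem (evOn_mem_locAt _) (hc A)
  | succ m ih =>
    have h1 : (fun x => uCoef P (regPt n P x) r (m + 1) A)
        = (fun _ : Regular n P => if A.card = r then (1 : ℂ) else 0)
          - ∑ ε with ε ≠ 0 ∧ Disjoint (supp ε) A,
            (fun x => coeffM P ε (A ∪ supp ε)ᶜ (regPt n P x))
              * fun x => uCoef P (regPt n P x) r m (A ∪ supp ε) := by
      funext x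
      simp [uCoef]
    rw [h1, mul_sub, Finset.mul_sum]
    exact sub_mem (mul_mem (evOn_mem_locAt _) (hc A)) (sum_mem fun ε _ =>
      coeffM_mul_uCoef_mem hβ h₀ r m ε _ _ Finset.subset_union_right (ih _))

theorem mul_dOp_mem_locAt (hβ : 0 < P.β) (h₀ : (l₀, c₀) ∈ factorSet n P) (r : ℕ)
    (p : Laurent n) : evOn (regPt n P) (linFac l₀ c₀)
      * (fun x => dOp P r (fun w => ev w p) (regPt n P x)) ∈ locAt (regPt n P) l₀ c₀ i₀ hi₀ := by
  choose s hs using fun ε => exists_ev_shiftU P ε p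
  have heq : (fun x => dOp P r (fun w => ev w p) (regPt n P x))
      = ∑ ε, (fun x => coeffM P ε (supp ε)ᶜ (regPt n P x))
        * (fun x => uCoef P (regPt n P x) r r (supp ε)) * evOn (regPt n P) (s ε - p) := by
    funext x
    rw [Finset.sum_apply]
    refine Finset.sum_congr rfl fun ε _ => ?_
    simp only [Pi.mul_apply, map_sub]
    rw [Pi.sub_apply, evOn_apply, evOn_apply, hs]
  rw [heq, Finset.mul_sum]
  refine sum_mem fun ε _ => ?_
  rw [← mul_assoc]
  exact mul_mem (coeffM_mul_uCoef_mem hβ h₀ r r ε _ _ subset_rfl (mul_uCoef_mem_locAt hβ h₀ r r _))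
    (evOn_mem_locAt _)

/-- The reflection `(σ, η)` fixes the zero set pointwise and preserves `D p`, whereas the simple
pole `1 / (1 - c₀ e^{l₀})` changes sign to leading order. The residue is therefore its own negative.
-/
theorem dOp_mem_locAt_of_sq (hβ : 0 < P.β) (h₀ : (l₀, c₀) ∈ factorSet n P) (hc : c₀ * c₀ = 1)
    {σ : Equiv.Perm (Fin n)} {η : Fin n → ℤˣ}
    (hσ : ∀ w, chi l₀ (wAct σ η w) = (chi l₀ w)⁻¹)
    (hfix : ∀ w, c₀ * chi l₀ w = 1 → wAct σ η w = w) (r : ℕ) {p : Laurent n} (hp : IsInv p) :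
    (fun x => dOp P r (fun w => ev w p) (regPt n P x)) ∈ locAt (regPt n P) l₀ c₀ i₀ hi₀ := by
  obtain ⟨s, q, hs, hq⟩ := mul_dOp_mem_locAt (i₀ := i₀) (hi₀ := hi₀) hβ h₀ r p
  obtain ⟨s', hs'⟩ := exists_ev_wAct σ η s
  obtain ⟨q', hq'⟩ := exists_ev_wAct σ η q
  have hpt : ∀ x, ev (regPt n P x) s * ((1 - c₀ * chi l₀ (regPt n P x))
      * dOp P r (fun w => ev w p) (regPt n P x)) = ev (regPt n P x) q := fun x => by
    have := congrFun hq x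
    simpa only [Pi.mul_apply, evOn_apply, ev_linFac] using this
  have hc' : (c₀ : ℂ) * c₀ = 1 := by rw [← Units.val_mul, hc, Units.val_one]
  -- the reflected identity
  have hkey : s' * q * AddMonoidAlgebra.single (-l₀) (-(c₀ : ℂ)) = s * q' := by
    refine evOn_regPt_injective (P := P) (funext fun x => ?_)
    have h1 := hpt (x.weyl σ η)
    rw [regPt_weyl, dOp_wAct σ η (fun w => hp σ η w), hσ, ← hs', ← hq'] at h1
    have h2 := hpt x
    have h3 : (chi l₀ (regPt n P x) : ℂ) * ((chi l₀ (regPt n P x))⁻¹ : ℂˣ) = 1 := by simp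
    simp only [map_mul, evOn_apply, ev_single, chi_neg]
    rw [← h1, ← h2]
    linear_combination (ev (regPt n P x) s' * ev (regPt n P x) s
      * dOp P r (fun w => ev w p) (regPt n P x)) * (hc' * (chi l₀ (regPt n P x) : ℂ)
        * ((chi l₀ (regPt n P x))⁻¹ : ℂˣ) + h3)
  -- On the zero set the reflected identity becomes `-s q = s q`, because the monomial takes the
  -- value `-c₀² = -1` there.
  have hdvd : linFac l₀ c₀ ∣ s * q := by
    refine (linFac_dvd_iff hi₀).2 fun w hw => ?_
    have h1 := congrArg (ev w) hkey
    rw [map_mul, map_mul, map_mul, hs', hq', hfix w hw, ev_single, chi_neg,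
      ← eq_inv_of_mul_eq_one_left hw, neg_mul, hc'] at h1
    rw [map_mul]
    linear_combination (-1 / 2 : ℂ) * h1
  obtain ⟨t, rfl⟩ := (linFac_dvd_mul hi₀ hdvd).resolve_left hs
  refine ⟨s, t, hs, funext fun x => ?_⟩
  have h1 := hpt x
  have h2 := linFac_ne_zero h₀ x
  rw [map_mul] at h1
  simp only [ev_linFac] at h1 h2
  simp only [Pi.mul_apply, evOn_apply]
  refine mul_left_cancel₀ h2 ?_
  rw [← h1]
  ring

end

/-! ### Reflections -/

/-- The sign change of one variable. -/
def flipSign (j : Fin n) : Fin n → ℤˣ := fun i => if i = j then -1 else 1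

theorem wAct_flip_self (j : Fin n) (w : Fin n → ℂˣ) : wAct 1 (flipSign j) w j = (w j)⁻¹ := by
  simp [wAct, flipSign]

theorem wAct_flip_of_ne {i j : Fin n} (h : i ≠ j) (w : Fin n → ℂˣ) :
    wAct 1 (flipSign j) w i = w i := by
  simp [wAct, flipSign, h]

/-- The signs of the reflection that exchanges two variables up to a sign. -/
def swapSign (j k : Fin n) (u : ℤˣ) : Fin n → ℤˣ := fun i => if i = j ∨ i = k then u else 1

theorem wAct_swap_left (j k : Fin n) (u : ℤˣ) (w : Fin n → ℂˣ) :
    wAct (Equiv.swap j k) (swapSign j k u) w j = w k ^ (u : ℤ) := by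
  simp [wAct, swapSign]

theorem wAct_swap_right (j k : Fin n) (u : ℤˣ) (w : Fin n → ℂˣ) :
    wAct (Equiv.swap j k) (swapSign j k u) w k = w j ^ (u : ℤ) := by
  simp [wAct, swapSign]

theorem wAct_swap_of_ne {i j k : Fin n} (hj : i ≠ j) (hk : i ≠ k) (u : ℤˣ) (w : Fin n → ℂˣ) :
    wAct (Equiv.swap j k) (swapSign j k u) w i = w i := by
  simp [wAct, swapSign, hj, hk, Equiv.swap_apply_of_ne_of_ne]

/-- The unit `-s t` for nonzero signs. -/
def negMul (s t : SignType) : ℤˣ := if s = t then -1 else 1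

theorem SignType.eq_or {s : SignType} (h : s ≠ 0) : s = 1 ∨ s = -1 := by
  revert s
  decide

theorem glue_of_eq_zero {ε b : Fin n → SignType} {i : Fin n} (h : b i = 0) : glue ε b i = ε i := by
  rw [glue, h, ite_eq_left_iff]
  exact fun h => (not_not.1 h).symm

/-- On `a x^s y^t = 1`, multiplying `x` by `a^s` gives the coordinate that the reflection in `s e_j
+ t e_k` puts in its place. With `a = 1` the reflection fixes the point; with `a = q` it acts as the
translation along `b`. -/
theorem eq_zpow_negMul {s t : SignType} (hs : s ≠ 0) (ht : t ≠ 0) {a x y : ℂˣ}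
    (h : a * (x ^ (s : ℤ) * y ^ (t : ℤ)) = 1) : x * a ^ (s : ℤ) = y ^ ((negMul s t : ℤˣ) : ℤ) := by
  have h1 : (1 : SignType) ≠ -1 := by decide
  rcases SignType.eq_or hs with rfl | rfl <;> rcases SignType.eq_or ht with rfl | rfl
  · simp [negMul] at h ⊢
    rw [← mul_assoc] at h
    rw [mul_comm, eq_inv_of_mul_eq_one_left h]
  · simp [negMul, h1] at h ⊢
    rw [← mul_assoc] at h
    rw [mul_comm, eq_of_mul_inv_eq_one h]
  · simp [negMul, h1.symm] at h ⊢
    rw [mul_inv_eq_iff_eq_mul, mul_comm y]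
    rw [mul_left_comm, inv_mul_eq_one] at h
    exact h
  · simp [negMul] at h ⊢
    rw [mul_left_comm, inv_mul_eq_one] at h
    rw [h]
    simp

/-- The constants `±1` give the reflection hyperplanes. The constants `±r` and `q` have modulus less
than one, and on their zero sets translation along `b` coincides with a reflection, which an
invariant `p` does not notice. The permutation `ι` is the identity for `±r`, where `c₀² = q`, and
the transposition of the two variables for `q`. -/
theorem dOp_mem_locAt (hβ : 0 < P.β) {a : (Fin n → ℤ) × ℂˣ} (ha : a ∈ factorSet n P) (r : ℕ)
    {p : Laurent n} (hp : IsInv p) (i₀ : Fin n) (hi₀ : a.1 i₀ * a.1 i₀ = 1) :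
    (fun x => dOp P r (fun w => ev w p) (regPt n P x)) ∈ locAt (regPt n P) a.1 a.2 i₀ hi₀ := by
  obtain ⟨l₀, c₀⟩ := a
  have h₀ := ha
  rcases ha with ⟨j, s, hs, h1, hc⟩ | ⟨j, k, s, t, hjk, hs, ht, h1, hc⟩
  · dsimp only at h1 hc hi₀ ⊢
    subst h1
    have typeI : c₀ * c₀ = 1 → (∀ w : ℂˣ, c₀ * w ^ (s : ℤ) = 1 → w⁻¹ = w) →
        (fun x => dOp P r (fun w => ev w p) (regPt n P x))
          ∈ locAt (regPt n P) (sgl j s) c₀ i₀ hi₀ := by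
      intro hc hw
      refine dOp_mem_locAt_of_sq hβ h₀ hc (σ := 1) (η := flipSign j) (fun w => ?_)
        (fun w h => ?_) r hp
      · rw [chi_sgl, chi_sgl, wAct_flip_self, inv_zpow]
      · rw [chi_sgl] at h
        funext i
        by_cases hi : i = j
        · rw [hi, wAct_flip_self, hw _ h]
        · exact wAct_flip_of_ne hi w
    have typeII : c₀ * c₀ = P.qU → ‖(c₀ : ℂ)‖ < 1 →
        (fun x => dOp P r (fun w => ev w p) (regPt n P x))
          ∈ locAt (regPt n P) (sgl j s) c₀ i₀ hi₀ := by
      intro hcq hn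
      have hb : ∀ i, sgl j s i = ((Pi.single j s : Fin n → SignType) i : ℤ) := by
        intro i
        by_cases hi : i = j
        · subst hi
          simp [sgl]
        · simp [sgl, hi]
      have hsupp : ∀ i, i ∈ supp (Pi.single j s : Fin n → SignType) ↔ i = j := by
        intro i
        by_cases hi : i = j
        · subst hi
          simpa [mem_supp] using hs
        · simp [mem_supp, hi]
      have hsq : ∀ w : ℂˣ, c₀ * w ^ (s : ℤ) = 1 →
          P.qU * (w ^ (s : ℤ) * w ^ (s : ℤ)) = 1 := by
        intro w hw
        rw [← hcq, mul_mul_mul_comm, hw, one_mul]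
      refine dOp_mem_locAt_of_norm_lt hβ h₀ hn hb 1 (fun i => Iff.rfl) (fun w hw i hi => ?_) p
        fun w hw ε hd => ?_
      · rw [(hsupp i).1 hi]
        rw [chi_sgl] at hw
        simpa [sgnPow] using hsq _ hw
      · rw [← hp 1 (flipSign j) (shiftU P ε w)]
        refine congrArg (fun v => ev v p) (funext fun i => ?_)
        by_cases hi : i = j
        · subst hi
          have hε : ε i = 0 := eq_zero_of_notMem_supp
            (Finset.disjoint_right.1 hd ((hsupp i).2 rfl))
          rw [chi_sgl] at hw
          have h3 := eq_zpow_negMul hs hs (hsq _ hw)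
          rw [wAct_flip_self]
          simpa [shiftU, glue, hε, negMul] using h3
        · rw [wAct_flip_of_ne hi]
          rw [shiftU, shiftU, glue_of_eq_zero (by simp [hi])]
    rcases hc with rfl | rfl | rfl | rfl
    · refine typeI (by simp) fun w hw => ?_
      rcases SignType.coe_eq_or hs with h | h <;> simp [h] at hw <;> simp [hw]
    · refine typeI (by simp) fun w hw => ?_
      rcases SignType.coe_eq_or hs with h | h <;> simp [h, neg_eq_iff_eq_neg] at hw
      · simp [hw]
      · rw [inv_eq_iff_eq_inv] at hw
        simp [hw]
    · exact typeII (pow_two _).symm (norm_rU_lt_one hβ)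
    · refine typeII ?_ ?_
      · rw [neg_mul_neg]
        exact (pow_two _).symm
      · rw [Units.val_neg, norm_neg]
        exact norm_rU_lt_one hβ
  · dsimp only at h1 hc hi₀ ⊢
    subst h1
    rcases hc with rfl | rfl
    · refine dOp_mem_locAt_of_sq hβ h₀ (by simp) (σ := Equiv.swap j k)
        (η := swapSign j k (negMul s t)) (fun w => ?_) (fun w h => ?_) r hp
      · rw [chi_dbl, chi_dbl, wAct_swap_left, wAct_swap_right]
        rcases SignType.coe_eq_or hs with h | h <;> rcases SignType.coe_eq_or ht with h' | h' <;>
          rw [← zpow_mul, ← zpow_mul, h, h', mul_inv, ← zpow_neg, ← zpow_neg, mul_comm]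
        all_goals
          have : (negMul s t : ℤ) = -((s : ℤ) * t) := by
            rw [h, h']
            rcases SignType.eq_or hs with rfl | rfl <;> rcases SignType.eq_or ht with rfl | rfl <;> simp_all [negMul]
          rw [this, h, h']
          norm_num
      · rw [chi_dbl] at h
        have h3 := eq_zpow_negMul hs ht h
        have h4 := eq_zpow_negMul ht hs (x := w k) (y := w j) (by rwa [mul_comm (w k ^ (t : ℤ)) (w j ^ (s : ℤ))])
        rw [one_zpow, mul_one] at h3 h4
        have h5 : negMul t s = negMul s t := by simp only [negMul, eq_comm]
        funext i
        by_cases hi : i = j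
        · rw [hi, wAct_swap_left, h3]
        · by_cases hi' : i = k
          · rw [hi', wAct_swap_right, h4, h5]
          · exact wAct_swap_of_ne hi hi' _ w
    · have hb : ∀ i, dbl j k s t i
          = ((if i = j then s else if i = k then t else 0 : SignType) : ℤ) := by
        intro i
        by_cases hi : i = j
        · subst hi
          simp [dbl_left hjk]
        · by_cases hi' : i = k
          · subst hi'
            simp [dbl_right hjk, hi]
          · simp [dbl_of_ne hi hi', hi, hi']
      have hsupp : ∀ i, i ∈ supp (fun i => if i = j then s else if i = k then t else 0)
          ↔ i = j ∨ i = k := by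
        intro i
        by_cases hi : i = j
        · simpa [mem_supp, hi] using hs
        · by_cases hi' : i = k
          · simpa [mem_supp, hi, hi', hjk.symm] using ht
          · simp [mem_supp, hi, hi']
      refine dOp_mem_locAt_of_norm_lt hβ h₀ (norm_qU_lt_one hβ) hb (Equiv.swap j k)
        (fun i => ?_) (fun w hw i hi => ?_) p fun w hw ε hd => ?_
      · rw [hsupp, hsupp]
        by_cases hi : i = j
        · simp [hi]
        · by_cases hi' : i = k
          · simp [hi']
          · simp [Equiv.swap_apply_of_ne_of_ne hi hi']
      · rw [chi_dbl] at hw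
        rcases (hsupp i).1 hi with rfl | rfl
        · simpa [sgnPow, hjk.symm, mul_comm] using hw
        · simpa [sgnPow, hjk.symm, mul_comm] using hw
      · rw [← hp (Equiv.swap j k) (swapSign j k (negMul s t)) (shiftU P ε w)]
        refine congrArg (fun v => ev v p) (funext fun i => ?_)
        have hε : ∀ i, (i = j ∨ i = k) → ε i = 0 := fun i hi => eq_zero_of_notMem_supp
            (Finset.disjoint_right.1 hd ((hsupp i).2 hi))
        rw [chi_dbl] at hw
        have h3 := eq_zpow_negMul hs ht hw
        have h4 := eq_zpow_negMul ht hs (x := w k) (y := w j) (by rwa [mul_comm (w k ^ (t : ℤ)) (w j ^ (s : ℤ))])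
        have h5 : negMul t s = negMul s t := by simp only [negMul, eq_comm]
        by_cases hi : i = j
        · rw [hi, wAct_swap_left]
          simpa [shiftU, glue, hε j (Or.inl rfl), hε k (Or.inr rfl)] using h3
        · by_cases hi' : i = k
          · rw [hi', wAct_swap_right, ← h5]
            simpa [shiftU, glue, hε j (Or.inl rfl), hε k (Or.inr rfl), hjk.symm] using h4
          · rw [wAct_swap_of_ne hi hi']
            rw [shiftU, shiftU, glue_of_eq_zero (by simp [hi, hi'])]

end Koornwinder

end

/-! ### Invariant polynomials are preserved, and the action is triangular. -/

noncomputable section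

open Filter Asymptotics

namespace Koornwinder

variable {n : ℕ} {P : Params}

/-! ### The difference operators preserve the invariant Laurent polynomials -/

theorem dOp_mem_of_subalgebra {X : Type*} {pt : X → Fin n → ℂˣ} {S : Subalgebra ℂ (X → ℂ)}
    (hS : ∀ a ∈ factorSet n P, ∀ g, uOn pt P g a.1 a.2 ∈ S) (ε : Fin n → SignType)
    (C : Finset (Fin n)) (r m : ℕ) (A : Finset (Fin n)) :
    (fun x => coeffM P ε C (pt x) * uCoef P (pt x) r m A) ∈ S := by
  have h1 : ∀ ε C, (fun x => coeffM P ε C (pt x)) ∈ S := fun ε C =>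
    coeffM_mem (fun j => singleFac_mem fun _ c hc g => hS _ hc g)
      fun j k hjk => pairFac_mem hjk fun s t c hc _ _ _ => hS _ hc _
  exact mul_mem (h1 ε C) (uCoef_mem_of (fun _ => True) (fun _ _ _ _ => trivial)
    (fun ε A _ _ => h1 _ _) m A trivial)

theorem dOp_mem_denOf (r : ℕ) (p : Laurent n) :
    (fun x => dOp P r (fun w => ev w p) (regPt n P x)) ∈ denOf (regPt n P) (factorSet n P) := by
  choose s hs using fun ε => exists_ev_shiftU P ε p
  have heq : (fun x => dOp P r (fun w => ev w p) (regPt n P x))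
      = ∑ ε, (fun x => coeffM P ε (supp ε)ᶜ (regPt n P x) * uCoef P (regPt n P x) r r (supp ε))
        * evOn (regPt n P) (s ε - p) := by
    funext x
    rw [Finset.sum_apply]
    refine Finset.sum_congr rfl fun ε _ => ?_
    simp only [Pi.mul_apply, map_sub]
    rw [Pi.sub_apply, evOn_apply, evOn_apply, hs]
  rw [heq]
  refine sum_mem fun ε _ => mul_mem (dOp_mem_of_subalgebra (fun a ha g => ?_) _ _ _ _ _)
    (evOn_mem_denOf _)
  rw [uOn_eq]
  exact mul_mem (evOn_mem_denOf _) (inv_mem_denOf ha (linFac_ne_zero ha))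

theorem exists_dOp_eq (hβ : 0 < P.β) (r : ℕ) {p : Laurent n} (hp : IsInv p) :
    ∃ q : Laurent n, IsInv q ∧
      ∀ x : Regular n P, dOp P r (fun w => ev w p) (regPt n P x) = ev (regPt n P x) q := by
  obtain ⟨q, hq⟩ := mem_range_of_locAt evOn_regPt_injective (fun a ha => linFac_ne_zero ha)
    (dOp_mem_denOf (P := P) r p) fun a ha => by
      obtain ⟨i₀, hi₀⟩ := (isRootLike_of_mem ha).exists_unit
      exact ⟨i₀, hi₀, dOp_mem_locAt hβ ha r hp i₀ hi₀⟩
  refine ⟨q, fun σ η w => ?_, congrFun hq⟩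
  obtain ⟨q', hq'⟩ := exists_ev_wAct σ η q
  have : q' = q := evOn_regPt_injective (P := P) (funext fun x => by
    rw [evOn_apply, hq', ← regPt_weyl, ← evOn_apply, ← congrFun hq, ← congrFun hq, regPt_weyl,
      dOp_wAct σ η fun w => hp σ η w])
  rw [← hq', this]

/-! ### Growth along the rays -/

/-- The functions of a real variable that are bounded near infinity. -/
def boundedAtTop : Subalgebra ℂ (ℝ → ℂ) where
  carrier := {f | f =O[atTop] fun _ => (1 : ℝ)}
  mul_mem' hf hg := by simpa using IsBigO.mul hf hg
  add_mem' hf hg := IsBigO.add hf hg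
  algebraMap_mem' a := isBigO_const_const a one_ne_zero atTop

/-- Since `height l ≠ 0`, the argument `y` tends to `0` or to infinity along the ray. In both cases
`u(y) = e^{βg/2} (q^g + (1 - q^g) / (1 - y))` stays bounded. -/
theorem uOn_ray_mem {l : Fin n → ℤ} (hl : l ≠ 0) (c : ℂˣ) (g : ℝ) :
    uOn (fun R : ℝ => expU (ray n R)) P g l c ∈ boundedAtTop := by
  have hh : height l ≠ 0 := fun h => hl (height_injective (h.trans (map_zero _).symm))
  have hu : uOn (fun R : ℝ => expU (ray n R)) P g l c
      = algebraMap ℂ _ (Complex.exp (P.β * g / 2)) * (fun R => 1 - P.qpow g *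
        (c * chi l (expU (ray n R)))) * fun R => (1 - c * (chi l (expU (ray n R)) : ℂ))⁻¹ := by
    funext R
    simp only [uOn, uFac, Pi.mul_apply, Pi.algebraMap_apply, Algebra.algebraMap_self,
      RingHom.id_apply]
    ring
  set y : ℝ → ℂ := fun R => c * chi l (expU (ray n R)) with hy
  set a : ℝ := ‖(c : ℂ) * chi l (expU (ray n 0))‖ with ha
  have ha0 : 0 < a := by simp [ha]
  have hny : ∀ R, ‖y R‖ = a * Real.exp (R * height l) := by
    intro R
    rw [hy]
    dsimp only
    rw [chi_ray, ← mul_assoc, norm_mul, Complex.norm_real, Real.norm_of_nonneg (Real.exp_pos _).le]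
  have hev : ∀ᶠ R in atTop, ‖y R‖ ≤ 1 / 2 ∨ 2 ≤ ‖y R‖ := by
    rcases lt_or_gt_of_ne hh with h | h
    · have ht : Tendsto (fun R : ℝ => a * Real.exp (R * height l)) atTop (nhds (a * 0)) :=
        (Real.tendsto_exp_atBot.comp (tendsto_id.atTop_mul_const_of_neg h)).const_mul a
      rw [mul_zero] at ht
      filter_upwards [ht.eventually (ge_mem_nhds (by norm_num : (0 : ℝ) < 1 / 2))] with R hR
      exact Or.inl (by rwa [hny])
    · have ht : Tendsto (fun R : ℝ => a * Real.exp (R * height l)) atTop atTop :=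
        (Real.tendsto_exp_atTop.comp (tendsto_id.atTop_mul_const h)).const_mul_atTop ha0
      filter_upwards [ht.eventually_ge_atTop 2] with R hR
      exact Or.inr (by rwa [hny])
  have hinv : (fun R => (1 - y R)⁻¹) ∈ boundedAtTop := by
    refine IsBigO.of_bound 2 (hev.mono fun R hR => ?_)
    rw [norm_inv, norm_one, mul_one]
    refine inv_le_of_inv_le₀ (by norm_num) ?_
    rcases hR with h | h
    · have := norm_sub_norm_le (1 : ℂ) (y R)
      rw [norm_one] at this
      linarith
    · have := norm_sub_norm_le (y R) 1
      rw [norm_one, norm_sub_rev] at this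
      linarith
  have hfin : uOn (fun R : ℝ => expU (ray n R)) P g l c =ᶠ[atTop]
      (algebraMap ℂ _ (Complex.exp (P.β * g / 2)) * (algebraMap ℂ (ℝ → ℂ) (P.qpow g)
        + algebraMap ℂ _ (1 - P.qpow g) * fun R => (1 - y R)⁻¹)) := by
    filter_upwards [hev] with R hR
    have hne : 1 - y R ≠ 0 := by
      intro h
      have h1 : y R = 1 := (sub_eq_zero.1 h).symm
      rw [h1, norm_one] at hR
      norm_num at hR
    rw [hu]
    simp only [Pi.mul_apply, Pi.add_apply, Pi.algebraMap_apply, Algebra.algebraMap_self,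
      RingHom.id_apply]
    change Complex.exp (P.β * g / 2) * (1 - P.qpow g * y R) * (1 - y R)⁻¹ = _
    field_simp
    ring
  have hmem := boundedAtTop.mul_mem (boundedAtTop.algebraMap_mem (Complex.exp (P.β * g / 2)))
    (boundedAtTop.add_mem (boundedAtTop.algebraMap_mem (P.qpow g))
      (boundedAtTop.mul_mem (boundedAtTop.algebraMap_mem (1 - P.qpow g)) hinv))
  exact IsBigO.congr' hmem hfin.symm EventuallyEq.rfl

/-- The coefficients are bounded along the ray and translations do not affect the exponential rate,
so the image grows no faster than `p`. This replaces any computation of leading terms. -/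
theorem height_le_of_dOp_eq {r : ℕ} {p q : Laurent n}
    (h : ∀ x : Regular n P, dOp P r (fun w => ev w p) (regPt n P x) = ev (regPt n P x) q)
    {d : ℝ} (hp : ∀ l ∈ p.coeff.support, height l ≤ d) : ∀ l ∈ q.coeff.support, height l ≤ d := by
  refine height_le_of_ev_ray_isBigO ?_
  have h1 : (fun R : ℝ => ev (expU (ray n R)) q) = fun R =>
      ∑ ε, coeffM P ε (supp ε)ᶜ (expU (ray n R)) * uCoef P (expU (ray n R)) r r (supp ε)
        * (ev (shiftU P ε (expU (ray n R))) p - ev (expU (ray n R)) p) :=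
    funext fun R => (h (regRay n P R)).symm
  rw [h1]
  refine IsBigO.fun_sum fun ε _ => ?_
  have h2 : (fun R : ℝ => coeffM P ε (supp ε)ᶜ (expU (ray n R))
      * uCoef P (expU (ray n R)) r r (supp ε)) ∈ boundedAtTop :=
    dOp_mem_of_subalgebra (fun a ha g => uOn_ray_mem (isRootLike_of_mem ha).1 _ _) _ _ _ _ _
  have h3 : (fun R : ℝ => ev (shiftU P ε (expU (ray n R))) p) =O[atTop]
      fun R : ℝ => Real.exp (R * d) :=
    ev_ray_isBigO hp fun j => P.qU ^ (ε j : ℤ)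
  have h4 : (fun R : ℝ => ev (expU (ray n R)) p) =O[atTop] fun R : ℝ => Real.exp (R * d) := by
    simpa using ev_ray_isBigO hp 1
  simpa using IsBigO.mul h2 (h3.sub h4)

end Koornwinder

end

/-! ### The weight function and the symmetry of the operators. -/

noncomputable section

open Filter

namespace Koornwinder

/-! ### The shifted factorials -/

section

variable {q : ℂ}

theorem summable_qPoch (hq : ‖q‖ < 1) (w : ℂ) : Summable fun m : ℕ => ‖-(w * q ^ m)‖ := by
  simp only [norm_neg, norm_mul, norm_pow]
  exact (summable_geometric_of_lt_one (norm_nonneg _) hq).mul_left _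

theorem multipliable_qPoch (hq : ‖q‖ < 1) (w : ℂ) : Multipliable fun m : ℕ => 1 - w * q ^ m := by
  simpa only [sub_eq_add_neg] using multipliable_one_add_of_summable (summable_qPoch hq w)

theorem qPoch_eq_mul (hq : ‖q‖ < 1) (w : ℂ) : qPoch w q = (1 - w) * qPoch (q * w) q := by
  have h1 : Multipliable fun m : ℕ => 1 - w * q ^ (m + 1) := by
    have h := multipliable_qPoch hq (q * w)
    have h' : ∀ m : ℕ, 1 - q * w * q ^ m = 1 - w * q ^ (m + 1) := fun m => by ring
    simpa only [h'] using h
  have h2 := tprod_eq_zero_mul' (f := fun m : ℕ => 1 - w * q ^ m) h1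
  have h3 : ∀ m : ℕ, 1 - w * q ^ (m + 1) = 1 - q * w * q ^ m := fun m => by ring
  simp only [pow_zero, mul_one, h3] at h2
  exact h2

theorem qPoch_ne_zero (hq : ‖q‖ < 1) {w : ℂ} (h : ∀ m : ℕ, w * q ^ m ≠ 1) : qPoch w q ≠ 0 := by
  have := tprod_one_add_ne_zero_of_summable (f := fun m : ℕ => -(w * q ^ m))
    (fun m => by rw [← sub_eq_add_neg, sub_ne_zero]; exact (h m).symm) (summable_qPoch hq w)
  simp only [← sub_eq_add_neg] at this
  exact this

theorem qPoch_ne_zero_of_norm (hq : ‖q‖ < 1) {w : ℂ} (h : ‖w‖ ≤ 1) (h1 : w ≠ 1) :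
    qPoch w q ≠ 0 := by
  refine qPoch_ne_zero hq fun m hm => ?_
  rcases m with _ | m
  · exact h1 (by simpa using hm)
  · have h2 := congrArg norm hm
    rw [norm_mul, norm_pow, norm_one] at h2
    have h3 : ‖q‖ ^ (m + 1) < 1 := pow_lt_one₀ (norm_nonneg _) hq (Nat.succ_ne_zero _)
    nlinarith [norm_nonneg w, pow_nonneg (norm_nonneg q) (m + 1)]

theorem differentiable_qPoch (hq : ‖q‖ < 1) : Differentiable ℂ fun w => qPoch w q := by
  intro w
  have h : HasProdLocallyUniformlyOn (fun (m : ℕ) (w : ℂ) => 1 + -(w * q ^ m))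
      (fun w => ∏' m : ℕ, (1 + -(w * q ^ m))) (Metric.ball 0 (‖w‖ + 1)) := by
    refine Summable.hasProdLocallyUniformlyOn_nat_one_add Metric.isOpen_ball
      ((summable_geometric_of_lt_one (norm_nonneg q) hq).mul_left (‖w‖ + 1))
      (.of_forall fun m x hx => ?_) fun m => by fun_prop
    rw [norm_neg, norm_mul, norm_pow]
    have : ‖x‖ < ‖w‖ + 1 := by simpa using hx
    gcongr
  have hd := h.differentiableOn
    (.of_forall fun _ => by simpa [Finset.prod_fn] using
      DifferentiableOn.finsetProd (fun _ _ => by fun_prop)) Metric.isOpen_ball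
  have hd' := hd.differentiableAt (Metric.isOpen_ball.mem_nhds (by simp : w ∈ Metric.ball 0 (‖w‖ + 1)))
  simpa only [qPoch, sub_eq_add_neg] using hd'

theorem qPoch_mul_qPoch_neg (hq : ‖q‖ < 1) (w : ℂ) :
    qPoch w q * qPoch (-w) q = qPoch (w ^ 2) (q ^ 2) := by
  rw [qPoch, qPoch, qPoch, ← (multipliable_qPoch hq w).tprod_mul (multipliable_qPoch hq (-w))]
  exact tprod_congr fun m => by ring

/-- Even and odd factors are separated. With `qPoch_mul_qPoch_neg` and base `r`, `r² = q`, this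
factors `(w²; q)` into the four symbols at `±w` and `±rw`, one for each denominator of `d_b^+`. -/
theorem qPoch_split (hq : ‖q‖ < 1) (w : ℂ) :
    qPoch w q = qPoch w (q ^ 2) * qPoch (q * w) (q ^ 2) := by
  have hq2 : ‖q ^ 2‖ < 1 := by
    rw [norm_pow]
    exact pow_lt_one₀ (norm_nonneg _) hq two_ne_zero
  have h1 := multipliable_qPoch hq2 w
  have h2 := multipliable_qPoch hq2 (q * w)
  have e1 : ∀ k : ℕ, 1 - w * (q ^ 2) ^ k = 1 - w * q ^ (2 * k) := fun k => by rw [← pow_mul]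
  have e2 : ∀ k : ℕ, 1 - q * w * (q ^ 2) ^ k = 1 - w * q ^ (2 * k + 1) := fun k => by
    rw [← pow_mul, pow_succ]
    ring
  simp only [e1] at h1
  simp only [e2] at h2
  rw [qPoch, qPoch, qPoch]
  simp only [e1, e2]
  exact (tprod_even_mul_odd (f := fun k => 1 - w * q ^ k) h1 h2).symm

end

variable (P : Params)

/-- The factor `(w; q)_∞ / (q^g w; q)_∞` of the weight function; its singularity for `g = 0`
is removed. -/
def eFac (g : ℝ) (w : ℂ) : ℂ :=
  if g = 0 then 1 else qPoch w (P.qpow 1) / qPoch (P.qpow g * w) (P.qpow 1)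

variable {P}

theorem norm_qpow_one_lt (hβ : 0 < P.β) : ‖P.qpow 1‖ < 1 := P.qU_val ▸ norm_qU_lt_one hβ

theorem norm_qpow (s : ℝ) : ‖P.qpow s‖ = Real.exp (-P.β * s) := by
  rw [Params.qpow, Complex.norm_real, Real.norm_of_nonneg (Real.exp_pos _).le]

theorem norm_qpow_lt_one (hβ : 0 < P.β) {s : ℝ} (hs : 0 < s) : ‖P.qpow s‖ < 1 := by
  rw [norm_qpow, Real.exp_lt_one_iff]
  nlinarith

theorem qpow_zero : P.qpow 0 = 1 := by simp [Params.qpow]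

theorem eFac_denom_ne_zero (hβ : 0 < P.β) {g : ℝ} (hg : 0 < g) {w : ℂ} (hw : ‖w‖ ≤ 1) :
    qPoch (P.qpow g * w) (P.qpow 1) ≠ 0 := by
  have h : ‖P.qpow g * w‖ < 1 := by
    rw [norm_mul]
    nlinarith [norm_qpow_lt_one hβ hg, norm_nonneg (P.qpow g), norm_nonneg w]
  refine qPoch_ne_zero_of_norm (norm_qpow_one_lt hβ) h.le fun h1 => ?_
  rw [h1, norm_one] at h
  exact lt_irrefl _ h

/-- For `g > 0` the zeros of the denominator lie outside the closed unit disc. For `g = 0` numerator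
and denominator cancel, including at `w = 1`, which is why `eFac` treats that value separately. -/
theorem differentiableAt_eFac (hβ : 0 < P.β) {g : ℝ} (hg : 0 ≤ g) {w : ℂ} (hw : ‖w‖ ≤ 1) :
    DifferentiableAt ℂ (eFac P g) w := by
  rcases hg.eq_or_lt with rfl | hg
  · have : eFac P 0 = fun _ => 1 := funext fun w => if_pos rfl
    rw [this]
    exact differentiableAt_const _
  · have : eFac P g = fun w => qPoch w (P.qpow 1) / qPoch (P.qpow g * w) (P.qpow 1) :=
      funext fun w => if_neg hg.ne'
    rw [this]
    have hd := differentiable_qPoch (norm_qpow_one_lt hβ)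
    have hd2 : DifferentiableAt ℂ (fun w => qPoch (P.qpow g * w) (P.qpow 1)) w :=
      (hd _).comp w (by fun_prop)
    exact (hd w).div hd2 (eFac_denom_ne_zero hβ hg hw)

theorem eFac_eq_div (hβ : 0 < P.β) {g : ℝ} {w : ℂ} (hw : ‖w‖ ≤ 1) (h1 : w ≠ 1) :
    eFac P g w = qPoch w (P.qpow 1) / qPoch (P.qpow g * w) (P.qpow 1) := by
  rw [eFac]
  split_ifs with h
  · rw [h, qpow_zero, one_mul, div_self (qPoch_ne_zero_of_norm (norm_qpow_one_lt hβ) hw h1)]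
  · rfl

/-- The `q`-difference equation of the weight: the infinite products at `w` and `qw` differ by one
factor each, and their quotient is the block `u(w)` up to the exponential. The pole of `u` at `1` is
absorbed by the zero of `(w; q)_∞`. -/
theorem uFac_mul_eFac (hβ : 0 < P.β) {g : ℝ} (hg : 0 ≤ g) {w : ℂ} (hw : ‖w‖ ≤ 1) (h1 : w ≠ 1) :
    uFac P g w * eFac P g w = Complex.exp (P.β * g / 2) * eFac P g (P.qU * w) := by
  have hw1 : 1 - w ≠ 0 := sub_ne_zero.2 h1.symm
  rcases hg.eq_or_lt with rfl | hg
  · simp [uFac, eFac, qpow_zero, hw1]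
  · have h2 : 1 - P.qpow g * w ≠ 0 := by
      rw [sub_ne_zero]
      intro h
      have h3 := congrArg norm h
      rw [norm_one, norm_mul] at h3
      nlinarith [norm_qpow_lt_one hβ hg, norm_nonneg (P.qpow g), norm_nonneg w]
    have h3 := eFac_denom_ne_zero hβ hg hw
    have h4 := h3
    rw [qPoch_eq_mul (norm_qpow_one_lt hβ)] at h4
    rw [eFac, eFac, if_neg hg.ne', if_neg hg.ne', uFac, qPoch_eq_mul (norm_qpow_one_lt hβ) w,
      qPoch_eq_mul (norm_qpow_one_lt hβ) (P.qpow g * w), P.qU_val,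
      mul_left_comm (P.qpow 1) (P.qpow g) w]
    have h5 := right_ne_zero_of_mul h4
    rw [mul_left_comm (P.qpow 1) (P.qpow g) w] at h5
    field_simp

theorem conj_eFac (g : ℝ) (w : ℂ) :
    (starRingEnd ℂ) (eFac P g w) = eFac P g ((starRingEnd ℂ) w) := by
  rw [eFac, eFac]
  split_ifs
  · simp
  · rw [map_div₀, conj_qPoch, conj_qPoch, map_mul, conj_qpow, conj_qpow]

variable (P) in
/-- The factor of the weight function attached to one variable. -/
def eFacB (w : ℂ) : ℂ :=
  eFac P P.g₀ w * eFac P P.g₁ (-w) * (eFac P P.g₀' (P.rU * w) * eFac P P.g₁' (-P.rU * w))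

theorem conj_rU : (starRingEnd ℂ) (P.rU : ℂ) = P.rU := conj_qpow P _

theorem conj_qU : (starRingEnd ℂ) (P.qU : ℂ) = P.qU := by rw [P.qU_val, conj_qpow]

theorem conj_eFacB (w : ℂ) : (starRingEnd ℂ) (eFacB P w) = eFacB P ((starRingEnd ℂ) w) := by
  simp only [eFacB, map_mul, conj_eFac, map_neg, conj_rU]

theorem norm_rU_mul_lt (hβ : 0 < P.β) {w : ℂ} (hw : ‖w‖ ≤ 1) : ‖P.rU * w‖ < 1 := by
  rw [norm_mul]
  nlinarith [norm_rU_lt_one hβ, norm_nonneg (P.rU : ℂ), norm_nonneg w]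

theorem ne_one_of_norm_lt {w : ℂ} (hw : ‖w‖ < 1) : w ≠ 1 := by
  rintro rfl
  simp at hw

theorem neg_ne_one_of_ne {w : ℂ} (h : w ≠ -1) : -w ≠ 1 := fun h' => h (by rw [← h', neg_neg])

theorem vbm_mul_eFacB (hP : P.Admissible) {w : ℂ} (hw : ‖w‖ ≤ 1) (h1 : w ≠ 1) (h2 : w ≠ -1) :
    vbm P w * eFacB P w = Complex.exp (P.β * (P.g₀ + P.g₁ + P.g₀' + P.g₁') / 2)
      * eFacB P (P.qU * w) := by
  have hβ := hP.β_pos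
  have hr := norm_rU_mul_lt hβ hw
  have hr' : ‖-P.rU * w‖ < 1 := by rwa [neg_mul, norm_neg]
  have e1 := uFac_mul_eFac hβ hP.g₀_nonneg hw h1
  have e2 := uFac_mul_eFac hβ hP.g₁_nonneg (by rwa [norm_neg]) (neg_ne_one_of_ne h2)
  have e3 := uFac_mul_eFac hβ hP.g₀'_nonneg hr.le (ne_one_of_norm_lt hr)
  have e4 := uFac_mul_eFac hβ hP.g₁'_nonneg hr'.le (ne_one_of_norm_lt hr')
  have e5 : Complex.exp (P.β * (P.g₀ + P.g₁ + P.g₀' + P.g₁') / 2)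
      = Complex.exp (P.β * P.g₀ / 2) * Complex.exp (P.β * P.g₁ / 2)
        * (Complex.exp (P.β * P.g₀' / 2) * Complex.exp (P.β * P.g₁' / 2)) := by
    rw [← Complex.exp_add, ← Complex.exp_add, ← Complex.exp_add]
    congr 1
    ring
  calc vbm P w * eFacB P w
      = (uFac P P.g₀ w * eFac P P.g₀ w) * (uFac P P.g₁ (-w) * eFac P P.g₁ (-w))
        * ((uFac P P.g₀' (P.rU * w) * eFac P P.g₀' (P.rU * w))
        * (uFac P P.g₁' (-P.rU * w) * eFac P P.g₁' (-P.rU * w))) := by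
        rw [vbm, eFacB]
        ring
    _ = _ := by
        rw [e1, e2, e3, e4, e5, eFacB, mul_neg, mul_left_comm (P.rU : ℂ) P.qU w,
          mul_left_comm (-P.rU : ℂ) P.qU w]
        ring

theorem norm_cexpI (z : AddCircle (2 * Real.pi)) : ‖cexpI z‖ = 1 := Circle.norm_coe _

theorem daPlus_eq (hβ : 0 < P.β) {z : AddCircle (2 * Real.pi)} (h : cexpI z ≠ 1) :
    daPlus P z = eFac P P.g (cexpI z) := by
  rw [daPlus, eFac_eq_div hβ (norm_cexpI z).le h]

theorem dbPlus_eq (hβ : 0 < P.β) {z : AddCircle (2 * Real.pi)} (h : cexpI z ≠ 1)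
    (h' : cexpI z ≠ -1) : dbPlus P z = eFacB P (cexpI z) := by
  have hn : ‖cexpI z‖ ≤ 1 := (norm_cexpI z).le
  have hr := norm_rU_mul_lt hβ hn
  have hr' : ‖-P.rU * cexpI z‖ < 1 := by rwa [neg_mul, norm_neg]
  have hr1 := norm_rU_lt_one hβ
  have hq : P.qpow 1 = (P.rU : ℂ) ^ 2 := by rw [← P.qU_val, Params.qU, Units.val_pow_eq_pow_val]
  have e1 : qPoch (cexpI z ^ 2) (P.qpow 1) = qPoch (cexpI z) (P.qpow 1)
      * qPoch (P.rU * cexpI z) (P.qpow 1)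
      * (qPoch (-cexpI z) (P.qpow 1) * qPoch (-P.rU * cexpI z) (P.qpow 1)) := by
    rw [hq, ← qPoch_mul_qPoch_neg hr1, qPoch_split hr1, qPoch_split hr1 (-cexpI z), mul_neg,
      neg_mul]
  rw [dbPlus, eFacB, eFac_eq_div hβ hn h, eFac_eq_div hβ (by rwa [norm_neg]) (neg_ne_one_of_ne h'),
    eFac_eq_div hβ hr.le (ne_one_of_norm_lt hr), eFac_eq_div hβ hr'.le (ne_one_of_norm_lt hr'), e1,
    P.qpow_add, P.qpow_add, ← P.rU_val, div_mul_div_comm, div_mul_div_comm, div_mul_div_comm]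
  congr 1
  · ring
  · simp only [mul_neg, neg_mul, mul_assoc]

end Koornwinder

end

noncomputable section

open MeasureTheory Filter

namespace Koornwinder

variable {n : ℕ}

/-! ### Points of the torus -/

/-- The multiplicative coordinates of a point of the torus. -/
def tw (t : Torus n) : Fin n → ℂˣ := fun j => Circle.toUnits (AddCircle.toCircle (t j))

/-- The representative in `(-π, π]ⁿ` of a point of the torus. -/
def rep (t : Torus n) : Fin n → ℝ := fun j => AddCircle.equivIoc (2 * Real.pi) (-Real.pi) (t j)

theorem tw_val (t : Torus n) (j : Fin n) : (tw t j : ℂ) = cexpI (t j) := rfl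

theorem norm_tw (t : Torus n) (j : Fin n) : ‖(tw t j : ℂ)‖ = 1 := norm_cexpI _

theorem coe_rep (t : Torus n) (j : Fin n) : ((rep t j : ℝ) : AddCircle (2 * Real.pi)) = t j :=
  AddCircle.coe_equivIoc

theorem expU_rep (t : Torus n) : expU (fun j => (rep t j : ℂ)) = tw t := by
  funext j
  ext
  rw [expU_val, ← cexpI_coe, coe_rep, tw_val]

theorem cexpI_add (x y : AddCircle (2 * Real.pi)) : cexpI (x + y) = cexpI x * cexpI y := by
  simp [cexpI, AddCircle.toCircle_add]

theorem continuous_cexpI : Continuous cexpI :=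
  continuous_subtype_val.comp AddCircle.continuous_toCircle

theorem continuous_tw (j : Fin n) : Continuous fun t : Torus n => (tw t j : ℂ) :=
  continuous_cexpI.comp (continuous_apply j)

/-- Translation of the torus along a sign vector. -/
def shiftT (ε : Fin n → ℤ) (s : ℝ) (t : Torus n) : Torus n :=
  t + fun j => ((2 * Real.pi * s * ε j : ℝ) : AddCircle (2 * Real.pi))

theorem tw_shiftT (ε : Fin n → ℤ) (s : ℝ) (t : Torus n) :
    tw (shiftT ε s t) = expU fun j => rep t j + 2 * Real.pi * s * ε j := by
  funext j
  ext
  rw [tw_val, shiftT, Pi.add_apply, cexpI_add, cexpI_coe, ← coe_rep t j, cexpI_coe, expU_val,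
    ← Complex.exp_add]
  congr 1
  push_cast
  ring

/-- Lebesgue measure on the unit interval. -/
def unitMeasure : Measure ℝ := volume.restrict (Set.Ioc 0 1)

instance : IsProbabilityMeasure unitMeasure := ⟨by simp [unitMeasure]⟩

theorem continuous_shiftT (ε : Fin n → ℤ) :
    Continuous fun p : Torus n × ℝ => shiftT ε p.2 p.1 := by
  refine continuous_fst.add (continuous_pi fun j => ?_)
  exact (AddCircle.continuous_mk' _).comp (by fun_prop)

/-- A skew product: for each fixed parameter the map is a translation of the torus, and the unit
interval has mass one. -/
theorem measurePreserving_shiftT (ε : Fin n → ℤ) :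
    MeasurePreserving (fun p : Torus n × ℝ => shiftT ε p.2 p.1) (volume.prod unitMeasure)
      volume := by
  have h1 : MeasurePreserving (fun p : ℝ × Torus n => (p.1, shiftT ε p.1 p.2))
      (unitMeasure.prod volume) (unitMeasure.prod volume) :=
    (MeasurePreserving.id unitMeasure).skew_product
      ((continuous_shiftT ε).measurable.comp measurable_swap)
      (ae_of_all _ fun s => (measurePreserving_add_right volume _).map_eq)
  exact (measurePreserving_snd.comp h1).comp Measure.measurePreserving_swap

/-- Averaging along a one-parameter group of translations of the torus. -/
theorem integral_eq_of_shiftT (ε : Fin n → ℤ) {F G : Torus n → ℂ} (hF : Continuous F)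
    (hG : Continuous G)
    (h : ∀ t, ∫ s in (0 : ℝ)..1, F (shiftT ε s t) = ∫ s in (0 : ℝ)..1, G (shiftT ε s t)) :
    ∫ t, F t = ∫ t, G t := by
  have key : ∀ F : Torus n → ℂ, Continuous F →
      ∫ t, F t = ∫ t, ∫ s in (0 : ℝ)..1, F (shiftT ε s t) := by
    intro F hF
    have hm := measurePreserving_shiftT ε
    have hint : Integrable F volume :=
      hF.integrable_of_hasCompactSupport (HasCompactSupport.of_compactSpace F)
    have h1 : ∫ t, F t = ∫ p : Torus n × ℝ, F (shiftT ε p.2 p.1) ∂(volume.prod unitMeasure) := by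
      rw [← integral_map hm.aemeasurable (hm.map_eq.symm ▸ hint.aestronglyMeasurable), hm.map_eq]
    rw [h1, integral_prod (fun p : Torus n × ℝ => F (shiftT ε p.2 p.1))
      (hm.integrable_comp_of_integrable hint)]
    refine integral_congr_ae (ae_of_all _ fun t => ?_)
    dsimp only
    rw [intervalIntegral.integral_of_le zero_le_one]
    rfl
  rw [key F hF, key G hG]
  simp only [h]

/-- The points of the torus on which no nontrivial character is `1`. -/
def Generic (t : Torus n) : Prop := ∀ l : Fin n → ℤ, l ≠ 0 → chi l (tw t) ≠ 1

theorem continuous_chi_tw (l : Fin n → ℤ) : Continuous fun t : Torus n => (chi l (tw t) : ℂ) := by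
  simp only [chi, Units.coe_prod, Units.val_zpow_eq_zpow_val]
  exact continuous_finsetProd _ fun j _ => (continuous_tw j).zpow₀ _ fun t => Or.inl (Units.ne_zero _)

/-- By Fubini along a coordinate `j` with `l_j ≠ 0`: on every such circle the character rotates with
speed `l_j`, so it takes the value `1` at countably many parameters only. -/
theorem ae_generic : ∀ᵐ t : Torus n, Generic t := by
  simp only [Generic]
  rw [ae_all_iff]
  intro l
  by_cases hl : l = 0
  · exact ae_of_all _ fun t h => absurd hl h
  obtain ⟨j, hj⟩ := Function.ne_iff.1 hl
  have hB : MeasurableSet {t : Torus n | (chi l (tw t) : ℂ) = 1} :=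
    (isClosed_singleton.preimage (continuous_chi_tw l)).measurableSet
  have h0 : volume {t : Torus n | (chi l (tw t) : ℂ) = 1} = 0 := by
    rw [← (measurePreserving_shiftT (Pi.single j 1)).measure_preimage hB.nullMeasurableSet,
      Measure.measure_prod_null
        ((measurePreserving_shiftT (Pi.single j 1)).measurable hB)]
    refine ae_of_all _ fun t => ?_
    have hchi : ∀ s : ℝ, (chi l (tw (shiftT (Pi.single j 1) s t)) : ℂ)
        = chi l (tw t) * Complex.exp (2 * Real.pi * Complex.I * (l j * s)) := by
      intro s
      rw [tw_shiftT, ← expU_rep, chi_expU, chi_expU, expo, expo, ← Complex.exp_add]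
      congr 1
      simp only [mul_add, Finset.sum_add_distrib]
      congr 1
      rw [Finset.sum_eq_single j]
      · simp
        ring
      · intro i _ hi
        simp [hi]
      · simp
    have hsub : {s : ℝ | (chi l (tw (shiftT (Pi.single j 1) s t)) : ℂ) = 1}.Countable := by
      by_cases hne : ({s : ℝ | (chi l (tw (shiftT (Pi.single j 1) s t)) : ℂ) = 1}).Nonempty
      · obtain ⟨s₀, hs₀⟩ := hne
        refine (Set.countable_range fun m : ℤ => s₀ + m / l j).mono fun s hs => ?_
        rw [Set.mem_ofPred_eq, hchi] at hs hs₀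
        have h1 : Complex.exp (2 * Real.pi * Complex.I * (l j * s))
            = Complex.exp (2 * Real.pi * Complex.I * (l j * s₀)) :=
          mul_left_cancel₀ (Units.ne_zero _) (hs.trans hs₀.symm)
        obtain ⟨m, hm⟩ := Complex.exp_eq_exp_iff_exists_int.1 h1
        have h2 : (l j * s : ℂ) = l j * s₀ + m := by
          refine mul_left_cancel₀ Complex.two_pi_I_ne_zero ?_
          rw [hm]
          ring
        have h3 : (l j * s : ℝ) = l j * s₀ + m := by exact_mod_cast h2
        refine ⟨m, ?_⟩
        have hj' : ((l j : ℤ) : ℝ) ≠ 0 := by exact_mod_cast hj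
        dsimp only
        field_simp
        linarith
      · rw [Set.not_nonempty_iff_eq_empty.1 hne]
        exact Set.countable_empty
    exact Measure.absolutelyContinuous_of_le Measure.restrict_le_self (hsub.measure_zero volume)
  have h1 : ∀ᵐ t : Torus n, ¬ (chi l (tw t) : ℂ) = 1 := by
    rw [ae_iff]
    simpa using h0
  filter_upwards [h1] with t ht _ h
  exact ht (by rw [h, Units.val_one])

/-- The shift of a period integral of a periodic holomorphic function. -/
theorem integral_eq_shift {G : ℂ → ℂ} {τ : ℝ} (hτ : 0 ≤ τ)
    (hd : ∀ z : ℂ, -τ ≤ z.im → z.im ≤ 0 → DifferentiableAt ℂ G z) (hper : ∀ z, G (z + 1) = G z) :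
    ∫ s in (0 : ℝ)..1, G s = ∫ s in (0 : ℝ)..1, G (s + (-τ : ℝ) * Complex.I) := by
  have h := Complex.integral_boundary_rect_eq_zero_of_differentiableOn G
    (⟨0, -τ⟩ : ℂ) (⟨1, 0⟩ : ℂ) fun z hz => by
      rw [Complex.mem_reProdIm] at hz
      have h2 := hz.2
      rw [Set.uIcc_of_le (by simpa using hτ)] at h2
      exact (hd z h2.1 h2.2).differentiableWithinAt
  -- By periodicity the vertical sides of the rectangle contribute opposite integrals.
  have h2 : ∀ y : ℝ, G ((1 : ℝ) + y * Complex.I) = G ((0 : ℝ) + y * Complex.I) := fun y => by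
    rw [← hper ((0 : ℝ) + y * Complex.I)]
    congr 1
    push_cast
    ring
  simp only [h2, Complex.ofReal_zero, zero_mul, add_zero] at h
  rw [add_sub_cancel_right, sub_eq_zero] at h
  exact h.symm

end Koornwinder

end

noncomputable section

namespace Koornwinder

variable {n : ℕ} {P : Params}

/-! ### The coefficients times the weight function -/

variable (P) in
/-- The factor of the weight function attached to a pair of variables. -/
def ePair (y z : ℂˣ) : ℂ :=
  eFac P P.g (y * z) * eFac P P.g ((y⁻¹ : ℂˣ) * (z⁻¹ : ℂˣ))
    * (eFac P P.g (y * (z⁻¹ : ℂˣ)) * eFac P P.g ((y⁻¹ : ℂˣ) * z))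

variable (P) in
/-- The product of `ePair` with the factor of a coefficient for two moving variables. -/
def kBoth (y z : ℂˣ) : ℂ :=
  Complex.exp (P.β * P.g / 2) ^ 2 * (eFac P P.g (P.qU * (P.qU * (y * z)))
    * eFac P P.g ((y⁻¹ : ℂˣ) * (z⁻¹ : ℂˣ))
    * (eFac P P.g (y * (z⁻¹ : ℂˣ)) * eFac P P.g ((y⁻¹ : ℂˣ) * z)))

variable (P) in
/-- The product of `ePair` with the factor of a coefficient for one moving variable. -/
def kOne (y z : ℂˣ) : ℂ :=
  Complex.exp (P.β * P.g / 2) ^ 2 * (eFac P P.g (P.qU * (y * z))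
    * eFac P P.g ((y⁻¹ : ℂˣ) * (z⁻¹ : ℂˣ))
    * (eFac P P.g (P.qU * (y * (z⁻¹ : ℂˣ))) * eFac P P.g ((y⁻¹ : ℂˣ) * z)))

variable (P) in
/-- The product of the one-variable factors of a coefficient and of the weight function. -/
def kSingle (y : ℂˣ) : ℂ :=
  Complex.exp (P.β * (P.g₀ + P.g₁ + P.g₀' + P.g₁') / 2)
    * (eFacB P (P.qU * y) * eFacB P (y⁻¹ : ℂˣ))

open scoped Classical in
/-- The pair factors of `coeffK`. -/
def kPair (P : Params) (ε : Fin n → SignType) (C : Finset (Fin n)) (w : Fin n → ℂˣ)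
    (j k : Fin n) : ℂ :=
  if ε j ≠ 0 ∧ ε k ≠ 0 then kBoth P (sgnPow ε w j) (sgnPow ε w k)
  else if ε j ≠ 0 ∧ k ∈ C then kOne P (sgnPow ε w j) (w k)
  else if ε k ≠ 0 ∧ j ∈ C then kOne P (sgnPow ε w k) (w j)
  else 1

/-- The coefficient `V_{ε;C}` times the factors of the weight function that involve the variables
with nonzero sign. -/
def coeffK (P : Params) (ε : Fin n → SignType) (C : Finset (Fin n)) (w : Fin n → ℂˣ) : ℂ :=
  (∏ j, if ε j ≠ 0 then kSingle P (sgnPow ε w j) else 1)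
    * ∏ p ∈ ltPairs n, kPair P ε C w p.1 p.2

open scoped Classical in
/-- The weight function of the variables outside a set. -/
def weightM (P : Params) (A : Finset (Fin n)) (w : Fin n → ℂˣ) : ℂ :=
  (∏ j, if j ∈ A then 1 else eFacB P (w j) * eFacB P ((w j)⁻¹ : ℂˣ))
    * ∏ p ∈ ltPairs n, if p.1 ∈ A ∨ p.2 ∈ A then 1 else ePair P (w p.1) (w p.2)

theorem ePair_comm (y z : ℂˣ) : ePair P y z = ePair P z y := by
  simp only [ePair, mul_comm (y : ℂ), mul_comm ((y⁻¹ : ℂˣ) : ℂ)]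
  ring

theorem ePair_inv_left (y z : ℂˣ) : ePair P y⁻¹ z = ePair P y z := by
  simp only [ePair, inv_inv]
  ring

theorem ePair_zpow_left (y z : ℂˣ) {s : SignType} (hs : s ≠ 0) :
    ePair P (y ^ (s : ℤ)) z = ePair P y z := by
  rcases SignType.eq_or hs with rfl | rfl
  · simp
  · simp [ePair_inv_left]

theorem ePair_zpow_right (y z : ℂˣ) {s : SignType} (hs : s ≠ 0) :
    ePair P y (z ^ (s : ℤ)) = ePair P y z := by
  rw [ePair_comm, ePair_zpow_left _ _ hs, ePair_comm]

theorem uFac_mul_ePair_both (hP : P.Admissible) {y z : ℂˣ} (hy : ‖(y : ℂ)‖ = 1)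
    (hz : ‖(z : ℂ)‖ = 1) (h : y * z ≠ 1) :
    uFac P P.g (y * z) * uFac P P.g (P.qU * (y * z)) * ePair P y z = kBoth P y z := by
  have h1 : ‖(y * z : ℂ)‖ ≤ 1 := by rw [norm_mul, hy, hz, one_mul]
  have h1' : (y * z : ℂ) ≠ 1 := fun h' => h (Units.ext (by simpa using h'))
  have h2 : ‖(P.qU * (y * z) : ℂ)‖ < 1 := by
    rw [norm_mul]
    nlinarith [norm_qU_lt_one hP.β_pos, norm_nonneg (P.qU : ℂ), norm_nonneg (y * z : ℂ)]
  have e1 := uFac_mul_eFac hP.β_pos hP.g_nonneg h1 h1'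
  have e2 := uFac_mul_eFac hP.β_pos hP.g_nonneg h2.le (ne_one_of_norm_lt h2)
  rw [ePair, kBoth]
  set a := uFac P P.g (y * z)
  set b := uFac P P.g (P.qU * (y * z))
  set c := eFac P P.g (P.qU * (y * z))
  calc _ = b * (a * eFac P P.g (y * z)) * eFac P P.g ((y⁻¹ : ℂˣ) * (z⁻¹ : ℂˣ))
      * (eFac P P.g (y * (z⁻¹ : ℂˣ)) * eFac P P.g ((y⁻¹ : ℂˣ) * z)) := by ring
    _ = Complex.exp (P.β * P.g / 2) * (b * c) * eFac P P.g ((y⁻¹ : ℂˣ) * (z⁻¹ : ℂˣ))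
      * (eFac P P.g (y * (z⁻¹ : ℂˣ)) * eFac P P.g ((y⁻¹ : ℂˣ) * z)) := by rw [e1]; ring
    _ = _ := by rw [e2]; ring

theorem uFac_mul_ePair_one (hP : P.Admissible) {y z : ℂˣ} (hy : ‖(y : ℂ)‖ = 1)
    (hz : ‖(z : ℂ)‖ = 1) (h : y * z ≠ 1) (h' : y * z⁻¹ ≠ 1) :
    uFac P P.g (y * z) * uFac P P.g (y * (z⁻¹ : ℂˣ)) * ePair P y z = kOne P y z := by
  have h1 : ‖(y * z : ℂ)‖ ≤ 1 := by rw [norm_mul, hy, hz, one_mul]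
  have h1' : (y * z : ℂ) ≠ 1 := fun h' => h (Units.ext (by simpa using h'))
  have h2 : ‖(y * (z⁻¹ : ℂˣ) : ℂ)‖ ≤ 1 := by
    rw [norm_mul, hy, Units.val_inv_eq_inv_val, norm_inv, hz, inv_one, one_mul]
  have h2' : (y * (z⁻¹ : ℂˣ) : ℂ) ≠ 1 := fun h => h' (Units.ext (by rw [Units.val_mul, h]; simp))
  have e1 := uFac_mul_eFac hP.β_pos hP.g_nonneg h1 h1'
  have e2 := uFac_mul_eFac hP.β_pos hP.g_nonneg h2 h2'
  rw [ePair, kOne]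
  set a := uFac P P.g (y * z)
  set b := uFac P P.g (y * (z⁻¹ : ℂˣ))
  calc _ = (a * eFac P P.g (y * z)) * (b * eFac P P.g (y * (z⁻¹ : ℂˣ)))
      * (eFac P P.g ((y⁻¹ : ℂˣ) * (z⁻¹ : ℂˣ)) * eFac P P.g ((y⁻¹ : ℂˣ) * z)) := by ring
    _ = _ := by rw [e1, e2]; ring

theorem norm_sgnPow {ε : Fin n → SignType} {w : Fin n → ℂˣ} (hw : ∀ j, ‖(w j : ℂ)‖ = 1)
    (j : Fin n) : ‖(sgnPow ε w j : ℂ)‖ = 1 := by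
  rw [sgnPow, Units.val_zpow_eq_zpow_val, norm_zpow, hw, one_zpow]

theorem sgnPow_mul_ne_one {w : Fin n → ℂˣ} (hg : ∀ l : Fin n → ℤ, l ≠ 0 → chi l w ≠ 1)
    {j k : Fin n} (hjk : j ≠ k) {s t : SignType} (hs : s ≠ 0) (ht : t ≠ 0) :
    w j ^ (s : ℤ) * w k ^ (t : ℤ) ≠ 1 := by
  rw [← chi_dbl]
  exact hg _ (isRootLike_dbl hjk hs ht).1

theorem kPair_comm (ε : Fin n → SignType) (C : Finset (Fin n)) (w : Fin n → ℂˣ) (j k : Fin n) :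
    kPair P ε C w j k = kPair P ε C w k j := by
  have hb : ∀ y z, kBoth P y z = kBoth P z y := by
    intro y z
    simp only [kBoth, mul_comm (y : ℂ), mul_comm ((y⁻¹ : ℂˣ) : ℂ)]
    ring
  unfold kPair
  by_cases hj : ε j = 0 <;> by_cases hk : ε k = 0
  · simp [hj, hk]
  · simp [hj, hk]
  · simp [hj, hk]
  · simp only [hj, hk, ne_eq, not_false_eq_true, and_self, if_true]
    exact hb _ _

theorem pairFac_mul_ePair (hP : P.Admissible) {w : Fin n → ℂˣ} (hw : ∀ j, ‖(w j : ℂ)‖ = 1)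
    (hg : ∀ l : Fin n → ℤ, l ≠ 0 → chi l w ≠ 1) {ε : Fin n → SignType} {A : Finset (Fin n)}
    (hA : Disjoint (supp ε) A) {j k : Fin n} (hjk : j ≠ k) :
    pairFac P ε (A ∪ supp ε)ᶜ w j k * (if j ∈ A ∨ k ∈ A then 1 else ePair P (w j) (w k))
      = kPair P ε (A ∪ supp ε)ᶜ w j k
        * (if j ∈ A ∪ supp ε ∨ k ∈ A ∪ supp ε then 1 else ePair P (w j) (w k)) := by
  have hnA : ∀ {j}, ε j ≠ 0 → j ∉ A := fun h => Finset.disjoint_left.1 hA (mem_supp.2 h)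
  have key : ∀ j k, j ≠ k → ε j ≠ 0 → ε k = 0 →
      pairFac P ε (A ∪ supp ε)ᶜ w j k * (if j ∈ A ∨ k ∈ A then 1 else ePair P (w j) (w k))
      = kPair P ε (A ∪ supp ε)ᶜ w j k
        * (if j ∈ A ∪ supp ε ∨ k ∈ A ∪ supp ε then 1 else ePair P (w j) (w k)) := by
    intro j k hjk hj hk
    have hjm : j ∈ A ∪ supp ε := Finset.mem_union_right _ (mem_supp.2 hj)
    have hnC : j ∉ (A ∪ supp ε)ᶜ := fun h => Finset.mem_compl.1 h hjm
    rw [if_pos (Or.inl hjm), mul_one]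
    by_cases hkA : k ∈ A
    · have hkC : k ∉ (A ∪ supp ε)ᶜ := fun h => Finset.mem_compl.1 h (Finset.mem_union_left _ hkA)
      rw [if_pos (Or.inr hkA), pairFac, kPair, if_neg (by simp [hk]), if_neg (fun h => hkC h.2),
        if_neg (by simp [hk]), if_neg (by simp [hk]), if_neg (fun h => hkC h.2), if_neg (by simp [hk]),
        one_mul]
    · have hkC : k ∈ (A ∪ supp ε)ᶜ := by simp [hkA, mem_supp, hk]
      rw [if_neg (by simp [hkA, hnA hj]), pairFac, kPair, if_neg (by simp [hk]), if_pos ⟨hj, hkC⟩,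
        if_neg (by simp [hk]), if_pos ⟨hj, hkC⟩]
      rw [← ePair_zpow_left (w j) (w k) hj]
      refine uFac_mul_ePair_one hP (norm_sgnPow hw j) (hw k) ?_ ?_
      · have := sgnPow_mul_ne_one hg hjk hj (t := 1) (by decide)
        simpa [sgnPow] using this
      · have := sgnPow_mul_ne_one hg hjk hj (t := -1) (by decide)
        simpa [sgnPow] using this
  by_cases hj : ε j = 0 <;> by_cases hk : ε k = 0
  · have h1 : pairFac P ε (A ∪ supp ε)ᶜ w j k = 1 :=
      pairFac_eq_one (by simp [hj]) (by simp [hj]) (by simp [hk])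
    have h2 : kPair P ε (A ∪ supp ε)ᶜ w j k = 1 := by simp [kPair, hj, hk]
    rw [h1, h2]
    simp [mem_supp, hj, hk]
  · have := key k j hjk.symm hk hj
    rw [pairFac_comm, kPair_comm, ePair_comm]
    simpa only [@or_comm (k ∈ _)] using this
  · exact key j k hjk hj hk
  · have hjm : j ∈ A ∪ supp ε := Finset.mem_union_right _ (mem_supp.2 hj)
    rw [if_pos (Or.inl hjm), mul_one, if_neg (by simp [hnA hj, hnA hk]), pairFac, kPair,
      if_pos ⟨hj, hk⟩, if_pos ⟨hj, hk⟩, ← ePair_zpow_left (w j) (w k) hj,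
      ← ePair_zpow_right _ (w k) hk]
    exact uFac_mul_ePair_both hP (norm_sgnPow hw j) (norm_sgnPow hw k)
      (sgnPow_mul_ne_one hg hjk hj hk)

theorem singleFac_mul_eFacB (hP : P.Admissible) {w : Fin n → ℂˣ} (hw : ∀ j, ‖(w j : ℂ)‖ = 1)
    (hg : ∀ l : Fin n → ℤ, l ≠ 0 → chi l w ≠ 1) {ε : Fin n → SignType} {A : Finset (Fin n)}
    (hA : Disjoint (supp ε) A) (j : Fin n) :
    singleFac P ε w j * (if j ∈ A then 1 else eFacB P (w j) * eFacB P ((w j)⁻¹ : ℂˣ))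
      = (if ε j ≠ 0 then kSingle P (sgnPow ε w j) else 1)
        * (if j ∈ A ∪ supp ε then 1 else eFacB P (w j) * eFacB P ((w j)⁻¹ : ℂˣ)) := by
  by_cases hj : ε j = 0
  · simp [singleFac, hj, mem_supp]
  · have hjA : j ∉ A := Finset.disjoint_left.1 hA (mem_supp.2 hj)
    rw [if_pos hj, if_neg hjA, if_pos (Finset.mem_union_right _ (mem_supp.2 hj)), mul_one, singleFac,
      if_pos hj, kSingle]
    have h1 : eFacB P (w j) * eFacB P ((w j)⁻¹ : ℂˣ)
        = eFacB P (sgnPow ε w j) * eFacB P ((sgnPow ε w j)⁻¹ : ℂˣ) := by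
      rw [sgnPow]
      rcases SignType.eq_or hj with h | h
      · simp [h]
      · simp [h, mul_comm]
    have h2 : (sgnPow ε w j : ℂ) ≠ 1 := fun h => by
      refine hg (sgl j (ε j)) (isRootLike_sgl j hj).1 (Units.ext ?_)
      rw [chi_sgl, Units.val_one, ← h, sgnPow]
    have h3 : (sgnPow ε w j : ℂ) ≠ -1 := fun h => by
      refine hg (sgl j (ε j) + sgl j (ε j)) (fun h0 => ?_) (Units.ext ?_)
      · have := congrFun h0 j
        simp only [sgl, Pi.add_apply, Pi.single_eq_same, Pi.zero_apply] at this
        have := SignType.coe_ne_zero hj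
        omega
      · rw [chi_add, chi_sgl, Units.val_mul, Units.val_one]
        change (sgnPow ε w j : ℂ) * sgnPow ε w j = 1
        rw [h]
        norm_num
    rw [h1, ← mul_assoc, vbm_mul_eFacB hP (norm_sgnPow hw j).le h2 h3, mul_assoc]

/-- By the `q`-difference equation every block of the coefficient moves one argument of the weight
by `q`. What remains is a product `coeffK` without poles on the torus, times the weight of the
variables outside `A ∪ supp ε`, which does not involve the moving variables. -/
theorem coeffM_mul_weightM (hP : P.Admissible) {w : Fin n → ℂˣ} (hw : ∀ j, ‖(w j : ℂ)‖ = 1)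
    (hg : ∀ l : Fin n → ℤ, l ≠ 0 → chi l w ≠ 1) {ε : Fin n → SignType} {A : Finset (Fin n)}
    (hA : Disjoint (supp ε) A) :
    coeffM P ε (A ∪ supp ε)ᶜ w * weightM P A w
      = coeffK P ε (A ∪ supp ε)ᶜ w * weightM P (A ∪ supp ε) w := by
  rw [coeffM, weightM, coeffK, weightM, mul_mul_mul_comm, mul_mul_mul_comm (∏ j, ite _ _ _),
    ← Finset.prod_mul_distrib, ← Finset.prod_mul_distrib, ← Finset.prod_mul_distrib,
    ← Finset.prod_mul_distrib]
  refine congrArg₂ (· * ·) (Finset.prod_congr rfl fun j _ => ?_)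
    (Finset.prod_congr rfl fun p hp => ?_)
  · exact singleFac_mul_eFacB hP hw hg hA j
  · have := pairFac_mul_ePair hP hw hg hA (mem_ltPairs.1 hp).ne
    convert this

/-! ### Regularity -/

section

variable {X : Type*} {S : Subalgebra ℂ (X → ℂ)} {Ω : Set X}

theorem eFacB_mem (hP : P.Admissible)
    (hE : ∀ g, 0 ≤ g → ∀ f ∈ S, (∀ x ∈ Ω, ‖f x‖ ≤ 1) → (fun x => eFac P g (f x)) ∈ S)
    {f : X → ℂ} (hf : f ∈ S) (h1 : ∀ x ∈ Ω, ‖f x‖ ≤ 1) : (fun x => eFacB P (f x)) ∈ S := by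
  have hr : ∀ x ∈ Ω, ‖P.rU * f x‖ ≤ 1 := fun x hx => (norm_rU_mul_lt hP.β_pos (h1 x hx)).le
  have hn : (fun x => P.rU * f x) ∈ S := mul_mem (Subalgebra.algebraMap_mem S (P.rU : ℂ)) hf
  have hn' : (fun x => -P.rU * f x) ∈ S := by
    convert neg_mem hn using 1
    funext x
    simp
  exact mul_mem (mul_mem (hE _ hP.g₀_nonneg _ hf h1)
    (hE _ hP.g₁_nonneg (-f) (neg_mem hf) fun x hx => by simpa using h1 x hx))
    (mul_mem (hE _ hP.g₀'_nonneg _ hn hr) (hE _ hP.g₁'_nonneg _ hn' fun x hx => by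
      simpa using hr x hx))

/-- If `|w_j| = ρ^{ε_j}` with `1 ≤ ρ ≤ q^{-1/2}`, all arguments of `eFac` in `coeffK` have modulus
at most one: the bounds needed are `qρ ≤ 1`, `q²ρ² ≤ 1` and `ρ⁻¹ ≤ 1`. The subalgebra is left open
so that continuity and holomorphy in the strip have one proof. -/
theorem coeffK_mem (hP : P.Admissible)
    (hE : ∀ g, 0 ≤ g → ∀ f ∈ S, (∀ x ∈ Ω, ‖f x‖ ≤ 1) → (fun x => eFac P g (f x)) ∈ S)
    {pt : X → Fin n → ℂˣ} (h1 : ∀ j, (fun x => (pt x j : ℂ)) ∈ S)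
    (h2 : ∀ j, (fun x => (((pt x j)⁻¹ : ℂˣ) : ℂ)) ∈ S) {ε : Fin n → SignType}
    (hadm : ∀ x ∈ Ω, ∃ ρ : ℝ, 1 ≤ ρ ∧ ‖(P.rU : ℂ)‖ * ρ ≤ 1 ∧ ∀ j, ‖(pt x j : ℂ)‖ = ρ ^ (ε j : ℤ))
    (C : Finset (Fin n)) : (fun x => coeffK P ε C (pt x)) ∈ S := by
  have hβ := hP.β_pos
  have hr1 := (norm_rU_lt_one hβ).le
  have hr0 := norm_nonneg (P.rU : ℂ)
  have hq : ‖(P.qU : ℂ)‖ = ‖(P.rU : ℂ)‖ * ‖(P.rU : ℂ)‖ := by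
    rw [Params.qU, Units.val_pow_eq_pow_val, norm_pow, pow_two]
  have hy : ∀ j, ε j ≠ 0 → (fun x => (sgnPow ε (pt x) j : ℂ)) ∈ S := by
    intro j hj
    rcases SignType.eq_or hj with h | h <;> simp only [sgnPow, h, SignType.coe_one,
      SignType.coe_neg_one, zpow_one, zpow_neg]
    · exact h1 j
    · exact h2 j
  have hy' : ∀ j, ε j ≠ 0 → (fun x => (((sgnPow ε (pt x) j)⁻¹ : ℂˣ) : ℂ)) ∈ S := by
    intro j hj
    rcases SignType.eq_or hj with h | h <;> simp only [sgnPow, h, SignType.coe_one,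
      SignType.coe_neg_one, zpow_one, zpow_neg, inv_inv]
    · exact h2 j
    · exact h1 j
  have hc : ∀ (c : ℂ) {f : X → ℂ}, f ∈ S → (fun x => c * f x) ∈ S := fun c f hf =>
    mul_mem (Subalgebra.algebraMap_mem S c) hf
  have hny : ∀ (x : X) (ρ : ℝ) (j : Fin n), ε j ≠ 0 → ‖(pt x j : ℂ)‖ = ρ ^ (ε j : ℤ) →
      ‖(sgnPow ε (pt x) j : ℂ)‖ = ρ := by
    intro x ρ j hj h
    rw [sgnPow, Units.val_zpow_eq_zpow_val, norm_zpow, h]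
    rcases SignType.eq_or hj with h | h <;> simp [h]
  have hbound : ∀ {ρ : ℝ}, 1 ≤ ρ → ‖(P.rU : ℂ)‖ * ρ ≤ 1 →
      ‖(P.qU : ℂ)‖ * ρ ≤ 1 ∧ ‖(P.qU : ℂ)‖ * (‖(P.qU : ℂ)‖ * (ρ * ρ)) ≤ 1 := by
    intro ρ hρ hρ'
    have h0 : 0 ≤ ‖(P.rU : ℂ)‖ * ρ := by positivity
    rw [hq]
    constructor
    · nlinarith
    · have h3 : (‖(P.rU : ℂ)‖ * ρ) * (‖(P.rU : ℂ)‖ * ρ) ≤ 1 := by nlinarith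
      have h4 : ‖(P.rU : ℂ)‖ * ‖(P.rU : ℂ)‖ ≤ 1 := by nlinarith
      have h5 : 0 ≤ ‖(P.rU : ℂ)‖ * ‖(P.rU : ℂ)‖ := by positivity
      have h6 : 0 ≤ (‖(P.rU : ℂ)‖ * ρ) * (‖(P.rU : ℂ)‖ * ρ) := by positivity
      nlinarith
  have hsingle : ∀ j, (fun x => if ε j ≠ 0 then kSingle P (sgnPow ε (pt x) j) else 1) ∈ S := by
    intro j
    by_cases hj : ε j = 0
    · simp only [hj, ne_eq, not_true_eq_false, if_false]
      exact one_mem S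
    · simp only [hj, ne_eq, not_false_eq_true, if_true, kSingle]
      refine hc _ (mul_mem (eFacB_mem hP hE (hc _ (hy j hj)) fun x hx => ?_)
        (eFacB_mem hP hE (hy' j hj) fun x hx => ?_))
      · obtain ⟨ρ, hρ, hρ', h⟩ := hadm x hx
        rw [norm_mul, hny x ρ j hj (h j)]
        exact (hbound hρ hρ').1
      · obtain ⟨ρ, hρ, hρ', h⟩ := hadm x hx
        rw [Units.val_inv_eq_inv_val, norm_inv, hny x ρ j hj (h j)]
        exact inv_le_one_of_one_le₀ hρ
  have hg := hP.g_nonneg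
  have hone : ∀ j k, ε j ≠ 0 → ε k = 0 → (fun x => kOne P (sgnPow ε (pt x) j) (pt x k)) ∈ S := by
    intro j k hj hk
    have hn : ∀ x ∈ Ω, ∃ ρ : ℝ, 1 ≤ ρ ∧ ‖(P.rU : ℂ)‖ * ρ ≤ 1 ∧ ‖(sgnPow ε (pt x) j : ℂ)‖ = ρ
        ∧ ‖(pt x k : ℂ)‖ = 1 := by
      intro x hx
      obtain ⟨ρ, hρ, hρ', h⟩ := hadm x hx
      exact ⟨ρ, hρ, hρ', hny x ρ j hj (h j), by rw [h k, hk]; simp⟩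
    refine hc _ (mul_mem (mul_mem (hE _ hg _ (hc _ (mul_mem (hy j hj) (h1 k))) fun x hx => ?_)
      (hE _ hg _ (mul_mem (hy' j hj) (h2 k)) fun x hx => ?_))
      (mul_mem (hE _ hg _ (hc _ (mul_mem (hy j hj) (h2 k))) fun x hx => ?_)
      (hE _ hg _ (mul_mem (hy' j hj) (h1 k)) fun x hx => ?_)))
    all_goals
      obtain ⟨ρ, hρ, hρ', hj', hk'⟩ := hn x hx
      simp only [norm_mul, Units.val_inv_eq_inv_val, norm_inv, hj', hk', inv_one,
        mul_one]
    · exact (hbound hρ hρ').1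
    · exact inv_le_one_of_one_le₀ hρ
    · exact (hbound hρ hρ').1
    · exact inv_le_one_of_one_le₀ hρ
  have hboth : ∀ j k, ε j ≠ 0 → ε k ≠ 0 →
      (fun x => kBoth P (sgnPow ε (pt x) j) (sgnPow ε (pt x) k)) ∈ S := by
    intro j k hj hk
    have hn : ∀ x ∈ Ω, ∃ ρ : ℝ, 1 ≤ ρ ∧ ‖(P.rU : ℂ)‖ * ρ ≤ 1 ∧ ‖(sgnPow ε (pt x) j : ℂ)‖ = ρ
        ∧ ‖(sgnPow ε (pt x) k : ℂ)‖ = ρ := by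
      intro x hx
      obtain ⟨ρ, hρ, hρ', h⟩ := hadm x hx
      exact ⟨ρ, hρ, hρ', hny x ρ j hj (h j), hny x ρ k hk (h k)⟩
    refine hc _ (mul_mem (mul_mem (hE _ hg _ (hc _ (hc _ (mul_mem (hy j hj) (hy k hk))))
      fun x hx => ?_) (hE _ hg _ (mul_mem (hy' j hj) (hy' k hk)) fun x hx => ?_))
      (mul_mem (hE _ hg _ (mul_mem (hy j hj) (hy' k hk)) fun x hx => ?_)
      (hE _ hg _ (mul_mem (hy' j hj) (hy k hk)) fun x hx => ?_)))
    all_goals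
      obtain ⟨ρ, hρ, hρ', hj', hk'⟩ := hn x hx
      simp only [norm_mul, Units.val_inv_eq_inv_val, norm_inv, hj', hk']
    · exact (hbound hρ hρ').2
    · exact mul_le_one₀ (inv_le_one_of_one_le₀ hρ) (by positivity) (inv_le_one_of_one_le₀ hρ)
    · exact (mul_inv_cancel₀ (by positivity)).le
    · exact (inv_mul_cancel₀ (by positivity)).le
  have hpair : ∀ j k, (fun x => kPair P ε C (pt x) j k) ∈ S := by
    intro j k
    unfold kPair
    split_ifs with c1 c2 c3
    · exact hboth j k c1.1 c1.2
    · exact hone j k c2.1 (by by_contra h; exact c1 ⟨c2.1, h⟩)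
    · exact hone k j c3.1 (by by_contra h; exact c1 ⟨h, c3.1⟩)
    · exact one_mem S
  have heq : (fun x => coeffK P ε C (pt x))
      = (∏ j, fun x => if ε j ≠ 0 then kSingle P (sgnPow ε (pt x) j) else 1)
        * ∏ p ∈ ltPairs n, fun x => kPair P ε C (pt x) p.1 p.2 := by
    funext x
    simp [coeffK]
  rw [heq]
  exact mul_mem (Subalgebra.prod_mem _ fun j _ => hsingle j)
    (Subalgebra.prod_mem _ fun p _ => hpair _ _)

end

/-! ### Complex conjugation -/

theorem conj_exp_ofReal (x : ℝ) : (starRingEnd ℂ) (Complex.exp x) = Complex.exp x := by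
  rw [← Complex.exp_conj, Complex.conj_ofReal]

/-- The condition on the moving coordinates says `|y| = q^{-1/2}`, the edge of the strip. There
conjugation exchanges the argument `qy` with `y⁻¹`, and permutes the arguments of the pair factors
likewise. -/
theorem conj_coeffK {ε : Fin n → SignType} {w : Fin n → ℂˣ}
    (h1 : ∀ j, ε j ≠ 0 → P.qU * (starRingEnd ℂ) (sgnPow ε w j : ℂ) = ((sgnPow ε w j)⁻¹ : ℂˣ))
    (h2 : ∀ j, ε j = 0 → (starRingEnd ℂ) (w j : ℂ) = ((w j)⁻¹ : ℂˣ)) (C : Finset (Fin n)) :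
    (starRingEnd ℂ) (coeffK P ε C w) = coeffK P ε C w := by
  have hq : ∀ y : ℂˣ, P.qU * (starRingEnd ℂ) (y : ℂ) = (y⁻¹ : ℂˣ) →
      P.qU * (starRingEnd ℂ) ((y⁻¹ : ℂˣ) : ℂ) = P.qU * (P.qU * y) := by
    intro y h
    rw [← h, map_mul, Complex.conj_conj, conj_qU]
  have hexp : ∀ x : ℝ, (starRingEnd ℂ) (Complex.exp x) = Complex.exp x := conj_exp_ofReal
  have hsingle : ∀ y : ℂˣ, P.qU * (starRingEnd ℂ) (y : ℂ) = (y⁻¹ : ℂˣ) →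
      (starRingEnd ℂ) (kSingle P y) = kSingle P y := by
    intro y h
    have h' : (starRingEnd ℂ) ((y⁻¹ : ℂˣ) : ℂ) = P.qU * y :=
      mul_left_cancel₀ P.qU.ne_zero (hq y h)
    have := hexp (P.β * (P.g₀ + P.g₁ + P.g₀' + P.g₁') / 2)
    push_cast at this
    rw [kSingle, map_mul, map_mul, conj_eFacB, conj_eFacB, map_mul, conj_qU, h, h', this,
      mul_comm (eFacB P _)]
  have hc : (starRingEnd ℂ) (Complex.exp (P.β * P.g / 2)) = Complex.exp (P.β * P.g / 2) := by
    have := hexp (P.β * P.g / 2)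
    push_cast at this
    exact this
  have hboth : ∀ y z : ℂˣ, P.qU * (starRingEnd ℂ) (y : ℂ) = (y⁻¹ : ℂˣ) →
      P.qU * (starRingEnd ℂ) (z : ℂ) = (z⁻¹ : ℂˣ) →
      (starRingEnd ℂ) (kBoth P y z) = kBoth P y z := by
    intro y z hy hz
    have hy' : (starRingEnd ℂ) ((y⁻¹ : ℂˣ) : ℂ) = P.qU * y :=
      mul_left_cancel₀ P.qU.ne_zero (hq y hy)
    have hz' : (starRingEnd ℂ) ((z⁻¹ : ℂˣ) : ℂ) = P.qU * z :=
      mul_left_cancel₀ P.qU.ne_zero (hq z hz)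
    have e1 : (starRingEnd ℂ) (P.qU * (P.qU * (y * z)) : ℂ) = (y⁻¹ : ℂˣ) * (z⁻¹ : ℂˣ) := by
      rw [map_mul, map_mul, map_mul, conj_qU, ← hy, ← hz]
      ring
    have e2 : (starRingEnd ℂ) ((y⁻¹ : ℂˣ) * (z⁻¹ : ℂˣ) : ℂ) = P.qU * (P.qU * (y * z)) := by
      rw [← e1, Complex.conj_conj]
    have e3 : (starRingEnd ℂ) (y * (z⁻¹ : ℂˣ) : ℂ) = (y⁻¹ : ℂˣ) * z := by
      rw [map_mul, hz', ← hy]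
      ring
    have e4 : (starRingEnd ℂ) ((y⁻¹ : ℂˣ) * z : ℂ) = y * (z⁻¹ : ℂˣ) := by
      rw [← e3, Complex.conj_conj]
    simp only [kBoth, map_mul (starRingEnd ℂ) (Complex.exp _ ^ 2), map_pow, hc,
      map_mul (starRingEnd ℂ) (_ * eFac P P.g _), map_mul (starRingEnd ℂ) (eFac P P.g _), conj_eFac,
      e1, e2, e3, e4]
    ring
  have hone : ∀ y z : ℂˣ, P.qU * (starRingEnd ℂ) (y : ℂ) = (y⁻¹ : ℂˣ) →
      (starRingEnd ℂ) (z : ℂ) = (z⁻¹ : ℂˣ) →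
      (starRingEnd ℂ) (kOne P y z) = kOne P y z := by
    intro y z hy hz
    have hz' : (starRingEnd ℂ) ((z⁻¹ : ℂˣ) : ℂ) = z := by rw [← hz, Complex.conj_conj]
    have e1 : (starRingEnd ℂ) (P.qU * (y * z) : ℂ) = (y⁻¹ : ℂˣ) * (z⁻¹ : ℂˣ) := by
      rw [map_mul, map_mul, conj_qU, ← hy, ← hz]
      ring
    have e2 : (starRingEnd ℂ) ((y⁻¹ : ℂˣ) * (z⁻¹ : ℂˣ) : ℂ) = P.qU * (y * z) := by
      rw [← e1, Complex.conj_conj]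
    have e3 : (starRingEnd ℂ) (P.qU * (y * (z⁻¹ : ℂˣ)) : ℂ) = (y⁻¹ : ℂˣ) * z := by
      rw [map_mul, map_mul, hz', ← hy, conj_qU]
      ring
    have e4 : (starRingEnd ℂ) ((y⁻¹ : ℂˣ) * z : ℂ) = P.qU * (y * (z⁻¹ : ℂˣ)) := by
      rw [← e3, Complex.conj_conj]
    simp only [kOne, map_mul (starRingEnd ℂ) (Complex.exp _ ^ 2), map_pow, hc,
      map_mul (starRingEnd ℂ) (_ * eFac P P.g _), map_mul (starRingEnd ℂ) (eFac P P.g _), conj_eFac,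
      e1, e2, e3, e4]
    ring
  rw [coeffK, map_mul, map_prod, map_prod]
  refine congrArg₂ (· * ·) (Finset.prod_congr rfl fun j _ => ?_)
    (Finset.prod_congr rfl fun p _ => ?_)
  · split_ifs with h
    · exact hsingle _ (h1 j h)
    · exact map_one _
  · unfold kPair
    split_ifs with c1 c2 c3
    · exact hboth _ _ (h1 _ c1.1) (h1 _ c1.2)
    · exact hone _ _ (h1 _ c2.1) (h2 _ (by by_contra h; exact c1 ⟨c2.1, h⟩))
    · exact hone _ _ (h1 _ c3.1) (h2 _ (by by_contra h; exact c1 ⟨h, c3.1⟩))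
    · exact map_one _

theorem conj_eq_inv {y : ℂˣ} (h : ‖(y : ℂ)‖ = 1) : (starRingEnd ℂ) (y : ℂ) = (y⁻¹ : ℂˣ) := by
  rw [Units.val_inv_eq_inv_val, Complex.inv_def, Complex.normSq_eq_norm_sq, h]
  simp

theorem conj_weightM {w : Fin n → ℂˣ} (hw : ∀ j, ‖(w j : ℂ)‖ = 1) (A : Finset (Fin n)) :
    (starRingEnd ℂ) (weightM P A w) = weightM P A w := by
  have h1 : ∀ j, (starRingEnd ℂ) (w j : ℂ) = ((w j)⁻¹ : ℂˣ) := fun j => conj_eq_inv (hw j)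
  have h2 : ∀ j, (starRingEnd ℂ) (((w j)⁻¹ : ℂˣ) : ℂ) = w j := fun j => by
    rw [← h1, Complex.conj_conj]
  rw [weightM, map_mul, map_prod, map_prod]
  refine congrArg₂ (· * ·) (Finset.prod_congr rfl fun j _ => ?_)
    (Finset.prod_congr rfl fun p _ => ?_)
  · split_ifs with h
    · exact map_one _
    · rw [map_mul, conj_eFacB, conj_eFacB, h1, h2, mul_comm]
  · split_ifs with h
    · exact map_one _
    · simp only [ePair, map_mul, conj_eFac, h1, h2]
      ring

theorem conj_uFac (g : ℝ) (y : ℂ) :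
    (starRingEnd ℂ) (uFac P g y) = uFac P g ((starRingEnd ℂ) y) := by
  have := conj_exp_ofReal (P.β * g / 2)
  push_cast at this
  rw [uFac, uFac, map_mul, this, map_mul, map_inv₀, map_sub, map_sub, map_mul, conj_qpow, map_one]

theorem coe_neg_signType (s : SignType) : ((-s : SignType) : ℤ) = -(s : ℤ) := by
  revert s
  decide

theorem supp_neg (ε : Fin n → SignType) : supp (-ε) = supp ε := by
  ext j
  simp [mem_supp]

theorem conj_coeffM {w : Fin n → ℂˣ} (hw : ∀ j, ‖(w j : ℂ)‖ = 1) (ε : Fin n → SignType)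
    (C : Finset (Fin n)) : (starRingEnd ℂ) (coeffM P ε C w) = coeffM P (-ε) C w := by
  have h1 : ∀ j, (starRingEnd ℂ) (w j : ℂ) = ((w j)⁻¹ : ℂˣ) := fun j => conj_eq_inv (hw j)
  have h2 : ∀ j, (starRingEnd ℂ) (((w j)⁻¹ : ℂˣ) : ℂ) = w j := fun j => by
    rw [← h1, Complex.conj_conj]
  have h3 : ∀ j, (starRingEnd ℂ) (sgnPow ε w j : ℂ) = sgnPow (-ε) w j := fun j => by
    rw [conj_eq_inv (norm_sgnPow hw j), sgnPow, sgnPow, Pi.neg_apply, coe_neg_signType, zpow_neg]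
  have h4 : ∀ j, (-ε) j ≠ 0 ↔ ε j ≠ 0 := fun j => by simp
  rw [coeffM, coeffM, map_mul, map_prod, map_prod]
  refine congrArg₂ (· * ·) (Finset.prod_congr rfl fun j _ => ?_)
    (Finset.prod_congr rfl fun p _ => ?_)
  · simp only [singleFac, h4]
    split_ifs
    · simp only [vbm, map_mul, conj_uFac, map_neg, h3, conj_rU]
    · exact map_one _
  · simp only [pairFac, h4]
    split_ifs
    · simp only [map_mul, conj_uFac, h3, conj_qU]
    · simp only [map_mul, conj_uFac, h3, h1, h2]
      exact mul_comm _ _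
    · simp only [map_mul, conj_uFac, h3, h1, h2]
      exact mul_comm _ _
    · exact map_one _

theorem neg_bijective : Function.Bijective (fun ε : Fin n → SignType => -ε) :=
  (neg_involutive (G := Fin n → SignType)).bijective

/-- Conjugation on the torus inverts the coordinates and so changes `ε` into `-ε`; the recursion
sums over both. -/
theorem conj_uCoef {w : Fin n → ℂˣ} (hw : ∀ j, ‖(w j : ℂ)‖ = 1) (r m : ℕ) (A : Finset (Fin n)) :
    (starRingEnd ℂ) (uCoef P w r m A) = uCoef P w r m A := by
  have hc : ∀ A : Finset (Fin n), (starRingEnd ℂ) (if A.card = r then (1 : ℂ) else 0)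
      = if A.card = r then (1 : ℂ) else 0 := fun A => by split_ifs <;> simp
  induction m generalizing A with
  | zero => exact hc A
  | succ m ih =>
    rw [uCoef, map_sub, hc, map_sum]
    refine congrArg _ (Finset.sum_bijective _ neg_bijective (fun ε => ?_) fun ε _ => ?_)
    · simp only [Finset.mem_filter, Finset.mem_univ, true_and, supp_neg]
      refine and_congr_left fun _ => not_congr ?_
      rw [← supp_eq_empty, ← supp_eq_empty, supp_neg]
    · rw [map_mul, ih, conj_coeffM hw]
      simp only [supp_neg]

end Koornwinder

end

noncomputable section

namespace Koornwinder

variable {n : ℕ} {P : Params}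

/-! ### The weight function in multiplicative coordinates -/

theorem cexpI_neg (z : AddCircle (2 * Real.pi)) : cexpI (-z) = (cexpI z)⁻¹ := by
  rw [cexpI, cexpI, AddCircle.toCircle_neg, Circle.coe_inv]

theorem chi_tw_ne_one {t : Torus n} (ht : Generic t) {l : Fin n → ℤ} (hl : l ≠ 0) :
    (chi l (tw t) : ℂ) ≠ 1 := fun h => ht l hl (Units.ext (by rw [h, Units.val_one]))

theorem tw_pair_ne_one {t : Torus n} (ht : Generic t) {j k : Fin n} (s s' : SignType) (hjk : j ≠ k)
    (hs : s ≠ 0) (hs' : s' ≠ 0) : ((tw t j ^ (s : ℤ) : ℂˣ) * (tw t k ^ (s' : ℤ) : ℂˣ) : ℂ) ≠ 1 := by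
  intro h
  have := chi_tw_ne_one ht (isRootLike_dbl hjk hs hs').1
  rw [chi_dbl, Units.val_mul] at this
  exact this h

theorem tw_single_ne {t : Torus n} (ht : Generic t) (j : Fin n) (s : SignType) (hs : s ≠ 0) :
    ((tw t j ^ (s : ℤ) : ℂˣ) : ℂ) ≠ 1 ∧ ((tw t j ^ (s : ℤ) : ℂˣ) : ℂ) ≠ -1 := by
  refine ⟨fun h => ?_, fun h => ?_⟩
  · have := chi_tw_ne_one ht (isRootLike_sgl j hs).1
    rw [chi_sgl] at this
    exact this h
  · have h0 : sgl j s + sgl j s ≠ 0 := fun h0 => by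
      have := congrFun h0 j
      simp only [sgl, Pi.add_apply, Pi.single_eq_same, Pi.zero_apply] at this
      have := SignType.coe_ne_zero hs
      omega
    have := chi_tw_ne_one ht h0
    rw [chi_add, chi_sgl, Units.val_mul, h] at this
    norm_num at this

theorem weight_eq_weightM (hβ : 0 < P.β) {t : Torus n} (ht : Generic t) :
    weight P t = weightM P ∅ (tw t) := by
  rw [weight, weightM, prod_prod_lt fun j k => da P (t j + t k) * da P (t j - t k), mul_comm]
  refine congrArg₂ (· * ·) (Finset.prod_congr rfl fun j _ => ?_)
    (Finset.prod_congr rfl fun p hp => ?_)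
  · have h1 := tw_single_ne ht j 1 (by decide)
    have h2 := tw_single_ne ht j (-1) (by decide)
    simp only [SignType.coe_one, zpow_one, SignType.coe_neg_one, zpow_neg,
      Units.val_inv_eq_inv_val, tw_val] at h1 h2
    rw [if_neg (Finset.notMem_empty _), db, dbPlus_eq hβ h1.1 h1.2, dbPlus_eq hβ, cexpI_neg,
      Units.val_inv_eq_inv_val, tw_val] <;> rw [cexpI_neg]
    exacts [h2.1, h2.2]
  · have hjk : p.1 ≠ p.2 := (mem_ltPairs.1 hp).ne
    have h1 := tw_pair_ne_one ht 1 1 hjk (by decide) (by decide)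
    have h2 := tw_pair_ne_one ht 1 (-1) hjk (by decide) (by decide)
    have h3 := tw_pair_ne_one ht (-1) 1 hjk (by decide) (by decide)
    have h4 := tw_pair_ne_one ht (-1) (-1) hjk (by decide) (by decide)
    simp only [SignType.coe_one, zpow_one, SignType.coe_neg_one, zpow_neg,
      Units.val_inv_eq_inv_val, tw_val, ← cexpI_neg, ← cexpI_add] at h1 h2 h3 h4
    have e3 : -t p.1 + t p.2 = -(t p.1 - t p.2) := by abel
    have e4 : -t p.1 + -t p.2 = -(t p.1 + t p.2) := by abel
    rw [if_neg (by simp), ePair, da, da, sub_eq_add_neg, daPlus_eq hβ h1, daPlus_eq hβ h2, neg_add,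
      neg_add, neg_neg, daPlus_eq hβ h3, daPlus_eq hβ h4]
    simp only [cexpI_add, cexpI_neg, Units.val_inv_eq_inv_val, tw_val]

/-! ### Continuity on the torus -/

theorem continuous_inv_tw (j : Fin n) :
    Continuous fun t : Torus n => (((tw t j)⁻¹ : ℂˣ) : ℂ) := by
  simp only [Units.val_inv_eq_inv_val]
  exact (continuous_tw j).inv₀ fun t => Units.ne_zero _

theorem continuous_eFac (hβ : 0 < P.β) {g : ℝ} (hg : 0 ≤ g) {X : Type*} [TopologicalSpace X]
    {f : X → ℂ} (hf : Continuous f) (h1 : ∀ x, ‖f x‖ ≤ 1) : Continuous fun x => eFac P g (f x) :=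
  continuous_iff_continuousAt.2 fun x =>
    ((differentiableAt_eFac hβ hg (h1 x)).continuousAt).comp hf.continuousAt

theorem continuous_coeffK (hP : P.Admissible) (ε : Fin n → SignType) (C : Finset (Fin n)) :
    Continuous fun t : Torus n => coeffK P ε C (tw t) :=
  coeffK_mem (S := continuousSubalgebra (α := Torus n) (R := ℂ) (A := ℂ)) (Ω := Set.univ) hP
    (fun _ hg _ hf h => continuous_eFac hP.β_pos hg hf fun x => h x trivial) continuous_tw
    continuous_inv_tw (fun t _ => ⟨1, le_rfl, by simpa using (norm_rU_lt_one hP.β_pos).le,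
      fun j => by simp [norm_tw]⟩) C

theorem continuous_weightM (hP : P.Admissible) (A : Finset (Fin n)) :
    Continuous fun t : Torus n => weightM P A (tw t) := by
  have hn : ∀ (t : Torus n) j, ‖(((tw t j)⁻¹ : ℂˣ) : ℂ)‖ = 1 := fun t j => by
    rw [Units.val_inv_eq_inv_val, norm_inv, norm_tw, inv_one]
  have hE : ∀ f : Torus n → ℂ, Continuous f → (∀ t, ‖f t‖ = 1) →
      Continuous fun t => eFac P P.g (f t) := fun f hf h =>
    continuous_eFac hP.β_pos hP.g_nonneg hf fun t => (h t).le
  have hB : ∀ f : Torus n → ℂ, Continuous f → (∀ t, ‖f t‖ = 1) →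
      Continuous fun t => eFacB P (f t) := fun f hf h =>
    eFacB_mem (S := continuousSubalgebra (α := Torus n) (R := ℂ) (A := ℂ)) (Ω := Set.univ) hP
      (fun _ hg _ hf h => continuous_eFac hP.β_pos hg hf fun x => h x trivial) hf
      fun t _ => (h t).le
  unfold weightM
  refine (continuous_finsetProd _ fun j _ => ?_).mul (continuous_finsetProd _ fun p _ => ?_)
  · split_ifs
    · exact continuous_const
    · exact (hB _ (continuous_tw j) fun t => norm_tw t j).mul
        (hB _ (continuous_inv_tw j) fun t => hn t j)
  · split_ifs
    · exact continuous_const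
    · refine ((hE _ ((continuous_tw _).mul (continuous_tw _)) ?_).mul
        (hE _ ((continuous_inv_tw _).mul (continuous_inv_tw _)) ?_)).mul
        ((hE _ ((continuous_tw _).mul (continuous_inv_tw _)) ?_).mul
        (hE _ ((continuous_inv_tw _).mul (continuous_tw _)) ?_)) <;>
      · intro t
        simp [hn, norm_tw, -Units.val_inv_eq_inv_val]

theorem continuous_ev_tw (p : Laurent n) : Continuous fun t : Torus n => ev (tw t) p := by
  simp only [ev_eq_sum]
  exact continuous_finsetSum _ fun l _ => continuous_const.mul (continuous_chi_tw l)

/-! ### The second coefficient times the weight function -/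

/-- The product of `uCoef` and `weightM`, defined by a recursion without denominators. -/
def yCoef (P : Params) (w : Fin n → ℂˣ) (r : ℕ) : ℕ → Finset (Fin n) → ℂ
  | 0, A => (if A.card = r then 1 else 0) * weightM P A w
  | m + 1, A => (if A.card = r then 1 else 0) * weightM P A w
      - ∑ ε with ε ≠ 0 ∧ Disjoint (supp ε) A,
          coeffK P ε (A ∪ supp ε)ᶜ w * yCoef P w r m (A ∪ supp ε)

theorem uCoef_mul_weightM (hP : P.Admissible) {w : Fin n → ℂˣ} (hw : ∀ j, ‖(w j : ℂ)‖ = 1)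
    (hg : ∀ l : Fin n → ℤ, l ≠ 0 → chi l w ≠ 1) (r m : ℕ) (A : Finset (Fin n)) :
    uCoef P w r m A * weightM P A w = yCoef P w r m A := by
  induction m generalizing A with
  | zero => rw [uCoef, yCoef]
  | succ m ih =>
    rw [uCoef, yCoef, sub_mul, Finset.sum_mul]
    refine congrArg _ (Finset.sum_congr rfl fun ε hε => ?_)
    rw [← ih, mul_right_comm, coeffM_mul_weightM hP hw hg (Finset.mem_filter.1 hε).2.2]
    ring

theorem continuous_yCoef (hP : P.Admissible) (r m : ℕ) (A : Finset (Fin n)) :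
    Continuous fun t : Torus n => yCoef P (tw t) r m A := by
  induction m generalizing A with
  | zero => exact continuous_const.mul (continuous_weightM hP A)
  | succ m ih =>
    simp only [yCoef]
    exact (continuous_const.mul (continuous_weightM hP A)).sub
      (continuous_finsetSum _ fun ε _ => (continuous_coeffK hP _ _).mul (ih _))

theorem weightM_congr {A : Finset (Fin n)} {w v : Fin n → ℂˣ} (h : ∀ j ∉ A, w j = v j) :
    weightM P A w = weightM P A v := by
  rw [weightM, weightM]
  refine congrArg₂ (· * ·) (Finset.prod_congr rfl fun j _ => ?_)
    (Finset.prod_congr rfl fun p _ => ?_)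
  · split_ifs with hj
    · rfl
    · rw [h j hj]
  · split_ifs with hp
    · rfl
    · rw [not_or] at hp
      rw [h _ hp.1, h _ hp.2]

theorem coeffK_congr {ε : Fin n → SignType} {C : Finset (Fin n)} {w v : Fin n → ℂˣ}
    (h : ∀ j, ε j ≠ 0 ∨ j ∈ C → w j = v j) : coeffK P ε C w = coeffK P ε C v := by
  rw [coeffK, coeffK]
  refine congrArg₂ (· * ·) (Finset.prod_congr rfl fun j _ => ?_)
    (Finset.prod_congr rfl fun p _ => ?_)
  · split_ifs with hj
    · rw [sgnPow, sgnPow, h j (Or.inl hj)]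
    · rfl
  · unfold kPair
    split_ifs with c1 c2 c3
    · rw [sgnPow, sgnPow, sgnPow, sgnPow, h _ (Or.inl c1.1), h _ (Or.inl c1.2)]
    · rw [sgnPow, sgnPow, h _ (Or.inl c2.1), h _ (Or.inr c2.2)]
    · rw [sgnPow, sgnPow, h _ (Or.inl c3.1), h _ (Or.inr c3.2)]
    · rfl

/-- No variable of `A` enters, because the weight and the coefficients in the recursion only involve
the complement. Hence the factor `yCoef` at `supp ε` is constant in the direction of `ε`, along
which the contour is moved. -/
theorem yCoef_congr (r m : ℕ) {A : Finset (Fin n)} {w v : Fin n → ℂˣ} (h : ∀ j ∉ A, w j = v j) :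
    yCoef P w r m A = yCoef P v r m A := by
  induction m generalizing A with
  | zero => rw [yCoef, yCoef, weightM_congr h]
  | succ m ih =>
    rw [yCoef, yCoef, weightM_congr h]
    refine congrArg _ (Finset.sum_congr rfl fun ε hε => ?_)
    have hd := (Finset.mem_filter.1 hε).2.2
    rw [ih fun j hj => h j fun h' => hj (Finset.mem_union_left _ h')]
    refine congrArg (· * _) (coeffK_congr fun j hj => h j ?_)
    rcases hj with hj | hj
    · exact Finset.disjoint_left.1 hd (mem_supp.2 hj)
    · exact fun h' => Finset.mem_compl.1 hj (Finset.mem_union_left _ h')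

theorem conj_yCoef (hP : P.Admissible) {t : Torus n} (ht : Generic t) (r m : ℕ)
    (A : Finset (Fin n)) :
    (starRingEnd ℂ) (yCoef P (tw t) r m A) = yCoef P (tw t) r m A := by
  rw [← uCoef_mul_weightM hP (norm_tw t) ht, map_mul, conj_uCoef (norm_tw t),
    conj_weightM (norm_tw t)]

/-! ### Regular points on the torus -/

/-- The regular point of `ℂⁿ` attached to a generic point of the torus. -/
theorem exists_regPt_eq_tw {t : Torus n} (ht : Generic t) :
    ∃ x : Regular n P, regPt n P x = tw t := by
  have hexp : ∀ {l : Fin n → ℤ}, l ≠ 0 → expo l (fun j => (rep t j : ℂ)) ≠ 1 := by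
    intro l hl
    rw [← chi_expU, expU_rep]
    exact chi_tw_ne_one ht hl
  have him : ∀ (r a : ℝ) (b : ℝ), (r : ℂ) = a + b * (2 * P.γ) → r = a := by
    intro r a b h
    have h1 := congrArg Complex.re h
    simpa [Params.γ] using h1
  have h2 : ∀ j, sgl j 1 + sgl j (1 : SignType) ≠ (0 : Fin n → ℤ) := fun j h0 => by
    have := congrFun h0 j
    simp [sgl] at this
  have hone : ∀ m : ℤ, Complex.exp (Complex.I * (m * (2 * Real.pi) : ℝ)) = 1 := fun m => by
    rw [Complex.exp_eq_one_iff]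
    exact ⟨m, by push_cast; ring⟩
  have hs : ∀ (j : Fin n) (s : SignType) (f : Fin n → ℝ),
      ∑ i, ((sgl j s i : ℤ) : ℂ) * f i = ((s : ℤ) : ℂ) * f j := by
    intro j s f
    rw [Finset.sum_eq_single j]
    · simp [sgl]
    · intro i _ hi
      simp [sgl, hi]
    · simp
  refine ⟨⟨fun j => (rep t j : ℂ), fun j k l h => hexp (h2 j) ?_, fun j k hjk a b =>
    ⟨fun h => hexp (isRootLike_dbl hjk (s := 1) (t := 1) (by decide) (by decide)).1 ?_,
    fun h => hexp (isRootLike_dbl hjk (s := 1) (t := -1) (by decide) (by decide)).1 ?_⟩⟩,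
    expU_rep t⟩
  · have h' := him (rep t j) (k * Real.pi) (l / 2) (h.trans (by push_cast; ring))
    rw [expo, ← hone k]
    congr 2
    simp only [Pi.add_apply, Int.cast_add, add_mul, Finset.sum_add_distrib, hs, h']
    push_cast
    simp
    ring
  · have h' := him (rep t j + rep t k) (a * (2 * Real.pi)) b (by rw [Complex.ofReal_add, h]; push_cast; ring)
    rw [expo, ← hone a, ← h']
    congr 2
    change ∑ i, ((sgl j 1 i + sgl k 1 i : ℤ) : ℂ) * _ = _
    simp only [Int.cast_add, add_mul, Finset.sum_add_distrib, hs]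
    simp
  · have h' := him (rep t j - rep t k) (a * (2 * Real.pi)) b (by rw [Complex.ofReal_sub, h]; push_cast; ring)
    rw [expo, ← hone a, ← h']
    congr 2
    change ∑ i, ((sgl j 1 i + sgl k (-1) i : ℤ) : ℂ) * _ = _
    simp only [Int.cast_add, add_mul, Finset.sum_add_distrib, hs]
    simp [sub_eq_add_neg]

end Koornwinder

end

noncomputable section

open MeasureTheory

namespace Koornwinder

variable {n : ℕ} {P : Params}

/-! ### Contour shifts -/

/-- Translation over half a period in multiplicative coordinates. -/
def hShift (P : Params) (ε : Fin n → SignType) (w : Fin n → ℂˣ) : Fin n → ℂˣ :=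
  fun j => w j * P.rU ^ (ε j : ℤ)

/-- The complex line through a point of the torus in the direction of a sign vector. -/
def cLine (ε : Fin n → SignType) (t : Torus n) (ζ : ℂ) : Fin n → ℂˣ :=
  expU fun j => rep t j + 2 * Real.pi * ζ * (ε j : ℤ)

theorem tw_shiftT' (ε : Fin n → SignType) (s : ℝ) (t : Torus n) :
    tw (shiftT (fun j => (ε j : ℤ)) s t) = cLine ε t s := tw_shiftT _ _ _

theorem cLine_add_one (ε : Fin n → SignType) (t : Torus n) (ζ : ℂ) :
    cLine ε t (ζ + 1) = cLine ε t ζ := by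
  funext j
  ext
  rw [cLine, cLine, expU_val, expU_val, Complex.exp_eq_exp_iff_exists_int]
  exact ⟨ε j, by ring⟩

/-- A real unit of `ζ` is a full period `2π`, so an imaginary step `-β/(4π)` multiplies `w_j` by
`e^{βε_j/2}`, the inverse of `r^{ε_j}`: half of the translation step. -/
theorem cLine_shift (ε : Fin n → SignType) (t : Torus n) (s : ℝ) :
    cLine ε t (s + (-(P.β / (4 * Real.pi)) : ℝ) * Complex.I)
      = hShift P (-ε) (tw (shiftT (fun j => (ε j : ℤ)) s t)) := by
  funext j
  ext
  have hr : ((P.rU ^ ((-ε) j : ℤ) : ℂˣ) : ℂ)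
      = Complex.exp (((-ε) j : ℤ) * (-P.β / 2)) := by
    rw [Units.val_zpow_eq_zpow_val, P.rU_val', ← Complex.exp_int_mul]
  rw [tw_shiftT', hShift, Units.val_mul, hr, cLine, cLine, expU_val, expU_val, ← Complex.exp_add,
    Pi.neg_apply, coe_neg_signType]
  refine congrArg Complex.exp ?_
  have hπ : (Real.pi : ℂ) ≠ 0 := by exact_mod_cast Real.pi_ne_zero
  push_cast
  field_simp
  ring_nf
  rw [Complex.I_sq]
  ring

theorem norm_cLine (ε : Fin n → SignType) (t : Torus n) (ζ : ℂ) (j : Fin n) :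
    ‖(cLine ε t ζ j : ℂ)‖ = Real.exp (-(2 * Real.pi * ζ.im)) ^ (ε j : ℤ) := by
  rw [cLine, expU_val, Complex.norm_exp, ← Real.rpow_intCast, ← Real.exp_mul]
  refine congrArg Real.exp ?_
  generalize (ε j : ℤ) = m
  simp

theorem norm_rU' : ‖(P.rU : ℂ)‖ = Real.exp (-P.β / 2) := by
  rw [P.rU_val', Complex.norm_exp]
  simp

theorem differentiable_cLine (ε : Fin n → SignType) (t : Torus n) (j : Fin n) :
    Differentiable ℂ fun ζ => (cLine ε t ζ j : ℂ) := by
  simp only [cLine, expU_val]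
  fun_prop

theorem differentiable_inv_cLine (ε : Fin n → SignType) (t : Torus n) (j : Fin n) :
    Differentiable ℂ fun ζ => (((cLine ε t ζ j)⁻¹ : ℂˣ) : ℂ) := by
  simp only [Units.val_inv_eq_inv_val]
  exact (differentiable_cLine ε t j).inv fun ζ => Units.ne_zero _

theorem differentiable_ev_cLine (ε : Fin n → SignType) (t : Torus n) (p : Laurent n) :
    Differentiable ℂ fun ζ => ev (cLine ε t ζ) p := by
  simp only [ev_eq_sum, cLine, chi_expU, expo]
  fun_prop

/-- The functions that are differentiable at the points of a set. -/
def diffSubalgebra (Ω : Set ℂ) : Subalgebra ℂ (ℂ → ℂ) where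
  carrier := {G | ∀ z ∈ Ω, DifferentiableAt ℂ G z}
  mul_mem' hf hg z hz := (hf z hz).mul (hg z hz)
  add_mem' hf hg z hz := (hf z hz).add (hg z hz)
  algebraMap_mem' c _ _ := differentiableAt_const c

theorem differentiableAt_coeffK (hP : P.Admissible) (ε : Fin n → SignType) (C : Finset (Fin n))
    (t : Torus n) {z : ℂ} (h1 : -(P.β / (4 * Real.pi)) ≤ z.im) (h2 : z.im ≤ 0) :
    DifferentiableAt ℂ (fun ζ => coeffK P ε C (cLine ε t ζ)) z := by
  refine coeffK_mem (S := diffSubalgebra {z | -(P.β / (4 * Real.pi)) ≤ z.im ∧ z.im ≤ 0})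
    (Ω := {z | -(P.β / (4 * Real.pi)) ≤ z.im ∧ z.im ≤ 0}) hP (fun g hg f hf h z hz => ?_)
    (fun j z _ => differentiable_cLine ε t j z) (fun j z _ => differentiable_inv_cLine ε t j z)
    (fun z hz => ⟨Real.exp (-(2 * Real.pi * z.im)), ?_, ?_, norm_cLine ε t z⟩) C z ⟨h1, h2⟩
  · exact (differentiableAt_eFac hP.β_pos hg (h z hz)).comp z (hf z hz)
  · rw [Real.one_le_exp_iff]
    nlinarith [Real.pi_pos, hz.2]
  · rw [norm_rU', ← Real.exp_add, Real.exp_le_one_iff]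
    have h3 := mul_le_mul_of_nonneg_left hz.1 Real.two_pi_pos.le
    have h4 : 2 * Real.pi * -(P.β / (4 * Real.pi)) = -P.β / 2 := by
      field_simp
      ring
    linarith

/-! ### Complex conjugation of Laurent polynomials -/

/-- The reflection in the torus. -/
def conjInv (w : Fin n → ℂˣ) : Fin n → ℂˣ :=
  fun j => (Units.map (starRingEnd ℂ : ℂ →* ℂ) (w j))⁻¹

theorem chi_conjInv (l : Fin n → ℤ) (w : Fin n → ℂˣ) :
    (starRingEnd ℂ) (chi l (conjInv w) : ℂ) = chi (-l) w := by
  simp only [chi, conjInv, Units.coe_prod, map_prod, Units.val_zpow_eq_zpow_val,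
    Units.val_inv_eq_inv_val, map_zpow₀, map_inv₀]
  refine Finset.prod_congr rfl fun j _ => ?_
  simp

theorem exists_ev_conj (p : Laurent n) :
    ∃ p' : Laurent n, ∀ w, ev w p' = (starRingEnd ℂ) (ev (conjInv w) p) := by
  induction p using AddMonoidAlgebra.induction_linear with
  | zero => exact ⟨0, fun w => by simp⟩
  | add p q hp hq =>
    obtain ⟨p', hp⟩ := hp
    obtain ⟨q', hq⟩ := hq
    exact ⟨p' + q', fun w => by simp [hp, hq]⟩
  | single l a =>
    exact ⟨AddMonoidAlgebra.single (-l) ((starRingEnd ℂ) a), fun w => by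
      rw [ev_single, ev_single, map_mul, chi_conjInv]⟩

theorem conjInv_tw (t : Torus n) : conjInv (tw t) = tw t := by
  funext j
  ext
  rw [conjInv, Units.val_inv_eq_inv_val]
  change ((starRingEnd ℂ) (tw t j : ℂ))⁻¹ = _
  rw [conj_eq_inv (norm_tw t j), Units.val_inv_eq_inv_val, inv_inv]

theorem conjInv_hShift (ε : Fin n → SignType) (t : Torus n) :
    conjInv (hShift P (-ε) (tw t)) = hShift P ε (tw t) := by
  have h := conjInv_tw t
  funext j
  have hj := congrFun h j
  have hr : Units.map (starRingEnd ℂ : ℂ →* ℂ) P.rU = P.rU := Units.ext conj_rU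
  rw [conjInv] at hj ⊢
  rw [hShift, map_mul, mul_inv, hj, map_zpow, hr, hShift, Pi.neg_apply, coe_neg_signType, zpow_neg,
    inv_inv]

theorem hShift_hShift (ε : Fin n → SignType) (w : Fin n → ℂˣ) :
    shiftU P ε (hShift P (-ε) w) = hShift P ε w := by
  funext j
  rw [shiftU, hShift, hShift, Params.qU, Pi.neg_apply, coe_neg_signType, mul_assoc, ← zpow_natCast,
    ← zpow_mul, ← zpow_add]
  congr 2
  push_cast
  ring

/-! ### The terms of the quadratic form -/

variable (P) in
/-- A term of the quadratic form of the difference operator. -/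
def termA (r : ℕ) (ε : Fin n → SignType) (p p' : Laurent n) (t : Torus n) : ℂ :=
  (starRingEnd ℂ) (ev (tw t) p) * coeffK P ε (supp ε)ᶜ (tw t) * yCoef P (tw t) r r (supp ε)
    * ev (shiftU P ε (tw t)) p'

variable (P) in
/-- A term of the quadratic form of the difference operator, after the contour shift. -/
def termB (r : ℕ) (ε : Fin n → SignType) (p p' : Laurent n) (t : Torus n) : ℂ :=
  (starRingEnd ℂ) (ev (hShift P ε (tw t)) p) * coeffK P ε (supp ε)ᶜ (hShift P (-ε) (tw t))
    * yCoef P (tw t) r r (supp ε) * ev (hShift P ε (tw t)) p'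

theorem exists_ev_hShift (ε : Fin n → SignType) (p : Laurent n) :
    ∃ p' : Laurent n, ∀ w, ev w p' = ev (hShift P ε w) p := by
  refine exists_ev_comp _ (fun l => ⟨chi l fun j => P.rU ^ (ε j : ℤ), l, fun w => ?_⟩) p
  have : hShift P ε w = (fun j => P.rU ^ (ε j : ℤ)) * w := funext fun j => mul_comm _ _
  rw [this, chi_mul, Units.val_mul]

theorem continuous_conj_ev_tw (p : Laurent n) :
    Continuous fun t : Torus n => (starRingEnd ℂ) (ev (tw t) p) :=
  Complex.continuous_conj.comp (continuous_ev_tw p)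

theorem continuous_termA (hP : P.Admissible) (r : ℕ) (ε : Fin n → SignType) (p p' : Laurent n) :
    Continuous (termA P r ε p p') := by
  obtain ⟨q', hq'⟩ := exists_ev_shiftU P ε p'
  unfold termA
  simp only [← hq']
  exact (((continuous_conj_ev_tw p).mul (continuous_coeffK hP _ _)).mul
    (continuous_yCoef hP _ _ _)).mul (continuous_ev_tw q')

theorem norm_hShift (ε : Fin n → SignType) (t : Torus n) (j : Fin n) :
    ‖(hShift P (-ε) (tw t) j : ℂ)‖ = (‖(P.rU : ℂ)‖⁻¹) ^ (ε j : ℤ) := by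
  rw [hShift, Units.val_mul, norm_mul, norm_tw, one_mul, Units.val_zpow_eq_zpow_val, norm_zpow,
    Pi.neg_apply, coe_neg_signType, zpow_neg, inv_zpow]

theorem continuous_termB (hP : P.Admissible) (r : ℕ) (ε : Fin n → SignType) (p p' : Laurent n) :
    Continuous (termB P r ε p p') := by
  obtain ⟨q, hq⟩ := exists_ev_hShift (P := P) ε p
  obtain ⟨q', hq'⟩ := exists_ev_hShift (P := P) ε p'
  have hr : 0 < ‖(P.rU : ℂ)‖ := norm_pos_iff.2 P.rU.ne_zero
  have hK : Continuous fun t : Torus n => coeffK P ε (supp ε)ᶜ (hShift P (-ε) (tw t)) := by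
    refine coeffK_mem (S := continuousSubalgebra (α := Torus n) (R := ℂ) (A := ℂ))
      (Ω := Set.univ) hP (fun _ hg _ hf h => continuous_eFac hP.β_pos hg hf fun x => h x trivial)
      (fun j => ?_) (fun j => ?_) (fun t _ => ⟨‖(P.rU : ℂ)‖⁻¹,
        (one_le_inv₀ hr).2 (norm_rU_lt_one hP.β_pos).le, (mul_inv_cancel₀ hr.ne').le,
        norm_hShift ε t⟩) _
    · simp only [hShift, Units.val_mul]
      exact (continuous_tw j).mul continuous_const
    · simp only [hShift, mul_inv, Units.val_mul]
      exact (continuous_inv_tw j).mul continuous_const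
  unfold termB
  simp only [← hq, ← hq']
  exact (((continuous_conj_ev_tw q).mul hK).mul (continuous_yCoef hP _ _ _)).mul
    (continuous_ev_tw q')

/-- The contour is moved by half a step against `ε`, with every other factor of the integrand
holomorphic in the strip and `yCoef` constant. This splits the translation evenly: both polynomials
end up evaluated at the point shifted by half a step along `ε`. -/
theorem integral_termA (hP : P.Admissible) (r : ℕ) (ε : Fin n → SignType) (p p' : Laurent n) :
    ∫ t, termA P r ε p p' t = ∫ t, termB P r ε p p' t := by
  refine integral_eq_of_shiftT (fun j => (ε j : ℤ)) (continuous_termA hP r ε p p')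
    (continuous_termB hP r ε p p') fun t => ?_
  obtain ⟨pc, hpc⟩ := exists_ev_conj p
  obtain ⟨q', hq'⟩ := exists_ev_shiftU P ε p'
  have hY : ∀ s : ℝ, yCoef P (tw (shiftT (fun j => (ε j : ℤ)) s t)) r r (supp ε)
      = yCoef P (tw t) r r (supp ε) := fun s => yCoef_congr r r fun j hj => by
    rw [tw_shiftT, ← expU_rep t]
    ext
    simp [eq_zero_of_notMem_supp hj]
  -- The polynomial `pc` is the holomorphic extension of the conjugate of `p` from the torus. At the
  -- shifted point it is the conjugate of `p` at the opposite half shift.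
  have key := integral_eq_shift (τ := P.β / (4 * Real.pi))
    (G := fun ζ => ev (cLine ε t ζ) pc * coeffK P ε (supp ε)ᶜ (cLine ε t ζ)
      * yCoef P (tw t) r r (supp ε) * ev (cLine ε t ζ) q')
    (by have := hP.β_pos; positivity)
    (fun z h1 h2 => (((differentiable_ev_cLine ε t pc z).mul
      (differentiableAt_coeffK hP ε _ t h1 h2)).mul (differentiableAt_const _)).mul
      (differentiable_ev_cLine ε t q' z))
    (fun z => by simp only [cLine_add_one])
  refine Eq.trans ?_ (key.trans ?_)
  · refine intervalIntegral.integral_congr fun s _ => ?_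
    simp only [termA, hY, hq', hpc, ← tw_shiftT', conjInv_tw]
  · refine intervalIntegral.integral_congr fun s _ => ?_
    simp only [termB, hY, hq', hpc, cLine_shift (P := P), conjInv_hShift, hShift_hShift]

/-- Both polynomials sit at the same point, while `coeffK` at the edge of the strip and `yCoef` on
the torus are real. Conjugation therefore only exchanges the polynomials. -/
theorem conj_termB (hP : P.Admissible) (r : ℕ) (ε : Fin n → SignType) (p p' : Laurent n)
    {t : Torus n} (ht : Generic t) :
    (starRingEnd ℂ) (termB P r ε p p' t) = termB P r ε p' p t := by
  have hr : P.rU * P.rU = P.qU := (pow_two _).symm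
  have hK : (starRingEnd ℂ) (coeffK P ε (supp ε)ᶜ (hShift P (-ε) (tw t)))
      = coeffK P ε (supp ε)ᶜ (hShift P (-ε) (tw t)) := by
    have hc : ∀ j, (starRingEnd ℂ) (tw t j : ℂ) = ((tw t j)⁻¹ : ℂˣ) := fun j =>
      conj_eq_inv (norm_tw t j)
    refine conj_coeffK (fun j hj => ?_) (fun j hj => ?_) _
    · have h1 : sgnPow ε (hShift P (-ε) (tw t)) j = sgnPow ε (tw t) j * P.rU⁻¹ := by
        rw [sgnPow, sgnPow, hShift, mul_zpow, ← zpow_mul, Pi.neg_apply, coe_neg_signType]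
        rcases SignType.eq_or hj with h | h <;> simp [h]
      have h2 := conj_eq_inv (norm_sgnPow (norm_tw t) (ε := ε) j)
      have h3 : (starRingEnd ℂ) ((P.rU⁻¹ : ℂˣ) : ℂ) = (P.rU⁻¹ : ℂˣ) := by
        rw [Units.val_inv_eq_inv_val, map_inv₀, conj_rU]
      rw [h1, Units.val_mul, map_mul, h2, h3, ← Units.val_mul, ← Units.val_mul, ← hr]
      refine congrArg _ ?_
      rw [mul_inv, inv_inv]
      calc _ = (sgnPow ε (tw t) j)⁻¹ * (P.rU * (P.rU * P.rU⁻¹)) := by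
            simp only [mul_assoc, mul_left_comm]
        _ = _ := by rw [mul_inv_cancel, mul_one]
    · rw [hShift, Pi.neg_apply, hj]
      simpa using hc j
  simp only [termB, map_mul, Complex.conj_conj, hK, conj_yCoef hP ht]
  ring

/-! ### Symmetry -/

/-- The inner product of two Laurent polynomials with respect to the weight function. -/
def form (P : Params) (p p' : Laurent n) : ℂ :=
  ∫ t : Torus n, (starRingEnd ℂ) (ev (tw t) p) * ev (tw t) p' * weightM P ∅ (tw t)

theorem integrable_of_continuous {F : Torus n → ℂ} (hF : Continuous F) : Integrable F :=
  hF.integrable_of_hasCompactSupport (HasCompactSupport.of_compactSpace F)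

theorem conj_form (p p' : Laurent n) : (starRingEnd ℂ) (form P p p') = form P p' p := by
  rw [form, ← integral_conj, form]
  refine congrArg _ (funext fun t => ?_)
  simp only [map_mul, Complex.conj_conj, conj_weightM (norm_tw t)]
  ring

variable (P) in
/-- The coefficient of the identity in the difference operator, times the weight function. -/
def diagK (r : ℕ) (t : Torus n) : ℂ :=
  ∑ ε : Fin n → SignType, coeffK P ε (supp ε)ᶜ (tw t) * yCoef P (tw t) r r (supp ε)

theorem coeff_mul_weight (hP : P.Admissible) (r : ℕ) (ε : Fin n → SignType) {t : Torus n}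
    (ht : Generic t) :
    coeffM P ε (supp ε)ᶜ (tw t) * uCoef P (tw t) r r (supp ε) * weightM P ∅ (tw t)
      = coeffK P ε (supp ε)ᶜ (tw t) * yCoef P (tw t) r r (supp ε) := by
  have h := coeffM_mul_weightM hP (norm_tw t) ht (Finset.disjoint_empty_right (supp ε))
  rw [Finset.empty_union] at h
  rw [← uCoef_mul_weightM hP (norm_tw t) ht, mul_right_comm, h]
  ring

theorem conj_diagK (hP : P.Admissible) (r : ℕ) {t : Torus n} (ht : Generic t) :
    (starRingEnd ℂ) (diagK P r t) = diagK P r t := by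
  simp only [diagK, ← coeff_mul_weight hP r _ ht, map_sum, map_mul, conj_weightM (norm_tw t),
    conj_uCoef (norm_tw t), conj_coeffM (norm_tw t)]
  refine Finset.sum_bijective _ neg_bijective (fun ε => by simp) fun ε _ => ?_
  rw [supp_neg]

/-- The identity part of `T_ε - 1` is kept apart: it multiplies by `diagK`, which is real on generic
points and needs no contour shift. -/
theorem form_dOp (hP : P.Admissible) (r : ℕ) (p : Laurent n) {p' q' : Laurent n}
    (h : ∀ x : Regular n P, dOp P r (fun w => ev w p') (regPt n P x) = ev (regPt n P x) q') :
    form P p q' = (∑ ε, ∫ t, termB P r ε p p' t)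
      - ∫ t : Torus n, (starRingEnd ℂ) (ev (tw t) p) * ev (tw t) p' * diagK P r t := by
  have hd : Continuous fun t : Torus n =>
      (starRingEnd ℂ) (ev (tw t) p) * ev (tw t) p' * diagK P r t :=
    ((continuous_conj_ev_tw p).mul (continuous_ev_tw p')).mul
      (continuous_finsetSum _ fun ε _ => (continuous_coeffK hP _ _).mul (continuous_yCoef hP _ _ _))
  simp only [← integral_termA hP]
  rw [← integral_finsetSum _ fun ε _ => integrable_of_continuous (continuous_termA hP r ε p p'),
    ← integral_sub (integrable_of_continuous
      (continuous_finsetSum _ fun ε _ => continuous_termA hP r ε p p'))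
      (integrable_of_continuous hd), form]
  refine integral_congr_ae ?_
  filter_upwards [ae_generic] with t ht
  obtain ⟨x, hx⟩ := exists_regPt_eq_tw (P := P) ht
  rw [← hx, ← h x, hx, dOp, diagK, Finset.mul_sum, Finset.mul_sum, Finset.sum_mul,
    ← Finset.sum_sub_distrib]
  refine Finset.sum_congr rfl fun ε _ => ?_
  rw [termA, mul_assoc _ (coeffK _ _ _ _), ← coeff_mul_weight hP r ε ht]
  ring

/-- The difference operators are symmetric. -/
theorem form_dOp_comm (hP : P.Admissible) (r : ℕ) {p p' q q' : Laurent n}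
    (h : ∀ x : Regular n P, dOp P r (fun w => ev w p) (regPt n P x) = ev (regPt n P x) q)
    (h' : ∀ x : Regular n P, dOp P r (fun w => ev w p') (regPt n P x) = ev (regPt n P x) q') :
    form P p q' = form P q p' := by
  rw [← conj_form p' q, form_dOp hP r p h', form_dOp hP r p' h, map_sub, map_sum]
  refine congrArg₂ (· - ·) (Finset.sum_congr rfl fun ε _ => ?_) ?_
  · rw [← integral_conj]
    refine integral_congr_ae ?_
    filter_upwards [ae_generic] with t ht
    exact (conj_termB hP r ε p' p ht).symm
  · rw [← integral_conj]
    refine integral_congr_ae ?_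
    filter_upwards [ae_generic] with t ht
    simp only [map_mul, Complex.conj_conj, conj_diagK hP r ht]
    ring

end Koornwinder

end

/-! ### Positivity, the finite-dimensional filtration, and commutation. -/

noncomputable section

open MeasureTheory

namespace Koornwinder

variable {n : ℕ} {P : Params}

/-! ### Positivity of the weight function -/

theorem eFac_ne_zero (hβ : 0 < P.β) {g : ℝ} (hg : 0 ≤ g) {w : ℂ} (hw : ‖w‖ ≤ 1) (h1 : w ≠ 1) :
    eFac P g w ≠ 0 := by
  rcases hg.eq_or_lt with rfl | hg
  · simp [eFac]
  · rw [eFac, if_neg hg.ne']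
    exact div_ne_zero (qPoch_ne_zero_of_norm (norm_qpow_one_lt hβ) hw h1)
      (eFac_denom_ne_zero hβ hg hw)

theorem eFacB_ne_zero (hP : P.Admissible) {w : ℂ} (hw : ‖w‖ ≤ 1) (h1 : w ≠ 1) (h2 : w ≠ -1) :
    eFacB P w ≠ 0 := by
  have hr := norm_rU_mul_lt hP.β_pos hw
  have hr' : ‖-P.rU * w‖ < 1 := by rwa [neg_mul, norm_neg]
  exact mul_ne_zero (mul_ne_zero (eFac_ne_zero hP.β_pos hP.g₀_nonneg hw h1)
    (eFac_ne_zero hP.β_pos hP.g₁_nonneg (by rwa [norm_neg]) (neg_ne_one_of_ne h2)))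
    (mul_ne_zero (eFac_ne_zero hP.β_pos hP.g₀'_nonneg hr.le (ne_one_of_norm_lt hr))
    (eFac_ne_zero hP.β_pos hP.g₁'_nonneg hr'.le (ne_one_of_norm_lt hr')))

theorem weightM_ne_zero (hP : P.Admissible) {t : Torus n} (ht : Generic t) :
    weightM P ∅ (tw t) ≠ 0 := by
  have hn : ∀ j, ‖(((tw t j)⁻¹ : ℂˣ) : ℂ)‖ = 1 := fun j => by
    rw [Units.val_inv_eq_inv_val, norm_inv, norm_tw, inv_one]
  refine mul_ne_zero (Finset.prod_ne_zero_iff.2 fun j _ => ?_)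
    (Finset.prod_ne_zero_iff.2 fun p hp => ?_)
  · have h1 := tw_single_ne ht j 1 (by decide)
    have h2 := tw_single_ne ht j (-1) (by decide)
    simp only [SignType.coe_one, zpow_one, SignType.coe_neg_one, zpow_neg] at h1 h2
    rw [if_neg (Finset.notMem_empty _)]
    exact mul_ne_zero (eFacB_ne_zero hP (norm_tw t j).le h1.1 h1.2)
      (eFacB_ne_zero hP (hn j).le h2.1 h2.2)
  · have hjk : p.1 ≠ p.2 := (mem_ltPairs.1 hp).ne
    have h1 := tw_pair_ne_one ht 1 1 hjk (by decide) (by decide)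
    have h2 := tw_pair_ne_one ht 1 (-1) hjk (by decide) (by decide)
    have h3 := tw_pair_ne_one ht (-1) 1 hjk (by decide) (by decide)
    have h4 := tw_pair_ne_one ht (-1) (-1) hjk (by decide) (by decide)
    simp only [SignType.coe_one, zpow_one, SignType.coe_neg_one, zpow_neg] at h1 h2 h3 h4
    rw [if_neg (by simp), ePair]
    refine mul_ne_zero (mul_ne_zero (eFac_ne_zero hP.β_pos hP.g_nonneg ?_ h1)
      (eFac_ne_zero hP.β_pos hP.g_nonneg ?_ h4)) (mul_ne_zero
      (eFac_ne_zero hP.β_pos hP.g_nonneg ?_ h2) (eFac_ne_zero hP.β_pos hP.g_nonneg ?_ h3)) <;>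
      simp [hn, norm_tw, -Units.val_inv_eq_inv_val]

theorem weightM_pos (hP : P.Admissible) {t : Torus n} (ht : Generic t) :
    ∃ w : ℝ, 0 < w ∧ weightM P ∅ (tw t) = w := by
  obtain ⟨w, hw, h⟩ := weight_real_nonneg P t
  rw [weight_eq_weightM hP.β_pos ht] at h
  refine ⟨w, hw.lt_of_ne fun h0 => weightM_ne_zero hP ht ?_, h⟩
  rw [h, ← h0, Complex.ofReal_zero]

/-! ### Independence of characters -/

theorem tw_add (s t : Torus n) : tw (s + t) = tw s * tw t := by
  funext j
  ext
  rw [Pi.mul_apply, Units.val_mul, tw_val, tw_val, tw_val, Pi.add_apply, cexpI_add]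

/-- The characters of the torus. -/
def charHom (l : Fin n → ℤ) : Multiplicative (Torus n) →* ℂ where
  toFun t := chi l (tw t.toAdd)
  map_one' := by
    have h : tw (0 : Torus n) = 1 := by
      funext j
      ext
      simp [tw_val, cexpI]
    rw [toAdd_one, h]
    simp [chi]
  map_mul' s t := by rw [toAdd_mul, tw_add, chi_mul, Units.val_mul]

theorem charHom_injective : Function.Injective (charHom (n := n)) := by
  intro l m h
  by_contra hlm
  obtain ⟨t, ht⟩ := (ae_generic (n := n)).exists
  refine ht (l - m) (sub_ne_zero.2 hlm) ?_
  have h1 : (chi l (tw t) : ℂ) = chi m (tw t) := DFunLike.congr_fun h (Multiplicative.ofAdd t)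
  rw [chi_sub, Units.ext h1, div_self']

/-- Distinct exponents give distinct characters of the torus group, and distinct characters are
linearly independent. -/
theorem eq_zero_of_ev_tw {p : Laurent n} (h : ∀ t : Torus n, ev (tw t) p = 0) : p = 0 := by
  have hli := (linearIndependent_monoidHom (Multiplicative (Torus n)) ℂ).comp charHom
    charHom_injective
  rw [← AddMonoidAlgebra.coeff_eq_zero]
  refine linearIndependent_iff.1 hli p.coeff (funext fun t => ?_)
  rw [Finsupp.linearCombination_apply, Finsupp.sum, Finset.sum_apply, Pi.zero_apply,
    ← h t.toAdd, ev_eq_sum]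
  rfl

/-- The weight is positive at generic points, so vanishing of the form forces the polynomial to
vanish almost everywhere, and by continuity everywhere on the torus. -/
theorem form_self_eq_zero (hP : P.Admissible) {p : Laurent n} (h : form P p p = 0) : p = 0 := by
  have hF : ∀ᵐ t : Torus n, (starRingEnd ℂ) (ev (tw t) p) * ev (tw t) p * weightM P ∅ (tw t)
      = ((Complex.normSq (ev (tw t) p) * (weightM P ∅ (tw t)).re : ℝ) : ℂ) := by
    filter_upwards [ae_generic] with t ht
    obtain ⟨w, -, hw⟩ := weightM_pos hP ht
    rw [hw, Complex.ofReal_re, Complex.ofReal_mul, Complex.normSq_eq_conj_mul_self]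
  have hc : Continuous fun t : Torus n =>
      Complex.normSq (ev (tw t) p) * (weightM P ∅ (tw t)).re :=
    (Complex.continuous_normSq.comp (continuous_ev_tw p)).mul
      (Complex.continuous_re.comp (continuous_weightM hP ∅))
  rw [form, integral_congr_ae hF, integral_complex_ofReal, Complex.ofReal_eq_zero,
    integral_eq_zero_iff_of_nonneg_ae] at h
  · have h0 : (fun t : Torus n => ev (tw t) p) =ᵐ[volume] fun _ => 0 := by
      filter_upwards [ae_generic, h] with t ht h
      obtain ⟨w, hw0, hw⟩ := weightM_pos hP ht
      rw [hw, Complex.ofReal_re, Pi.zero_apply] at h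
      rcases mul_eq_zero.1 h with h | h
      · exact Complex.normSq_eq_zero.1 h
      · exact absurd h hw0.ne'
    refine eq_zero_of_ev_tw fun t => ?_
    exact congrFun ((Continuous.ae_eq_iff_eq volume (continuous_ev_tw p) continuous_const).1 h0) t
  · filter_upwards [ae_generic] with t ht
    obtain ⟨w, hw0, hw⟩ := weightM_pos hP ht
    rw [hw, Complex.ofReal_re]
    exact mul_nonneg (Complex.normSq_nonneg _) hw0.le
  · exact hc.integrable_of_hasCompactSupport (HasCompactSupport.of_compactSpace _)

/-! ### The filtration of the invariant Laurent polynomials -/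

variable (n) in
/-- The invariant Laurent polynomials. -/
def invL : Submodule ℂ (Laurent n) where
  carrier := {p | IsInv p}
  zero_mem' := fun σ η w => by simp
  add_mem' hp hq := fun σ η w => by simp [hp σ η w, hq σ η w]
  smul_mem' a p hp := fun σ η w => by simp [hp σ η w]

variable (n) in
/-- The invariant Laurent polynomials with bounded exponents. -/
def hFil (d : ℝ) : Submodule ℂ (invL n) where
  carrier := {p | ∀ l, d < height l → p.1.coeff l = 0}
  zero_mem' l _ := rfl
  add_mem' hp hq l h := by simp [hp l h, hq l h]
  smul_mem' a p hp l h := by simp [hp l h]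

theorem mem_hFil {d : ℝ} {p : invL n} :
    p ∈ hFil n d ↔ ∀ l ∈ p.1.coeff.support, height l ≤ d := by
  refine forall_congr' fun l => ?_
  rw [Finsupp.mem_support_iff, ← not_lt, not_imp_not]

/-- Sign flips of the lattice. -/
def flipL (η : Fin n → ℤˣ) : (Fin n → ℤ) ≃+ (Fin n → ℤ) where
  toFun l j := η j * l j
  invFun l j := η j * l j
  left_inv l := funext fun j => by
    rcases Int.units_eq_one_or (η j) with h | h <;> simp [h]
  right_inv l := funext fun j => by
    rcases Int.units_eq_one_or (η j) with h | h <;> simp [h]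
  map_add' l m := funext fun j => mul_add _ _ _

theorem ev_domCongr_flipL (η : Fin n → ℤˣ) (w : Fin n → ℂˣ) (p : Laurent n) :
    ev w (AddMonoidAlgebra.domCongr ℂ ℂ (flipL η) p) = ev (wAct 1 η w) p := by
  induction p using AddMonoidAlgebra.induction_linear with
  | zero => simp
  | add p q hp hq => simp [hp, hq]
  | single l a =>
    rw [AddMonoidAlgebra.domCongr_single, ev_single, ev_single]
    congr 2
    refine Finset.prod_congr rfl fun j _ => ?_
    rw [wAct, ← zpow_mul]
    rfl

theorem IsInv.coeff_flipL {p : Laurent n} (hp : IsInv p) (η : Fin n → ℤˣ) (l : Fin n → ℤ) :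
    p.coeff (flipL η l) = p.coeff l := by
  have h : AddMonoidAlgebra.domCongr ℂ ℂ (flipL η) p = p := ev_ext fun w => by
    rw [ev_domCongr_flipL, hp]
  have h1 := AddMonoidAlgebra.coeff_domCongr (R := ℂ) (A := ℂ) (flipL η) p (flipL η l)
  rw [h, AddEquiv.symm_apply_apply] at h1
  exact h1

/-- The exponents that can occur in an invariant Laurent polynomial of bounded height. -/
def absBox (n : ℕ) (d : ℝ) : Set (Fin n → ℤ) :=
  {l | ∑ j, |(l j : ℝ)| * genericBase ^ (j : ℕ) ≤ d}

theorem height_le_of_mem_absBox {d : ℝ} {l : Fin n → ℤ} (h : l ∈ absBox n d) : height l ≤ d := by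
  refine le_trans ?_ h
  rw [height_apply]
  exact Finset.sum_le_sum fun j _ =>
    mul_le_mul_of_nonneg_right (le_abs_self _) (pow_pos genericBase_pos _).le

/-- Invariance under sign flips puts the exponent with entries `|l_j|` into the support as well, and
its height is the weighted sum that defines the box. The half-space condition thus becomes a finite
one. -/
theorem mem_absBox_of_mem_hFil {d : ℝ} {p : invL n} (hp : p ∈ hFil n d) {l : Fin n → ℤ}
    (hl : p.1.coeff l ≠ 0) : l ∈ absBox n d := by
  set η : Fin n → ℤˣ := fun j => if l j < 0 then -1 else 1
  have h1 : (p.1.coeff (flipL η l)) ≠ 0 := by rwa [IsInv.coeff_flipL p.2]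
  have h2 := mem_hFil.1 hp _ (Finsupp.mem_support_iff.2 h1)
  have h3 : ∀ j, ((flipL η l j : ℤ) : ℝ) = |(l j : ℝ)| := fun j => by
    have : flipL η l j = |l j| := by
      change ((η j : ℤˣ) : ℤ) * l j = _
      simp only [η]
      split_ifs with h
      · rw [abs_of_neg h]
        simp
      · rw [abs_of_nonneg (not_lt.1 h)]
        simp
    rw [this, Int.cast_abs]
  rw [height_apply] at h2
  simpa only [absBox, Set.mem_ofPred_eq, h3] using h2

theorem finite_absBox (d : ℝ) : (absBox n d).Finite := by
  refine (Set.finite_Icc (fun j : Fin n => -⌈d / genericBase ^ (j : ℕ)⌉)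
    fun j => ⌈d / genericBase ^ (j : ℕ)⌉).subset fun l hl => ?_
  have h : ∀ j, |l j| ≤ ⌈d / genericBase ^ (j : ℕ)⌉ := fun j => by
    have hb := pow_pos genericBase_pos (j : ℕ)
    have h1 : |(l j : ℝ)| * genericBase ^ (j : ℕ) ≤ d := le_trans
      (Finset.single_le_sum (f := fun j : Fin n => |(l j : ℝ)| * genericBase ^ (j : ℕ))
        (fun i _ => mul_nonneg (abs_nonneg _) (pow_pos genericBase_pos _).le)
        (Finset.mem_univ j)) hl
    have h2 : |(l j : ℝ)| ≤ d / genericBase ^ (j : ℕ) := (le_div_iff₀ hb).2 h1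
    have h3 := h2.trans (Int.le_ceil _)
    exact_mod_cast h3
  exact ⟨fun j => (abs_le.1 (h j)).1, fun j => (abs_le.1 (h j)).2⟩

instance finiteDimensional_hFil (d : ℝ) : FiniteDimensional ℂ (hFil n d) := by
  let W : Submodule ℂ (Laurent n) :=
    Submodule.span ℂ ((fun l => AddMonoidAlgebra.single l (1 : ℂ)) '' absBox n d)
  have : FiniteDimensional ℂ W :=
    FiniteDimensional.span_of_finite ℂ ((finite_absBox d).image _)
  have hW : ∀ p : hFil n d, (p.1.1 : Laurent n) ∈ W := fun p => by
    rw [← AddMonoidAlgebra.sum_coeff_single p.1.1]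
    refine Submodule.sum_mem _ fun l hl => ?_
    have : AddMonoidAlgebra.single l (p.1.1.coeff l)
        = p.1.1.coeff l • AddMonoidAlgebra.single l (1 : ℂ) := by
      rw [AddMonoidAlgebra.smul_single, smul_eq_mul, mul_one]
    rw [this]
    exact W.smul_mem _ (Submodule.subset_span ⟨l, mem_absBox_of_mem_hFil p.2
      (Finsupp.mem_support_iff.1 hl), rfl⟩)
  let f : hFil n d →ₗ[ℂ] W :=
    LinearMap.codRestrict W ((invL n).subtype ∘ₗ (hFil n d).subtype) hW
  refine FiniteDimensional.of_injective f fun p q h => ?_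
  have h1 : (p.1.1 : Laurent n) = q.1.1 := congrArg (fun x : W => (x : Laurent n)) h
  exact Subtype.ext (Subtype.ext h1)

theorem hFil_mono {d e : ℝ} (h : d ≤ e) : hFil n d ≤ hFil n e :=
  fun _ hp l hl => hp l (h.trans_lt hl)

theorem exists_nat_mem_hFil (p : invL n) : ∃ k : ℕ, p ∈ hFil n k := by
  obtain ⟨d, hd⟩ := (p.1.coeff.support.image height).bddAbove
  obtain ⟨k, hk⟩ := exists_nat_ge d
  refine ⟨k, mem_hFil.2 fun l hl => le_trans (hd ?_) hk⟩
  exact Finset.mem_coe.2 (Finset.mem_image_of_mem _ hl)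

/-- The leading exponent. -/
theorem exists_height_eq {p : invL n} (hp : p ≠ 0) :
    ∃ l, p.1.coeff l ≠ 0 ∧ p ∈ hFil n (height l) := by
  have h1 : p.1.coeff.support.Nonempty := by
    rw [Finsupp.support_nonempty_iff, ne_eq, AddMonoidAlgebra.coeff_eq_zero]
    exact fun h => hp (Subtype.ext h)
  obtain ⟨l, hl, hmax⟩ := p.1.coeff.support.exists_max_image height h1
  exact ⟨l, Finsupp.mem_support_iff.1 hl, mem_hFil.2 hmax⟩

/-! ### Commuting symmetric operators -/

variable (P) in
/-- The symmetric operators that preserve the filtration. -/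
structure IsSymmFil (X : invL n →ₗ[ℂ] invL n) : Prop where
  map_hFil : ∀ d p, p ∈ hFil n d → X p ∈ hFil n d
  symm : ∀ p p' : invL n, form P p.1 (X p').1 = form P (X p).1 p'.1

/-- If the coefficient at `l` vanishes, the leading exponent lies strictly below `l`, and a filtered
operator cannot raise it again. -/
theorem coeff_eq_zero_of_leading {X : invL n →ₗ[ℂ] invL n}
    (hX : ∀ d p, p ∈ hFil n d → X p ∈ hFil n d) {l : Fin n → ℤ} {p : invL n}
    (hp : p ∈ hFil n (height l)) (hl : p.1.coeff l = 0) : (X p).1.coeff l = 0 := by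
  by_cases h0 : p = 0
  · rw [h0, map_zero]
    rfl
  · obtain ⟨m, hm, hpm⟩ := exists_height_eq h0
    refine hX _ _ hpm l (lt_of_le_of_ne ?_ ?_)
    · exact mem_hFil.1 hp m (Finsupp.mem_support_iff.2 hm)
    · intro h
      rw [height_injective h] at hm
      exact hm hl

/-- The combination of `p` and `q` whose coefficient at `l` cancels keeps a zero coefficient there.
In other words, `X` acts on leading coefficients by a scalar depending on `l` alone. -/
theorem coeff_mul_coeff_leading {X : invL n →ₗ[ℂ] invL n}
    (hX : ∀ d p, p ∈ hFil n d → X p ∈ hFil n d) {l : Fin n → ℤ} {p q : invL n}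
    (hp : p ∈ hFil n (height l)) (hq : q ∈ hFil n (height l)) :
    (X p).1.coeff l * q.1.coeff l = (X q).1.coeff l * p.1.coeff l := by
  have h := coeff_eq_zero_of_leading hX (l := l) (p := q.1.coeff l • p - p.1.coeff l • q)
    (Submodule.sub_mem _ (Submodule.smul_mem _ _ hp) (Submodule.smul_mem _ _ hq))
    (by simp [mul_comm])
  rw [map_sub, map_smul, map_smul] at h
  simp only [Submodule.coe_sub, Submodule.coe_smul, AddMonoidAlgebra.coeff_sub,
    AddMonoidAlgebra.coeff_smul, Finsupp.sub_apply, Finsupp.smul_apply, smul_eq_mul] at h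
  linear_combination h

/-- The leading coefficient is multiplied by scalars under `X` and `Y`, and scalars commute. So the
commutator strictly lowers the leading exponent. -/
theorem coeff_commutator {X Y : invL n →ₗ[ℂ] invL n}
    (hX : ∀ d p, p ∈ hFil n d → X p ∈ hFil n d) (hY : ∀ d p, p ∈ hFil n d → Y p ∈ hFil n d)
    {l : Fin n → ℤ} {p : invL n} (hp : p ∈ hFil n (height l)) :
    (X (Y p)).1.coeff l = (Y (X p)).1.coeff l := by
  by_cases h0 : p.1.coeff l = 0
  · rw [coeff_eq_zero_of_leading hX (hY _ _ hp) (coeff_eq_zero_of_leading hY hp h0),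
      coeff_eq_zero_of_leading hY (hX _ _ hp) (coeff_eq_zero_of_leading hX hp h0)]
  · have h1 := coeff_mul_coeff_leading hX hp (hY _ _ hp)
    have h2 := coeff_mul_coeff_leading hY hp (hX _ _ hp)
    refine mul_right_cancel₀ h0 ?_
    rw [← h1, ← h2, mul_comm]

theorem form_sub_left (hP : P.Admissible) (p q r : Laurent n) :
    form P (p - q) r = form P p r - form P q r := by
  have hc : ∀ p : Laurent n, Integrable fun t : Torus n =>
      (starRingEnd ℂ) (ev (tw t) p) * ev (tw t) r * weightM P ∅ (tw t) := fun p =>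
    integrable_of_continuous (((continuous_conj_ev_tw p).mul (continuous_ev_tw r)).mul
      (continuous_weightM hP ∅))
  rw [form, form, form, ← integral_sub (hc p) (hc q)]
  simp only [map_sub, sub_mul]

theorem form_sub_right (hP : P.Admissible) (p q r : Laurent n) :
    form P r (p - q) = form P r p - form P r q := by
  rw [← conj_form, form_sub_left hP, map_sub, conj_form, conj_form]

/-- The commutator `Z` of symmetric operators is skew, so `⟨Zp, Zp⟩ = -⟨p, Z(Zp)⟩`. As `Zp` has a
lower leading exponent than `p`, induction gives `Z(Zp) = 0`, and positivity of the form gives `Zp =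
0`. No explicit eigenvalues or identities between coefficients enter. -/
theorem IsSymmFil.comm (hP : P.Admissible) {X Y : invL n →ₗ[ℂ] invL n} (hX : IsSymmFil P X)
    (hY : IsSymmFil P Y) (p : invL n) : X (Y p) = Y (X p) := by
  have hxy : ∀ p q : invL n, form P (X (Y p)).1 q.1 = form P p.1 (Y (X q)).1 := fun p q => by
    rw [← hX.symm, ← hY.symm]
  have hyx : ∀ p q : invL n, form P (Y (X p)).1 q.1 = form P p.1 (X (Y q)).1 := fun p q => by
    rw [← hY.symm, ← hX.symm]
  have key : ∀ (N : ℕ) (d : ℝ), (absBox n d).ncard ≤ N → ∀ p ∈ hFil n d, X (Y p) - Y (X p) = 0 := by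
    intro N
    induction N with
    | zero =>
      intro d hd p hp
      have h0 : p = 0 := by
        by_contra h0
        obtain ⟨l, hl, -⟩ := exists_height_eq h0
        have := (Set.ncard_pos (finite_absBox d)).2 ⟨l, mem_absBox_of_mem_hFil hp hl⟩
        omega
      simp [h0]
    | succ N ih =>
      intro d hd p hp
      by_cases h0 : p = 0
      · simp [h0]
      obtain ⟨l, hl, hpl⟩ := exists_height_eq h0
      set q := X (Y p) - Y (X p) with hq
      have hskew : form P q.1 q.1 = -form P p.1 (X (Y q) - Y (X q)).1 := by
        have h1 : q.1 = (X (Y p)).1 - (Y (X p)).1 := rfl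
        have h2 : form P q.1 q.1 = form P (X (Y p)).1 q.1 - form P (Y (X p)).1 q.1 := by
          rw [← form_sub_left hP, ← h1]
        have h3 : form P p.1 (X (Y q) - Y (X q)).1 = form P p.1 (X (Y q)).1 - form P p.1 (Y (X q)).1 :=
          form_sub_right hP _ _ _
        rw [h2, h3, hxy p q, hyx p q]
        ring
      have hqq : X (Y q) - Y (X q) = 0 := by
        by_cases hq0 : q = 0
        · simp [hq0]
        obtain ⟨m, hm, hqm⟩ := exists_height_eq hq0
        have hqd : q ∈ hFil n (height l) := Submodule.sub_mem _ (hX.map_hFil _ _ (hY.map_hFil _ _ hpl))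
          (hY.map_hFil _ _ (hX.map_hFil _ _ hpl))
        have hql : q.1.coeff l = 0 := by
          rw [hq, Submodule.coe_sub, AddMonoidAlgebra.coeff_sub, Finsupp.sub_apply,
            coeff_commutator hX.map_hFil hY.map_hFil hpl, sub_self]
        have hml : height m < height l := lt_of_le_of_ne
          (mem_hFil.1 hqd m (Finsupp.mem_support_iff.2 hm))
          fun h => hm (by rw [height_injective h, hql])
        have hld : l ∈ absBox n d := mem_absBox_of_mem_hFil hp hl
        -- The induction counts lattice points of the box. Passing to the smaller height loses at
        -- least `l`, since membership of `l` would bound its height by that of `m`.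
        refine ih (height m) (Nat.le_of_lt_succ (lt_of_lt_of_le (Set.ncard_lt_ncard ?_
          (finite_absBox d)) hd)) q hqm
        refine ⟨fun k hk => le_trans hk (hml.le.trans (height_le_of_mem_absBox hld)), fun h => ?_⟩
        exact absurd (height_le_of_mem_absBox (h hld)) (not_le.2 hml)
      rw [hqq] at hskew
      have : form P p.1 (0 : invL n).1 = 0 := by simp [form]
      rw [this, neg_zero] at hskew
      exact Subtype.ext (form_self_eq_zero hP hskew)
  obtain ⟨k, hk⟩ := exists_nat_mem_hFil p
  exact sub_eq_zero.1 (key _ k le_rfl p hk)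

end Koornwinder

end

/-! ### The algebra generated by the operators, acting on invariant polynomials. -/

noncomputable section

namespace Koornwinder

variable {n : ℕ} {P : Params}

/-! ### The algebra of difference operators acting on invariant Laurent polynomials -/

variable (P) in
/-- An operator on invariant Laurent polynomials is induced by an operator on functions of regular
points. -/
def Induces (D : Module.End ℂ (Regular n P → ℂ)) (X : invL n →ₗ[ℂ] invL n) : Prop :=
  ∀ p : invL n, D (evOn (regPt n P) p.1) = evOn (regPt n P) (X p).1

theorem exists_induces (D : Module.End ℂ (Regular n P → ℂ))
    (h : ∀ p : invL n, ∃ q : invL n, D (evOn (regPt n P) p.1) = evOn (regPt n P) q.1) :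
    ∃ X, Induces P D X := by
  choose X hX using h
  have hinj : ∀ p q : invL n, evOn (regPt n P) p.1 = evOn (regPt n P) q.1 → p = q :=
    fun p q h => Subtype.ext (evOn_regPt_injective h)
  refine ⟨{ toFun := X, map_add' := fun p q => hinj _ _ ?_, map_smul' := fun a p => hinj _ _ ?_ }, hX⟩
  · rw [← hX, Submodule.coe_add, Submodule.coe_add, map_add, map_add, map_add, hX, hX]
  · rw [← hX, RingHom.id_apply, Submodule.coe_smul, Submodule.coe_smul, map_smul, map_smul, map_smul,
      hX]

theorem exists_isSymmFil_diffOp (hP : P.Admissible) {r : ℕ} (hr : 1 ≤ r) :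
    ∃ X, Induces P (diffOp n P r) X ∧ IsSymmFil P X := by
  have hD : ∀ (p q : Laurent n), diffOp n P r (evOn (regPt n P) p) = evOn (regPt n P) q ↔
      ∀ x : Regular n P, dOp P r (fun w => ev w p) (regPt n P x) = ev (regPt n P x) q := by
    intro p q
    rw [funext_iff]
    exact forall_congr' fun x => by
      rw [show diffOp n P r (evOn (regPt n P) p) x = _ from diffOp_apply P hr (fun w => ev w p) x]
      rfl
  obtain ⟨X, hX⟩ := exists_induces (diffOp n P r) fun p => by
    obtain ⟨q, hq, h⟩ := exists_dOp_eq hP.β_pos r p.2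
    exact ⟨⟨q, hq⟩, (hD _ _).2 h⟩
  refine ⟨X, hX, fun d p hp => ?_, fun p p' => ?_⟩
  · exact mem_hFil.2 (height_le_of_dOp_eq ((hD _ _).1 (hX p)) (mem_hFil.1 hp))
  · exact form_dOp_comm hP r ((hD _ _).1 (hX p)) ((hD _ _).1 (hX p'))

theorem form_add_left (hP : P.Admissible) (p q r : Laurent n) :
    form P (p + q) r = form P p r + form P q r := by
  have h := form_sub_left hP (p + q) q r
  rw [add_sub_cancel_right] at h
  rw [h, sub_add_cancel]

theorem form_add_right (hP : P.Admissible) (p q r : Laurent n) :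
    form P r (p + q) = form P r p + form P r q := by
  rw [← conj_form, form_add_left hP, map_add, conj_form, conj_form]

theorem form_smul_right (a : ℂ) (p r : Laurent n) : form P r (a • p) = a * form P r p := by
  rw [form, form, ← MeasureTheory.integral_const_mul]
  refine congrArg _ (funext fun t => ?_)
  rw [map_smul, smul_eq_mul]
  ring

theorem form_smul_left (a : ℂ) (p r : Laurent n) :
    form P (a • p) r = (starRingEnd ℂ) a * form P p r := by
  rw [← conj_form, form_smul_right, map_mul, conj_form]

/-- Symmetry survives real scalars and sums directly, and products because symmetric filtered
operators commute. Carrying the filtration through the induction is what makes `IsSymmFil.comm`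
applicable at every product. -/
theorem exists_isSymmFil (hP : P.Admissible) {D : Module.End ℂ (Regular n P → ℂ)}
    (hD : D ∈ diffOpAlgebra n P) : ∃ X, Induces P D X ∧ IsSymmFil P X := by
  induction hD using Algebra.adjoin_induction with
  | mem D h =>
    obtain ⟨r, hr, rfl⟩ := h
    exact exists_isSymmFil_diffOp hP hr.1
  | algebraMap c =>
    refine ⟨(c : ℂ) • LinearMap.id, fun p => ?_, fun d p hp => Submodule.smul_mem _ _ hp,
      fun p p' => ?_⟩
    · rw [Module.algebraMap_end_apply, LinearMap.smul_apply, LinearMap.id_apply, Submodule.coe_smul,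
        map_smul, Complex.coe_smul]
    · rw [LinearMap.smul_apply, LinearMap.id_apply, LinearMap.smul_apply, LinearMap.id_apply,
        Submodule.coe_smul, Submodule.coe_smul, form_smul_left, form_smul_right, Complex.conj_ofReal]
  | add D E _ _ hD hE =>
    obtain ⟨X, hX, hX'⟩ := hD
    obtain ⟨Y, hY, hY'⟩ := hE
    refine ⟨X + Y, fun p => ?_, fun d p hp => Submodule.add_mem _ (hX'.map_hFil d p hp)
      (hY'.map_hFil d p hp), fun p p' => ?_⟩
    · rw [LinearMap.add_apply, LinearMap.add_apply, Submodule.coe_add, map_add, hX, hY]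
    · rw [LinearMap.add_apply, LinearMap.add_apply, Submodule.coe_add, Submodule.coe_add,
        form_add_left hP, form_add_right hP, hX'.symm, hY'.symm]
  | mul D E _ _ hD hE =>
    obtain ⟨X, hX, hX'⟩ := hD
    obtain ⟨Y, hY, hY'⟩ := hE
    refine ⟨X ∘ₗ Y, fun p => ?_, fun d p hp => hX'.map_hFil d _ (hY'.map_hFil d p hp),
      fun p p' => ?_⟩
    · rw [Module.End.mul_apply, LinearMap.comp_apply, hY, hX]
    · rw [LinearMap.comp_apply, LinearMap.comp_apply, hX'.symm, hY'.symm, hX'.comm hP hY']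

/-! ### Invariant trigonometric polynomials -/

theorem mem_trigPoly {f : (Fin n → ℂ) → ℂ} :
    f ∈ trigPoly n ↔ ∃ p : Laurent n, f = fun x => ev (expU x) p := by
  constructor
  · intro h
    induction h using Submodule.span_induction with
    | mem f h =>
      obtain ⟨l, rfl⟩ := h
      exact ⟨AddMonoidAlgebra.single l 1, funext fun x => by rw [ev_single, one_mul, chi_expU]⟩
    | zero => exact ⟨0, funext fun x => by simp⟩
    | add f g _ _ hf hg =>
      obtain ⟨p, rfl⟩ := hf
      obtain ⟨q, rfl⟩ := hg
      exact ⟨p + q, funext fun x => by simp⟩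
    | smul a f _ hf =>
      obtain ⟨p, rfl⟩ := hf
      exact ⟨a • p, funext fun x => by simp⟩
  · rintro ⟨p, rfl⟩
    have : (fun x => ev (expU x) p) = ∑ l ∈ p.coeff.support, p.coeff l • expo l := by
      funext x
      simp [ev_eq_sum, chi_expU]
    rw [this]
    exact Submodule.sum_mem _ fun l _ => Submodule.smul_mem _ _ (Submodule.subset_span ⟨l, rfl⟩)

theorem mem_trigPolyW {f : (Fin n → ℂ) → ℂ} :
    f ∈ trigPolyW n ↔ ∃ p : invL n, f = fun x => ev (expU x) p.1 := by
  constructor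
  · rintro ⟨h, hW⟩
    obtain ⟨p, rfl⟩ := mem_trigPoly.1 h
    refine ⟨⟨p, fun σ η w => ?_⟩, rfl⟩
    obtain ⟨x, rfl⟩ := expU_surjective w
    rw [← expU_weylAct]
    exact hW σ η x
  · rintro ⟨p, rfl⟩
    refine ⟨mem_trigPoly.2 ⟨p.1, rfl⟩, fun σ η x => ?_⟩
    dsimp only
    rw [expU_weylAct]
    exact p.2 σ η _

theorem onTorus_ev (p : Laurent n) :
    onTorus (fun x => ev (expU x) p) = fun t : Torus n => ev (tw t) p :=
  funext fun t => congrArg (fun w => ev w p) (expU_rep t)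

end Koornwinder

end

/-! ### Essential self-adjointness from finite-dimensional invariant subspaces. -/

noncomputable section

open Filter Topology

namespace Koornwinder

/-! ### A criterion for essential self-adjointness -/

section

variable {H : Type*} [NormedAddCommGroup H] [InnerProductSpace ℂ H] [CompleteSpace H]

/-- Since `T` is symmetric and preserves `V k`, the orthogonal projection `P_k` satisfies `T P_k u =
P_k T* u`, as pairing with vectors of `V k` shows. The projections converge strongly to the identity
because the subspaces exhaust a dense domain. -/
theorem tendsto_of_mem_adjoint {T : H →ₗ.[ℂ] H} (hd : Dense (T.domain : Set H))
    (hs : T.IsFormalAdjoint T) {V : ℕ → Submodule ℂ H} [∀ k, FiniteDimensional ℂ (V k)]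
    (hmono : Monotone V) (hV : ∀ k, ∀ v ∈ V k, ∃ h : v ∈ T.domain, T ⟨v, h⟩ ∈ V k)
    (hsup : ∀ v ∈ T.domain, ∃ k, v ∈ V k) (u : T.adjoint.domain) :
    ∃ x : ℕ → T.domain, Tendsto (fun k => (x k : H)) atTop (𝓝 (u : H)) ∧
      Tendsto (fun k => T (x k)) atTop (𝓝 (T.adjoint u)) := by
  have htop : ⊤ ≤ (⨆ k, V k).topologicalClosure := by
    intro v _
    refine closure_mono (fun w hw => ?_) (hd v)
    obtain ⟨k, hk⟩ := hsup w hw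
    exact Submodule.mem_iSup_of_mem k hk
  have hlim : ∀ v : H, Tendsto (fun k => (V k).starProjection v) atTop (𝓝 v) := fun v =>
    Submodule.starProjection_tendsto_self V hmono v htop
  choose hdom hTV using hV
  have hmem : ∀ k (v : H), (V k).starProjection v ∈ V k := fun k v =>
    Submodule.starProjection_apply_mem _ _
  have hself : ∀ k (v w : H), v ∈ V k → inner ℂ v ((V k).starProjection w) = inner ℂ v w := by
    intro k v w hv
    rw [← Submodule.inner_starProjection_left_eq_right, Submodule.starProjection_eq_self_iff.2 hv]
  refine ⟨fun k => ⟨(V k).starProjection u, hdom k _ (hmem k _)⟩, hlim u, ?_⟩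
  have key : ∀ k, T ⟨(V k).starProjection u, hdom k _ (hmem k _)⟩
      = (V k).starProjection (T.adjoint u) := by
    intro k
    set x : T.domain := ⟨(V k).starProjection u, hdom k _ (hmem k _)⟩
    have hx : T x ∈ V k := hTV k _ (hmem k _)
    have hv : ∀ v ∈ V k, inner ℂ v (T x - (V k).starProjection (T.adjoint u)) = 0 := by
      intro v hv
      have h1 := hs ⟨v, hdom k v hv⟩ x
      have h2 := ((LinearPMap.adjoint_isFormalAdjoint hd).symm) ⟨v, hdom k v hv⟩ u
      rw [inner_sub_right, hself k v _ hv, ← h2, ← h1, hself k _ _ (hTV k v hv), sub_self]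
    exact sub_eq_zero.1 (inner_self_eq_zero.1 (hv _ (Submodule.sub_mem _ hx (hmem k _))))
  simp only [key]
  exact hlim _

/-- The approximation puts the graph of the adjoint into the closure of the graph of `T`, and the
reverse inclusion holds because the adjoint is closed and extends `T`. The same approximation shows
that the adjoint is symmetric, so it lies below its own adjoint; conversely, the second adjoint lies
below the first because `T` does. -/
theorem isEssentiallySelfAdjoint_of_finiteDimensional {T : H →ₗ.[ℂ] H}
    (hd : Dense (T.domain : Set H)) (hs : T.IsFormalAdjoint T) {V : ℕ → Submodule ℂ H}
    [∀ k, FiniteDimensional ℂ (V k)] (hmono : Monotone V)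
    (hV : ∀ k, ∀ v ∈ V k, ∃ h : v ∈ T.domain, T ⟨v, h⟩ ∈ V k)
    (hsup : ∀ v ∈ T.domain, ∃ k, v ∈ V k) : IsEssentiallySelfAdjoint T := by
  have hlim := tendsto_of_mem_adjoint hd hs hmono hV hsup
  have hclosed : T.adjoint.IsClosed := LinearPMap.adjoint_isClosed hd
  have hle : T ≤ T.adjoint := hs.le_adjoint hd
  have hcl : T.IsClosable := hclosed.isClosable.leIsClosable hle
  have hadj : T.closure = T.adjoint := by
    refine le_antisymm (LinearPMap.le_of_le_graph ?_) (LinearPMap.le_of_le_graph ?_)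
    · rw [← hcl.graph_closure_eq_closure_graph]
      exact Submodule.topologicalClosure_minimal _ (LinearPMap.le_graph_of_le hle) hclosed
    · rw [← hcl.graph_closure_eq_closure_graph]
      intro z hz
      obtain ⟨u, hu1, hu2⟩ := (LinearPMap.mem_graph_iff _).1 hz
      obtain ⟨x, hx1, hx2⟩ := hlim u
      rw [hu1] at hx1
      rw [hu2] at hx2
      exact mem_closure_of_tendsto (hx1.prodMk_nhds hx2)
        (Eventually.of_forall fun k => T.mem_graph (x k))
  have hd' : Dense (T.adjoint.domain : Set H) := hd.mono hle.1
  have hsymm : T.adjoint.IsFormalAdjoint T.adjoint := by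
    intro u v
    obtain ⟨x, hx1, hx2⟩ := hlim u
    refine tendsto_nhds_unique ((hx2.inner tendsto_const_nhds)) ?_
    refine (hx1.inner tendsto_const_nhds).congr fun k => ?_
    exact (((LinearPMap.adjoint_isFormalAdjoint hd).symm) (x k) v).symm
  refine ⟨hd, hs, ?_⟩
  rw [hadj, LinearPMap.isSelfAdjoint_def]
  refine le_antisymm ?_ (hsymm.le_adjoint hd')
  refine LinearPMap.IsFormalAdjoint.le_adjoint hd fun x y => ?_
  have h := ((LinearPMap.adjoint_isFormalAdjoint hd').symm) ⟨x, hle.1 x.2⟩ y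
  rwa [← hle.2 (x := x) (y := ⟨x, hle.1 x.2⟩) rfl] at h

end

end Koornwinder

end

/-! ### The Hilbert space, density, and the conclusion. -/

noncomputable section

open MeasureTheory

namespace Koornwinder

variable {n : ℕ} {P : Params}

/-! ### Trigonometric polynomials in the Hilbert space -/

theorem weightMeasure_eq (hβ : 0 < P.β) : weightMeasure n P
    = volume.withDensity fun t : Torus n => ENNReal.ofReal (weightM P ∅ (tw t)).re := by
  refine withDensity_congr_ae ?_
  filter_upwards [ae_generic] with t ht
  rw [weight_eq_weightM hβ ht]

theorem continuous_re_weightM (hP : P.Admissible) :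
    Continuous fun t : Torus n => (weightM P ∅ (tw t)).re :=
  Complex.continuous_re.comp (continuous_weightM hP ∅)

theorem isFiniteMeasure_weightMeasure (hP : P.Admissible) :
    IsFiniteMeasure (weightMeasure n P) := by
  rw [weightMeasure_eq hP.β_pos]
  exact isFiniteMeasure_withDensity_ofReal
    ((continuous_re_weightM hP).integrable_of_hasCompactSupport
      (HasCompactSupport.of_compactSpace _)).hasFiniteIntegral

theorem integral_weightMeasure (hP : P.Admissible) (G : Torus n → ℂ) :
    ∫ t, G t ∂(weightMeasure n P) = ∫ t, G t * weightM P ∅ (tw t) := by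
  rw [weightMeasure_eq hP.β_pos, integral_withDensity_eq_integral_toReal_smul
    (continuous_re_weightM hP).measurable.ennreal_ofReal
    (ae_of_all _ fun _ => ENNReal.ofReal_lt_top)]
  refine integral_congr_ae ?_
  filter_upwards [ae_generic] with t ht
  obtain ⟨w, hw0, hw⟩ := weightM_pos hP ht
  rw [hw, Complex.ofReal_re, ENNReal.toReal_ofReal hw0.le, Complex.real_smul, mul_comm]

theorem tw_weylAct (σ : Equiv.Perm (Fin n)) (η : Fin n → ℤˣ) (t : Torus n) :
    tw (weylAct σ η t) = wAct σ η (tw t) := by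
  funext j
  ext
  rw [wAct, tw_val, weylAct]
  rcases Int.units_eq_one_or (η j) with h | h <;> simp [h, cexpI_neg, tw_val]

/-- Laurent polynomials as continuous functions on the torus. -/
def evC (n : ℕ) : Laurent n →ₐ[ℂ] C(Torus n, ℂ) where
  toFun p := ⟨fun t => ev (tw t) p, continuous_ev_tw p⟩
  map_one' := by ext; simp
  map_mul' p q := by ext; simp
  map_zero' := by ext; simp
  map_add' p q := by ext; simp
  commutes' a := by ext; simp [chi_zero]

/-- Stone–Weierstrass: the coordinate characters separate points, and conjugation on the torus is
inversion of the exponents. -/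
theorem denseRange_evC : DenseRange (evC n) := by
  have hstar : ∀ a ∈ (evC n).range, star a ∈ (evC n).range := by
    rintro _ ⟨p, rfl⟩
    obtain ⟨q, hq⟩ := exists_ev_conj p
    refine ⟨q, ContinuousMap.ext fun t => ?_⟩
    change ev (tw t) q = (starRingEnd ℂ) (ev (tw t) p)
    rw [hq, conjInv_tw]
  let A : StarSubalgebra ℂ C(Torus n, ℂ) := { (evC n).range with star_mem' := fun {a} => hstar a }
  have hA : A.topologicalClosure = ⊤ := by
    refine ContinuousMap.starSubalgebra_topologicalClosure_eq_top_of_separatesPoints A ?_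
    intro s t hst
    obtain ⟨j, hj⟩ := Function.ne_iff.1 hst
    refine ⟨fun u => ev (tw u) (AddMonoidAlgebra.single (Pi.single j 1) 1),
      ⟨evC n (AddMonoidAlgebra.single (Pi.single j 1) 1), ⟨_, rfl⟩, rfl⟩, fun h => hj ?_⟩
    simp only [ev_single, one_mul, chi_single, zpow_one, tw_val, cexpI] at h
    exact AddCircle.injective_toCircle Real.two_pi_pos.ne' (Subtype.ext h)
  intro f
  have : f ∈ A.topologicalClosure := by
    rw [hA]
    trivial
  have h2 : f ∈ closure (A : Set C(Torus n, ℂ)) := this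
  exact h2

/-- The class of an invariant Laurent polynomial in the Hilbert space. -/
def embL (hP : P.Admissible) : invL n →ₗ[ℂ] L2W n P :=
  have := isFiniteMeasure_weightMeasure (n := n) hP
  LinearMap.codRestrict (L2W n P)
    ((ContinuousMap.toLp 2 (weightMeasure n P) ℂ).toLinearMap ∘ₗ (evC n).toLinearMap
      ∘ₗ (invL n).subtype)
    fun p => ⟨fun t => ev (tw t) p.1, fun σ η t => by
      dsimp only
      rw [tw_weylAct]
      exact p.2 σ η _,
      ContinuousMap.coeFn_toLp _ _⟩

theorem embL_ae (hP : P.Admissible) (p : invL n) :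
    (embL hP p : Torus n → ℂ) =ᵐ[weightMeasure n P] fun t => ev (tw t) p.1 := by
  have := isFiniteMeasure_weightMeasure (n := n) hP
  exact ContinuousMap.coeFn_toLp (weightMeasure n P) (evC n p.1)

theorem inner_embL (hP : P.Admissible) (p q : invL n) :
    inner ℂ (embL hP p) (embL hP q) = form P p.1 q.1 := by
  rw [Submodule.coe_inner, L2.inner_def, form, ← integral_weightMeasure hP fun t =>
    (starRingEnd ℂ) (ev (tw t) p.1) * ev (tw t) q.1]
  refine integral_congr_ae ?_
  filter_upwards [embL_ae hP p, embL_ae hP q] with t h1 h2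
  rw [h1, h2, RCLike.inner_apply, mul_comm]

theorem embL_injective (hP : P.Admissible) : Function.Injective (embL (n := n) hP) := by
  rw [injective_iff_map_eq_zero]
  intro p hp
  refine Subtype.ext (form_self_eq_zero hP ?_)
  rw [← inner_embL hP, hp, inner_zero_left]

/-! ### Density -/

theorem continuous_weylAct (σ : Equiv.Perm (Fin n)) (η : Fin n → ℤˣ) :
    Continuous fun t : Torus n => weylAct σ η t :=
  continuous_pi fun j => (continuous_zsmul _).comp (continuous_apply (σ j))

theorem measurePreserving_weylAct (σ : Equiv.Perm (Fin n)) (η : Fin n → ℤˣ) :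
    MeasurePreserving (fun t : Torus n => weylAct σ η t) := by
  have h1 : MeasurePreserving (fun (t : Torus n) j => ((η j : ℤˣ) : ℤ) • t j) := by
    refine measurePreserving_pi (fun _ : Fin n => (volume : Measure (AddCircle (2 * Real.pi))))
      (fun _ => volume) (f := fun j x => ((η j : ℤˣ) : ℤ) • x) fun j => ?_
    rcases Int.units_eq_one_or (η j) with h | h
    · have : (fun x : AddCircle (2 * Real.pi) => ((η j : ℤˣ) : ℤ) • x) = id := funext fun x => by
        simp [h]
      rw [this]
      exact MeasurePreserving.id _
    · have : (fun x : AddCircle (2 * Real.pi) => ((η j : ℤˣ) : ℤ) • x) = Neg.neg :=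
        funext fun x => by simp [h]
      rw [this]
      exact Measure.measurePreserving_neg _
  have h2 := volume_measurePreserving_piCongrLeft
    (fun _ : Fin n => AddCircle (2 * Real.pi)) σ.symm
  have h3 : (fun t : Torus n => weylAct σ η t) = (fun (t : Torus n) j => ((η j : ℤˣ) : ℤ) • t j)
      ∘ MeasurableEquiv.piCongrLeft (fun _ : Fin n => AddCircle (2 * Real.pi)) σ.symm := by
    funext t j
    have := MeasurableEquiv.piCongrLeft_apply_apply (β := fun _ : Fin n => AddCircle (2 * Real.pi))
      σ.symm t (σ j)
    rw [Equiv.symm_apply_apply] at this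
    rw [Function.comp_apply, this, weylAct]
  rw [h3]
  exact h1.comp h2

theorem weylAct_injective (σ : Equiv.Perm (Fin n)) (η : Fin n → ℤˣ) :
    Function.Injective fun t : Torus n => weylAct σ η t := by
  intro s t h
  funext j
  have := congrFun h (σ.symm j)
  simp only [weylAct, Equiv.apply_symm_apply] at this
  rcases Int.units_eq_one_or (η (σ.symm j)) with h | h <;> simpa [h] using this

theorem integral_weylAct (σ : Equiv.Perm (Fin n)) (η : Fin n → ℤˣ) (G : Torus n → ℂ) :
    ∫ t : Torus n, G (weylAct σ η t) = ∫ t, G t :=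
  (measurePreserving_weylAct σ η).integral_comp
    ((continuous_weylAct σ η).isClosedEmbedding (weylAct_injective σ η)).measurableEmbedding G

theorem weightM_wAct (σ : Equiv.Perm (Fin n)) (η : Fin n → ℤˣ) (w : Fin n → ℂˣ) :
    weightM P ∅ (wAct σ η w) = weightM P ∅ w := by
  have hpair : ∀ j k, ePair P (wAct σ η w j) (wAct σ η w k) = ePair P (w (σ j)) (w (σ k)) := by
    intro j k
    have hr : ∀ y z : ℂˣ, ePair P y z⁻¹ = ePair P y z := fun y z => by
      rw [ePair_comm, ePair_inv_left, ePair_comm]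
    rw [wAct, wAct]
    rcases Int.units_eq_one_or (η j) with h | h <;> rcases Int.units_eq_one_or (η k) with h' | h' <;>
      rw [h, h'] <;> simp [ePair_inv_left, hr]
  have hsgl : ∀ j, eFacB P (wAct σ η w j) * eFacB P ((wAct σ η w j)⁻¹ : ℂˣ)
      = eFacB P (w (σ j)) * eFacB P ((w (σ j))⁻¹ : ℂˣ) := by
    intro j
    rw [wAct]
    rcases Int.units_eq_one_or (η j) with h | h <;> rw [h]
    · simp
    · simp [mul_comm]
  simp only [weightM, Finset.notMem_empty, or_self, if_false, hpair, hsgl]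
  rw [Equiv.prod_comp σ fun j => eFacB P (w j) * eFacB P ((w j)⁻¹ : ℂˣ),
    prod_ltPairs_perm σ (fun j k => ePair P (w j) (w k)) fun j k => ePair_comm _ _]

theorem wAct_wAct (σ τ : Equiv.Perm (Fin n)) (η θ : Fin n → ℤˣ) (w : Fin n → ℂˣ) :
    wAct σ η (wAct τ θ w) = wAct (τ * σ) (fun j => θ (σ j) * η j) w := by
  funext j
  simp only [wAct, ← zpow_mul, Units.val_mul, Equiv.Perm.mul_apply]

/-- The sum of the Weyl group translates of a Laurent polynomial. -/
theorem exists_average (p : Laurent n) : ∃ (q : invL n)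
    (f : Equiv.Perm (Fin n) × (Fin n → ℤˣ) → Laurent n), q.1 = ∑ g, f g ∧
      ∀ g w, ev w (f g) = ev (wAct g.1 g.2 w) p := by
  choose f hf using fun g : Equiv.Perm (Fin n) × (Fin n → ℤˣ) => exists_ev_wAct g.1 g.2 p
  refine ⟨⟨∑ g, f g, fun σ η w => ?_⟩, f, rfl, hf⟩
  simp only [map_sum, hf, wAct_wAct]
  refine Finset.sum_bijective
    (fun g : Equiv.Perm (Fin n) × (Fin n → ℤˣ) => (σ * g.1, fun j => η (g.1 j) * g.2 j))
    (Finite.injective_iff_bijective.1 ?_) (fun g => by simp) fun g _ => rfl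
  rintro ⟨a, b⟩ ⟨c, d⟩ h
  obtain ⟨h1, h2⟩ := Prod.mk.inj h
  have h3 : a = c := mul_left_cancel h1
  subst h3
  exact Prod.ext rfl (funext fun j => mul_left_cancel (congrFun h2 j))

/-- Let an invariant `u` be orthogonal to all invariant polynomials. By invariance of `u`, of the
weight and of the measure, all group translates of a polynomial have the same inner product with
`u`, and their sum has inner product zero. Hence `u` is orthogonal to every Laurent polynomial, and
these are dense in `L²`. -/
theorem dense_range_embL (hP : P.Admissible) :
    Dense ((LinearMap.range (embL (n := n) hP) : Submodule ℂ (L2W n P)) : Set (L2W n P)) := by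
  have := isFiniteMeasure_weightMeasure (n := n) hP
  rw [Submodule.dense_iff_topologicalClosure_eq_top, Submodule.topologicalClosure_eq_top_iff,
    Submodule.eq_bot_iff]
  intro u hu
  obtain ⟨φ, hφ, huφ⟩ := u.2
  have hinner : ∀ p : Laurent n,
      inner ℂ (ContinuousMap.toLp 2 (weightMeasure n P) ℂ (evC n p)) (u : Lp ℂ 2 (weightMeasure n P))
      = ∫ t : Torus n, (starRingEnd ℂ) (ev (tw t) p) * φ t * weightM P ∅ (tw t) := by
    intro p
    rw [L2.inner_def, ← integral_weightMeasure hP fun t => (starRingEnd ℂ) (ev (tw t) p) * φ t]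
    refine integral_congr_ae ?_
    filter_upwards [ContinuousMap.coeFn_toLp (𝕜 := ℂ) (p := 2) (weightMeasure n P) (evC n p), huφ]
      with t h1 h2
    rw [h1, h2, RCLike.inner_apply, mul_comm]
    rfl
  have hzero : ∀ p : Laurent n, inner ℂ (ContinuousMap.toLp 2 (weightMeasure n P) ℂ (evC n p))
      (u : Lp ℂ 2 (weightMeasure n P)) = 0 := by
    intro p
    obtain ⟨q, f, hq, hf⟩ := exists_average p
    have h1 : ∀ g, inner ℂ (ContinuousMap.toLp 2 (weightMeasure n P) ℂ (evC n (f g)))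
        (u : Lp ℂ 2 (weightMeasure n P))
        = inner ℂ (ContinuousMap.toLp 2 (weightMeasure n P) ℂ (evC n p))
          (u : Lp ℂ 2 (weightMeasure n P)) := by
      intro g
      rw [hinner, hinner, ← integral_weylAct g.1 g.2 fun t =>
        (starRingEnd ℂ) (ev (tw t) p) * φ t * weightM P ∅ (tw t)]
      simp only [hf, tw_weylAct, hφ, weightM_wAct]
    have h2 : inner ℂ (embL hP q : Lp ℂ 2 (weightMeasure n P)) (u : Lp ℂ 2 (weightMeasure n P)) = 0 :=
      hu _ ⟨q, rfl⟩
    have h3 : (embL hP q : Lp ℂ 2 (weightMeasure n P))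
        = ∑ g, ContinuousMap.toLp 2 (weightMeasure n P) ℂ (evC n (f g)) := by
      rw [← map_sum, ← map_sum, ← hq]
      rfl
    rw [h3, sum_inner, Finset.sum_congr rfl fun g _ => h1 g, Finset.sum_const, nsmul_eq_mul] at h2
    refine (mul_eq_zero.1 h2).resolve_left ?_
    exact_mod_cast Finset.card_ne_zero_of_mem (Finset.mem_univ 1)
  have hd : DenseRange fun p : Laurent n =>
      ContinuousMap.toLp (E := ℂ) 2 (weightMeasure n P) ℂ (evC n p) :=
    (ContinuousMap.toLp_denseRange ℂ (weightMeasure n P) ℂ (by simp)).comp denseRange_evC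
      (ContinuousLinearMap.continuous _)
  refine Subtype.ext (Dense.eq_zero_of_inner_right ℂ hd ?_)
  rintro _ ⟨p, rfl⟩
  exact hzero p

end Koornwinder

end

theorem mainTheorem12 (n : ℕ) (P : Koornwinder.Params) (hP : P.Admissible)
    (D : Module.End ℂ (Koornwinder.Regular n P → ℂ))
    (hD : D ∈ Koornwinder.diffOpAlgebra n P) :
    ∃ T : Koornwinder.L2W n P →ₗ.[ℂ] Koornwinder.L2W n P,
      Koornwinder.IsRealization D T ∧ Koornwinder.IsEssentiallySelfAdjoint T := by
  open Koornwinder in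
  obtain ⟨X, hX, hX'⟩ := exists_isSymmFil hP hD
  set e := LinearEquiv.ofInjective (embL (n := n) hP) (embL_injective hP) with he
  -- Injectivity of `embL`, that is, positivity of the form, makes the operator well defined on
  -- classes.
  set T : L2W n P →ₗ.[ℂ] L2W n P :=
    ⟨LinearMap.range (embL (n := n) hP), embL hP ∘ₗ X ∘ₗ e.symm.toLinearMap⟩ with hT
  have hTe : ∀ p : invL n, T (e p) = embL hP (X p) := fun p => by
    change embL hP (X (e.symm (e p))) = _
    rw [LinearEquiv.symm_apply_apply]
  have hsymm : T.IsFormalAdjoint T := by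
    intro u v
    obtain ⟨p, rfl⟩ := e.surjective u
    obtain ⟨q, rfl⟩ := e.surjective v
    rw [hTe, hTe]
    change inner ℂ (embL hP (X p)) (embL hP q) = inner ℂ (embL hP p) (embL hP (X q))
    rw [inner_embL, inner_embL, hX'.symm]
  refine ⟨T, ⟨fun u => ?_, fun f hf => ?_⟩, ?_⟩
  · obtain ⟨p, hp⟩ := u.2
    refine ⟨_, mem_trigPolyW.2 ⟨p, rfl⟩, ?_⟩
    rw [onTorus_ev, ← hp]
    exact embL_ae hP p
  · obtain ⟨p, rfl⟩ := mem_trigPolyW.1 hf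
    refine ⟨e p, _, mem_trigPolyW.2 ⟨X p, rfl⟩, ?_, hX p, ?_⟩
    · rw [onTorus_ev]
      exact embL_ae hP p
    · rw [onTorus_ev, hTe]
      exact embL_ae hP (X p)
  -- The exhausting subspaces are the images of the invariant polynomials of height at most `k`;
  -- every polynomial has bounded height.
  · refine isEssentiallySelfAdjoint_of_finiteDimensional (dense_range_embL hP) hsymm
      (V := fun k : ℕ => (hFil n k).map (embL hP)) (fun k m hkm => Submodule.map_mono
        (hFil_mono (by exact_mod_cast hkm))) ?_ ?_
    · rintro k _ ⟨p, hp, rfl⟩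
      refine ⟨⟨p, rfl⟩, X p, hX'.map_hFil _ p hp, (hTe p).symm⟩
    · rintro _ ⟨p, rfl⟩
      obtain ⟨k, hk⟩ := exists_nat_mem_hFil p
      exact ⟨k, p, hk, rfl⟩
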